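/- **Setting.** Let $\Psi$ be a security lattice with order $\sqsubseteq$ and join $\sqcup$, and let $\xi\in\Psi$ be the level of an observer. We work in the recursion-free, information-flow-typed language of intuitionistic linear session types $A ::= 1 \mid \oplus\{\ell{:}A_\ell\}_{\ell\in I} \mid \&\{\ell{:}A_\ell\}_{\ell\in I} \mid A\otimes B \mid A\multimap B$. Run-time channels $y_\alpha^c$ carry a generation $\alpha$ and a maximal secrecy $c\in\Psi$. Processes $\mathbf{proc}(y[c],P@d)$ carry a running secrecy $d$; receiving along a channel of maximal secrecy $c'$ raises it from $d$ to $d\sqcup c'$ (a provider that receives along its own channel of maximal secrecy $c$ continues at $c$). Sending as a client along a channel of maximal secrecy $c'$ requires $d\sqsubseteq c'$. In well-typed configurations the maximal secrecies are non-increasing from a node to its children, and $d\sqsubseteq c$ at every process. Outputs are asynchronous: a send spawns a message $\mathbf{msg}(P)$ and moves the channel to its next generation. $\Psi;\Delta\Vdash\mathcal D::\Delta'$ is the configuration typing judgement ($\mathcal D$ uses the channels of $\Delta$ and provides those of $\Delta'$), and $\mapsto$ is the asynchronous small-step relation on configurations; a forwarder to a channel that the typing of the configuration provides is not executed. $K$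 ranges over $x{:}A[c]$ and $\cdot$, where $\cdot$ on the right stands for the empty context or for a terminating channel $w{:}1$ whose name and secrecy do not matter. **Projections and relevance.** $\Delta{\Downarrow}\xi$ keeps exactly the channels of $\Delta$ of maximal secrecy $\sqsubseteq\xi$; $(x{:}A[c]){\Downarrow}\xi$ is $x{:}A[c]$ if $c\sqsubseteq\xi$ and $\cdot$ otherwise. The quasi running secrecy of a node of $\mathcal D$ is: $d\sqcup c$ for a process with running secrecy $d$ whose term is a $\mathbf{case}$ or $\mathbf{recv}$ along a channel of maximal secrecy $c$; $d$ for any other process with running secrecy $d$; $c$ for a negative message along a channel of maximal secrecy $c$; $d'\sqcup c$ for a positive message along such a channel whose parent in $\mathcal D$ has quasi running secrecy $d'$, and $c$ if it has no parent in $\mathcal D$. The relevant channels of $\Delta\Vdash\mathcal D::K$ are the channels of maximal secrecy $\sqsubseteq\xi$ that occur in $\Delta$ or $K$, or that (inductively) share a process or message of quasi running secrecy $\sqsubseteq\xi$ with a relevant channel. $\mathcal D{\Downarrow}\xi$ consists of the processes and messages of $\mathcal D$ of quasi running secrecy $\sqsubseteq\xi$ that have at least one relevant channel. $\mathcal D_1{\Downarrow}\xi=_\xi\mathcal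 D_2{\Downarrow}\xi$ means that they agree, process by process and message by message, up to secrecy-preserving renaming of channels whose maximal secrecy is not $\sqsubseteq\xi$. **Logical relation.** For a closed configuration divided as $\langle\mathcal C|\mathcal D|\mathcal F\rangle$ with $\cdot\Vdash\mathcal C::\Delta$, $\Delta\Vdash\mathcal D::K$, $K\Vdash\mathcal F::\cdot$, let $\mapsto_{\Delta\Vdash K}$ be a step of one of its three parts, and call it poised if each part is poised: it cannot step, and it is empty or one of its nodes attempts to communicate along a channel of its interface. The relations $\mathcal E^\xi_\Psi$ and $\mathcal V^\xi_\Psi$ are defined by well-founded recursion. * $(\mathcal B_1,\mathcal B_2)\in\mathcal E^\xi_\Psi[\![\Delta\Vdash K]\!]$ iff $\mathcal B_1,\mathcal B_2$ can be divided as above into $\langle\mathcal C_i|\mathcal D_i|\mathcal F_i\rangle$, and these run by $\mapsto^*_{\Delta\Vdash K}$ to poised ones that are related by $\mathcal V^\xi_\Psi[\![\Delta\Vdash K]\!]$. * $(\langle\mathcal C_1|\mathcal D_1|\mathcal F_1\rangle,\langle\mathcal C_2|\mathcal D_2|\mathcal F_2\rangle)\in\mathcal V^\xi_\Psi[\![\Delta\Vdash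 K]\!]$ iff both are divided and typed as above for $\Delta\Vdash K$ and: * *(assert)* whenever one of $\mathcal D_1,\mathcal D_2$ contains a message sent out along a channel of the interface (a positive one along $K$, a negative one along a channel of $\Delta$), the other contains the same message $m$. If $m$ is a close message along $K=y{:}1$, then moreover $\Delta=\cdot$ and $\mathcal D_1=\mathcal D_2=m$. Otherwise, after moving $m$ out of both $\mathcal D_i$ into $\mathcal F_i$ (resp. $\mathcal C_i$), the configurations are related by $\mathcal E^\xi_\Psi$ at the interface with the continuation channel and type. If $m$ sends a channel $x{:}A$, then $\Delta$ without the carrier of $m$ splits as $\Delta',\Delta''$, and correspondingly $\mathcal C_i=\mathcal C_i'\mathcal C_i''$, and $\mathcal D_i=\mathcal D_i'\,\mathcal T_i\,m$ with $\Delta''\Vdash\mathcal T_i::x{:}A$. Both $\mathcal E^\xi_\Psi[\![\Delta''\Vdash x{:}A]\!]$, with $\mathcal T_i$ as the partial program, and $\mathcal E^\xi_\Psi$ at the remaining interface with the continuation, with $\mathcal D_i'$ as the partial program, must then hold; * *(assume)* whenever both $\mathcal C_1,\mathcal C_2$ (resp. both $\mathcal F_1,\mathcal F_2$) contain the same message sent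 to $\mathcal D_1,\mathcal D_2$ along a channel of $\Delta$ (resp. $K$), the configurations in which it is moved into $\mathcal D_1$ and $\mathcal D_2$ are related by $\mathcal E^\xi_\Psi$ at the interface with the continuation channel and type (with the channel removed for a close message). If it sends a channel $x{:}A$, that channel is added to $\Delta$, and the trees providing it are placed on the side of $\mathcal C_i$; * *(forwarding)* with $K=y{:}A$, if one of $\mathcal D_1,\mathcal D_2$ contains a forwarder $y\leftarrow x$, so does the other, with the same $x$. After removing it and substituting $x$ for $y$ throughout, the configurations are related by $\mathcal E^\xi_\Psi[\![\Delta\Vdash x{:}A]\!]$. With $y{:}A$ in $\Delta$, if both $\mathcal C_1,\mathcal C_2$ contain a forwarder $y\leftarrow x$ with the same $x$, then after removing it and substituting $x$ for $y$ throughout (the interface included) the configurations are related by $\mathcal E^\xi_\Psi$. **Equivalence up to observable messages.** $(\Delta_1\Vdash\mathcal D_1::u{:}A_1[c_1])\equiv^\Psi_\xi(\Delta_2\Vdash\mathcal D_2::v{:}A_2[c_2])$ means: both judgements $\Psi;\Delta_1\Vdash\mathcal D_1::u{:}A_1[c_1]$ and $\Psi;\Delta_2\Vdash\mathcal D_2::v{:}A_2[c_2]$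 hold; $\Delta_1{\Downarrow}\xi=\Delta_2{\Downarrow}\xi=:\Delta$ and $(u{:}A_1[c_1]){\Downarrow}\xi=(v{:}A_2[c_2]){\Downarrow}\xi=:K$; and for all closing configurations $\cdot\Vdash\mathcal C_1::\Delta_1$, $\cdot\Vdash\mathcal C_2::\Delta_2$, $u{:}A_1[c_1]\Vdash\mathcal F_1::\cdot$, $v{:}A_2[c_2]\Vdash\mathcal F_2::\cdot$ whose channel names do not clash with each other and with those of $\mathcal D_i$, $$(\mathcal C_1\mathcal D_1\mathcal F_1,\ \mathcal C_2\mathcal D_2\mathcal F_2)\in\mathcal E^\xi_\Psi[\![\Delta\Vdash K]\!].$$ (No clash: in $\mathcal C_i\mathcal D_i\mathcal F_i$ no channel is offered twice, and a channel that coexists with a later generation of itself carries a message not yet received, so that the next generation of a channel along which a process sends is always new.) **Theorem (Fundamental Theorem).** For every security level $\xi$ and all configurations $\Psi;\Delta_1\Vdash\mathcal D_1::u{:}A_1[c_1]$ and $\Psi;\Delta_2\Vdash\mathcal D_2::v{:}A_2[c_2]$ with $$\mathcal D_1{\Downarrow}\xi=_\xi\mathcal D_2{\Downarrow}\xi,\qquad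 \Delta_1{\Downarrow}\xi=\Delta_2{\Downarrow}\xi,\qquad (u{:}A_1[c_1]){\Downarrow}\xi=(v{:}A_2[c_2]){\Downarrow}\xi,$$ we have $$(\Delta_1\Vdash\mathcal D_1::u{:}A_1[c_1])\ \equiv^\Psi_\xi\ (\Delta_2\Vdash\mathcal D_2::v{:}A_2[c_2]).$$ -/

import Mathlib

namespace SecSess

universe u

/-! ## Session types, channels and terms -/

/-- Session types.  Labels are natural numbers; a choice type carries a finite set of labels `I`
and one continuation type for each label in `I`. -/
inductive Ty : Type
  | one : Ty
  | plus (I : Finset ℕ) (A : {ℓ // ℓ ∈ I} → Ty) : Ty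
  | amp (I : Finset ℕ) (A : {ℓ // ℓ ∈ I} → Ty) : Ty
  | tensor (A B : Ty) : Ty
  | lolli (A B : Ty) : Ty

/-- A run-time channel `y_α^c`: name `y`, generation `α`, maximal secrecy `c`. -/
@[ext]
structure Chan (L : Type u) : Type u where
  name : ℕ
  gen : ℕ
  lvl : L

/-- The next generation `y_{α+1}` of the channel `y_α`. -/
def Chan.next {L : Type u} (y : Chan L) : Chan L := ⟨y.name, y.gen + 1, y.lvl⟩

/-- An occurrence of a channel in a term: a bound channel variable (de Bruijn index) or a
run-time channel. -/
inductive Ref (L : Type u) : Type u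
  | bvar (i : ℕ) : Ref L
  | chan (c : Chan L) : Ref L

instance {L : Type u} : Coe (Chan L) (Ref L) := ⟨Ref.chan⟩

/-- A secrecy annotation in a term: an element of the security lattice or the secrecy variable `ψ`
that stands for the maximal secrecy of the `i`-th bound channel variable. -/
inductive Sec (L : Type u) : Type u
  | lit (ℓ : L) : Sec L
  | psi (i : ℕ) : Sec L

/-- Process terms (locally nameless; `recv` binds one channel variable in its continuation, `cut`
binds the new channel in both terms).
* `sel x k P` is `x.k; P`
* `branch x I Q` is `case x (ℓ ⇒ Q ℓ)_{ℓ ∈ I}`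
* `send z x P` is `send z x; P` (`z` is sent along `x`)
* `recv x P` is `w ← recv x; P`
* `close x` is `close x`, and `wait x P` is `wait x; P`
* `fwd y x` is `y ← x`
* `cut d e P Q` is `(x^d ← P)@e; Q`. -/
inductive Proc (L : Type u) : Type u
  | sel (x : Ref L) (k : ℕ) (P : Proc L) : Proc L
  | branch (x : Ref L) (I : Finset ℕ) (Q : {ℓ // ℓ ∈ I} → Proc L) : Proc L
  | send (z x : Ref L) (P : Proc L) : Proc L
  | recv (x : Ref L) (P : Proc L) : Proc L
  | close (x : Ref L) : Proc L
  | wait (x : Ref L) (P : Proc L) : Proc L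
  | fwd (y x : Ref L) : Proc L
  | cut (d e : Sec L) (P Q : Proc L) : Proc L

section Terms

variable {L : Type u}

/-- Replace the bound variable with index `k` by the channel `w`. -/
def Ref.inst (k : ℕ) (w : Chan L) : Ref L → Ref L
  | .bvar i => if i = k then .chan w else .bvar i
  | .chan c => .chan c

/-- Replace the secrecy variable with index `k` by the maximal secrecy of `w`. -/
def Sec.inst (k : ℕ) (w : Chan L) : Sec L → Sec L
  | .lit ℓ => .lit ℓ
  | .psi i => if i = k then .lit w.lvl else .psi i

/-- Replace the channel variable with index `k`, and its secrecy variable, by the channel `w` and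
its maximal secrecy. -/
def Proc.inst (k : ℕ) (w : Chan L) : Proc L → Proc L
  | .sel x l P => .sel (x.inst k w) l (P.inst k w)
  | .branch x I Q => .branch (x.inst k w) I (fun ℓ => (Q ℓ).inst k w)
  | .send z x P => .send (z.inst k w) (x.inst k w) (P.inst k w)
  | .recv x P => .recv (x.inst k w) (P.inst (k + 1) w)
  | .close x => .close (x.inst k w)
  | .wait x P => .wait (x.inst k w) (P.inst k w)
  | .fwd y x => .fwd (y.inst k w) (x.inst k w)
  | .cut d e P Q => .cut (d.inst k w) (e.inst k w) (P.inst (k + 1) w) (Q.inst (k + 1) w)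

/-- `P.at w` is `[w/x]P` for the outermost bound channel variable `x` of `P`. -/
abbrev Proc.at (P : Proc L) (w : Chan L) : Proc L := P.inst 0 w

/-- Renaming of run-time channels. -/
def Ref.map (f : Chan L → Chan L) : Ref L → Ref L
  | .bvar i => .bvar i
  | .chan c => .chan (f c)

/-- Renaming of run-time channels. -/
def Proc.map (f : Chan L → Chan L) : Proc L → Proc L
  | .sel x l P => .sel (x.map f) l (P.map f)
  | .branch x I Q => .branch (x.map f) I (fun ℓ => (Q ℓ).map f)
  | .send z x P => .send (z.map f) (x.map f) (P.map f)
  | .recv x P => .recv (x.map f) (P.map f)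
  | .close x => .close (x.map f)
  | .wait x P => .wait (x.map f) (P.map f)
  | .fwd y x => .fwd (y.map f) (x.map f)
  | .cut d e P Q => .cut d e (P.map f) (Q.map f)

open Classical in
/-- The renaming `[x/y]`. -/
noncomputable def ren (y x : Chan L) : Chan L → Chan L := fun c => if c = y then x else c

/-- The run-time channels of a reference. -/
def Ref.chans : Ref L → Set (Chan L)
  | .bvar _ => ∅
  | .chan c => {c}

/-- The run-time channels that occur in a term. -/
def Proc.chans : Proc L → Set (Chan L)
  | .sel x _ P => x.chans ∪ P.chans
  | .branch x _ Q => x.chans ∪ ⋃ ℓ, (Q ℓ).chans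
  | .send z x P => z.chans ∪ x.chans ∪ P.chans
  | .recv x P => x.chans ∪ P.chans
  | .close x => x.chans
  | .wait x P => x.chans ∪ P.chans
  | .fwd y x => y.chans ∪ x.chans
  | .cut _ _ P Q => P.chans ∪ Q.chans

/-! ## Messages, nodes and configurations -/

/-- Messages in flight.
* `close y` is `close y`
* `selPos y k v` is `y.k; y ← v` and `selNeg y k v` is `y.k; v ← y`
* `sendPos x y v` is `send x y; y ← v` and `sendNeg x y v` is `send x y; v ← y`. -/
inductive Msg (L : Type u) : Type u
  | close (y : Chan L) : Msg L
  | selPos (y : Chan L) (k : ℕ) (v : Chan L) : Msg L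
  | selNeg (y : Chan L) (k : ℕ) (v : Chan L) : Msg L
  | sendPos (x y v : Chan L) : Msg L
  | sendNeg (x y v : Chan L) : Msg L

/-- The process term that a message consists of. -/
def Msg.toProc : Msg L → Proc L
  | .close y => .close y
  | .selPos y k v => .sel y k (.fwd y v)
  | .selNeg y k v => .sel y k (.fwd v y)
  | .sendPos x y v => .send x y (.fwd y v)
  | .sendNeg x y v => .send x y (.fwd v y)

/-- The channel along which a message is offered to its parent. -/
def Msg.offer : Msg L → Chan L
  | .close y => y
  | .selPos y _ _ => y
  | .selNeg _ _ v => v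
  | .sendPos _ y _ => y
  | .sendNeg _ _ v => v

/-- The channel along which a message is sent. -/
def Msg.carrier : Msg L → Chan L
  | .close y => y
  | .selPos y _ _ => y
  | .selNeg y _ _ => y
  | .sendPos _ y _ => y
  | .sendNeg _ y _ => y

/-- Messages of a positive type (`1`, `⊕`, `⊗`); the others are negative (`&`, `⊸`). -/
def Msg.Positive : Msg L → Prop
  | .close _ => True
  | .selPos _ _ _ => True
  | .selNeg _ _ _ => False
  | .sendPos _ _ _ => True
  | .sendNeg _ _ _ => False

/-- Renaming of the channels of a message. -/
def Msg.map (f : Chan L → Chan L) : Msg L → Msg L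
  | .close y => .close (f y)
  | .selPos y k v => .selPos (f y) k (f v)
  | .selNeg y k v => .selNeg (f y) k (f v)
  | .sendPos x y v => .sendPos (f x) (f y) (f v)
  | .sendNeg x y v => .sendNeg (f x) (f y) (f v)

/-- A node of a configuration: a process `proc(y[c], P@d)`, where `c` is the maximal secrecy of
`y` and `d` the running secrecy, or a message `msg(P)`. -/
inductive Node (L : Type u) : Type u
  | proc (y : Chan L) (P : Proc L) (d : L) : Node L
  | msg (m : Msg L) : Node L

/-- The channel that a node offers. -/
def Node.offer : Node L → Chan L
  | .proc y _ _ => y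
  | .msg m => m.offer

/-- The channels of a node: the offered one and those that its term mentions. -/
def Node.chans : Node L → Set (Chan L)
  | .proc y P _ => {y} ∪ P.chans
  | .msg m => m.toProc.chans

/-- The channels that a node uses as a client. -/
def Node.uses (n : Node L) : Set (Chan L) := n.chans \ {n.offer}

/-- Renaming of the channels of a node. -/
def Node.map (f : Chan L → Chan L) : Node L → Node L
  | .proc y P d => .proc (f y) (P.map f) d
  | .msg m => .msg (m.map f)

end Terms

/-- Configurations, considered up to permutation of their processes and messages. -/
abbrev Config (L : Type u) : Type u := Multiset (Node L)

/-- Linear contexts; the maximal secrecy is part of the channel. -/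
abbrev Ctx (L : Type u) : Type u := Multiset (Chan L × Ty)

/-- The right-hand side `K` of an interface: a typed channel `x : A` or `·`. -/
abbrev RIface (L : Type u) : Type u := Option (Chan L × Ty)

section Systems

variable {L : Type u}

/-- The channels of a context. -/
def Ctx.chans (Δ : Ctx L) : Set (Chan L) := {c | ∃ A, (c, A) ∈ Δ}

/-- The context with the channel of `K`, if any. -/
def RIface.ctx : RIface L → Ctx L
  | some p => {p}
  | none => 0

/-- The channels that occur in a configuration. -/
def Config.chans (B : Config L) : Set (Chan L) := {c | ∃ n ∈ B, c ∈ n.chans}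

/-- The channel names that occur in a configuration. -/
def Config.names (B : Config L) : Set ℕ := {a | ∃ c ∈ Config.chans B, c.name = a}

/-- The renaming `[x/y]` applied to a configuration. -/
noncomputable def Config.rename (B : Config L) (y x : Chan L) : Config L :=
  Multiset.map (Node.map (ren y x)) B

/-- The renaming `[x/y]` applied to the right-hand side of an interface. -/
noncomputable def RIface.rename (K : RIface L) (y x : Chan L) : RIface L :=
  Option.map (fun p => (ren y x p.1, p.2)) K

/-- The naming discipline of run-time channels in a closed configuration: no channel is offered
twice, and a channel that coexists with a later generation of itself still carries a message that
has not been received.  (A channel is advanced to its next generation exactly when a message is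
sent along it, and is replaced by the later generation when that message is received; so the next
generation of a channel along which a process sends is always a new channel.) -/
def WellNamed (B : Config L) : Prop :=
  (Multiset.map Node.offer B).Nodup ∧
    ∀ c ∈ Config.chans B, ∀ c' ∈ Config.chans B,
      c.name = c'.name → c.lvl = c'.lvl → c.gen < c'.gen → ∃ m, Node.msg m ∈ B ∧ m.carrier = c

end Systems

section Lattice

variable {L : Type u} [Lattice L]

/-! ## Typing -/

/-- `PTyped Δ P d y A` is the judgement `Ψ; Δ ⊢ P@d :: (y : A[c])` over the security lattice `L`,
where `c` is the maximal secrecy of `y`.  A bound channel variable is represented by an arbitrary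
channel `w` that does not occur in the sequent.  For a received channel the premise
`w.lvl = x.lvl` is the hypothesis `ψ = c` on its secrecy variable, by which `Ψ` is extended. -/
inductive PTyped : Ctx L → Proc L → L → Chan L → Ty → Prop
  | plusR {Δ : Ctx L} {P : Proc L} {d : L} {y : Chan L} {I : Finset ℕ}
      {A : {ℓ // ℓ ∈ I} → Ty} (k : {ℓ // ℓ ∈ I}) :
      PTyped Δ P d y (A k) →
      PTyped Δ (.sel y k P) d y (.plus I A)
  | plusL {Δ : Ctx L} {d : L} {x y : Chan L} {C : Ty} {I : Finset ℕ}
      {A : {ℓ // ℓ ∈ I} → Ty} {Q : {ℓ // ℓ ∈ I} → Proc L} :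
      (∀ k, PTyped ((x, A k) ::ₘ Δ) (Q k) (x.lvl ⊔ d) y C) →
      PTyped ((x, .plus I A) ::ₘ Δ) (.branch x I Q) d y C
  | ampR {Δ : Ctx L} {d : L} {y : Chan L} {I : Finset ℕ}
      {A : {ℓ // ℓ ∈ I} → Ty} {Q : {ℓ // ℓ ∈ I} → Proc L} :
      (∀ k, PTyped Δ (Q k) y.lvl y (A k)) →
      PTyped Δ (.branch y I Q) d y (.amp I A)
  | ampL {Δ : Ctx L} {P : Proc L} {d : L} {x y : Chan L} {C : Ty} {I : Finset ℕ}
      {A : {ℓ // ℓ ∈ I} → Ty} (k : {ℓ // ℓ ∈ I}) :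
      d ≤ x.lvl →
      PTyped ((x, A k) ::ₘ Δ) P d y C →
      PTyped ((x, .amp I A) ::ₘ Δ) (.sel x k P) d y C
  | tensorR {Δ : Ctx L} {P : Proc L} {d : L} {y z : Chan L} {A B : Ty} :
      z.lvl = y.lvl →
      PTyped Δ P d y B →
      PTyped ((z, A) ::ₘ Δ) (.send z y P) d y (.tensor A B)
  | tensorL {Δ : Ctx L} {P : Proc L} {d : L} {x y : Chan L} {A B C : Ty} :
      (∀ w : Chan L, w.lvl = x.lvl → w ∉ Ctx.chans Δ → w ≠ x → w ≠ y →
        PTyped ((w, A) ::ₘ (x, B) ::ₘ Δ) (P.at w) (x.lvl ⊔ d) y C) →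
      PTyped ((x, .tensor A B) ::ₘ Δ) (.recv x P) d y C
  | lolliR {Δ : Ctx L} {P : Proc L} {d : L} {y : Chan L} {A B : Ty} :
      (∀ w : Chan L, w.lvl = y.lvl → w ∉ Ctx.chans Δ → w ≠ y →
        PTyped ((w, A) ::ₘ Δ) (P.at w) y.lvl y B) →
      PTyped Δ (.recv y P) d y (.lolli A B)
  | lolliL {Δ : Ctx L} {P : Proc L} {d : L} {x y z : Chan L} {A B C : Ty} :
      d ≤ x.lvl → z.lvl = x.lvl →
      PTyped ((x, B) ::ₘ Δ) P d y C →
      PTyped ((z, A) ::ₘ (x, .lolli A B) ::ₘ Δ) (.send z x P) d y C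
  | oneR {d : L} {y : Chan L} :
      PTyped 0 (.close y) d y .one
  | oneL {Δ : Ctx L} {P : Proc L} {d : L} {x y : Chan L} {C : Ty} :
      PTyped Δ P (x.lvl ⊔ d) y C →
      PTyped ((x, .one) ::ₘ Δ) (.wait x P) d y C
  | fwd {d : L} {x y : Chan L} {A : Ty} :
      x.lvl = y.lvl →
      PTyped {(x, A)} (.fwd y x) d y A
  | cut {Δ₁ Δ₂ : Ctx L} {P Q : Proc L} {d₁ d₂ d' : L} {y : Chan L} (B : Ty) {C : Ty} :
      d₁ ≤ d₂ → d₂ ≤ d' → (∀ z ∈ Ctx.chans Δ₁, z.lvl ≤ d') → d' ≤ y.lvl →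
      (∀ w : Chan L, w.lvl = d' → w ∉ Ctx.chans (Δ₁ + Δ₂) → w ≠ y →
        PTyped Δ₁ (P.at w) d₂ w B) →
      (∀ w : Chan L, w.lvl = d' → w ∉ Ctx.chans (Δ₁ + Δ₂) → w ≠ y →
        PTyped ((w, B) ::ₘ Δ₂) (Q.at w) d₁ y C) →
      PTyped (Δ₁ + Δ₂) (.cut (.lit d') (.lit d₂) P Q) d₁ y C

/-- `CTyped Δ C Δ'` is the configuration typing judgement `Ψ; Δ ⊩ C :: Δ'`. -/
inductive CTyped : Ctx L → Config L → Ctx L → Prop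
  | emp₁ (x : Chan L) (A : Ty) : CTyped {(x, A)} 0 {(x, A)}
  | emp₂ : CTyped 0 0 0
  | proc {Δ₀ Δ₀' Δ : Ctx L} {C : Config L} {P : Proc L} {d : L} {x : Chan L} {A : Ty} :
      (x ::ₘ Multiset.map Prod.fst (Δ₀' + Δ)).Nodup →
      d ≤ x.lvl → (∀ y ∈ Ctx.chans (Δ₀' + Δ), y.lvl ≤ x.lvl) →
      CTyped Δ₀ C Δ → PTyped (Δ₀' + Δ) P d x A →
      CTyped (Δ₀ + Δ₀') (Node.proc x P d ::ₘ C) {(x, A)}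
  | msg {Δ₀ Δ₀' Δ : Ctx L} {C : Config L} {m : Msg L} {x : Chan L} {A : Ty} :
      (x ::ₘ Multiset.map Prod.fst (Δ₀' + Δ)).Nodup →
      (∀ y ∈ Ctx.chans (Δ₀' + Δ), y.lvl ≤ x.lvl) →
      CTyped Δ₀ C Δ → PTyped (Δ₀' + Δ) m.toProc x.lvl x A →
      CTyped (Δ₀ + Δ₀') (Node.msg m ::ₘ C) {(x, A)}
  | comp {Δ₀ Δ₀' Δ : Ctx L} {C C₁ : Config L} {x : Chan L} {A : Ty} :
      CTyped Δ₀ C Δ → CTyped Δ₀' C₁ {(x, A)} →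
      CTyped (Δ₀ + Δ₀') (C + C₁) ((x, A) ::ₘ Δ)

/-- The contexts that `K` may stand for on the right of a configuration judgement: `x : A` stands
for itself, and `·` for the empty context or for an unnamed terminating channel `w : 1`. -/
def RIface.Stands : RIface L → Ctx L → Prop
  | some p, Λ => Λ = {p}
  | none, Λ => Λ = 0 ∨ ∃ w : Chan L, Λ = {(w, Ty.one)}

/-- The judgement `Ψ; Δ ⊩ D :: K`. -/
def KTyped (Δ : Ctx L) (D : Config L) (K : RIface L) : Prop :=
  ∃ Λ, RIface.Stands K Λ ∧ CTyped Δ D Λ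

/-! ## Asynchronous dynamics -/

/-- One step of a configuration.  Forwarding to a channel in `keep`, the channels of the
right-hand side of the configuration typing, is not executed.  `used` holds the channel names in
use, which a spawn has to avoid. -/
inductive Step (used : Set ℕ) (keep : Set (Chan L)) : Config L → Config L → Prop
  | fwd (R : Config L) (y x : Chan L) (d : L) :
      y ∉ keep →
      Step used keep (.proc y (.fwd y x) d ::ₘ R) (Config.rename R y x)
  | cut (R : Config L) (y : Chan L) (P Q : Proc L) (d d₁ d₂ : L) (a : ℕ) :
      a ∉ used →
      Step used keep (.proc y (.cut (.lit d) (.lit d₂) P Q) d₁ ::ₘ R)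
        (.proc ⟨a, 0, d⟩ (P.at ⟨a, 0, d⟩) d₂ ::ₘ .proc y (Q.at ⟨a, 0, d⟩) d₁ ::ₘ R)
  | oneSend (R : Config L) (y : Chan L) (d : L) :
      Step used keep (.proc y (.close y) d ::ₘ R) (.msg (.close y) ::ₘ R)
  | oneRecv (R : Config L) (x y : Chan L) (Q : Proc L) (d : L) :
      Step used keep (.msg (.close y) ::ₘ .proc x (.wait y Q) d ::ₘ R)
        (.proc x Q (d ⊔ y.lvl) ::ₘ R)
  | plusSend (R : Config L) (y : Chan L) (k : ℕ) (P : Proc L) (d : L) :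
      Step used keep (.proc y (.sel y k P) d ::ₘ R)
        (.proc y.next (P.map (ren y y.next)) d ::ₘ .msg (.selPos y k y.next) ::ₘ R)
  | plusRecv (R : Config L) (u y v : Chan L) (I : Finset ℕ) (k : {ℓ // ℓ ∈ I})
      (Q : {ℓ // ℓ ∈ I} → Proc L) (d : L) :
      u ≠ y →
      Step used keep (.msg (.selPos y k v) ::ₘ .proc u (.branch y I Q) d ::ₘ R)
        (.proc u ((Q k).map (ren y v)) (d ⊔ y.lvl) ::ₘ R)
  | ampSend (R : Config L) (x y : Chan L) (k : ℕ) (P : Proc L) (d : L) :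
      x ≠ y →
      Step used keep (.proc y (.sel x k P) d ::ₘ R)
        (.msg (.selNeg x k x.next) ::ₘ .proc y (P.map (ren x x.next)) d ::ₘ R)
  | ampRecv (R : Config L) (y v : Chan L) (I : Finset ℕ) (k : {ℓ // ℓ ∈ I})
      (Q : {ℓ // ℓ ∈ I} → Proc L) (d : L) :
      Step used keep (.proc y (.branch y I Q) d ::ₘ .msg (.selNeg y k v) ::ₘ R)
        (.proc v ((Q k).map (ren y v)) y.lvl ::ₘ R)
  | tensorSend (R : Config L) (x y : Chan L) (P : Proc L) (d : L) :
      Step used keep (.proc y (.send x y P) d ::ₘ R)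
        (.proc y.next (P.map (ren y y.next)) d ::ₘ .msg (.sendPos x y y.next) ::ₘ R)
  | tensorRecv (R : Config L) (u x y v : Chan L) (P : Proc L) (d : L) :
      u ≠ y →
      Step used keep (.msg (.sendPos x y v) ::ₘ .proc u (.recv y P) d ::ₘ R)
        (.proc u ((P.map (ren y v)).at x) (d ⊔ y.lvl) ::ₘ R)
  | lolliSend (R : Config L) (x y z : Chan L) (P : Proc L) (d : L) :
      z ≠ y →
      Step used keep (.proc y (.send x z P) d ::ₘ R)
        (.msg (.sendNeg x z z.next) ::ₘ .proc y (P.map (ren z z.next)) d ::ₘ R)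
  | lolliRecv (R : Config L) (x y v : Chan L) (P : Proc L) (d : L) :
      Step used keep (.proc y (.recv y P) d ::ₘ .msg (.sendNeg x y v) ::ₘ R)
        (.proc v ((P.map (ren y v)).at x) y.lvl ::ₘ R)

/-- The node attempts to communicate with a provider along `c`: it is a negative message sent
along `c`, or a process that receives along the channel `c`, of which it is the client. -/
def Node.CommLeft : Node L → Chan L → Prop
  | .proc y P _, c => c ≠ y ∧
      ((∃ I Q, P = .branch c I Q) ∨ (∃ Q, P = .recv c Q) ∨ ∃ Q, P = .wait c Q)
  | .msg m, c => ¬ m.Positive ∧ m.carrier = c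

/-- The node attempts to communicate with its client along `c`: it is a positive message sent
along `c`, or a process offering `c` that receives along `c` or forwards to `c`. -/
def Node.CommRight : Node L → Chan L → Prop
  | .proc y P _, c => c = y ∧
      ((∃ I Q, P = .branch c I Q) ∨ (∃ Q, P = .recv c Q) ∨ ∃ x : Chan L, P = .fwd c x)
  | .msg m, c => m.Positive ∧ m.carrier = c

/-- `Ψ; Δ ⊩ C :: Λ` is poised: it cannot take a step, and it is empty or one of its nodes attempts
to communicate along a channel of `Δ` or `Λ`. -/
def Poised (used : Set ℕ) (keep : Set (Chan L)) (Δ : Ctx L) (C : Config L) (Λ : Ctx L) : Prop :=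
  (∀ C', ¬ Step used keep C C') ∧
    (C = 0 ∨ ∃ n ∈ C, (∃ c ∈ Ctx.chans Δ, n.CommLeft c) ∨ ∃ c ∈ Ctx.chans Λ, n.CommRight c)

/-! ## The logical relation -/

/-- A closed configuration `⟨C | D | F⟩`, divided into a partial program `D` and its closing
configurations. -/
structure Triple (L : Type u) : Type u where
  C : Config L
  D : Config L
  F : Config L

/-- The undivided configuration `C D F`. -/
def Triple.all (t : Triple L) : Config L := t.C + t.D + t.F

/-- One run of the relation `Tree_Ψ(Δ ⊩ K)`. -/
def Tree (Δ : Ctx L) (K : RIface L) (t : Triple L) : Prop :=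
  CTyped 0 t.C Δ ∧ KTyped Δ t.D K ∧ KTyped (RIface.ctx K) t.F none

/-- `⟨C | D | F⟩ ↦_{Δ ⊩ K} ⟨C' | D' | F'⟩`: one of the parts takes a step, and names that it
allocates are new to the whole configuration. -/
inductive TStep (Δ : Ctx L) (K : RIface L) : Triple L → Triple L → Prop
  | left {C D F C' : Config L} :
      Step (Config.names (C + D + F)) (Ctx.chans Δ) C C' → TStep Δ K ⟨C, D, F⟩ ⟨C', D, F⟩
  | mid {C D F D' : Config L} :
      Step (Config.names (C + D + F)) (Ctx.chans (RIface.ctx K)) D D' →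
      TStep Δ K ⟨C, D, F⟩ ⟨C, D', F⟩
  | right {C D F F' : Config L} :
      Step (Config.names (C + D + F)) ∅ F F' → TStep Δ K ⟨C, D, F⟩ ⟨C, D, F'⟩

/-- `⟨C | D | F⟩` is poised: each of its parts is poised. -/
def TPoised (Δ : Ctx L) (K : RIface L) (t : Triple L) : Prop :=
  Poised (Config.names t.all) (Ctx.chans Δ) 0 t.C Δ ∧
  (∃ Λ, RIface.Stands K Λ ∧ CTyped Δ t.D Λ ∧
    Poised (Config.names t.all) (Ctx.chans (RIface.ctx K)) Δ t.D Λ) ∧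
  (∃ Λ, RIface.Stands none Λ ∧ CTyped (RIface.ctx K) t.F Λ ∧
    Poised (Config.names t.all) ∅ (RIface.ctx K) t.F Λ)

/-- `t ↦^poised_{Δ ⊩ K} t'`. -/
def RunsTo (Δ : Ctx L) (K : RIface L) (t t' : Triple L) : Prop :=
  Relation.ReflTransGen (TStep Δ K) t t' ∧ TPoised Δ K t'

/-- Relations on closed configurations indexed by an interface `Δ ⊩ K`. -/
abbrev IRel (L : Type u) : Type u := Ctx L → RIface L → Config L → Config L → Prop

/-- The value relation `V⟦Δ ⊩ K⟧` on poised divided configurations `s`, `t`, with `E` as the term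
relation: there is one clause for each connective and each side of the interface, and one for
forwarding on each side.  The clauses for messages (and forwards) of the partial programs assert:
as soon as one of the two programs is ready to send along a channel of the interface, both send the
same message.  The clauses for messages (and forwards) of the closing configurations assume that
both runs send the same message. -/
structure Val (E : IRel L) (Δ : Ctx L) (K : RIface L) (s t : Triple L) : Prop where
  tree₁ : Tree Δ K s
  tree₂ : Tree Δ K t
  oneR : ∀ y : Chan L, K = some (y, .one) →
    Node.msg (.close y) ∈ s.D ∨ Node.msg (.close y) ∈ t.D →
    Δ = 0 ∧ s.C = 0 ∧ t.C = 0 ∧ s.D = {.msg (.close y)} ∧ t.D = {.msg (.close y)}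
  plusR : ∀ (y : Chan L) (I : Finset ℕ) (A : {ℓ // ℓ ∈ I} → Ty) (k : ℕ) (v : Chan L),
    K = some (y, .plus I A) →
    Node.msg (.selPos y k v) ∈ s.D ∨ Node.msg (.selPos y k v) ∈ t.D →
    ∃ (hk : k ∈ I) (D₁ D₂ : Config L),
      s.D = D₁ + {.msg (.selPos y k v)} ∧ t.D = D₂ + {.msg (.selPos y k v)} ∧
      E Δ (some (v, A ⟨k, hk⟩)) (s.C + D₁ + ({.msg (.selPos y k v)} + s.F))
        (t.C + D₂ + ({.msg (.selPos y k v)} + t.F))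
  ampR : ∀ (y : Chan L) (I : Finset ℕ) (A : {ℓ // ℓ ∈ I} → Ty) (k : {ℓ // ℓ ∈ I}) (v : Chan L)
    (F₁ F₂ : Config L),
    K = some (y, .amp I A) →
    s.F = {.msg (.selNeg y k v)} + F₁ → t.F = {.msg (.selNeg y k v)} + F₂ →
    E Δ (some (v, A k)) (s.C + (s.D + {.msg (.selNeg y k v)}) + F₁)
      (t.C + (t.D + {.msg (.selNeg y k v)}) + F₂)
  tensorR : ∀ (y : Chan L) (A B : Ty) (x v : Chan L),
    K = some (y, .tensor A B) →
    Node.msg (.sendPos x y v) ∈ s.D ∨ Node.msg (.sendPos x y v) ∈ t.D →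
    ∃ (Δ' Δ'' : Ctx L) (C₁' C₁'' C₂' C₂'' D₁ D₂ T₁ T₂ : Config L),
      Δ = Δ' + Δ'' ∧ s.C = C₁' + C₁'' ∧ t.C = C₂' + C₂'' ∧
      CTyped 0 C₁' Δ' ∧ CTyped 0 C₁'' Δ'' ∧ CTyped 0 C₂' Δ' ∧ CTyped 0 C₂'' Δ'' ∧
      CTyped Δ'' T₁ {(x, A)} ∧ CTyped Δ'' T₂ {(x, A)} ∧
      s.D = D₁ + T₁ + {.msg (.sendPos x y v)} ∧ t.D = D₂ + T₂ + {.msg (.sendPos x y v)} ∧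
      E Δ'' (some (x, A)) (C₁'' + T₁ + (C₁' + D₁ + {.msg (.sendPos x y v)} + s.F))
        (C₂'' + T₂ + (C₂' + D₂ + {.msg (.sendPos x y v)} + t.F)) ∧
      E Δ' (some (v, B)) (C₁' + D₁ + (C₁'' + T₁ + {.msg (.sendPos x y v)} + s.F))
        (C₂' + D₂ + (C₂'' + T₂ + {.msg (.sendPos x y v)} + t.F))
  lolliR : ∀ (y : Chan L) (A B : Ty) (x v : Chan L) (T₁ T₂ F₁ F₂ : Config L),
    K = some (y, .lolli A B) →
    CTyped 0 T₁ {(x, A)} → CTyped 0 T₂ {(x, A)} →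
    s.F = T₁ + {.msg (.sendNeg x y v)} + F₁ → t.F = T₂ + {.msg (.sendNeg x y v)} + F₂ →
    E ((x, A) ::ₘ Δ) (some (v, B)) (s.C + T₁ + (s.D + {.msg (.sendNeg x y v)}) + F₁)
      (t.C + T₂ + (t.D + {.msg (.sendNeg x y v)}) + F₂)
  oneL : ∀ (Δ' : Ctx L) (y : Chan L) (C₁ C₂ : Config L),
    Δ = (y, .one) ::ₘ Δ' →
    s.C = C₁ + {.msg (.close y)} → t.C = C₂ + {.msg (.close y)} →
    E Δ' K (C₁ + ({.msg (.close y)} + s.D) + s.F) (C₂ + ({.msg (.close y)} + t.D) + t.F)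
  plusL : ∀ (Δ' : Ctx L) (y : Chan L) (I : Finset ℕ) (A : {ℓ // ℓ ∈ I} → Ty) (k : {ℓ // ℓ ∈ I})
    (v : Chan L) (C₁ C₂ : Config L),
    Δ = (y, .plus I A) ::ₘ Δ' →
    s.C = C₁ + {.msg (.selPos y k v)} → t.C = C₂ + {.msg (.selPos y k v)} →
    E ((v, A k) ::ₘ Δ') K (C₁ + ({.msg (.selPos y k v)} + s.D) + s.F)
      (C₂ + ({.msg (.selPos y k v)} + t.D) + t.F)
  ampL : ∀ (Δ' : Ctx L) (y : Chan L) (I : Finset ℕ) (A : {ℓ // ℓ ∈ I} → Ty) (k : ℕ) (v : Chan L),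
    Δ = (y, .amp I A) ::ₘ Δ' →
    Node.msg (.selNeg y k v) ∈ s.D ∨ Node.msg (.selNeg y k v) ∈ t.D →
    ∃ (hk : k ∈ I) (D₁ D₂ : Config L),
      s.D = {.msg (.selNeg y k v)} + D₁ ∧ t.D = {.msg (.selNeg y k v)} + D₂ ∧
      E ((v, A ⟨k, hk⟩) ::ₘ Δ') K (s.C + {.msg (.selNeg y k v)} + D₁ + s.F)
        (t.C + {.msg (.selNeg y k v)} + D₂ + t.F)
  tensorL : ∀ (Δ' : Ctx L) (y : Chan L) (A B : Ty) (x v : Chan L) (T₁ T₂ C₁ C₂ : Config L),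
    Δ = (y, .tensor A B) ::ₘ Δ' →
    CTyped 0 T₁ {(x, A)} → CTyped 0 T₂ {(x, A)} →
    s.C = C₁ + T₁ + {.msg (.sendPos x y v)} → t.C = C₂ + T₂ + {.msg (.sendPos x y v)} →
    E ((x, A) ::ₘ (v, B) ::ₘ Δ') K (C₁ + T₁ + ({.msg (.sendPos x y v)} + s.D) + s.F)
      (C₂ + T₂ + ({.msg (.sendPos x y v)} + t.D) + t.F)
  lolliL : ∀ (Δ₀ : Ctx L) (y : Chan L) (A B : Ty) (x v : Chan L),
    Δ = (y, .lolli A B) ::ₘ Δ₀ →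
    Node.msg (.sendNeg x y v) ∈ s.D ∨ Node.msg (.sendNeg x y v) ∈ t.D →
    ∃ (Δ' Δ'' : Ctx L) (C₁' C₁'' C₂' C₂'' D₁ D₂ T₁ T₂ : Config L),
      Δ₀ = Δ' + Δ'' ∧ s.C = C₁' + C₁'' ∧ t.C = C₂' + C₂'' ∧
      CTyped 0 C₁' ((y, .lolli A B) ::ₘ Δ') ∧ CTyped 0 C₁'' Δ'' ∧
      CTyped 0 C₂' ((y, .lolli A B) ::ₘ Δ') ∧ CTyped 0 C₂'' Δ'' ∧
      CTyped Δ'' T₁ {(x, A)} ∧ CTyped Δ'' T₂ {(x, A)} ∧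
      s.D = T₁ + {.msg (.sendNeg x y v)} + D₁ ∧ t.D = T₂ + {.msg (.sendNeg x y v)} + D₂ ∧
      E Δ'' (some (x, A)) (C₁'' + T₁ + (C₁' + {.msg (.sendNeg x y v)} + D₁ + s.F))
        (C₂'' + T₂ + (C₂' + {.msg (.sendNeg x y v)} + D₂ + t.F)) ∧
      E ((v, B) ::ₘ Δ') K (C₁' + C₁'' + T₁ + {.msg (.sendNeg x y v)} + D₁ + s.F)
        (C₂' + C₂'' + T₂ + {.msg (.sendNeg x y v)} + D₂ + t.F)
  fwdR : ∀ (y : Chan L) (A : Ty) (x : Chan L),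
    K = some (y, A) →
    (∃ d, Node.proc y (.fwd y x) d ∈ s.D ∨ Node.proc y (.fwd y x) d ∈ t.D) →
    ∃ (d₁ d₂ : L) (D₁ D₂ : Config L),
      s.D = D₁ + {.proc y (.fwd y x) d₁} ∧ t.D = D₂ + {.proc y (.fwd y x) d₂} ∧
      E Δ (some (x, A)) (Config.rename (s.C + D₁ + s.F) y x)
        (Config.rename (t.C + D₂ + t.F) y x)
  fwdL : ∀ (Δ' : Ctx L) (y : Chan L) (A : Ty) (x : Chan L) (d₁ d₂ : L) (C₁ C₂ : Config L),
    Δ = (y, A) ::ₘ Δ' →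
    s.C = C₁ + {.proc y (.fwd y x) d₁} → t.C = C₂ + {.proc y (.fwd y x) d₂} →
    E ((x, A) ::ₘ Δ') (RIface.rename K y x) (Config.rename (C₁ + s.D + s.F) y x)
      (Config.rename (C₂ + t.D + t.F) y x)

/-- The defining clause of the term relation, with `E` as the term relation in the value relation:
both closed configurations can be divided along the interface and run to poised ones that are
related by the value relation. -/
def TermClause (E : IRel L) : IRel L := fun Δ K B₁ B₂ =>
  ∃ s t s' t' : Triple L,
    B₁ = s.all ∧ B₂ = t.all ∧ Tree Δ K s ∧ Tree Δ K t ∧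
    RunsTo Δ K s s' ∧ RunsTo Δ K t t' ∧ Val E Δ K s' t'

/-- The term relation `E⟦Δ ⊩ K⟧`: the least relation closed under `TermClause`. -/
inductive Term : Ctx L → RIface L → Config L → Config L → Prop
  | intro (E : IRel L) (hE : ∀ Δ K B₁ B₂, E Δ K B₁ B₂ → Term Δ K B₁ B₂)
      {Δ : Ctx L} {K : RIface L} {B₁ B₂ : Config L} (h : TermClause E Δ K B₁ B₂) :
      Term Δ K B₁ B₂

/-! ## Observers: projections, relevance and equivalence -/

open Classical in
/-- The projection `Δ ⇓ ξ` to the observable channels. -/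
noncomputable def Ctx.proj (ξ : L) (Δ : Ctx L) : Ctx L := Multiset.filter (fun p => p.1.lvl ≤ ξ) Δ

open Classical in
/-- The projection `(x : A) ⇓ ξ`. -/
noncomputable def projR (ξ : L) (p : Chan L × Ty) : RIface L := if p.1.lvl ≤ ξ then some p else none

/-- The quasi running secrecy of a process with the given term and running secrecy. -/
def Proc.quasi (d : L) : Proc L → L
  | .branch (.chan y) _ _ => d ⊔ y.lvl
  | .recv (.chan y) _ => d ⊔ y.lvl
  | _ => d

/-- `Quasi D n q`: the node `n` has quasi running secrecy `q` in the configuration `D`. -/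
inductive Quasi (D : Config L) : Node L → L → Prop
  | proc (y : Chan L) (P : Proc L) (d : L) : Quasi D (.proc y P d) (P.quasi d)
  | neg (m : Msg L) : ¬ m.Positive → Quasi D (.msg m) m.carrier.lvl
  | root (m : Msg L) : m.Positive → (∀ n ∈ D, m.offer ∉ n.uses) → Quasi D (.msg m) m.carrier.lvl
  | child (m : Msg L) (n : Node L) (q : L) : m.Positive → n ∈ D → m.offer ∈ n.uses →
      Quasi D n q → Quasi D (.msg m) (q ⊔ m.carrier.lvl)

/-- The node has a quasi running secrecy lower than or equal to `ξ`. -/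
def QuasiLe (ξ : L) (D : Config L) (n : Node L) : Prop := ∃ q, Quasi D n q ∧ q ≤ ξ

/-- The relevant channels of `Δ ⊩ D :: Λ` for the observer level `ξ`. -/
inductive RelChan (ξ : L) (Δ : Ctx L) (D : Config L) (Λ : Ctx L) : Chan L → Prop
  | obs (c : Chan L) : c.lvl ≤ ξ → c ∈ Ctx.chans Δ ∪ Ctx.chans Λ → RelChan ξ Δ D Λ c
  | share (c c' : Chan L) (n : Node L) : c.lvl ≤ ξ → n ∈ D → QuasiLe ξ D n →
      c ∈ n.chans → c' ∈ n.chans → RelChan ξ Δ D Λ c' → RelChan ξ Δ D Λ c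

open Classical in
/-- `D ⇓ ξ`: the relevant processes and messages of `Δ ⊩ D :: Λ`. -/
noncomputable def relevant (ξ : L) (Δ : Ctx L) (D : Config L) (Λ : Ctx L) : Config L :=
  Multiset.filter (fun n => QuasiLe ξ D n ∧ ∃ c ∈ n.chans, RelChan ξ Δ D Λ c) D

/-- `n'` is `n` up to renaming of channels with a maximal secrecy higher than or incomparable to
`ξ`. -/
def NodeEq (ξ : L) (n n' : Node L) : Prop :=
  ∃ π : Equiv.Perm (Chan L), (∀ c, (π c).lvl = c.lvl) ∧ (∀ c, c.lvl ≤ ξ → π c = c) ∧ n' = n.map π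

/-- The equality `=_ξ` of (relevant parts of) configurations, up to renaming of non-observable
channels in the processes and messages. -/
def ConfigEq (ξ : L) (D D' : Config L) : Prop := Multiset.Rel (NodeEq ξ) D D'

/-- Equivalence up to observable messages,
`(Δ₁ ⊩ D₁ :: x : A₁) ≡^Ψ_ξ (Δ₂ ⊩ D₂ :: y : A₂)`. -/
def ObsEquiv (ξ : L) (Δ₁ : Ctx L) (D₁ : Config L) (p₁ : Chan L × Ty)
    (Δ₂ : Ctx L) (D₂ : Config L) (p₂ : Chan L × Ty) : Prop :=
  CTyped Δ₁ D₁ {p₁} ∧ CTyped Δ₂ D₂ {p₂} ∧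
  Ctx.proj ξ Δ₁ = Ctx.proj ξ Δ₂ ∧ projR ξ p₁ = projR ξ p₂ ∧
  ∀ C₁ C₂ F₁ F₂ : Config L,
    CTyped 0 C₁ Δ₁ → CTyped 0 C₂ Δ₂ → KTyped {p₁} F₁ none → KTyped {p₂} F₂ none →
    WellNamed (C₁ + D₁ + F₁) → WellNamed (C₂ + D₂ + F₂) →
    Term (Ctx.proj ξ Δ₁) (projR ξ p₁) (C₁ + D₁ + F₁) (C₂ + D₂ + F₂)

end Lattice

end SecSess

/-! The theorem is a noninterference statement, and its proof is a lockstep simulation of two runs.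
After a closed configuration has been divided along the observable interface, the nodes of the
partial program fall into three groups (`Side`). `S` holds nodes of observable secrecy that
correspond, up to a renaming of secret channels, to nodes of the other run. `W` holds processes that
run at a secret level or wait along a secret channel, and positive messages whose observable channel
occurs neither at the interface nor in `S` or `U`. `U` holds nodes that share no observable channel
with the interface or with `S`. Two programs `Agree` if they have such partitions with corresponding
`S`. Initially `S` is the relevant part of the program (`St.side`).

Each step of one program is answered by at most one step of the other, so that agreement persists
(`Agree.step`). A step within `S` is copied through the renaming. A process of `W` that sends or
spawns runs at a secret level, and the flow conditions of the type system keep all its products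
secret; a process of `W` that receives stays secret. Nodes of `U` react only with each other. In the
last two situations the other run rests. Three facts close the cases: all channels of a message have
one level, so an observable message is literally the same in both runs; channels are linear, so a
message has just one receiver; and a process runs below the level of the channel that it offers, so
a process with a secret running secrecy never receives an observable negative message.

Every step shrinks the configuration, so matching steps of either side ends in two agreeing
configurations without steps (`Related.run`), which progress shows to be poised. A message or
forwarder of a program at the interface has observable channels only, hence it lies in `S` and
occurs in both programs (`Agree.take`). If a channel is sent, the tree below it is observable
throughout, because levels do not increase downwards, so this tree is common to both programs
(`Agree.subtree`). These facts give the clauses of the value relation (`Related.val`). The term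
relation follows by lexicographic induction on the joint size of the two configurations and the
number of connectives of the interface (`Related.term`): a message that changes sides leaves the
configuration alone and shortens a type, while the removal of a forwarder shrinks the configuration.

The typing judgement for configurations is tree-shaped and awkward to cut and regroup. It is
therefore replaced by a global description of the closed configuration (`Typed`, `Wt`): a type for
each channel, a rank that decreases from the offer of a node to its client channels, and the
multiset equation that the offered channels are the used ones and the root. Whether a part is typed
at its boundary then amounts to an equation of multisets (`Bal`, `CTyped.of_bal`, `CTyped.bal`). One
obstacle is that a branching without labels is typed in every context, so a term need not mention
all its client channels. Terms with this defect are doomed: doom persists under steps, whereas a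
closed configuration runs to a single close message, so it contains no doomed process
(`Typed.not_doomed`). -/

namespace SecSess

universe u

variable {L : Type u}

/-! ## Renaming and instantiation -/

/-- A renaming that keeps the maximal secrecy of every channel. -/
def LvlPres (f : Chan L → Chan L) : Prop := ∀ c, (f c).lvl = c.lvl

theorem Ref.map_map (f g : Chan L → Chan L) (x : Ref L) : (x.map f).map g = x.map (g ∘ f) := by
  cases x <;> rfl

theorem Ref.map_congr {f g : Chan L → Chan L} {x : Ref L} (h : ∀ c ∈ x.chans, f c = g c) :
    x.map f = x.map g := by
  cases x with
  | bvar => rfl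
  | chan c => simp [Ref.map, h c (by simp [Ref.chans])]

theorem Ref.chans_map (f : Chan L → Chan L) (x : Ref L) : (x.map f).chans = f '' x.chans := by
  cases x <;> simp [Ref.map, Ref.chans]

theorem Ref.map_inst {f : Chan L → Chan L} (k : ℕ) (w : Chan L) (x : Ref L) :
    (x.inst k w).map f = (x.map f).inst k (f w) := by
  cases x with
  | bvar i => by_cases h : i = k <;> simp [Ref.inst, Ref.map, h]
  | chan c => rfl

theorem Proc.map_map (f g : Chan L → Chan L) (P : Proc L) :
    (P.map f).map g = P.map (g ∘ f) := by
  induction P <;> simp_all [Proc.map, Ref.map_map]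

theorem Proc.map_congr {f g : Chan L → Chan L} {P : Proc L} (h : ∀ c ∈ P.chans, f c = g c) :
    P.map f = P.map g := by
  induction P with
  | sel x k P ih | recv x P ih | wait x P ih =>
    simp only [Proc.chans, Set.mem_union] at h
    simp only [Proc.map]
    rw [Ref.map_congr (fun c hc => h c (.inl hc)), ih (fun c hc => h c (.inr hc))]
  | branch x I Q ih =>
    simp only [Proc.chans, Set.mem_union, Set.mem_iUnion] at h
    simp only [Proc.map]
    rw [Ref.map_congr (fun c hc => h c (.inl hc))]
    congr 1
    funext l
    exact ih l (fun c hc => h c (.inr ⟨l, hc⟩))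
  | send z x P ih =>
    simp only [Proc.chans, Set.mem_union] at h
    simp only [Proc.map]
    rw [Ref.map_congr (fun c hc => h c (.inl (.inl hc))),
      Ref.map_congr (fun c hc => h c (.inl (.inr hc))), ih (fun c hc => h c (.inr hc))]
  | close x =>
    simp only [Proc.map]
    rw [Ref.map_congr h]
  | fwd y x =>
    simp only [Proc.chans, Set.mem_union] at h
    simp only [Proc.map]
    rw [Ref.map_congr (fun c hc => h c (.inl hc)), Ref.map_congr (fun c hc => h c (.inr hc))]
  | cut d e P Q ih₁ ih₂ =>
    simp only [Proc.chans, Set.mem_union] at h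
    simp only [Proc.map]
    rw [ih₁ (fun c hc => h c (.inl hc)), ih₂ (fun c hc => h c (.inr hc))]

theorem Ref.map_id' (x : Ref L) : x.map (fun c => c) = x := by cases x <;> rfl

theorem Proc.map_id' (P : Proc L) : P.map (fun c => c) = P := by
  induction P <;> simp_all [Proc.map, Ref.map_id']

theorem Proc.chans_map (f : Chan L → Chan L) (P : Proc L) : (P.map f).chans = f '' P.chans := by
  induction P <;> simp_all [Proc.map, Proc.chans, Ref.chans_map, Set.image_union, Set.image_iUnion]

theorem Sec.inst_congr {k : ℕ} {w w' : Chan L} (h : w.lvl = w'.lvl) (d : Sec L) :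
    d.inst k w = d.inst k w' := by
  cases d <;> simp [Sec.inst, h]

/-- Instantiation also writes the level of the channel into the secrecy annotations of `cut`, which
a renaming leaves alone. This is where `f` has to preserve levels. -/
theorem Proc.map_inst {f : Chan L → Chan L} (hf : LvlPres f) (w : Chan L) (P : Proc L) (k : ℕ) :
    (P.inst k w).map f = (P.map f).inst k (f w) := by
  induction P generalizing k <;>
    simp_all [Proc.map, Proc.inst, Ref.map_inst, Sec.inst_congr (hf w)]

theorem Ref.chans_inst_subset (k : ℕ) (w : Chan L) (x : Ref L) :
    (x.inst k w).chans ⊆ {w} ∪ x.chans := by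
  cases x with
  | bvar i => by_cases h : i = k <;> simp [Ref.inst, Ref.chans, h]
  | chan c => simp [Ref.inst, Ref.chans]

theorem Ref.chans_subset_inst (k : ℕ) (w : Chan L) (x : Ref L) :
    x.chans ⊆ (x.inst k w).chans := by
  cases x <;> simp [Ref.inst, Ref.chans]

theorem Proc.chans_inst_subset (w : Chan L) (P : Proc L) (k : ℕ) :
    (P.inst k w).chans ⊆ {w} ∪ P.chans := by
  induction P generalizing k with
  | sel x l P ih | recv x P ih | wait x P ih =>
    intro c hc
    rcases hc with hc | hc
    · rcases Ref.chans_inst_subset _ _ _ hc with h | h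
      exacts [.inl h, .inr (.inl h)]
    · rcases ih _ hc with h | h
      exacts [.inl h, .inr (.inr h)]
  | branch x I Q ih =>
    intro c hc
    rcases hc with hc | hc
    · rcases Ref.chans_inst_subset _ _ _ hc with h | h
      exacts [.inl h, .inr (.inl h)]
    · obtain ⟨l, hl⟩ := Set.mem_iUnion.1 hc
      rcases ih l _ hl with h | h
      exacts [.inl h, .inr (.inr (Set.mem_iUnion.2 ⟨l, h⟩))]
  | send z x P ih =>
    intro c hc
    rcases hc with (hc | hc) | hc
    · rcases Ref.chans_inst_subset _ _ _ hc with h | h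
      exacts [.inl h, .inr (.inl (.inl h))]
    · rcases Ref.chans_inst_subset _ _ _ hc with h | h
      exacts [.inl h, .inr (.inl (.inr h))]
    · rcases ih _ hc with h | h
      exacts [.inl h, .inr (.inr h)]
  | close x => exact Ref.chans_inst_subset _ _ _
  | fwd y x =>
    intro c hc
    rcases hc with hc | hc
    · rcases Ref.chans_inst_subset _ _ _ hc with h | h
      exacts [.inl h, .inr (.inl h)]
    · rcases Ref.chans_inst_subset _ _ _ hc with h | h
      exacts [.inl h, .inr (.inr h)]
  | cut d e P Q ih₁ ih₂ =>
    intro c hc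
    rcases hc with hc | hc
    · rcases ih₁ _ hc with h | h
      exacts [.inl h, .inr (.inl h)]
    · rcases ih₂ _ hc with h | h
      exacts [.inl h, .inr (.inr h)]

theorem Proc.chans_subset_inst (w : Chan L) (P : Proc L) (k : ℕ) :
    P.chans ⊆ (P.inst k w).chans := by
  induction P generalizing k with
  | sel x l P ih | recv x P ih | wait x P ih =>
    exact Set.union_subset_union (Ref.chans_subset_inst _ _ _) (ih _)
  | branch x I Q ih =>
    exact Set.union_subset_union (Ref.chans_subset_inst _ _ _)
      (Set.iUnion_mono fun l => ih l _)
  | send z x P ih =>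
    exact Set.union_subset_union (Set.union_subset_union (Ref.chans_subset_inst _ _ _)
      (Ref.chans_subset_inst _ _ _)) (ih _)
  | close x => exact Ref.chans_subset_inst _ _ _
  | fwd y x =>
    exact Set.union_subset_union (Ref.chans_subset_inst _ _ _) (Ref.chans_subset_inst _ _ _)
  | cut d e P Q ih₁ ih₂ => exact Set.union_subset_union (ih₁ _) (ih₂ _)

theorem Ref.chans_finite (x : Ref L) : x.chans.Finite := by
  cases x <;> simp [Ref.chans]

theorem Proc.chans_finite (P : Proc L) : P.chans.Finite := by
  induction P with
  | branch x I Q ih =>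
    exact (Ref.chans_finite x).union (Set.finite_iUnion ih)
  | _ => simp_all [Proc.chans, Ref.chans_finite]

/-! ## Size and doom -/

/-- The number of steps that a term can cause, at most. -/
def Proc.size : Proc L → ℕ
  -- A send is replaced by its continuation and a message of size 1, so it has to weigh 2 for a
  -- strict decrease; likewise `close`, which turns into a message.
  | .sel _ _ P => P.size + 2
  | .branch _ _ Q => (∑ ℓ, (Q ℓ).size) + 1
  | .send _ _ P => P.size + 2
  | .recv _ P => P.size + 1
  | .close _ => 2
  | .wait _ P => P.size + 1
  | .fwd _ _ => 1
  | .cut _ _ P Q => P.size + Q.size + 1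

/-- Every path through the term ends in a branching without branches. -/
def Proc.Doomed : Proc L → Prop
  | .sel _ _ P => P.Doomed
  | .branch _ _ Q => ∀ ℓ, (Q ℓ).Doomed
  | .send _ _ P => P.Doomed
  | .recv _ P => P.Doomed
  | .close _ => False
  | .wait _ P => P.Doomed
  | .fwd _ _ => False
  -- A disjunction, because a cut splits the context and an unmentioned channel goes to only one of
  -- the two terms.
  | .cut _ _ P Q => P.Doomed ∨ Q.Doomed

theorem Proc.size_map (f : Chan L → Chan L) (P : Proc L) : (P.map f).size = P.size := by
  induction P <;> simp_all [Proc.map, Proc.size]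

theorem Proc.size_inst (w : Chan L) (P : Proc L) (k : ℕ) : (P.inst k w).size = P.size := by
  induction P generalizing k <;> simp_all [Proc.inst, Proc.size]

theorem Proc.doomed_map (f : Chan L → Chan L) (P : Proc L) : (P.map f).Doomed ↔ P.Doomed := by
  induction P <;> simp_all [Proc.map, Proc.Doomed]

theorem Proc.doomed_inst (w : Chan L) (P : Proc L) (k : ℕ) : (P.inst k w).Doomed ↔ P.Doomed := by
  induction P generalizing k <;> simp_all [Proc.inst, Proc.Doomed]

/-- The node is a process with a doomed term. -/
def Node.Doomed : Node L → Prop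
  | .proc _ P _ => P.Doomed
  | .msg _ => False

/-- The size of a node. -/
def Node.size : Node L → ℕ
  | .proc _ P _ => P.size
  | .msg _ => 1

/-- The size of a configuration. -/
def Config.size (D : Config L) : ℕ := (Multiset.map Node.size D).sum

theorem Node.doomed_map (f : Chan L → Chan L) (n : Node L) : (n.map f).Doomed ↔ n.Doomed := by
  cases n <;> simp [Node.map, Node.Doomed, Proc.doomed_map]

theorem Node.size_map (f : Chan L → Chan L) (n : Node L) : (n.map f).size = n.size := by
  cases n <;> simp [Node.map, Node.size, Proc.size_map]

@[simp] theorem Config.size_cons (n : Node L) (D : Config L) :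
    Config.size (n ::ₘ D) = n.size + Config.size D := by simp [Config.size]

@[simp] theorem Config.size_add (D E : Config L) :
    Config.size (D + E) = Config.size D + Config.size E := by simp [Config.size]

@[simp] theorem Config.size_singleton (n : Node L) :
    Config.size ({n} : Config L) = n.size := by simp [Config.size]

@[simp] theorem Config.size_rename (D : Config L) (y x : Chan L) :
    Config.size (Config.rename D y x) = Config.size D := by
  simp [Config.size, Config.rename, Node.size_map]

/-! ## Channels of messages and nodes -/

theorem Msg.toProc_map (f : Chan L → Chan L) (m : Msg L) :
    (m.map f).toProc = m.toProc.map f := by cases m <;> rfl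

theorem Msg.offer_map (f : Chan L → Chan L) (m : Msg L) : (m.map f).offer = f m.offer := by
  cases m <;> rfl

theorem Msg.carrier_map (f : Chan L → Chan L) (m : Msg L) :
    (m.map f).carrier = f m.carrier := by cases m <;> rfl

theorem Msg.positive_map (f : Chan L → Chan L) (m : Msg L) :
    (m.map f).Positive ↔ m.Positive := by cases m <;> rfl

theorem Node.offer_map (f : Chan L → Chan L) (n : Node L) : (n.map f).offer = f n.offer := by
  cases n <;> simp [Node.map, Node.offer, Msg.offer_map]

theorem Node.chans_map (f : Chan L → Chan L) (n : Node L) :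
    (n.map f).chans = f '' n.chans := by
  cases n <;>
    simp [Node.map, Node.chans, Msg.toProc_map, Proc.chans_map, Set.image_insert_eq]

theorem Node.chans_finite (n : Node L) : n.chans.Finite := by
  cases n <;> simp [Node.chans, Proc.chans_finite]

theorem Msg.offer_mem (m : Msg L) : m.offer ∈ m.toProc.chans := by
  cases m <;> simp [Msg.offer, Msg.toProc, Proc.chans, Ref.chans]

theorem Msg.carrier_mem (m : Msg L) : m.carrier ∈ m.toProc.chans := by
  cases m <;> simp [Msg.carrier, Msg.toProc, Proc.chans, Ref.chans]

theorem Node.offer_mem (n : Node L) : n.offer ∈ n.chans := by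
  cases n <;> simp [Node.offer, Node.chans, Msg.offer_mem]

theorem Msg.map_congr {f g : Chan L → Chan L} {m : Msg L}
    (h : ∀ c ∈ m.toProc.chans, f c = g c) : m.map f = m.map g := by
  cases m <;> simp_all [Msg.map, Msg.toProc, Proc.chans, Ref.chans]

theorem Node.map_congr {f g : Chan L → Chan L} {n : Node L} (h : ∀ c ∈ n.chans, f c = g c) :
    n.map f = n.map g := by
  cases n with
  | proc y P d =>
    simp only [Node.map]
    rw [h y (.inl rfl), Proc.map_congr fun c hc => h c (.inr hc)]
  | msg m =>
    simp only [Node.map]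
    rw [Msg.map_congr h]

theorem Msg.map_id' (m : Msg L) : m.map (fun c => c) = m := by cases m <;> rfl

theorem Node.map_map (f g : Chan L → Chan L) (n : Node L) : (n.map f).map g = n.map (g ∘ f) := by
  cases n with
  | proc => simp [Node.map, Proc.map_map]
  | msg m => cases m <;> rfl

theorem Config.chans_finite (D : Config L) : (Config.chans D).Finite := by
  have : Config.chans D = ⋃ n ∈ {n | n ∈ D}, Node.chans n := by
    ext c; simp [Config.chans]
  rw [this]
  refine Set.Finite.biUnion ?_ fun n _ => Node.chans_finite n
  classical
  exact (D.toFinset.finite_toSet).subset fun n hn => by simpa using hn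

theorem Config.names_finite (D : Config L) : (Config.names D).Finite :=
  ((Config.chans_finite D).image Chan.name).subset fun _ ⟨c, hc, h⟩ => ⟨c, hc, h⟩

/-! ## The renaming of one channel -/

@[simp] theorem ren_self (y x : Chan L) : ren y x y = x := by simp [ren]

theorem ren_of_ne {y x c : Chan L} (h : c ≠ y) : ren y x c = c := by simp [ren, h]

theorem ren_lvl {y x : Chan L} (h : x.lvl = y.lvl) : LvlPres (ren y x) := by
  intro c
  by_cases hc : c = y
  · simp [hc, h]
  · rw [ren_of_ne hc]

open Classical in
theorem swap_lvl {y x : Chan L} (h : x.lvl = y.lvl) : LvlPres (Equiv.swap y x) := by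
  intro c
  rw [Equiv.swap_apply_def]
  split_ifs with h₁ h₂ <;> simp_all

-- Away from its target, the renaming `[x/y]` is a transposition. Typing derivations and equality of
-- nodes are transported along permutations, and this is how renamings of one channel inherit those
-- results.
open Classical in
theorem ren_eq_swap {y x c : Chan L} (h : c ≠ x ∨ x = y) : ren y x c = Equiv.swap y x c := by
  rcases h with h | rfl
  · by_cases hc : c = y
    · simp [hc]
    · rw [ren_of_ne hc, Equiv.swap_apply_of_ne_of_ne hc h]
  · by_cases hc : c = x
    · simp [hc]
    · rw [ren_of_ne hc]; simp

theorem Node.map_ren_of_notMem {n : Node L} {y x : Chan L} (h : y ∉ n.chans) :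
    n.map (ren y x) = n := by
  have h₁ : n.map (ren y x) = n.map (fun c => c) :=
    Node.map_congr fun c hc => ren_of_ne (by rintro rfl; exact h hc)
  have h₂ : n.map (fun c => c) = n := by
    cases n with
    | proc => simp [Node.map, Proc.map_id']
    | msg m => simp [Node.map, Msg.map_id']
  rw [h₁, h₂]

theorem Chan.next_ne (y : Chan L) : y.next ≠ y := by
  intro h
  have := congrArg Chan.gen h
  simp [Chan.next] at this

end SecSess

/-! ### Contexts, and process typing under renaming -/

namespace SecSess

universe u

variable {L : Type u}

/-! ## Contexts -/

/-- Renaming of the channels of a context. -/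
def Ctx.ren (f : Chan L → Chan L) (Γ : Ctx L) : Ctx L := Multiset.map (fun p => (f p.1, p.2)) Γ

/-- The channels of a context, with multiplicities. -/
def Ctx.fst (Γ : Ctx L) : Multiset (Chan L) := Multiset.map Prod.fst Γ

theorem Ctx.mem_fst {Γ : Ctx L} {c : Chan L} : c ∈ Ctx.fst Γ ↔ c ∈ Ctx.chans Γ := by
  simp [Ctx.fst, Ctx.chans]

@[simp] theorem Ctx.fst_zero : Ctx.fst (0 : Ctx L) = 0 := rfl

@[simp] theorem Ctx.fst_cons (p : Chan L × Ty) (Γ : Ctx L) :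
    Ctx.fst (p ::ₘ Γ) = p.1 ::ₘ Ctx.fst Γ := by simp [Ctx.fst]

@[simp] theorem Ctx.fst_singleton (p : Chan L × Ty) :
    Ctx.fst ({p} : Ctx L) = {p.1} := by simp [Ctx.fst]

@[simp] theorem Ctx.fst_add (Γ Δ : Ctx L) : Ctx.fst (Γ + Δ) = Ctx.fst Γ + Ctx.fst Δ := by
  simp [Ctx.fst]

theorem Ctx.mem_chans_cons {p : Chan L × Ty} {Γ : Ctx L} {c : Chan L} :
    c ∈ Ctx.chans (p ::ₘ Γ) ↔ c = p.1 ∨ c ∈ Ctx.chans Γ := by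
  rw [← Ctx.mem_fst, ← Ctx.mem_fst]; simp

theorem Ctx.mem_chans_add {Γ Δ : Ctx L} {c : Chan L} :
    c ∈ Ctx.chans (Γ + Δ) ↔ c ∈ Ctx.chans Γ ∨ c ∈ Ctx.chans Δ := by
  simp only [← Ctx.mem_fst, Ctx.fst_add, Multiset.mem_add]

theorem Ctx.mem_chans_singleton {p : Chan L × Ty} {c : Chan L} :
    c ∈ Ctx.chans ({p} : Ctx L) ↔ c = p.1 := by
  simp [← Ctx.mem_fst]

theorem Ctx.notMem_chans_zero {c : Chan L} : c ∉ Ctx.chans (0 : Ctx L) := by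
  simp [← Ctx.mem_fst]

theorem Ctx.chans_finite (Γ : Ctx L) : (Ctx.chans Γ).Finite := by
  classical
  exact ((Ctx.fst Γ).toFinset.finite_toSet).subset fun c hc => by
    simpa [Ctx.mem_fst] using hc

theorem Ctx.ren_add (f : Chan L → Chan L) (Γ Δ : Ctx L) :
    Ctx.ren f (Γ + Δ) = Ctx.ren f Γ + Ctx.ren f Δ := by simp [Ctx.ren]

theorem Ctx.ren_cons (f : Chan L → Chan L) (p : Chan L × Ty) (Γ : Ctx L) :
    Ctx.ren f (p ::ₘ Γ) = (f p.1, p.2) ::ₘ Ctx.ren f Γ := by simp [Ctx.ren]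

theorem Ctx.mem_chans_ren {π : Equiv.Perm (Chan L)} {Γ : Ctx L} {c : Chan L} :
    c ∈ Ctx.chans (Ctx.ren π Γ) ↔ π.symm c ∈ Ctx.chans Γ := by
  simp only [Ctx.chans, Ctx.ren, Multiset.mem_map, Set.mem_ofPred_eq, Prod.mk.injEq, Prod.exists]
  constructor
  · rintro ⟨A, c', A', h, rfl, rfl⟩
    exact ⟨A', by simpa using h⟩
  · rintro ⟨A, h⟩
    exact ⟨A, _, A, h, by simp, rfl⟩

theorem Ctx.ren_of_notMem {a b : Chan L} {Γ : Ctx L} (h : a ∉ Ctx.chans Γ) :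
    Ctx.ren (SecSess.ren a b) Γ = Γ := by
  rw [Ctx.ren]
  conv_rhs => rw [← Multiset.map_id Γ]
  refine Multiset.map_congr rfl fun p hp => ?_
  rw [ren_of_ne]
  · rfl
  · rintro rfl
    exact h ⟨p.2, hp⟩

/-- A channel of a given level that avoids a finite set. -/
theorem exists_fresh_chan (ℓ : L) {s : Set (Chan L)} (hs : s.Finite) :
    ∃ w : Chan L, w.lvl = ℓ ∧ w ∉ s := by
  obtain ⟨a, ha⟩ := (hs.image Chan.name).exists_notMem
  exact ⟨⟨a, 0, ℓ⟩, rfl, fun h => ha ⟨_, h, rfl⟩⟩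

variable [Lattice L]

/-! ## Renaming of typing derivations -/

/-- Bound channels are quantified over all fresh channels. A channel that is fresh for the renamed
sequent has to be pulled back to one that is fresh for the original, which is why the renaming is a
permutation. -/
theorem PTyped.map_perm {π : Equiv.Perm (Chan L)} (hπ : LvlPres π) {Γ : Ctx L} {P : Proc L}
    {d : L} {y : Chan L} {A : Ty} (h : PTyped Γ P d y A) :
    PTyped (Ctx.ren π Γ) (P.map π) d (π y) A := by
  induction h with
  | plusR k _ ih => exact .plusR k ih
  | plusL _ ih =>
    rw [Ctx.ren_cons]
    refine .plusL fun k => ?_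
    have := ih k
    rwa [Ctx.ren_cons, ← hπ] at this
  | ampR _ ih =>
    refine .ampR fun k => ?_
    have := ih k
    rwa [← hπ] at this
  | ampL k hd _ ih =>
    rw [Ctx.ren_cons] at ih ⊢
    exact .ampL k (by rwa [hπ]) ih
  | tensorR hz _ ih =>
    rw [Ctx.ren_cons]
    exact .tensorR (by rw [hπ, hπ, hz]) ih
  | @tensorL Δ P d x y A B C _ ih =>
    rw [Ctx.ren_cons]
    refine .tensorL fun w hw h₁ h₂ h₃ => ?_
    have := ih (π.symm w) (by rw [← hπ (π.symm w), ← hπ x]; simpa using hw)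
      (by rwa [Ctx.mem_chans_ren] at h₁) (by rintro rfl; simp at h₂) (by rintro rfl; simp at h₃)
    rw [Ctx.ren_cons, Ctx.ren_cons, Proc.map_inst hπ] at this
    simpa [hπ x] using this
  | @lolliR Δ P d y A B _ ih =>
    refine .lolliR fun w hw h₁ h₂ => ?_
    have := ih (π.symm w) (by rw [← hπ (π.symm w), ← hπ y]; simpa using hw)
      (by rwa [Ctx.mem_chans_ren] at h₁) (by rintro rfl; simp at h₂)
    rw [Ctx.ren_cons, Proc.map_inst hπ] at this
    simpa [hπ y] using this
  | lolliL hd hz _ ih =>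
    rw [Ctx.ren_cons] at ih
    rw [Ctx.ren_cons, Ctx.ren_cons]
    exact .lolliL (by rwa [hπ]) (by rw [hπ, hπ, hz]) ih
  | oneR => exact .oneR
  | oneL _ ih =>
    rw [Ctx.ren_cons]
    refine .oneL ?_
    rwa [hπ]
  | fwd hl => exact .fwd (by rw [hπ, hπ, hl])
  | @cut Δ₁ Δ₂ P Q d₁ d₂ d' y B C h₁ h₂ h₃ h₄ _ _ ih₁ ih₂ =>
    rw [Ctx.ren_add]
    refine .cut B h₁ h₂ ?_ (by rwa [hπ]) ?_ ?_
    · intro z hz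
      have := h₃ _ (Ctx.mem_chans_ren.1 hz)
      rwa [← hπ, Equiv.apply_symm_apply] at this
    · intro w hw h₅ h₆
      have := ih₁ (π.symm w) (by rw [← hπ (π.symm w)]; simpa using hw)
        (by rwa [← Ctx.ren_add, Ctx.mem_chans_ren] at h₅) (by rintro rfl; simp at h₆)
      rw [Proc.map_inst hπ] at this
      simpa using this
    · intro w hw h₅ h₆
      have := ih₂ (π.symm w) (by rw [← hπ (π.symm w)]; simpa using hw)
        (by rwa [← Ctx.ren_add, Ctx.mem_chans_ren] at h₅) (by rintro rfl; simp at h₆)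
      rw [Proc.map_inst hπ, Ctx.ren_cons] at this
      simpa using this

theorem PTyped.chans_subset {Γ : Ctx L} {P : Proc L} {d : L} {y : Chan L} {A : Ty}
    (h : PTyped Γ P d y A) {c : Chan L} (hc : c ∈ P.chans) : c = y ∨ c ∈ Ctx.chans Γ := by
  induction h with
  | plusR k _ ih =>
    rcases hc with hc | hc
    exacts [.inl hc, ih hc]
  | plusL _ ih =>
    rcases hc with hc | hc
    · exact .inr (Ctx.mem_chans_cons.2 (.inl hc))
    · obtain ⟨k, hk⟩ := Set.mem_iUnion.1 hc
      simpa only [Ctx.mem_chans_cons] using ih k hk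
  | ampR _ ih =>
    rcases hc with hc | hc
    · exact .inl hc
    · obtain ⟨k, hk⟩ := Set.mem_iUnion.1 hc
      exact ih k hk
  | ampL k hd _ ih =>
    rcases hc with hc | hc
    · exact .inr (Ctx.mem_chans_cons.2 (.inl hc))
    · simpa only [Ctx.mem_chans_cons] using ih hc
  | tensorR hz _ ih =>
    rw [Ctx.mem_chans_cons]
    rcases hc with (hc | hc) | hc
    · exact .inr (.inl hc)
    · exact .inl hc
    · exact (ih hc).imp_right .inr
  | @tensorL Δ P d x y A B C _ ih =>
    rw [Ctx.mem_chans_cons]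
    rcases hc with hc | hc
    · exact .inr (.inl hc)
    -- The instance is also kept away from `c`, so that the induction hypothesis for the
    -- instantiated body cannot answer `c = w`.
    · obtain ⟨w, hw, hn⟩ := exists_fresh_chan x.lvl
        ((((Ctx.chans_finite Δ).insert x).insert y).insert c)
      simp only [Set.mem_insert_iff, not_or] at hn
      have := ih w hw hn.2.2.2 hn.2.2.1 hn.2.1 (Proc.chans_subset_inst _ _ _ hc)
      simp only [Ctx.mem_chans_cons] at this
      rcases this with h | h | h
      exacts [.inl h, absurd h.symm hn.1, .inr h]
  | @lolliR Δ P d y A B _ ih =>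
    rcases hc with hc | hc
    · exact .inl hc
    · obtain ⟨w, hw, hn⟩ := exists_fresh_chan y.lvl
        (((Ctx.chans_finite Δ).insert y).insert c)
      simp only [Set.mem_insert_iff, not_or] at hn
      have := ih w hw hn.2.2 hn.2.1 (Proc.chans_subset_inst _ _ _ hc)
      simp only [Ctx.mem_chans_cons] at this
      rcases this with h | h | h
      exacts [.inl h, absurd h.symm hn.1, .inr h]
  | lolliL hd hz _ ih =>
    simp only [Ctx.mem_chans_cons] at ih ⊢
    rcases hc with (hc | hc) | hc
    · exact .inr (.inl hc)
    · exact .inr (.inr (.inl hc))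
    · exact (ih hc).imp_right .inr
  | oneR => exact .inl hc
  | oneL _ ih =>
    rw [Ctx.mem_chans_cons]
    rcases hc with hc | hc
    exacts [.inr (.inl hc), (ih hc).imp_right .inr]
  | fwd hl =>
    rw [Ctx.mem_chans_singleton]
    rcases hc with hc | hc
    exacts [.inl hc, .inr hc]
  | @cut Δ₁ Δ₂ P Q d₁ d₂ d' y B C h₁ h₂ h₃ h₄ _ _ ih₁ ih₂ =>
    obtain ⟨w, hw, hn⟩ := exists_fresh_chan d'
        (((Ctx.chans_finite (Δ₁ + Δ₂)).insert y).insert c)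
    simp only [Set.mem_insert_iff, not_or] at hn
    rw [Ctx.mem_chans_add]
    rcases hc with hc | hc
    · rcases ih₁ w hw hn.2.2 hn.2.1 (Proc.chans_subset_inst _ _ _ hc) with h | h
      exacts [absurd h.symm hn.1, .inr (.inl h)]
    · have := ih₂ w hw hn.2.2 hn.2.1 (Proc.chans_subset_inst _ _ _ hc)
      simp only [Ctx.mem_chans_cons] at this
      rcases this with h | h | h
      exacts [.inl h, absurd h.symm hn.1, .inr (.inr h)]

/-- A term that does not mention a channel of its context is doomed. -/
theorem PTyped.doomed {Γ : Ctx L} {P : Proc L} {d : L} {y : Chan L} {A : Ty}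
    (h : PTyped Γ P d y A) {c : Chan L} (hc : c ∈ Ctx.chans Γ) (hP : c ∉ P.chans) :
    P.Doomed := by
  induction h with
  | plusR k _ ih => exact ih hc fun h => hP (.inr h)
  -- This case and `ampR` are the actual base cases: without labels there is no induction
  -- hypothesis, and the term is doomed in any context.
  | plusL _ ih =>
    intro k
    exact ih k (by simpa only [Ctx.mem_chans_cons] using hc)
      fun h => hP (.inr (Set.mem_iUnion.2 ⟨k, h⟩))
  | ampR _ ih => exact fun k => ih k hc fun h => hP (.inr (Set.mem_iUnion.2 ⟨k, h⟩))
  | ampL k hd _ ih =>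
    exact ih (by simpa only [Ctx.mem_chans_cons] using hc) fun h => hP (.inr h)
  | tensorR hz _ ih =>
    rcases Ctx.mem_chans_cons.1 hc with rfl | hc
    · exact absurd (.inl (.inl rfl)) hP
    · exact ih hc fun h => hP (.inr h)
  | @tensorL Δ P d x y A B C _ ih =>
    rcases Ctx.mem_chans_cons.1 hc with rfl | hc
    · exact absurd (.inl rfl) hP
    · obtain ⟨w, hw, hn⟩ := exists_fresh_chan x.lvl
        ((((Ctx.chans_finite Δ).insert x).insert y).insert c)
      simp only [Set.mem_insert_iff, not_or] at hn
      have := ih w hw hn.2.2.2 hn.2.2.1 hn.2.1 (by simp only [Ctx.mem_chans_cons]; tauto)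
        (fun h => (Proc.chans_inst_subset _ _ _ h).elim (fun h => hn.1 h.symm)
          fun h => hP (.inr h))
      rwa [Proc.doomed_inst] at this
  | @lolliR Δ P d y A B _ ih =>
    obtain ⟨w, hw, hn⟩ := exists_fresh_chan y.lvl
        (((Ctx.chans_finite Δ).insert y).insert c)
    simp only [Set.mem_insert_iff, not_or] at hn
    have := ih w hw hn.2.2 hn.2.1 (by simp only [Ctx.mem_chans_cons]; tauto)
        (fun h => (Proc.chans_inst_subset _ _ _ h).elim (fun h => hn.1 h.symm)
          fun h => hP (.inr h))
    rwa [Proc.doomed_inst] at this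
  | lolliL hd hz _ ih =>
    rcases Ctx.mem_chans_cons.1 hc with rfl | hc
    · exact absurd (.inl (.inl rfl)) hP
    · exact ih (by simpa only [Ctx.mem_chans_cons] using hc) fun h => hP (.inr h)
  | oneR => exact absurd hc Ctx.notMem_chans_zero
  | oneL _ ih =>
    rcases Ctx.mem_chans_cons.1 hc with rfl | hc
    · exact absurd (.inl rfl) hP
    · exact ih hc fun h => hP (.inr h)
  | fwd hl => exact absurd (.inr (Ctx.mem_chans_singleton.1 hc)) hP
  | @cut Δ₁ Δ₂ P Q d₁ d₂ d' y B C h₁ h₂ h₃ h₄ _ _ ih₁ ih₂ =>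
    obtain ⟨w, hw, hn⟩ := exists_fresh_chan d'
        (((Ctx.chans_finite (Δ₁ + Δ₂)).insert y).insert c)
    simp only [Set.mem_insert_iff, not_or] at hn
    rcases Ctx.mem_chans_add.1 hc with hc | hc
    · refine .inl ?_
      have := ih₁ w hw hn.2.2 hn.2.1 hc
        (fun h => (Proc.chans_inst_subset _ _ _ h).elim (fun h => hn.1 h.symm)
          fun h => hP (.inl h))
      rwa [Proc.doomed_inst] at this
    · refine .inr ?_
      have := ih₂ w hw hn.2.2 hn.2.1 (Ctx.mem_chans_cons.2 (.inr hc))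
        (fun h => (Proc.chans_inst_subset _ _ _ h).elim (fun h => hn.1 h.symm)
          fun h => hP (.inr h))
      rwa [Proc.doomed_inst] at this

/-- On everything that occurs in the sequent, renaming `a` to a fresh `b` acts as the transposition
of the two. -/
theorem PTyped.ren {Γ : Ctx L} {P : Proc L} {d : L} {y : Chan L} {A : Ty}
    (h : PTyped Γ P d y A) {a b : Chan L} (hl : b.lvl = a.lvl) (hb : b ≠ y)
    (hbΓ : b ∉ Ctx.chans Γ) :
    PTyped (Ctx.ren (ren a b) Γ) (P.map (ren a b)) d (SecSess.ren a b y) A := by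
  classical
  have := h.map_perm (swap_lvl hl)
  have e₁ : Ctx.ren (Equiv.swap a b) Γ = Ctx.ren (SecSess.ren a b) Γ := by
    refine Multiset.map_congr rfl fun p hp => ?_
    rw [ren_eq_swap (.inl ?_)]
    rintro e
    exact hbΓ ⟨p.2, by rw [← e]; exact hp⟩
  have e₂ : P.map (Equiv.swap a b) = P.map (SecSess.ren a b) := by
    refine Proc.map_congr fun c hc => ?_
    rw [ren_eq_swap (.inl ?_)]
    rintro rfl
    exact (h.chans_subset hc).elim hb hbΓ
  rw [e₁, e₂, ← ren_eq_swap (.inl hb.symm)] at this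
  exact this

end SecSess

/-! ### Local typing of nodes: client channels, levels and ranks -/

namespace SecSess

universe u

variable {L : Type u}

/-! ## Contexts given by a type assignment -/

/-- The context of the channels `γ`, with the types that `τ` assigns. -/
def tctx (τ : Chan L → Ty) (γ : Multiset (Chan L)) : Ctx L := Multiset.map (fun c => (c, τ c)) γ

@[simp] theorem tctx_cons (τ : Chan L → Ty) (c : Chan L) (γ : Multiset (Chan L)) :
    tctx τ (c ::ₘ γ) = (c, τ c) ::ₘ tctx τ γ := by simp [tctx]

@[simp] theorem tctx_singleton (τ : Chan L → Ty) (c : Chan L) :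
    tctx τ {c} = {(c, τ c)} := by simp [tctx]

@[simp] theorem tctx_add (τ : Chan L → Ty) (γ δ : Multiset (Chan L)) :
    tctx τ (γ + δ) = tctx τ γ + tctx τ δ := by simp [tctx]

@[simp] theorem fst_tctx (τ : Chan L → Ty) (γ : Multiset (Chan L)) :
    Ctx.fst (tctx τ γ) = γ := by simp [tctx, Ctx.fst]

theorem mem_chans_tctx {τ : Chan L → Ty} {γ : Multiset (Chan L)} {c : Chan L} :
    c ∈ Ctx.chans (tctx τ γ) ↔ c ∈ γ := by rw [← Ctx.mem_fst, fst_tctx]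

theorem tctx_congr {τ τ' : Chan L → Ty} {γ : Multiset (Chan L)} (h : ∀ c ∈ γ, τ' c = τ c) :
    tctx τ' γ = tctx τ γ := Multiset.map_congr rfl fun c hc => by rw [h c hc]

theorem tctx_eq_cons {τ : Chan L → Ty} {γ : Multiset (Chan L)} {x : Chan L} {T : Ty} {Δ : Ctx L}
    (h : tctx τ γ = (x, T) ::ₘ Δ) : ∃ γ', γ = x ::ₘ γ' ∧ τ x = T ∧ Δ = tctx τ γ' := by
  classical
  obtain ⟨a, ha, h₁, h₂⟩ := (Multiset.map_eq_cons _ _ _ _).2 h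
  obtain ⟨rfl, rfl⟩ := Prod.mk.inj h₁
  exact ⟨γ.erase a, (Multiset.cons_erase ha).symm, rfl, h₂.symm⟩

theorem eq_tctx_fst {τ : Chan L → Ty} {Δ : Ctx L} (h : ∀ p ∈ Δ, τ p.1 = p.2) :
    Δ = tctx τ (Ctx.fst Δ) := by
  rw [tctx, Ctx.fst, Multiset.map_map]
  conv_lhs => rw [← Multiset.map_id Δ]
  refine Multiset.map_congr rfl fun p hp => ?_
  ext1
  · rfl
  · exact (h p hp).symm

theorem ren_tctx {τ : Chan L → Ty} {γ : Multiset (Chan L)} {f : Chan L → Chan L}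
    (h : ∀ c ∈ γ, τ (f c) = τ c) : Ctx.ren f (tctx τ γ) = tctx τ (γ.map f) := by
  rw [Ctx.ren, tctx, tctx, Multiset.map_map, Multiset.map_map]
  refine Multiset.map_congr rfl fun c hc => ?_
  simp [h c hc]

/-- The term of a node. -/
def Node.term : Node L → Proc L
  | .proc _ P _ => P
  | .msg m => m.toProc

/-- The running secrecy of a node; a message runs at the level of the channel that it offers. -/
def Node.sec : Node L → L
  | .proc _ _ d => d
  | .msg m => m.offer.lvl

theorem Node.term_map (f : Chan L → Chan L) (n : Node L) : (n.map f).term = n.term.map f := by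
  cases n <;> simp [Node.map, Node.term, Msg.toProc_map]

theorem Node.sec_map {f : Chan L → Chan L} (hf : LvlPres f) (n : Node L) :
    (n.map f).sec = n.sec := by
  cases n <;> simp [Node.map, Node.sec, Msg.offer_map, hf _]

theorem Node.chans_eq (n : Node L) : n.chans = {n.offer} ∪ n.term.chans := by
  cases n with
  | proc => rfl
  | msg m =>
    ext c
    simp only [Node.chans, Node.offer, Node.term, Set.mem_union, Set.mem_singleton_iff]
    exact ⟨.inr, fun h => h.elim (fun h => h ▸ m.offer_mem) id⟩

/-- The shape of the well-typed messages with client channels `γ`. -/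
def MsgOk (τ : Chan L → Ty) (γ : Multiset (Chan L)) : Msg L → Prop
  | .close y => γ = 0 ∧ τ y = .one
  | .selPos y k v => γ = {v} ∧ v.lvl = y.lvl ∧
      ∃ (I : Finset ℕ) (A : {ℓ // ℓ ∈ I} → Ty) (hk : k ∈ I), τ y = .plus I A ∧ τ v = A ⟨k, hk⟩
  | .selNeg y k v => γ = {y} ∧ v.lvl = y.lvl ∧
      ∃ (I : Finset ℕ) (A : {ℓ // ℓ ∈ I} → Ty) (hk : k ∈ I), τ y = .amp I A ∧ τ v = A ⟨k, hk⟩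
  | .sendPos x y v => γ = {x, v} ∧ x.lvl = y.lvl ∧ v.lvl = y.lvl ∧ τ y = .tensor (τ x) (τ v)
  | .sendNeg x y v => γ = {x, y} ∧ x.lvl = y.lvl ∧ v.lvl = y.lvl ∧ τ y = .lolli (τ x) (τ v)

/-- All channels of a well-typed message have the same level. -/
theorem MsgOk.lvl_eq {τ : Chan L → Ty} {m : Msg L} {γ : Multiset (Chan L)}
    (h : MsgOk τ γ m) {c : Chan L} (hc : c ∈ m.toProc.chans) : c.lvl = m.carrier.lvl := by
  cases m <;>
    simp only [MsgOk, Msg.toProc, Proc.chans, Ref.chans, Set.mem_union, Set.mem_singleton_iff,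
      Msg.carrier] at h hc ⊢
  · rw [hc]
  all_goals rcases hc with hc | hc <;> (try rcases hc with hc | hc) <;> simp_all

theorem MsgOk.mem_chans {τ : Chan L → Ty} {m : Msg L} {γ : Multiset (Chan L)}
    (h : MsgOk τ γ m) {c : Chan L} (hc : c ∈ γ) : c ∈ m.toProc.chans := by
  cases m <;> obtain ⟨rfl, -⟩ := h <;>
    simp [Msg.toProc, Proc.chans, Ref.chans] at hc ⊢ <;> tauto

/-- The channels that a node uses as a client, as a multiset. -/
noncomputable def Node.usesM (n : Node L) : Multiset (Chan L) :=
  ((n.chans_finite.subset Set.sdiff_subset : n.uses.Finite).toFinset).val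

theorem Node.mem_usesM {n : Node L} {c : Chan L} : c ∈ n.usesM ↔ c ∈ n.chans ∧ c ≠ n.offer := by
  simp [Node.usesM, Node.uses]

variable [Lattice L]

/-! ## Inversion of process typing -/

theorem PTyped.inv_sel {Γ : Ctx L} {x y : Chan L} {k : ℕ} {P : Proc L} {d : L} {C : Ty}
    (h : PTyped Γ (.sel (.chan x) k P) d y C) :
    (x = y ∧ ∃ (I : Finset ℕ) (A : {ℓ // ℓ ∈ I} → Ty) (hk : k ∈ I),
      C = .plus I A ∧ PTyped Γ P d y (A ⟨k, hk⟩)) ∨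
    ∃ (Δ : Ctx L) (I : Finset ℕ) (A : {ℓ // ℓ ∈ I} → Ty) (hk : k ∈ I),
      Γ = (x, .amp I A) ::ₘ Δ ∧ d ≤ x.lvl ∧ PTyped ((x, A ⟨k, hk⟩) ::ₘ Δ) P d y C := by
  cases h with
  | plusR k h => exact .inl ⟨rfl, _, _, k.2, rfl, h⟩
  | ampL k hd h => exact .inr ⟨_, _, _, k.2, rfl, hd, h⟩

theorem PTyped.inv_branch {Γ : Ctx L} {x y : Chan L} {I : Finset ℕ}
    {Q : {ℓ // ℓ ∈ I} → Proc L} {d : L} {C : Ty}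
    (h : PTyped Γ (.branch (.chan x) I Q) d y C) :
    (x = y ∧ ∃ A : {ℓ // ℓ ∈ I} → Ty,
      C = .amp I A ∧ ∀ k, PTyped Γ (Q k) y.lvl y (A k)) ∨
    ∃ (Δ : Ctx L) (A : {ℓ // ℓ ∈ I} → Ty),
      Γ = (x, .plus I A) ::ₘ Δ ∧ ∀ k, PTyped ((x, A k) ::ₘ Δ) (Q k) (x.lvl ⊔ d) y C := by
  cases h with
  | ampR h => exact .inl ⟨rfl, _, rfl, h⟩
  | plusL h => exact .inr ⟨_, _, rfl, h⟩

theorem PTyped.inv_send {Γ : Ctx L} {x y z : Chan L} {P : Proc L} {d : L} {C : Ty}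
    (h : PTyped Γ (.send (.chan z) (.chan x) P) d y C) :
    (x = y ∧ ∃ (Δ : Ctx L) (A B : Ty),
      Γ = (z, A) ::ₘ Δ ∧ C = .tensor A B ∧ z.lvl = y.lvl ∧ PTyped Δ P d y B) ∨
    ∃ (Δ : Ctx L) (A B : Ty), Γ = (z, A) ::ₘ (x, .lolli A B) ::ₘ Δ ∧ d ≤ x.lvl ∧
      z.lvl = x.lvl ∧ PTyped ((x, B) ::ₘ Δ) P d y C := by
  cases h with
  | tensorR hz h => exact .inl ⟨rfl, _, _, _, rfl, rfl, hz, h⟩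
  | lolliL hd hz h => exact .inr ⟨_, _, _, rfl, hd, hz, h⟩

theorem PTyped.inv_recv {Γ : Ctx L} {x y : Chan L} {P : Proc L} {d : L} {C : Ty}
    (h : PTyped Γ (.recv (.chan x) P) d y C) :
    (x = y ∧ ∃ A B : Ty, C = .lolli A B ∧
      ∀ w : Chan L, w.lvl = y.lvl → w ∉ Ctx.chans Γ → w ≠ y →
        PTyped ((w, A) ::ₘ Γ) (P.at w) y.lvl y B) ∨
    ∃ (Δ : Ctx L) (A B : Ty), Γ = (x, .tensor A B) ::ₘ Δ ∧
      ∀ w : Chan L, w.lvl = x.lvl → w ∉ Ctx.chans Δ → w ≠ x → w ≠ y →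
        PTyped ((w, A) ::ₘ (x, B) ::ₘ Δ) (P.at w) (x.lvl ⊔ d) y C := by
  cases h with
  | lolliR h => exact .inl ⟨rfl, _, _, rfl, h⟩
  | tensorL h => exact .inr ⟨_, _, _, rfl, h⟩

theorem PTyped.inv_close {Γ : Ctx L} {x y : Chan L} {d : L} {C : Ty}
    (h : PTyped Γ (.close (.chan x)) d y C) : x = y ∧ Γ = 0 ∧ C = .one := by
  cases h; exact ⟨rfl, rfl, rfl⟩

theorem PTyped.inv_wait {Γ : Ctx L} {x y : Chan L} {P : Proc L} {d : L} {C : Ty}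
    (h : PTyped Γ (.wait (.chan x) P) d y C) :
    ∃ Δ : Ctx L, Γ = (x, .one) ::ₘ Δ ∧ PTyped Δ P (x.lvl ⊔ d) y C := by
  cases h with
  | oneL h => exact ⟨_, rfl, h⟩

theorem PTyped.inv_fwd {Γ : Ctx L} {x y z : Chan L} {d : L} {C : Ty}
    (h : PTyped Γ (.fwd (.chan z) (.chan x)) d y C) :
    z = y ∧ Γ = {(x, C)} ∧ x.lvl = y.lvl := by
  cases h with
  | fwd h => exact ⟨rfl, rfl, h⟩

theorem PTyped.inv_cut {Γ : Ctx L} {y : Chan L} {P Q : Proc L} {d d₁ d₂ : L} {C : Ty}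
    (h : PTyped Γ (.cut (.lit d) (.lit d₂) P Q) d₁ y C) :
    ∃ (Δ₁ Δ₂ : Ctx L) (B : Ty), Γ = Δ₁ + Δ₂ ∧ d₁ ≤ d₂ ∧ d₂ ≤ d ∧
      (∀ z ∈ Ctx.chans Δ₁, z.lvl ≤ d) ∧ d ≤ y.lvl ∧
      ∀ w : Chan L, w.lvl = d → w ∉ Ctx.chans (Δ₁ + Δ₂) → w ≠ y →
        PTyped Δ₁ (P.at w) d₂ w B ∧ PTyped ((w, B) ::ₘ Δ₂) (Q.at w) d₁ y C := by
  cases h with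
  | cut B h₁ h₂ h₃ h₄ h₅ h₆ =>
    exact ⟨_, _, B, rfl, h₁, h₂, h₃, h₄, fun w a b c => ⟨h₅ w a b c, h₆ w a b c⟩⟩

/-! ## Locally typed nodes -/

/-- The node `n` with the client channels `γ` is well-typed for the type assignment `τ`, and the
channel that it offers has a higher rank than its client channels. -/
structure Ok (τ : Chan L → Ty) (r : Chan L → ℕ) (n : Node L) (γ : Multiset (Chan L)) : Prop where
  nodup : (n.offer ::ₘ γ).Nodup
  sec : n.sec ≤ n.offer.lvl
  lvl : ∀ c ∈ γ, c.lvl ≤ n.offer.lvl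
  rank : ∀ c ∈ γ, r c < r n.offer
  typ : PTyped (tctx τ γ) n.term n.sec n.offer (τ n.offer)

/-- A message is a send followed by a forwarder, and the forwarder reveals the offered channel.
Reading a positive message as sent by a client, or a negative one as sent by a provider, would put
the offered channel into its own context, which `hn` forbids. -/
theorem PTyped.msg_inv {Γ : Ctx L} {m : Msg L} {d : L} {z : Chan L} {C : Ty}
    (h : PTyped Γ m.toProc d z C) (hn : (z ::ₘ Ctx.fst Γ).Nodup) :
    m.offer = z ∧ ∀ τ : Chan L → Ty, (∀ p ∈ Γ, τ p.1 = p.2) → τ z = C →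
      MsgOk τ (Ctx.fst Γ) m := by
  cases m with
  | close y =>
    obtain ⟨rfl, rfl, rfl⟩ := h.inv_close
    exact ⟨rfl, fun τ _ hz => ⟨rfl, hz⟩⟩
  | selPos y k v =>
    rcases h.inv_sel with ⟨rfl, I, A, hk, rfl, h'⟩ | ⟨Δ, I, A, hk, rfl, hd, h'⟩
    · obtain ⟨-, rfl, hl⟩ := h'.inv_fwd
      refine ⟨rfl, fun τ hτ hz => ⟨by simp, hl, I, A, hk, hz, ?_⟩⟩
      exact hτ _ (Multiset.mem_singleton_self _)
    · obtain ⟨rfl, -, -⟩ := h'.inv_fwd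
      simp at hn
  | selNeg y k v =>
    rcases h.inv_sel with ⟨rfl, I, A, hk, rfl, h'⟩ | ⟨Δ, I, A, hk, rfl, hd, h'⟩
    · obtain ⟨rfl, rfl, hl⟩ := h'.inv_fwd
      simp at hn
    · obtain ⟨rfl, he, hl⟩ := h'.inv_fwd
      obtain ⟨h₁, rfl⟩ := Multiset.cons_eq_cons.1
        (he.trans (Multiset.cons_zero _).symm) |>.resolve_right (by
          rintro ⟨-, cs, -, h⟩
          exact Multiset.zero_ne_cons h)
      refine ⟨rfl, fun τ hτ hz => ⟨by simp, hl.symm, I, A, hk, hτ (y, .amp I A) (by simp), ?_⟩⟩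
      rw [hz]
      exact (Prod.mk.inj h₁).2.symm
  | sendPos x y v =>
    rcases h.inv_send with ⟨rfl, Δ, A, B, rfl, rfl, hx, h'⟩ | ⟨Δ, A, B, rfl, hd, hx, h'⟩
    · obtain ⟨-, rfl, hl⟩ := h'.inv_fwd
      refine ⟨rfl, fun τ hτ hz => ⟨by simp, hx, hl, ?_⟩⟩
      rw [hz, hτ (x, A) (by simp), hτ (v, B) (by simp)]
    · obtain ⟨rfl, -, -⟩ := h'.inv_fwd
      simp at hn
  | sendNeg x y v =>
    rcases h.inv_send with ⟨rfl, Δ, A, B, rfl, rfl, hx, h'⟩ | ⟨Δ, A, B, rfl, hd, hx, h'⟩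
    · obtain ⟨rfl, rfl, -⟩ := h'.inv_fwd
      simp at hn
    · obtain ⟨rfl, he, hl⟩ := h'.inv_fwd
      obtain ⟨h₁, rfl⟩ := Multiset.cons_eq_cons.1
        (he.trans (Multiset.cons_zero _).symm) |>.resolve_right (by
          rintro ⟨-, cs, -, h⟩
          exact Multiset.zero_ne_cons h)
      refine ⟨rfl, fun τ hτ hz => ⟨by simp, hx, hl.symm, ?_⟩⟩
      rw [hz, hτ (x, A) (by simp), hτ (y, .lolli A B) (by simp), (Prod.mk.inj h₁).2]

theorem Ok.msgOk {τ : Chan L → Ty} {r : Chan L → ℕ} {m : Msg L} {γ : Multiset (Chan L)}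
    (h : Ok τ r (.msg m) γ) : MsgOk τ γ m := by
  have := (h.typ.msg_inv (by rw [fst_tctx]; exact h.nodup)).2 τ
    (by simp +contextual [tctx]) rfl
  rwa [fst_tctx] at this

theorem MsgOk.ptyped {τ : Chan L → Ty} {m : Msg L} {γ : Multiset (Chan L)}
    (h : MsgOk τ γ m) : PTyped (tctx τ γ) m.toProc m.offer.lvl m.offer (τ m.offer) := by
  cases m with
  | close y =>
    obtain ⟨rfl, h⟩ := h
    simp only [Msg.offer, h]
    exact .oneR
  | selPos y k v =>
    obtain ⟨rfl, hl, I, A, hk, h₁, h₂⟩ := h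
    simp only [Msg.offer, Msg.toProc, tctx_singleton, h₁, h₂]
    exact .plusR ⟨k, hk⟩ (.fwd hl)
  | selNeg y k v =>
    obtain ⟨rfl, hl, I, A, hk, h₁, h₂⟩ := h
    simp only [Msg.offer, Msg.toProc, tctx_singleton, h₁, h₂]
    exact .ampL ⟨k, hk⟩ hl.le (.fwd hl.symm)
  | sendPos x y v =>
    obtain ⟨rfl, hx, hv, h⟩ := h
    simp only [Msg.offer, Msg.toProc, Multiset.insert_eq_cons, tctx_cons, tctx_singleton, h]
    exact .tensorR hx (.fwd hv)
  | sendNeg x y v =>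
    obtain ⟨rfl, hx, hv, h⟩ := h
    simp only [Msg.offer, Msg.toProc, Multiset.insert_eq_cons, tctx_cons, tctx_singleton, h]
    exact .lolliL hv.le hx (.fwd hv.symm)

theorem Ok.mono {τ τ' : Chan L → Ty} {r r' : Chan L → ℕ} {n : Node L} {γ : Multiset (Chan L)}
    (h : Ok τ r n γ) (hτ : ∀ c ∈ n.offer ::ₘ γ, τ' c = τ c)
    (hr : ∀ c ∈ γ, r c < r n.offer → r' c < r' n.offer) : Ok τ' r' n γ where
  nodup := h.nodup
  sec := h.sec
  lvl := h.lvl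
  rank c hc := hr c hc (h.rank c hc)
  typ := by
    rw [tctx_congr fun c hc => hτ c (by simp [hc]), hτ _ (by simp)]
    exact h.typ

theorem Ok.mem_of_mem_chans {τ : Chan L → Ty} {r : Chan L → ℕ} {n : Node L}
    {γ : Multiset (Chan L)} (h : Ok τ r n γ) {c : Chan L} (hc : c ∈ n.chans) :
    c ∈ n.offer ::ₘ γ := by
  rw [Node.chans_eq] at hc
  rcases hc with rfl | hc
  · simp
  · rcases h.typ.chans_subset hc with rfl | h
    · simp
    · rw [mem_chans_tctx] at h
      simp [h]

theorem Ok.mem_chans {τ : Chan L → Ty} {r : Chan L → ℕ} {n : Node L}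
    {γ : Multiset (Chan L)} (h : Ok τ r n γ) (hd : ¬ n.Doomed) {c : Chan L} (hc : c ∈ γ) :
    c ∈ n.chans := by
  cases n with
  | proc y P d =>
    by_contra hn
    exact hd (h.typ.doomed (mem_chans_tctx.2 hc) fun h => hn (.inr h))
  | msg m => exact h.msgOk.mem_chans hc

/-- The annotation with client channels is determined by the node itself. This later allows closed
configurations to be treated without annotations. -/
theorem Ok.eq_usesM {τ : Chan L → Ty} {r : Chan L → ℕ} {n : Node L}
    {γ : Multiset (Chan L)} (h : Ok τ r n γ) (hd : ¬ n.Doomed) : γ = n.usesM := by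
  have hn := Multiset.nodup_cons.1 h.nodup
  refine (Multiset.Nodup.ext hn.2 (Finset.nodup _)).2 fun c => ?_
  rw [← Node.usesM, Node.mem_usesM]
  constructor
  · exact fun hc => ⟨h.mem_chans hd hc, by rintro rfl; exact hn.1 hc⟩
  · rintro ⟨h₁, h₂⟩
    simpa [h₂] using h.mem_of_mem_chans h₁

end SecSess

/-! ### Global typing of configurations, to and from the typing judgement -/

namespace SecSess

universe u

variable {L : Type u}

/-! ## Annotated configurations -/

/-- A configuration whose nodes are annotated with their client channels. -/
abbrev TConfig (L : Type u) : Type u := Multiset (Node L × Multiset (Chan L))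

/-- The channels that the nodes of a configuration offer. -/
def Config.offers (D : Config L) : Multiset (Chan L) := Multiset.map Node.offer D

/-- The channels that the nodes of a configuration use as clients. -/
noncomputable def Config.usesM (D : Config L) : Multiset (Chan L) :=
  (Multiset.map Node.usesM D).sum

/-- The underlying configuration. -/
def TConfig.cfg (t : TConfig L) : Config L := Multiset.map Prod.fst t

/-- The client channels of an annotated configuration. -/
def TConfig.ctxs (t : TConfig L) : Multiset (Chan L) := (Multiset.map Prod.snd t).sum

/-- The channels that the nodes of an annotated configuration offer. -/
def TConfig.offers (t : TConfig L) : Multiset (Chan L) := Multiset.map (fun a => a.1.offer) t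

@[simp] theorem Config.offers_zero : Config.offers (0 : Config L) = 0 := rfl
@[simp] theorem Config.offers_cons (n : Node L) (D : Config L) :
    Config.offers (n ::ₘ D) = n.offer ::ₘ Config.offers D := by simp [Config.offers]
@[simp] theorem Config.offers_singleton (n : Node L) :
    Config.offers ({n} : Config L) = {n.offer} := by simp [Config.offers]
@[simp] theorem Config.offers_add (D E : Config L) :
    Config.offers (D + E) = Config.offers D + Config.offers E := by simp [Config.offers]
@[simp] theorem Config.usesM_zero : Config.usesM (0 : Config L) = 0 := rfl
@[simp] theorem Config.usesM_cons (n : Node L) (D : Config L) :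
    Config.usesM (n ::ₘ D) = n.usesM + Config.usesM D := by simp [Config.usesM]
@[simp] theorem Config.usesM_singleton (n : Node L) :
    Config.usesM ({n} : Config L) = n.usesM := by simp [Config.usesM]
@[simp] theorem Config.usesM_add (D E : Config L) :
    Config.usesM (D + E) = Config.usesM D + Config.usesM E := by simp [Config.usesM]
@[simp] theorem TConfig.cfg_zero : TConfig.cfg (0 : TConfig L) = 0 := rfl
@[simp] theorem TConfig.cfg_cons (a : Node L × Multiset (Chan L)) (t : TConfig L) :
    TConfig.cfg (a ::ₘ t) = a.1 ::ₘ TConfig.cfg t := by simp [TConfig.cfg]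
@[simp] theorem TConfig.cfg_singleton (a : Node L × Multiset (Chan L)) :
    TConfig.cfg ({a} : TConfig L) = {a.1} := by simp [TConfig.cfg]
@[simp] theorem TConfig.cfg_add (t s : TConfig L) :
    TConfig.cfg (t + s) = TConfig.cfg t + TConfig.cfg s := by simp [TConfig.cfg]
@[simp] theorem TConfig.ctxs_zero : TConfig.ctxs (0 : TConfig L) = 0 := rfl
@[simp] theorem TConfig.ctxs_cons (a : Node L × Multiset (Chan L)) (t : TConfig L) :
    TConfig.ctxs (a ::ₘ t) = a.2 + TConfig.ctxs t := by simp [TConfig.ctxs]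
@[simp] theorem TConfig.ctxs_singleton (a : Node L × Multiset (Chan L)) :
    TConfig.ctxs ({a} : TConfig L) = a.2 := by simp [TConfig.ctxs]
@[simp] theorem TConfig.ctxs_add (t s : TConfig L) :
    TConfig.ctxs (t + s) = TConfig.ctxs t + TConfig.ctxs s := by simp [TConfig.ctxs]
@[simp] theorem TConfig.offers_zero : TConfig.offers (0 : TConfig L) = 0 := rfl
@[simp] theorem TConfig.offers_cons (a : Node L × Multiset (Chan L)) (t : TConfig L) :
    TConfig.offers (a ::ₘ t) = a.1.offer ::ₘ TConfig.offers t := by simp [TConfig.offers]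
@[simp] theorem TConfig.offers_singleton (a : Node L × Multiset (Chan L)) :
    TConfig.offers ({a} : TConfig L) = {a.1.offer} := by simp [TConfig.offers]
@[simp] theorem TConfig.offers_add (t s : TConfig L) :
    TConfig.offers (t + s) = TConfig.offers t + TConfig.offers s := by simp [TConfig.offers]
@[simp] theorem TConfig.offers_cfg (t : TConfig L) :
    Config.offers (TConfig.cfg t) = TConfig.offers t := by
  simp [TConfig.cfg, TConfig.offers, Config.offers]

theorem Config.mem_offers {D : Config L} {c : Chan L} :
    c ∈ Config.offers D ↔ ∃ n ∈ D, n.offer = c := by simp [Config.offers]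

theorem Config.mem_offers_of_mem {D : Config L} {n : Node L} (h : n ∈ D) :
    n.offer ∈ Config.offers D := Config.mem_offers.2 ⟨n, h, rfl⟩

theorem TConfig.mem_offers {t : TConfig L} {c : Chan L} :
    c ∈ TConfig.offers t ↔ ∃ a ∈ t, a.1.offer = c := by simp [TConfig.offers]

theorem TConfig.mem_offers_of_mem {t : TConfig L} {a : Node L × Multiset (Chan L)} (h : a ∈ t) :
    a.1.offer ∈ TConfig.offers t := TConfig.mem_offers.2 ⟨a, h, rfl⟩

theorem TConfig.mem_ctxs {t : TConfig L} {c : Chan L} :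
    c ∈ TConfig.ctxs t ↔ ∃ a ∈ t, c ∈ a.2 := by
  induction t using Multiset.induction_on with
  | empty => simp
  | cons a t ih => simp [ih]

theorem Config.mem_usesM {D : Config L} {c : Chan L} :
    c ∈ Config.usesM D ↔ ∃ n ∈ D, c ∈ n.usesM := by
  induction D using Multiset.induction_on with
  | empty => simp
  | cons a t ih => simp [ih]

theorem TConfig.mem_cfg {t : TConfig L} {n : Node L} :
    n ∈ TConfig.cfg t ↔ ∃ γ, (n, γ) ∈ t := by simp [TConfig.cfg]

theorem TConfig.cfg_eq_cons {t : TConfig L} {n : Node L} {R : Config L}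
    (h : TConfig.cfg t = n ::ₘ R) : ∃ γ s, t = (n, γ) ::ₘ s ∧ TConfig.cfg s = R := by
  classical
  obtain ⟨a, ha, h₁, h₂⟩ := (Multiset.map_eq_cons _ _ _ _).2 h
  exact ⟨a.2, t.erase a, by rw [← h₁]; exact (Multiset.cons_erase ha).symm, h₂⟩

theorem Msg.not_doomed (m : Msg L) : ¬ m.toProc.Doomed := by
  cases m <;> simp [Msg.toProc, Proc.Doomed]

theorem Node.doomed_iff (n : Node L) : n.Doomed ↔ n.term.Doomed := by
  cases n with
  | proc => rfl
  | msg m => simp [Node.Doomed, Node.term, m.not_doomed]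

variable [Lattice L]

/-! ## From configuration typing to annotated configurations -/

/-- The induction step of `CTyped.extract` that processes and messages have in common. The offered
channel `x` does not occur in the part below, so its type and rank can be set without disturbing the
choices made there. -/
theorem extract_node {Γ Δ₀ Δ₀' Δ : Ctx L} {C : Config L} {n : Node L} {x : Chan L} {A : Ty}
    {τ₀ : Chan L → Ty} {r₀ : Chan L → ℕ} (hΓ : Γ = Δ₀' + Δ) (hx : n.offer = x)
    (hnd : (x ::ₘ Ctx.fst Γ).Nodup) (hs : n.sec ≤ x.lvl) (hl : ∀ y ∈ Ctx.chans Γ, y.lvl ≤ x.lvl)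
    (hty : PTyped Γ n.term n.sec x A)
    (hoff : (Config.offers (n ::ₘ C)).Nodup)
    (hdis : ∀ c ∈ Config.offers (n ::ₘ C), c ∉ Ctx.chans (Δ₀ + Δ₀'))
    (hτ₀ : ∀ p ∈ Δ₀ + Δ₀', τ₀ p.1 = p.2)
    (ih : (Config.offers C).Nodup → (∀ c ∈ Config.offers C, c ∉ Ctx.chans Δ₀) →
      ∀ (τ₀ : Chan L → Ty) (r₀ : Chan L → ℕ), (∀ p ∈ Δ₀, τ₀ p.1 = p.2) →
      ∃ (τ : Chan L → Ty) (r : Chan L → ℕ) (t : TConfig L), TConfig.cfg t = C ∧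
        (∀ c, c ∉ Config.offers C → τ c = τ₀ c ∧ r c = r₀ c) ∧ (∀ a ∈ t, Ok τ r a.1 a.2) ∧
        Ctx.fst Δ₀ + Config.offers C = Ctx.fst Δ + TConfig.ctxs t ∧ ∀ p ∈ Δ, τ p.1 = p.2) :
    ∃ (τ : Chan L → Ty) (r : Chan L → ℕ) (t : TConfig L), TConfig.cfg t = n ::ₘ C ∧
      (∀ c, c ∉ Config.offers (n ::ₘ C) → τ c = τ₀ c ∧ r c = r₀ c) ∧ (∀ a ∈ t, Ok τ r a.1 a.2) ∧
      Ctx.fst (Δ₀ + Δ₀') + Config.offers (n ::ₘ C) = Ctx.fst ({(x, A)} : Ctx L) + TConfig.ctxs t ∧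
      ∀ p ∈ ({(x, A)} : Ctx L), τ p.1 = p.2 := by
  classical
  subst hΓ
  rw [Config.offers_cons, hx] at hoff hdis
  obtain ⟨hx₁, hoff⟩ := Multiset.nodup_cons.1 hoff
  have hx₂ : x ∉ Ctx.chans (Δ₀ + Δ₀') := hdis x (by simp)
  obtain ⟨τ, r, t, ht, hag, hok, hbal, hΛ⟩ := ih hoff
    (fun c hc h => hdis c (by simp [hc]) (Ctx.mem_chans_add.2 (.inl h))) τ₀ r₀
    (fun p hp => hτ₀ p (Multiset.mem_add.2 (.inl hp)))
  have hxΓ := (Multiset.nodup_cons.1 hnd).1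
  have hxC : ∀ a ∈ t, x ∉ a.1.offer ::ₘ a.2 := by
    intro a ha hxa
    have h₁ : a.1.offer ∈ Config.offers C := by
      rw [← ht, TConfig.offers_cfg]; exact TConfig.mem_offers_of_mem ha
    rcases Multiset.mem_cons.1 hxa with h | h
    · exact hx₁ (h ▸ h₁)
    · have : x ∈ Ctx.fst Δ + TConfig.ctxs t :=
        Multiset.mem_add.2 (.inr (TConfig.mem_ctxs.2 ⟨a, ha, h⟩))
      rw [← hbal, Multiset.mem_add] at this
      rcases this with h | h
      · exact hx₂ (Ctx.mem_chans_add.2 (.inl (Ctx.mem_fst.1 h)))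
      · exact hx₁ h
  have hτΓ : ∀ p ∈ Δ₀' + Δ, τ p.1 = p.2 := by
    intro p hp
    rcases Multiset.mem_add.1 hp with hp' | hp'
    · rw [(hag p.1 fun h => hdis p.1 (by simp [h])
        (Ctx.mem_chans_add.2 (.inr ⟨p.2, hp'⟩))).1]
      exact hτ₀ p (Multiset.mem_add.2 (.inr hp'))
    · exact hΛ p hp'
  have hΓ := eq_tctx_fst hτΓ
  set γ := Ctx.fst (Δ₀' + Δ) with hγ
  -- The rank of `x` only has to exceed those of all client channels; their sum plus one does.
  refine ⟨Function.update τ x A, Function.update r x ((γ.map r).sum + 1), (n, γ) ::ₘ t,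
    by simp [ht], ?_, ?_, ?_, ?_⟩
  · intro c hc
    rw [Config.offers_cons, hx, Multiset.mem_cons, not_or] at hc
    rw [Function.update_of_ne hc.1, Function.update_of_ne hc.1]
    exact hag c hc.2
  · intro a ha
    rcases Multiset.mem_cons.1 ha with rfl | ha
    · have hne : ∀ c ∈ γ, c ≠ x := fun c hc h => hxΓ (h ▸ hc)
      constructor
      · simpa [hx] using hnd
      · simpa [hx] using hs
      · intro c hc
        simpa [hx] using hl c (Ctx.mem_fst.1 hc)
      · intro c hc
        simp only [hx, Function.update_self]
        rw [Function.update_of_ne (hne c hc)]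
        exact Nat.lt_succ_of_le (Multiset.single_le_sum (by simp) _ (Multiset.mem_map_of_mem r hc))
      · simp only [hx, Function.update_self]
        rw [tctx_congr fun c hc => Function.update_of_ne (hne c hc) _ _, ← hΓ]
        exact hty
    · have hne : ∀ c ∈ a.1.offer ::ₘ a.2, c ≠ x := fun c hc h => hxC a ha (h ▸ hc)
      refine (hok a ha).mono (fun c hc => Function.update_of_ne (hne c hc) _ _) ?_
      intro c hc hr
      rwa [Function.update_of_ne (hne c (by simp [hc])), Function.update_of_ne (hne _ (by simp))]
  · simp only [Ctx.fst_add, Config.offers_cons, hx, TConfig.ctxs_cons, Ctx.fst_singleton, γ,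
      Multiset.add_cons, Multiset.singleton_add]
    congr 1
    calc _ = Ctx.fst Δ₀' + (Ctx.fst Δ₀ + Config.offers C) := by abel
      _ = _ := by rw [hbal]; abel
  · simp

/-- A well-typed configuration without name clashes has a type assignment and ranks. -/
theorem CTyped.extract {Δ Λ : Ctx L} {D : Config L} (h : CTyped Δ D Λ) :
    (Config.offers D).Nodup → (∀ c ∈ Config.offers D, c ∉ Ctx.chans Δ) →
    ∀ (τ₀ : Chan L → Ty) (r₀ : Chan L → ℕ), (∀ p ∈ Δ, τ₀ p.1 = p.2) →
    ∃ (τ : Chan L → Ty) (r : Chan L → ℕ) (t : TConfig L), TConfig.cfg t = D ∧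
      (∀ c, c ∉ Config.offers D → τ c = τ₀ c ∧ r c = r₀ c) ∧ (∀ a ∈ t, Ok τ r a.1 a.2) ∧
      Ctx.fst Δ + Config.offers D = Ctx.fst Λ + TConfig.ctxs t ∧ ∀ p ∈ Λ, τ p.1 = p.2 := by
  induction h with
  | emp₁ x A => exact fun _ _ τ r h => ⟨τ, r, 0, rfl, fun _ _ => ⟨rfl, rfl⟩, by simp, by simp, h⟩
  | emp₂ => exact fun _ _ τ r h => ⟨τ, r, 0, rfl, fun _ _ => ⟨rfl, rfl⟩, by simp, by simp, h⟩
  | @proc Δ₀ Δ₀' Δ C P d x A hnd hs hl hC hP ih =>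
    intro hoff hdis τ₀ r₀ hτ₀
    exact extract_node rfl rfl (by simpa [Ctx.fst] using hnd) hs hl hP hoff hdis hτ₀ ih
  | @msg Δ₀ Δ₀' Δ C m x A hnd hl hC hP ih =>
    intro hoff hdis τ₀ r₀ hτ₀
    have hx := (hP.msg_inv (by simpa [Ctx.fst] using hnd)).1
    exact extract_node (n := .msg m) rfl hx (by simpa [Ctx.fst] using hnd)
      (by simp [Node.sec, hx]) hl (by simpa [Node.sec, hx, Node.term] using hP) hoff hdis hτ₀ ih
  | @comp Δ₀ Δ₀' Δ C C₁ x A hC hC₁ ih ih₁ =>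
    intro hoff hdis τ₀ r₀ hτ₀
    rw [Config.offers_add] at hoff hdis
    obtain ⟨hn₁, hn₂, hd⟩ := Multiset.nodup_add.1 hoff
    rw [Multiset.disjoint_left] at hd
    obtain ⟨τ₁, r₁, t₁, rfl, hag₁, hok₁, hb₁, hΛ₁⟩ := ih hn₁
      (fun c hc h => hdis c (by simp [hc]) (Ctx.mem_chans_add.2 (.inl h))) τ₀ r₀
      (fun p hp => hτ₀ p (Multiset.mem_add.2 (.inl hp)))
    -- The second part starts from the assignment of the first, so only channels that the second
    -- part offers are reassigned; by `key` they do not occur in the first part.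
    obtain ⟨τ₂, r₂, t₂, rfl, hag₂, hok₂, hb₂, hΛ₂⟩ := ih₁ hn₂
      (fun c hc h => hdis c (by simp [hc]) (Ctx.mem_chans_add.2 (.inr h))) τ₁ r₁
      (fun p hp => by
        rw [(hag₁ p.1 fun h => hdis p.1 (Multiset.mem_add.2 (.inl h)) (Ctx.mem_chans_add.2 (.inr ⟨p.2, hp⟩))).1]
        exact hτ₀ p (Multiset.mem_add.2 (.inr hp)))
    have key : ∀ c ∈ Ctx.fst Δ + TConfig.ctxs t₁, c ∉ Config.offers (TConfig.cfg t₂) := by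
      intro c hc h
      rw [← hb₁, Multiset.mem_add] at hc
      rcases hc with hc | hc
      · exact hdis c (Multiset.mem_add.2 (.inr h)) (Ctx.mem_chans_add.2 (.inl (Ctx.mem_fst.1 hc)))
      · exact hd hc h
    refine ⟨τ₂, r₂, t₁ + t₂, by simp, ?_, ?_, ?_, ?_⟩
    · intro c hc
      rw [Config.offers_add, Multiset.mem_add, not_or] at hc
      rw [(hag₂ c hc.2).1, (hag₂ c hc.2).2]
      exact hag₁ c hc.1
    · intro a ha
      rcases Multiset.mem_add.1 ha with ha | ha
      · have hk : ∀ c ∈ a.1.offer ::ₘ a.2, c ∉ Config.offers (TConfig.cfg t₂) := by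
          intro c hc
          rcases Multiset.mem_cons.1 hc with rfl | hc
          · exact fun h => hd (by rw [TConfig.offers_cfg]; exact TConfig.mem_offers_of_mem ha) h
          · exact key c (Multiset.mem_add.2 (.inr (TConfig.mem_ctxs.2 ⟨a, ha, hc⟩)))
        refine (hok₁ a ha).mono (fun c hc => (hag₂ c (hk c hc)).1) fun c hc hr => ?_
        rwa [(hag₂ c (hk c (by simp [hc]))).2, (hag₂ _ (hk _ (by simp))).2]
      · exact hok₂ a ha
    · simp only [Ctx.fst_add, Config.offers_add, TConfig.ctxs_add, Ctx.fst_cons]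
      calc _ = (Ctx.fst Δ₀ + Config.offers (TConfig.cfg t₁)) +
            (Ctx.fst Δ₀' + Config.offers (TConfig.cfg t₂)) := by abel
        _ = _ := by
          rw [hb₁, hb₂, Ctx.fst_singleton, ← Multiset.singleton_add]; abel
    · intro p hp
      rcases Multiset.mem_cons.1 hp with rfl | hp
      · exact hΛ₂ _ (by simp)
      · rw [(hag₂ _ (key _ (Multiset.mem_add.2 (.inl (Ctx.mem_fst.2 ⟨p.2, hp⟩))))).1]
        exact hΛ₁ p hp

/-! ## Composition and splitting of configurations -/

theorem CTyped.par {Δ Λ Δ' Λ' : Ctx L} {D D' : Config L} (h : CTyped Δ D Λ)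
    (h' : CTyped Δ' D' Λ') : CTyped (Δ + Δ') (D + D') (Λ + Λ') := by
  induction h with
  | emp₁ x A =>
    have := CTyped.comp h' (.emp₁ x A)
    rwa [add_comm, add_comm D'] at this
  | emp₂ => simpa using h'
  | proc hnd hs hl hC hP ih =>
    have := CTyped.comp h' (.proc hnd hs hl hC hP)
    rwa [add_comm, add_comm D'] at this
  | msg hnd hl hC hP ih =>
    have := CTyped.comp h' (.msg hnd hl hC hP)
    rwa [add_comm, add_comm D'] at this
  | @comp Δ₀ Δ₀' Δ C C₁ x A hC hC₁ ih ih₁ =>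
    have := CTyped.comp ih hC₁
    rw [Multiset.cons_add]
    convert this using 1 <;> abel

theorem CTyped.empty (Λ : Ctx L) : CTyped Λ 0 Λ := by
  induction Λ using Multiset.induction_on with
  | empty => exact .emp₂
  | cons p Λ ih => simpa [← Multiset.singleton_add, add_comm] using ih.par (.emp₁ p.1 p.2)

/-- The tree that provides `p` may have been added at any stage of the derivation; the induction
descends to it and composes the remaining trees again. -/
theorem CTyped.pop {Δ Θ : Ctx L} {D : Config L} (h : CTyped Δ D Θ) :
    ∀ {p : Chan L × Ty} {Λ : Ctx L}, Θ = p ::ₘ Λ →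
    ∃ (Δa Δb : Ctx L) (Da Db : Config L), Δ = Δa + Δb ∧ D = Da + Db ∧
      CTyped Δa Da {p} ∧ CTyped Δb Db Λ := by
  have single : ∀ {q : Chan L × Ty} {Δ : Ctx L} {D : Config L}, CTyped Δ D {q} →
    ∀ {p : Chan L × Ty} {Λ : Ctx L}, {q} = p ::ₘ Λ →
      ∃ (Δa Δb : Ctx L) (Da Db : Config L), Δ = Δa + Δb ∧ D = Da + Db ∧
      CTyped Δa Da {p} ∧ CTyped Δb Db Λ := by
    intro q Δ D h p Λ he
    obtain ⟨rfl, rfl⟩ := Multiset.singleton_eq_cons_iff _ |>.1 he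
    exact ⟨Δ, 0, D, 0, by simp, by simp, h, .emp₂⟩
  induction h with
  | emp₁ x A => exact fun he => single (.emp₁ x A) he
  | emp₂ => exact fun he => absurd he (Multiset.zero_ne_cons)
  | proc hnd hs hl hC hP ih => exact fun he => single (.proc hnd hs hl hC hP) he
  | msg hnd hl hC hP ih => exact fun he => single (.msg hnd hl hC hP) he
  | @comp Δ₀ Δ₀' Δ C C₁ x A hC hC₁ ih ih₁ =>
    intro p Λ he
    rcases Multiset.cons_eq_cons.1 he with ⟨rfl, rfl⟩ | ⟨-, cs, rfl, rfl⟩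
    · exact ⟨Δ₀', Δ₀, C₁, C, add_comm _ _, add_comm _ _, hC₁, hC⟩
    · obtain ⟨Δa, Δb, Da, Db, rfl, rfl, h₁, h₂⟩ := ih rfl
      exact ⟨Δa, Δb + Δ₀', Da, Db + C₁, by abel, by abel, h₁, .comp h₂ hC₁⟩

theorem CTyped.zero_right {Δ Θ : Ctx L} {D : Config L} (h : CTyped Δ D Θ) (hΘ : Θ = 0) :
    Δ = 0 ∧ D = 0 := by
  cases h <;> simp_all

theorem CTyped.split {Δ Λ Λ' : Ctx L} {D : Config L} (h : CTyped Δ D (Λ + Λ')) :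
    ∃ (Δa Δb : Ctx L) (Da Db : Config L), Δ = Δa + Δb ∧ D = Da + Db ∧
      CTyped Δa Da Λ ∧ CTyped Δb Db Λ' := by
  induction Λ using Multiset.induction_on generalizing Δ D with
  | empty => exact ⟨0, Δ, 0, D, by simp, by simp, .emp₂, by simpa using h⟩
  | cons p Λ ih =>
    obtain ⟨Δa, Δb, Da, Db, rfl, rfl, h₁, h₂⟩ := h.pop (Multiset.cons_add _ _ _)
    obtain ⟨Δc, Δd, Dc, Dd, rfl, rfl, h₃, h₄⟩ := ih h₂
    refine ⟨Δa + Δc, Δd, Da + Dc, Dd, by abel, by abel, ?_, h₄⟩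
    simpa [Multiset.singleton_add] using h₁.par h₃

/-! ## From annotated configurations to configuration typing -/

theorem CTyped.of_ok {τ : Chan L → Ty} {r : Chan L → ℕ} {t : TConfig L}
    {δ l : Multiset (Chan L)} (hok : ∀ a ∈ t, Ok τ r a.1 a.2)
    (hbal : δ + TConfig.offers t = l + TConfig.ctxs t) :
    CTyped (tctx τ δ) (TConfig.cfg t) (tctx τ l) := by
  classical
  induction hn : Multiset.card t generalizing t l with
  | zero =>
    rw [Multiset.card_eq_zero] at hn
    subst hn
    simp only [TConfig.offers_zero, TConfig.ctxs_zero, add_zero] at hbal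
    subst hbal
    exact .empty _
  | succ k ih =>
    obtain ⟨a, ha, hmax⟩ := t.toFinset.exists_max_image (fun a => r a.1.offer) (by
      obtain ⟨a, ha⟩ := Multiset.card_pos_iff_exists_mem.1 (by omega : 0 < Multiset.card t)
      exact ⟨a, by simpa using ha⟩)
    rw [Multiset.mem_toFinset] at ha
    have hnot : a.1.offer ∉ TConfig.ctxs t := by
      intro h
      obtain ⟨b, hb, hab⟩ := TConfig.mem_ctxs.1 h
      exact absurd ((hok b hb).rank _ hab) (not_lt.2 (hmax b (by simpa using hb)))
    have hmem : a.1.offer ∈ l := by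
      have : a.1.offer ∈ δ + TConfig.offers t :=
        Multiset.mem_add.2 (.inr (TConfig.mem_offers_of_mem ha))
      rw [hbal, Multiset.mem_add] at this
      exact this.resolve_right hnot
    obtain ⟨l, rfl⟩ := Multiset.exists_cons_of_mem hmem
    obtain ⟨t, rfl⟩ := Multiset.exists_cons_of_mem ha
    have hoka := hok a (by simp)
    have hb : δ + TConfig.offers t = (l + a.2) + TConfig.ctxs t := by
      simp only [TConfig.offers_cons, TConfig.ctxs_cons, Multiset.add_cons, Multiset.cons_add,
        Multiset.cons_inj_right] at hbal
      rw [hbal]; abel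
    have := ih (fun b hb => hok b (by simp [hb])) hb (by simpa using hn)
    rw [tctx_add] at this
    -- The part that provides the client channels of the removed node becomes the forest below that
    -- node.
    obtain ⟨Δa, Δb, Da, Db, hΔ, hD, h₁, h₂⟩ := this.split
    have hnode : CTyped Δb (a.1 ::ₘ Db) {(a.1.offer, τ a.1.offer)} := by
      have hnd : (a.1.offer ::ₘ Multiset.map Prod.fst (0 + tctx τ a.2)).Nodup := by
        have := hoka.nodup
        rwa [← fst_tctx τ a.2, Ctx.fst, ← zero_add (tctx τ a.2)] at this
      have hl : ∀ y ∈ Ctx.chans (0 + tctx τ a.2), y.lvl ≤ a.1.offer.lvl := by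
        intro y hy
        rw [zero_add, mem_chans_tctx] at hy
        exact hoka.lvl y hy
      have hty := hoka.typ
      have hs := hoka.sec
      rw [← add_zero Δb]
      rw [← zero_add (tctx τ a.2)] at hty
      obtain ⟨n, γ⟩ := a
      cases n with
      | proc y P d => exact .proc hnd hs hl h₂ hty
      | msg m => exact .msg hnd hl h₂ hty
    rw [hΔ, TConfig.cfg_cons, hD, tctx_cons, ← Multiset.add_cons]
    exact .comp h₁ hnode

theorem PTyped.fst_eq_usesM {Γ : Ctx L} {n : Node L} {d : L} {x : Chan L} {A : Ty}
    (h : PTyped Γ n.term d x A) (hx : n.offer = x) (hnd : (x ::ₘ Ctx.fst Γ).Nodup)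
    (hd : ¬ n.Doomed) : Ctx.fst Γ = n.usesM := by
  subst hx
  have hn := Multiset.nodup_cons.1 hnd
  refine (Multiset.Nodup.ext hn.2 (Finset.nodup _)).2 fun c => ?_
  rw [← Node.usesM, Node.mem_usesM, Node.chans_eq, Ctx.mem_fst]
  constructor
  · intro hc
    refine ⟨?_, by rintro rfl; exact hn.1 (Ctx.mem_fst.2 hc)⟩
    by_contra hnc
    exact hd (n.doomed_iff.2 (h.doomed hc fun h => hnc (.inr h)))
  · rintro ⟨h₁ | h₁, h₂⟩
    · exact absurd h₁ h₂
    · exact (h.chans_subset h₁).resolve_left h₂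

/-- The linear balance of a well-typed configuration without doomed processes. -/
theorem CTyped.bal {Δ Λ : Ctx L} {D : Config L} (h : CTyped Δ D Λ)
    (hd : ∀ n ∈ D, ¬ n.Doomed) :
    Ctx.fst Δ + Config.offers D = Ctx.fst Λ + Config.usesM D := by
  induction h with
  | emp₁ x A => simp
  | emp₂ => simp
  | @proc Δ₀ Δ₀' Δ C P d x A hnd hs hl hC hP ih =>
    have h₁ := PTyped.fst_eq_usesM (n := .proc x P d) hP rfl
      (by simpa [Ctx.fst] using hnd) (hd _ (by simp))
    have h₂ := ih fun n hn => hd n (by simp [hn])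
    simp only [Ctx.fst_add, Config.offers_cons, Config.usesM_cons, ← h₁, Ctx.fst_singleton,
      Node.offer, Multiset.add_cons, Multiset.singleton_add]
    congr 1
    calc _ = Ctx.fst Δ₀' + (Ctx.fst Δ₀ + Config.offers C) := by abel
      _ = _ := by rw [h₂]; abel
  | @msg Δ₀ Δ₀' Δ C m x A hnd hl hC hP ih =>
    have hx := (hP.msg_inv (by simpa [Ctx.fst] using hnd)).1
    have h₁ := PTyped.fst_eq_usesM (n := .msg m) hP hx
      (by simpa [Ctx.fst] using hnd) (hd _ (by simp))
    have h₂ := ih fun n hn => hd n (by simp [hn])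
    simp only [Ctx.fst_add, Config.offers_cons, Config.usesM_cons, ← h₁, Ctx.fst_singleton,
      Node.offer, Multiset.add_cons, Multiset.singleton_add, hx]
    congr 1
    calc _ = Ctx.fst Δ₀' + (Ctx.fst Δ₀ + Config.offers C) := by abel
      _ = _ := by rw [h₂]; abel
  | @comp Δ₀ Δ₀' Δ C C₁ x A hC hC₁ ih ih₁ =>
    have h₁ := ih fun n hn => hd n (by simp [hn])
    have h₂ := ih₁ fun n hn => hd n (by simp [hn])
    simp only [Ctx.fst_add, Config.offers_add, Config.usesM_add, Ctx.fst_cons]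
    calc _ = (Ctx.fst Δ₀ + Config.offers C) + (Ctx.fst Δ₀' + Config.offers C₁) := by abel
      _ = _ := by rw [h₁, h₂, Ctx.fst_singleton, ← Multiset.singleton_add]; abel

/-! ## Globally typed closed configurations -/

/-- A channel that coexists with a later generation carries a message. -/
def Named (D : Config L) : Prop :=
  ∀ c ∈ Config.offers D, ∀ c' ∈ Config.offers D,
    c.name = c'.name → c.lvl = c'.lvl → c.gen < c'.gen → ∃ m, Node.msg m ∈ D ∧ m.carrier = c

/-- A well-typed annotated closed configuration that offers the terminating channel `w`. -/
structure Typed (τ : Chan L → Ty) (r : Chan L → ℕ) (t : TConfig L) (w : Chan L) : Prop where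
  ok : ∀ a ∈ t, Ok τ r a.1 a.2
  bal : TConfig.offers t = w ::ₘ TConfig.ctxs t
  nodup : (TConfig.offers t).Nodup
  one : τ w = .one
  named : Named (TConfig.cfg t)

end SecSess

/-! ### Reductions, termination and linearity -/

namespace SecSess

universe u

set_option linter.unusedSectionVars false

variable {L : Type u} [Lattice L]

/-! ## Reductions -/

/-- The reductions of a single process, other than forwarding. -/
inductive Red1 (used : Set ℕ) : Node L → Config L → Prop
  | cut (y : Chan L) (P Q : Proc L) (d d₁ d₂ : L) (a : ℕ) : a ∉ used →
      Red1 used (.proc y (.cut (.lit d) (.lit d₂) P Q) d₁)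
        (.proc ⟨a, 0, d⟩ (P.at ⟨a, 0, d⟩) d₂ ::ₘ {.proc y (Q.at ⟨a, 0, d⟩) d₁})
  | oneSend (y : Chan L) (d : L) : Red1 used (.proc y (.close y) d) {.msg (.close y)}
  | plusSend (y : Chan L) (k : ℕ) (P : Proc L) (d : L) :
      Red1 used (.proc y (.sel y k P) d)
        (.proc y.next (P.map (ren y y.next)) d ::ₘ {.msg (.selPos y k y.next)})
  | ampSend (x y : Chan L) (k : ℕ) (P : Proc L) (d : L) : x ≠ y →
      Red1 used (.proc y (.sel x k P) d)
        (.msg (.selNeg x k x.next) ::ₘ {.proc y (P.map (ren x x.next)) d})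
  | tensorSend (x y : Chan L) (P : Proc L) (d : L) :
      Red1 used (.proc y (.send x y P) d)
        (.proc y.next (P.map (ren y y.next)) d ::ₘ {.msg (.sendPos x y y.next)})
  | lolliSend (x y z : Chan L) (P : Proc L) (d : L) : z ≠ y →
      Red1 used (.proc y (.send x z P) d)
        (.msg (.sendNeg x z z.next) ::ₘ {.proc y (P.map (ren z z.next)) d})

/-- The reductions in which a process receives a message. -/
inductive Red2 : Msg L → Node L → Node L → Prop
  | oneRecv (x y : Chan L) (Q : Proc L) (d : L) :
      Red2 (.close y) (.proc x (.wait y Q) d) (.proc x Q (d ⊔ y.lvl))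
  | plusRecv (u y v : Chan L) (I : Finset ℕ) (k : {ℓ // ℓ ∈ I})
      (Q : {ℓ // ℓ ∈ I} → Proc L) (d : L) : u ≠ y →
      Red2 (.selPos y k v) (.proc u (.branch y I Q) d)
        (.proc u ((Q k).map (ren y v)) (d ⊔ y.lvl))
  | ampRecv (y v : Chan L) (I : Finset ℕ) (k : {ℓ // ℓ ∈ I})
      (Q : {ℓ // ℓ ∈ I} → Proc L) (d : L) :
      Red2 (.selNeg y k v) (.proc y (.branch y I Q) d) (.proc v ((Q k).map (ren y v)) y.lvl)
  | tensorRecv (u x y v : Chan L) (P : Proc L) (d : L) : u ≠ y →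
      Red2 (.sendPos x y v) (.proc u (.recv y P) d)
        (.proc u ((P.map (ren y v)).at x) (d ⊔ y.lvl))
  | lolliRecv (x y v : Chan L) (P : Proc L) (d : L) :
      Red2 (.sendNeg x y v) (.proc y (.recv y P) d) (.proc v ((P.map (ren y v)).at x) y.lvl)

/-- The rules are grouped by the way in which another run will have to match them: a forwarding
renames the whole configuration, and every other rule replaces either a single process or a message
with its receiver. -/
theorem Step.inv {used : Set ℕ} {keep : Set (Chan L)} {D D' : Config L}
    (h : Step used keep D D') :
    (∃ R y x d, y ∉ keep ∧ D = .proc y (.fwd (.chan y) (.chan x)) d ::ₘ R ∧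
      D' = Config.rename R y x) ∨
    (∃ n b R, Red1 used n b ∧ D = n ::ₘ R ∧ D' = b + R) ∨
    ∃ m n n' R, Red2 m n n' ∧ D = .msg m ::ₘ n ::ₘ R ∧ D' = n' ::ₘ R := by
  cases h with
  | fwd R y x d h => exact .inl ⟨R, y, x, d, h, rfl, rfl⟩
  | cut R y P Q d d₁ d₂ a h => exact .inr (.inl ⟨_, _, R, .cut y P Q d d₁ d₂ a h, rfl, by simp⟩)
  | oneSend R y d => exact .inr (.inl ⟨_, _, R, .oneSend y d, rfl, by simp⟩)
  | oneRecv R x y Q d => exact .inr (.inr ⟨_, _, _, R, .oneRecv x y Q d, rfl, rfl⟩)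
  | plusSend R y k P d => exact .inr (.inl ⟨_, _, R, .plusSend y k P d, rfl, by simp⟩)
  | plusRecv R u y v I k Q d h =>
    exact .inr (.inr ⟨_, _, _, R, .plusRecv u y v I k Q d h, rfl, rfl⟩)
  | ampSend R x y k P d h => exact .inr (.inl ⟨_, _, R, .ampSend x y k P d h, rfl, by simp⟩)
  | ampRecv R y v I k Q d =>
    exact .inr (.inr ⟨_, _, _, R, .ampRecv y v I k Q d, Multiset.cons_swap _ _ _, rfl⟩)
  | tensorSend R x y P d => exact .inr (.inl ⟨_, _, R, .tensorSend x y P d, rfl, by simp⟩)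
  | tensorRecv R u x y v P d h =>
    exact .inr (.inr ⟨_, _, _, R, .tensorRecv u x y v P d h, rfl, rfl⟩)
  | lolliSend R x y z P d h => exact .inr (.inl ⟨_, _, R, .lolliSend x y z P d h, rfl, by simp⟩)
  | lolliRecv R x y v P d =>
    exact .inr (.inr ⟨_, _, _, R, .lolliRecv x y v P d, Multiset.cons_swap _ _ _, rfl⟩)

theorem Red1.step {used : Set ℕ} {keep : Set (Chan L)} {n : Node L} {b : Config L}
    (h : Red1 used n b) (R : Config L) : Step used keep (n ::ₘ R) (b + R) := by
  cases h with
  | cut y P Q d d₁ d₂ a h => simpa using Step.cut (keep := keep) R y P Q d d₁ d₂ a h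
  | oneSend y d => simpa using Step.oneSend (used := used) (keep := keep) R y d
  | plusSend y k P d => simpa using Step.plusSend (used := used) (keep := keep) R y k P d
  | ampSend x y k P d h => simpa using Step.ampSend (used := used) (keep := keep) R x y k P d h
  | tensorSend x y P d => simpa using Step.tensorSend (used := used) (keep := keep) R x y P d
  | lolliSend x y z P d h =>
    simpa using Step.lolliSend (used := used) (keep := keep) R x y z P d h

theorem Red2.step {used : Set ℕ} {keep : Set (Chan L)} {m : Msg L} {n n' : Node L}
    (h : Red2 m n n') (R : Config L) : Step used keep (.msg m ::ₘ n ::ₘ R) (n' ::ₘ R) := by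
  cases h with
  | oneRecv x y Q d => exact .oneRecv R x y Q d
  | plusRecv u y v I k Q d h => exact .plusRecv R u y v I k Q d h
  | ampRecv y v I k Q d => rw [Multiset.cons_swap]; exact .ampRecv R y v I k Q d
  | tensorRecv u x y v P d h => exact .tensorRecv R u x y v P d h
  | lolliRecv x y v P d => rw [Multiset.cons_swap]; exact .lolliRecv R x y v P d

theorem Red1.size_lt {used : Set ℕ} {n : Node L} {b : Config L} (h : Red1 used n b) :
    Config.size b < n.size := by
  cases h <;> simp [Node.size, Proc.size, Proc.size_map, Proc.size_inst] <;> omega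

theorem Red2.size_le {m : Msg L} {n n' : Node L} (h : Red2 m n n') : n'.size < n.size := by
  cases h with
  | plusRecv u y v I k Q d h =>
    simp only [Node.size, Proc.size, Proc.size_map]
    exact Nat.lt_succ_of_le (Finset.single_le_sum (f := fun ℓ => (Q ℓ).size)
      (fun _ _ => Nat.zero_le _) (Finset.mem_univ k))
  | ampRecv y v I k Q d =>
    simp only [Node.size, Proc.size, Proc.size_map]
    exact Nat.lt_succ_of_le (Finset.single_le_sum (f := fun ℓ => (Q ℓ).size)
      (fun _ _ => Nat.zero_le _) (Finset.mem_univ k))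
  | _ => simp [Node.size, Proc.size, Proc.size_map, Proc.size_inst]

/-- The language has no recursion: a receive continues with a term whose size was already counted, a
send pays for its message, and a forwarder disappears. Hence all runs terminate, typed or not. -/
theorem Step.size_lt {used : Set ℕ} {keep : Set (Chan L)} {D D' : Config L}
    (h : Step used keep D D') : Config.size D' < Config.size D := by
  rcases h.inv with ⟨R, y, x, d, -, rfl, rfl⟩ | ⟨n, b, R, hr, rfl, rfl⟩ | ⟨m, n, n', R, hr, rfl, rfl⟩
  · simp [Node.size, Proc.size]
  · have := hr.size_lt
    simp only [Config.size_cons, Config.size_add]; omega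
  · have := hr.size_le
    simp only [Config.size_cons]; omega

theorem Red1.doomed {used : Set ℕ} {n : Node L} {b : Config L} (h : Red1 used n b)
    (hd : n.Doomed) : ∃ n' ∈ b, n'.Doomed := by
  cases h with
  | cut y P Q d d₁ d₂ a h =>
    rcases hd with hd | hd
    · exact ⟨_, Multiset.mem_cons_self _ _, (Proc.doomed_inst _ _ _).2 hd⟩
    · exact ⟨_, Multiset.mem_cons_of_mem (Multiset.mem_singleton_self _),
        (Proc.doomed_inst _ _ _).2 hd⟩
  | oneSend y d => exact hd.elim
  | plusSend y k P d => exact ⟨_, Multiset.mem_cons_self _ _, (Proc.doomed_map _ _).2 hd⟩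
  | tensorSend x y P d => exact ⟨_, Multiset.mem_cons_self _ _, (Proc.doomed_map _ _).2 hd⟩
  | ampSend x y k P d h => exact ⟨_, Multiset.mem_cons_of_mem (Multiset.mem_singleton_self _),
        (Proc.doomed_map _ _).2 hd⟩
  | lolliSend x y z P d h => exact ⟨_, Multiset.mem_cons_of_mem (Multiset.mem_singleton_self _),
        (Proc.doomed_map _ _).2 hd⟩

theorem Red2.doomed {m : Msg L} {n n' : Node L} (h : Red2 m n n') (hd : n.Doomed) :
    n'.Doomed := by
  cases h with
  | oneRecv x y Q d => exact hd
  | plusRecv u y v I k Q d h => exact (Proc.doomed_map _ _).2 (hd k)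
  | ampRecv y v I k Q d => exact (Proc.doomed_map _ _).2 (hd k)
  | tensorRecv u x y v P d h => exact (Proc.doomed_inst _ _ _).2 ((Proc.doomed_map _ _).2 hd)
  | lolliRecv x y v P d => exact (Proc.doomed_inst _ _ _).2 ((Proc.doomed_map _ _).2 hd)

/-- A doomed term is neither a forwarder nor a close, and each of its other steps leaves a doomed
term behind. -/
theorem Step.doomed {used : Set ℕ} {keep : Set (Chan L)} {D D' : Config L}
    (h : Step used keep D D') (hd : ∃ n ∈ D, n.Doomed) : ∃ n ∈ D', n.Doomed := by
  obtain ⟨p, hp, hd⟩ := hd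
  rcases h.inv with ⟨R, y, x, d, -, rfl, rfl⟩ | ⟨n, b, R, hr, rfl, rfl⟩ | ⟨m, n, n', R, hr, rfl, rfl⟩
  · rcases Multiset.mem_cons.1 hp with rfl | hp
    · exact hd.elim
    · exact ⟨_, Multiset.mem_map_of_mem _ hp, (Node.doomed_map _ _).2 hd⟩
  · rcases Multiset.mem_cons.1 hp with rfl | hp
    · obtain ⟨n', hn', hd'⟩ := hr.doomed hd
      exact ⟨n', Multiset.mem_add.2 (.inl hn'), hd'⟩
    · exact ⟨p, Multiset.mem_add.2 (.inr hp), hd⟩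
  · rcases Multiset.mem_cons.1 hp with rfl | hp
    · exact hd.elim
    · rcases Multiset.mem_cons.1 hp with rfl | hp
      · exact ⟨n', Multiset.mem_cons_self _ _, hr.doomed hd⟩
      · exact ⟨p, Multiset.mem_cons_of_mem hp, hd⟩

/-! ## Linearity of globally typed configurations -/

/-- The positive types. -/
def Ty.Pos : Ty → Prop
  | .one => True
  | .plus _ _ => True
  | .amp _ _ => False
  | .tensor _ _ => True
  | .lolli _ _ => False

theorem MsgOk.pos {τ : Chan L → Ty} {γ : Multiset (Chan L)} {m : Msg L} (h : MsgOk τ γ m)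
    (hm : m.Positive) : (τ m.carrier).Pos ∧ m.carrier = m.offer := by
  cases m with
  | close y => simp [Msg.carrier, h.2, Ty.Pos, Msg.offer]
  | selPos y k v =>
    obtain ⟨-, -, I, A, hk, h₁, -⟩ := h
    simp [Msg.carrier, h₁, Ty.Pos, Msg.offer]
  | sendPos x y v => simp [Msg.carrier, h.2.2.2, Ty.Pos, Msg.offer]
  | selNeg y k v => exact hm.elim
  | sendNeg x y v => exact hm.elim

theorem MsgOk.neg {τ : Chan L → Ty} {γ : Multiset (Chan L)} {m : Msg L} (h : MsgOk τ γ m)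
    (hm : ¬ m.Positive) : ¬ (τ m.carrier).Pos ∧ m.carrier ∈ γ := by
  cases m with
  | close y => exact absurd trivial hm
  | selPos y k v => exact absurd trivial hm
  | sendPos x y v => exact absurd trivial hm
  | selNeg y k v =>
    obtain ⟨rfl, -, I, A, hk, h₁, -⟩ := h
    simp [Msg.carrier, h₁, Ty.Pos]
  | sendNeg x y v =>
    obtain ⟨rfl, -, -, h₁⟩ := h
    simp [Msg.carrier, h₁, Ty.Pos]

theorem Ok.of_msgOk {τ : Chan L → Ty} {r : Chan L → ℕ} {γ : Multiset (Chan L)} {m : Msg L}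
    (h : MsgOk τ γ m) (hn : (m.offer ::ₘ γ).Nodup) (hr : ∀ c ∈ γ, r c < r m.offer) :
    Ok τ r (.msg m) γ where
  nodup := hn
  sec := le_rfl
  lvl c hc := by
    rw [h.lvl_eq (h.mem_chans hc), ← h.lvl_eq m.offer_mem]
    exact le_rfl
  rank := hr
  typ := h.ptyped

section Linear

variable {τ : Chan L → Ty} {r : Chan L → ℕ} {t : TConfig L} {w : Chan L}

/-- The balance turns the absence of double offers into linearity: no channel has two clients, and
the root has none. -/
theorem Typed.nodup_ctxs (H : Typed τ r t w) : (w ::ₘ TConfig.ctxs t).Nodup := by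
  have := H.nodup
  rwa [H.bal] at this

theorem Typed.mem_offers_of_mem_ctxs (H : Typed τ r t w) {c : Chan L}
    (h : c ∈ TConfig.ctxs t) : c ∈ TConfig.offers t := by
  rw [H.bal]; exact Multiset.mem_cons_of_mem h

theorem Typed.mem_offers_of_mem (H : Typed τ r t w) {a : Node L × Multiset (Chan L)}
    (ha : a ∈ t) {c : Chan L} (hc : c ∈ a.1.offer ::ₘ a.2) : c ∈ TConfig.offers t := by
  rcases Multiset.mem_cons.1 hc with rfl | hc
  · exact TConfig.mem_offers_of_mem ha
  · exact H.mem_offers_of_mem_ctxs (TConfig.mem_ctxs.2 ⟨a, ha, hc⟩)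

theorem Typed.offer_inj (H : Typed τ r t w) {a b : Node L × Multiset (Chan L)}
    (ha : a ∈ t) (hb : b ∈ t) (h : a.1.offer = b.1.offer) : a = b :=
  Multiset.inj_on_of_nodup_map H.nodup a ha b hb h

theorem Typed.ctx_inj (H : Typed τ r t w) {a b : Node L × Multiset (Chan L)}
    (ha : a ∈ t) (hb : b ∈ t) {c : Chan L} (hca : c ∈ a.2) (hcb : c ∈ b.2) : a = b := by
  by_contra hne
  obtain ⟨t, rfl⟩ := Multiset.exists_cons_of_mem ha
  have hb' := (Multiset.mem_cons.1 hb).resolve_left fun h => hne h.symm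
  have := (Multiset.nodup_cons.1 H.nodup_ctxs).2
  rw [TConfig.ctxs_cons] at this
  exact Multiset.disjoint_left.1 (Multiset.nodup_add.1 this).2.2 hca
    (TConfig.mem_ctxs.2 ⟨b, hb', hcb⟩)

/-- A message along `y` would be either positive, and then offered at `y` in conflict with the
process, or negative, against the polarity of the type. This and its counterpart for client channels
make the next generation of a channel new when a process sends along it. -/
theorem Typed.no_msg_offer (H : Typed τ r t w) {y : Chan L} {P : Proc L} {d : L}
    {γ : Multiset (Chan L)} (hn : (Node.proc y P d, γ) ∈ t) (hy : (τ y).Pos) {m : Msg L}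
    (hm : Node.msg m ∈ TConfig.cfg t) : m.carrier ≠ y := by
  rintro rfl
  obtain ⟨γm, hm⟩ := TConfig.mem_cfg.1 hm
  have hok := (H.ok _ hm).msgOk
  by_cases hp : m.Positive
  · have := H.offer_inj hm hn (hok.pos hp).2.symm
    cases this
  · exact (hok.neg hp).1 hy

theorem Typed.no_msg_ctx (H : Typed τ r t w) {y x : Chan L} {P : Proc L} {d : L}
    {γ : Multiset (Chan L)} (hn : (Node.proc y P d, γ) ∈ t) (hx : x ∈ γ) (hy : ¬ (τ x).Pos)
    {m : Msg L} (hm : Node.msg m ∈ TConfig.cfg t) : m.carrier ≠ x := by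
  rintro rfl
  obtain ⟨γm, hm⟩ := TConfig.mem_cfg.1 hm
  have hok := (H.ok _ hm).msgOk
  by_cases hp : m.Positive
  · exact hy (hok.pos hp).1
  · have := H.ctx_inj hm hn (hok.neg hp).2 hx
    cases this

end Linear

/-! ## Replacement of nodes -/

theorem Named.insert {D D' : Config L} {z : Chan L} (h : Named D)
    (ho : ∀ c ∈ Config.offers D', c = z ∨ c ∈ Config.offers D)
    (hm : ∀ m, Node.msg m ∈ D → Node.msg m ∈ D')
    (h₁ : ∀ c ∈ Config.offers D, c.name = z.name → c.lvl = z.lvl → c.gen < z.gen →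
      ∃ m, Node.msg m ∈ D' ∧ m.carrier = c)
    (h₂ : ∀ c ∈ Config.offers D, z.name = c.name → z.lvl = c.lvl → z.gen < c.gen → False) :
    Named D' := by
  intro c hc c' hc' e₁ e₂ e₃
  rcases ho c hc with rfl | hc
  · rcases ho c' hc' with rfl | hc'
    · exact absurd e₃ (lt_irrefl _)
    · exact (h₂ c' hc' e₁ e₂ e₃).elim
  · rcases ho c' hc' with rfl | hc'
    · exact h₁ c hc e₁ e₂ e₃
    · obtain ⟨m, h₃, h₄⟩ := h c hc c' hc' e₁ e₂ e₃
      exact ⟨m, hm m h₃, h₄⟩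

/-- Older generations of `y` still carry their messages, and `y` itself carries the new one. A
generation later than `y` cannot be present, because `y` has carried no message so far. -/
theorem Named.insert_next {D D' : Config L} {y : Chan L} (h : Named D)
    (hy : y ∈ Config.offers D)
    (hno : ∀ m, Node.msg m ∈ D → m.carrier ≠ y)
    (ho : ∀ c ∈ Config.offers D', c = y.next ∨ c ∈ Config.offers D)
    (hm : ∀ m, Node.msg m ∈ D → Node.msg m ∈ D')
    (hnew : ∃ m, Node.msg m ∈ D' ∧ m.carrier = y) : Named D' := by
  refine h.insert ho hm ?_ ?_
  · intro c hc e₁ e₂ e₃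
    rcases Nat.lt_succ_iff_lt_or_eq.1 (show c.gen < y.gen + 1 from e₃) with e | e
    · obtain ⟨m, h₁, h₂⟩ := h c hc y hy e₁ e₂ e
      exact ⟨m, hm m h₁, h₂⟩
    · obtain rfl : c = y := Chan.ext e₁ e e₂
      exact hnew
  · intro c hc e₁ e₂ e₃
    obtain ⟨m, h₁, h₂⟩ := h y hy c hc e₁ e₂ (lt_trans (Nat.lt_succ_self _) e₃)
    exact hno m h₁ h₂

theorem Named.next_notMem {D : Config L} {y : Chan L} (h : Named D)
    (hy : y ∈ Config.offers D) (hno : ∀ m, Node.msg m ∈ D → m.carrier ≠ y) :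
    y.next ∉ Config.offers D := by
  intro hc
  obtain ⟨m, h₁, h₂⟩ := h y hy y.next hc rfl rfl (Nat.lt_succ_self _)
  exact hno m h₁ h₂

open Classical in
/-- Ranks for a new channel `z`. -/
noncomputable def bump (r : Chan L → ℕ) (z : Chan L) (e : ℕ) : Chan L → ℕ :=
  -- All old ranks become odd, which leaves an even value free just above and just below each of
  -- them for the new channel.
  fun c => if c = z then e else 2 * r c + 1

@[simp] theorem bump_self (r : Chan L → ℕ) (z : Chan L) (e : ℕ) : bump r z e z = e := by
  simp [bump]

theorem bump_ne {r : Chan L → ℕ} {z : Chan L} {e : ℕ} {c : Chan L} (h : c ≠ z) :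
    bump r z e c = 2 * r c + 1 := by simp [bump, h]

open Classical in
/-- The type assignment extended by a new channel. -/
noncomputable def extend (τ : Chan L → Ty) (z : Chan L) (T : Ty) : Chan L → Ty :=
  fun c => if c = z then T else τ c

@[simp] theorem extend_self (τ : Chan L → Ty) (z : Chan L) (T : Ty) : extend τ z T z = T := by
  simp [extend]

theorem extend_ne {τ : Chan L → Ty} {z : Chan L} {T : Ty} {c : Chan L} (h : c ≠ z) :
    extend τ z T c = τ c := by simp [extend, h]

/-- Meant for cuts and sends that create one channel `z`: it is both offered and used by the new
nodes, so the two sides of the balance grow alike. -/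
theorem Typed.replace_new {τ : Chan L → Ty} {r : Chan L → ℕ} {ta tb tR : TConfig L}
    {w z : Chan L} {T : Ty} {e : ℕ} (H : Typed τ r (ta + tR) w)
    (hz : z ∉ TConfig.offers (ta + tR))
    (ho : TConfig.offers tb = z ::ₘ TConfig.offers ta)
    (hc : TConfig.ctxs tb = z ::ₘ TConfig.ctxs ta)
    (hok : ∀ a ∈ tb, Ok (extend τ z T) (bump r z e) a.1 a.2)
    (hn : Named (TConfig.cfg (tb + tR))) :
    Typed (extend τ z T) (bump r z e) (tb + tR) w where
  ok a ha := by
    rcases Multiset.mem_add.1 ha with ha | ha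
    · exact hok a ha
    · have ha' := Multiset.mem_add.2 (.inr ha : a ∈ ta ∨ a ∈ tR)
      have hne : ∀ c ∈ a.1.offer ::ₘ a.2, c ≠ z := by
        rintro c hca rfl
        exact hz (H.mem_offers_of_mem ha' hca)
      refine (H.ok a ha').mono (fun c hc => extend_ne (hne c hc)) fun c hc hr => ?_
      rw [bump_ne (hne c (by simp [hc])), bump_ne (hne _ (by simp))]
      omega
  bal := by
    have := H.bal
    rw [TConfig.offers_add, TConfig.ctxs_add] at this ⊢
    rw [ho, hc, Multiset.cons_add, this, Multiset.cons_add, Multiset.cons_swap]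
  nodup := by
    have := H.nodup
    rw [TConfig.offers_add] at this hz ⊢
    rw [ho, Multiset.cons_add]
    exact Multiset.nodup_cons.2 ⟨hz, this⟩
  one := by
    rw [extend_ne, H.one]
    rintro rfl
    exact hz (by rw [H.bal]; simp)
  named := hn

/-- Meant for `close` and for receives, where no channel is created. A received message no longer
justifies the coexistence of its carrier with later generations, so `hn` asks that the carrier is no
longer offered. -/
theorem Typed.replace_old {τ : Chan L → Ty} {r : Chan L → ℕ} {ta tb tR : TConfig L}
    {w : Chan L} (H : Typed τ r (ta + tR) w)
    (hbal : TConfig.offers ta + TConfig.ctxs tb = TConfig.offers tb + TConfig.ctxs ta)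
    (hle : TConfig.offers tb ≤ TConfig.offers ta)
    (hok : ∀ a ∈ tb, Ok τ r a.1 a.2)
    (hn : ∀ m, Node.msg m ∈ TConfig.cfg ta → m.carrier ∉ TConfig.offers (tb + tR)) :
    Typed τ r (tb + tR) w where
  ok a ha := by
    rcases Multiset.mem_add.1 ha with ha | ha
    · exact hok a ha
    · exact H.ok a (Multiset.mem_add.2 (.inr ha))
  bal := by
    have h := H.bal
    rw [TConfig.offers_add, TConfig.ctxs_add] at h ⊢
    apply add_left_cancel (a := TConfig.offers ta + TConfig.ctxs ta)
    rw [← Multiset.singleton_add] at h ⊢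
    calc _ = (TConfig.offers tb + TConfig.ctxs ta) + (TConfig.offers ta + TConfig.offers tR) := by
          abel
      _ = _ := by rw [h, ← hbal]; abel
  nodup := by
    refine Multiset.nodup_of_le ?_ H.nodup
    rw [TConfig.offers_add, TConfig.offers_add]
    exact add_le_add_left hle _
  one := H.one
  named := by
    intro c hc c' hc' e₁ e₂ e₃
    rw [TConfig.offers_cfg] at hc hc'
    have hsub : ∀ c ∈ TConfig.offers (tb + tR), c ∈ Config.offers (TConfig.cfg (ta + tR)) := by
      intro c hc
      rw [TConfig.offers_cfg, TConfig.offers_add]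
      rw [TConfig.offers_add] at hc
      exact Multiset.mem_of_le (add_le_add_left hle _) hc
    obtain ⟨m, hm, rfl⟩ := H.named c (hsub c hc) c' (hsub c' hc') e₁ e₂ e₃
    refine ⟨m, ?_, rfl⟩
    rw [TConfig.cfg_add, Multiset.mem_add] at hm ⊢
    exact .inr (hm.resolve_left fun h => hn m h hc)

end SecSess

/-! ### Preservation of typing by cuts, sends and receives -/

namespace SecSess

universe u

set_option linter.unusedSectionVars false

variable {L : Type u} [Lattice L]

/-! ## Preservation -/

/-- The continuation of a sending provider moves to the new channel `z`. Its rank `2 * r y` lies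
between the new rank `2 * r y + 1` of `y` and the new ranks of the client channels of `y`. -/
theorem send_provider_ok {τ : Chan L → Ty} {r : Chan L → ℕ} {y z : Chan L} {P₀ P : Proc L} {d : L}
    {γ γ' : Multiset (Chan L)} {T : Ty} (hok : Ok τ r (.proc y P₀ d) γ) (hzl : z.lvl = y.lvl)
    (hz : z ∉ y ::ₘ γ) (hγ : γ' ≤ γ) (ht : PTyped (tctx τ γ') P d y T) :
    Ok (extend τ z T) (bump r z (2 * r y)) (.proc z (P.map (ren y z)) d) γ' := by
  rw [Multiset.mem_cons, not_or] at hz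
  have hz' : ∀ c ∈ γ', c ≠ z := fun c hc h => hz.2 (h ▸ Multiset.mem_of_le hγ hc)
  have hy : y ∉ γ' := fun h => (Multiset.nodup_cons.1 hok.nodup).1 (Multiset.mem_of_le hγ h)
  constructor
  · exact Multiset.nodup_cons.2 ⟨fun h => hz' _ h rfl,
      Multiset.nodup_of_le hγ (Multiset.nodup_cons.1 hok.nodup).2⟩
  · exact hok.sec.trans hzl.ge
  · exact fun c hc => (hok.lvl c (Multiset.mem_of_le hγ hc)).trans hzl.ge
  · intro c hc
    have := hok.rank c (Multiset.mem_of_le hγ hc)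
    simp only [Node.offer] at this ⊢
    rw [bump_self, bump_ne (hz' c hc)]
    omega
  · have := ht.ren (a := y) (b := z) hzl hz.1 (fun h => hz' _ (mem_chans_tctx.1 h) rfl)
    rw [Ctx.ren_of_notMem (fun h => hy (mem_chans_tctx.1 h)), ren_self] at this
    rw [tctx_congr fun c hc => extend_ne (hz' c hc)]
    simpa [Node.term, Node.offer, Node.sec] using this

/-- The client stays at `y` and exchanges `x` for `z`. Nothing else is needed of the rank `e` than
to stay below the new rank of `y`; its lower bound comes from the message. -/
theorem send_client_ok {τ : Chan L → Ty} {r : Chan L → ℕ} {x y z : Chan L} {P₀ P : Proc L} {d : L}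
    {γ γ' : Multiset (Chan L)} {T : Ty} {e : ℕ} (hok : Ok τ r (.proc y P₀ d) γ)
    (hzl : z.lvl = x.lvl) (he : e < 2 * r y + 1) (hz : z ∉ y ::ₘ γ) (hγ : x ::ₘ γ' ≤ γ) (ht : PTyped ((x, T) ::ₘ tctx τ γ') P d y (τ y)) :
    Ok (extend τ z T) (bump r z e) (.proc y (P.map (ren x z)) d) (z ::ₘ γ') := by
  rw [Multiset.mem_cons, not_or] at hz
  have hnd := Multiset.nodup_cons.1 hok.nodup
  have hxγ : x ∈ γ := Multiset.mem_of_le hγ (by simp)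
  have hγ' : ∀ c ∈ γ', c ∈ γ := fun c hc => Multiset.mem_of_le hγ (by simp [hc])
  have hz' : ∀ c ∈ γ', c ≠ z := fun c hc h => hz.2 (h ▸ hγ' c hc)
  have hxn := Multiset.nodup_cons.1 (Multiset.nodup_of_le hγ hnd.2)
  have hyx : y ≠ x := by rintro rfl; exact hnd.1 hxγ
  constructor
  · refine Multiset.nodup_cons.2 ⟨?_, Multiset.nodup_cons.2 ⟨fun h => hz' _ h rfl, hxn.2⟩⟩
    rw [Multiset.mem_cons, not_or]
    exact ⟨fun h => hz.1 h.symm, fun h => hnd.1 (hγ' _ h)⟩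
  · exact hok.sec
  · intro c hc
    rcases Multiset.mem_cons.1 hc with rfl | hc
    · rw [hzl]; exact hok.lvl x hxγ
    · exact hok.lvl c (hγ' c hc)
  · intro c hc
    simp only [Node.offer]
    rw [bump_ne (Ne.symm hz.1)]
    rcases Multiset.mem_cons.1 hc with rfl | hc
    · rwa [bump_self]
    · have : r c < r y := hok.rank c (hγ' c hc)
      rw [bump_ne (hz' c hc)]
      omega
  · have hzc : z ∉ Ctx.chans ((x, T) ::ₘ tctx τ γ') := by
      rw [Ctx.mem_chans_cons, mem_chans_tctx, not_or]
      exact ⟨fun h => hz.2 (h ▸ hxγ), fun h => hz' _ h rfl⟩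
    have := ht.ren (a := x) (b := z) hzl hz.1 hzc
    rw [Ctx.ren_cons, Ctx.ren_of_notMem (fun h => hxn.1 (mem_chans_tctx.1 h)), ren_self,
      ren_of_ne hyx] at this
    rw [tctx_cons, extend_self, tctx_congr fun c hc => extend_ne (hz' c hc)]
    simpa only [Node.term, Node.offer, Node.sec, extend_ne (Ne.symm hz.1)] using this

section

variable {used : Set ℕ} {τ : Chan L → Ty} {r : Chan L → ℕ} {tR : TConfig L} {w : Chan L}
  {γ : Multiset (Chan L)}

/-- The next generation of the channel along which a process sends is new. -/
theorem Typed.next_new {n : Node L} {y : Chan L}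
    (H : Typed τ r ((n, γ) ::ₘ tR) w) (hy : y ∈ n.offer ::ₘ γ)
    (hno : ∀ m, Node.msg m ∈ TConfig.cfg ((n, γ) ::ₘ tR) → m.carrier ≠ y) :
    y.next ∉ TConfig.offers ((n, γ) ::ₘ tR) := by
  rw [← TConfig.offers_cfg]
  refine H.named.next_notMem ?_ hno
  rw [TConfig.offers_cfg]
  exact H.mem_offers_of_mem (Multiset.mem_cons_self _ _) hy

theorem send_named {y₀ : Chan L} {P₀ : Proc L} {d : L} {y : Chan L} {tb : TConfig L}
    (H : Typed τ r ((.proc y₀ P₀ d, γ) ::ₘ tR) w)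
    (hy : y ∈ y₀ ::ₘ γ)
    (hno : ∀ m, Node.msg m ∈ TConfig.cfg ((.proc y₀ P₀ d, γ) ::ₘ tR) → m.carrier ≠ y)
    (ho : TConfig.offers tb = y.next ::ₘ {y₀})
    (hnew : ∃ m, Node.msg m ∈ TConfig.cfg tb ∧ m.carrier = y) :
    Named (TConfig.cfg (tb + tR)) := by
  refine H.named.insert_next ?_ hno ?_ ?_ ?_
  · rw [TConfig.offers_cfg]
    exact H.mem_offers_of_mem (Multiset.mem_cons_self _ _) hy
  · intro c hc
    rw [TConfig.offers_cfg, TConfig.offers_add, ho] at hc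
    simpa [Node.offer, or_assoc] using hc
  · intro m hm
    simp only [TConfig.cfg_cons, Multiset.mem_cons, TConfig.cfg_add, Multiset.mem_add] at hm ⊢
    rcases hm with hm | hm
    · cases hm
    · exact .inr hm
  · obtain ⟨m, hm, e⟩ := hnew
    exact ⟨m, by simp [hm], e⟩

theorem Typed.replace_send {y₀ : Chan L} {P₀ : Proc L} {d : L} {y : Chan L} {tb : TConfig L}
    {T : Ty} {e : ℕ} (H : Typed τ r ((.proc y₀ P₀ d, γ) ::ₘ tR) w)
    (hy : y ∈ y₀ ::ₘ γ)
    (hno : ∀ m, Node.msg m ∈ TConfig.cfg ((.proc y₀ P₀ d, γ) ::ₘ tR) → m.carrier ≠ y)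
    (ho : TConfig.offers tb = y.next ::ₘ {y₀}) (hc : TConfig.ctxs tb = y.next ::ₘ γ)
    (hok : ∀ a ∈ tb, Ok (extend τ y.next T) (bump r y.next e) a.1 a.2)
    (hnew : ∃ m, Node.msg m ∈ TConfig.cfg tb ∧ m.carrier = y) :
    ∃ (τ' : Chan L → Ty) (r' : Chan L → ℕ) (tb' : TConfig L), TConfig.cfg tb' = TConfig.cfg tb ∧
      Typed τ' r' (tb' + tR) w ∧
      ∀ c ∈ TConfig.offers ((Node.proc y₀ P₀ d, γ) ::ₘ tR), τ' c = τ c := by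
  have hz := H.next_new hy hno
  refine ⟨_, _, tb, rfl, Typed.replace_new (ta := {(.proc y₀ P₀ d, γ)}) (by simpa using H)
    (by simpa using hz) (by simpa [Node.offer] using ho) (by simpa using hc) hok
    (send_named H hy hno ho hnew), ?_⟩
  intro c hc
  exact extend_ne fun h => hz (h ▸ hc)

theorem Red1.pres {n : Node L} {b : Config L} (h : Red1 used n b)
    (H : Typed τ r ((n, γ) ::ₘ tR) w)
    (hu : Config.names (TConfig.cfg ((n, γ) ::ₘ tR)) ⊆ used) :
    ∃ (τ' : Chan L → Ty) (r' : Chan L → ℕ) (tb : TConfig L), TConfig.cfg tb = b ∧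
      Typed τ' r' (tb + tR) w ∧ ∀ c ∈ TConfig.offers ((n, γ) ::ₘ tR), τ' c = τ c := by
  have hok := H.ok (n, γ) (by simp)
  have hmem : (n, γ) ∈ (n, γ) ::ₘ tR := by simp
  have hyγ := (Multiset.nodup_cons.1 hok.nodup).1
  have hγn := (Multiset.nodup_cons.1 hok.nodup).2
  cases h with
  | oneSend y d =>
    have ht : PTyped (tctx τ γ) (.close (.chan y)) d y (τ y) := hok.typ
    obtain ⟨-, hγ, hy⟩ := ht.inv_close
    have hγ0 : γ = 0 := by simpa [tctx] using hγ
    subst hγ0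
    refine ⟨τ, r, {(.msg (.close y), 0)}, by simp, ?_, fun _ _ => rfl⟩
    refine Typed.replace_old (ta := {(.proc y (.close (.chan y)) d, 0)}) (by simpa using H)
      (by simp [Node.offer, Msg.offer]) (by simp [Node.offer, Msg.offer]) ?_ (by simp)
    intro a ha
    rw [Multiset.mem_singleton] at ha
    subst ha
    exact .of_msgOk ⟨rfl, hy⟩ (by simp) (by simp)
  | plusSend y k P d =>
    have ht : PTyped (tctx τ γ) (.sel (.chan y) k P) d y (τ y) := hok.typ
    rcases ht.inv_sel with ⟨-, I, A, hk, hy, ht'⟩ | ⟨Δ, I, A, hk, hΓ, -, -⟩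
    · have hno := fun m => H.no_msg_offer (m := m) hmem (by rw [hy]; trivial)
      have hz := H.next_new (y := y) (by simp [Node.offer]) hno
      have hzn : y.next ∉ y ::ₘ γ := fun h => hz (H.mem_offers_of_mem hmem h)
      have := H.replace_send (y := y) (T := A ⟨k, hk⟩) (e := 2 * r y)
        (tb := (.proc y.next (P.map (ren y y.next)) d, γ) ::ₘ
          {(.msg (.selPos y k y.next), {y.next})}) (by simp) hno
        (by simp [Node.offer, Msg.offer]) (by simp [← Multiset.singleton_add, add_comm])
        ?_ ⟨.selPos y k y.next, by simp, rfl⟩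
      · simpa using this
      intro a ha
      simp only [Multiset.mem_cons, Multiset.mem_singleton] at ha
      rcases ha with rfl | rfl
      · exact send_provider_ok hok rfl hzn le_rfl ht'
      · refine .of_msgOk ⟨rfl, rfl, I, A, hk, by rw [extend_ne y.next_ne.symm, hy], by simp⟩
          (by simpa [Msg.offer] using y.next_ne.symm) ?_
        simp [Msg.offer, bump_ne y.next_ne.symm]
    · obtain ⟨γ', rfl, -, -⟩ := tctx_eq_cons hΓ
      simp [Node.offer] at hyγ
  | ampSend x y k P d hne =>
    have ht : PTyped (tctx τ γ) (.sel (.chan x) k P) d y (τ y) := hok.typ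
    rcases ht.inv_sel with ⟨e, -⟩ | ⟨Δ, I, A, hk, hΓ, hd, ht'⟩
    · exact absurd e hne
    · obtain ⟨γ', rfl, hx, rfl⟩ := tctx_eq_cons hΓ
      have hno := fun m => H.no_msg_ctx (m := m) (x := x) hmem (by simp) (by simp [hx, Ty.Pos])
      have hz := H.next_new (y := x) (by simp) hno
      have hzn : x.next ∉ y ::ₘ x ::ₘ γ' := fun h => hz (H.mem_offers_of_mem hmem h)
      -- The negative message uses `x` and offers `x.next` to the process at `y`, so the new channel
      -- is ranked directly above `x`.
      have := H.replace_send (y := x) (T := A ⟨k, hk⟩) (e := 2 * r x + 2)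
        (tb := (.msg (.selNeg x k x.next), {x}) ::ₘ
          {(.proc y (P.map (ren x x.next)) d, x.next ::ₘ γ')}) (by simp) hno
        (by simp [Node.offer, Msg.offer])
        (by simp [Multiset.singleton_add, Multiset.cons_swap])
        ?_ ⟨.selNeg x k x.next, by simp, rfl⟩
      · simpa using this
      intro a ha
      simp only [Multiset.mem_cons, Multiset.mem_singleton] at ha
      rcases ha with rfl | rfl
      · refine .of_msgOk ⟨rfl, rfl, I, A, hk, by rw [extend_ne x.next_ne.symm, hx], by simp⟩
          (by simpa [Msg.offer] using x.next_ne) ?_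
        simp [Msg.offer, bump_ne x.next_ne.symm]
      · refine send_client_ok hok rfl ?_ hzn le_rfl ht'
        have : r x < r y := hok.rank x (by simp)
        omega
  | tensorSend x y P d =>
    have ht : PTyped (tctx τ γ) (.send (.chan x) (.chan y) P) d y (τ y) := hok.typ
    rcases ht.inv_send with ⟨-, Δ, A, B, hΓ, hy, hl, ht'⟩ | ⟨Δ, A, B, hΓ, -, -, -⟩
    · obtain ⟨γ', rfl, hx, rfl⟩ := tctx_eq_cons hΓ
      have hno := fun m => H.no_msg_offer (m := m) hmem (by rw [hy]; trivial)
      have hz := H.next_new (y := y) (by simp [Node.offer]) hno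
      have hzn : y.next ∉ y ::ₘ x ::ₘ γ' := fun h => hz (H.mem_offers_of_mem hmem h)
      have hxy : x ≠ y := by rintro rfl; simp [Node.offer] at hyγ
      have hxz : x ≠ y.next := by rintro rfl; simp at hzn
      have hr : r x < r y := hok.rank x (by simp)
      have := H.replace_send (y := y) (T := B) (e := 2 * r y)
        (tb := (.proc y.next (P.map (ren y y.next)) d, γ') ::ₘ
          {(.msg (.sendPos x y y.next), {x, y.next})}) (by simp) hno
        (by simp [Node.offer, Msg.offer])
        (by
          simp only [TConfig.ctxs_cons, TConfig.ctxs_singleton, Multiset.insert_eq_cons]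
          simp only [← Multiset.singleton_add]
          abel)
        ?_ ⟨.sendPos x y y.next, by simp, rfl⟩
      · simpa using this
      intro a ha
      simp only [Multiset.mem_cons, Multiset.mem_singleton] at ha
      rcases ha with rfl | rfl
      · exact send_provider_ok hok rfl hzn (Multiset.le_cons_self _ _) ht'
      · refine .of_msgOk ⟨rfl, hl, rfl, by
          rw [extend_ne y.next_ne.symm, hy, extend_ne hxz, hx, extend_self]⟩ ?_ ?_
        · simpa [Msg.offer, Multiset.insert_eq_cons] using ⟨⟨hxy.symm, y.next_ne.symm⟩, hxz⟩
        · simp only [Msg.offer, Multiset.insert_eq_cons, Multiset.mem_cons,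
            Multiset.mem_singleton, forall_eq_or_imp, forall_eq, bump_ne y.next_ne.symm,
            bump_ne hxz, bump_self]
          omega
    · obtain ⟨γ', rfl, -, h₂⟩ := tctx_eq_cons hΓ
      obtain ⟨γ'', rfl, -, -⟩ := tctx_eq_cons h₂.symm
      simp [Node.offer] at hyγ
  | lolliSend x y z P d hne =>
    have ht : PTyped (tctx τ γ) (.send (.chan x) (.chan z) P) d y (τ y) := hok.typ
    rcases ht.inv_send with ⟨e, -⟩ | ⟨Δ, A, B, hΓ, hd, hl, ht'⟩
    · exact absurd e hne
    · obtain ⟨γ₁, rfl, hx, h₂⟩ := tctx_eq_cons hΓ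
      obtain ⟨γ', rfl, hzt, rfl⟩ := tctx_eq_cons h₂.symm
      have hno := fun m => H.no_msg_ctx (m := m) (x := z) hmem (by simp)
        (by simp [hzt, Ty.Pos])
      have hz := H.next_new (y := z) (by simp) hno
      have hzn : z.next ∉ y ::ₘ x ::ₘ z ::ₘ γ' := fun h => hz (H.mem_offers_of_mem hmem h)
      have hxz : x ≠ z := by rintro rfl; simp at hγn
      have hxz' : x ≠ z.next := by rintro rfl; simp at hzn
      have hr : r x < r y := hok.rank x (by simp)
      -- The message uses both `x` and `z`, so its offer has to be ranked above both and still below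
      -- `y`.
      have := H.replace_send (y := z) (T := B) (e := 2 * max (r x) (r z) + 2)
        (tb := (.msg (.sendNeg x z z.next), {x, z}) ::ₘ
          {(.proc y (P.map (ren z z.next)) d, z.next ::ₘ γ')}) (by simp) hno
        (by simp [Node.offer, Msg.offer])
        (by simp [Multiset.insert_eq_cons, Multiset.cons_swap])
        ?_ ⟨.sendNeg x z z.next, by simp, rfl⟩
      · simpa using this
      intro a ha
      simp only [Multiset.mem_cons, Multiset.mem_singleton] at ha
      rcases ha with rfl | rfl
      · refine .of_msgOk ⟨rfl, hl, rfl, by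
          rw [extend_ne z.next_ne.symm, hzt, extend_ne hxz', hx, extend_self]⟩ ?_ ?_
        · simpa [Msg.offer, Multiset.insert_eq_cons] using ⟨⟨hxz'.symm, z.next_ne⟩, hxz⟩
        · simp only [Msg.offer, Multiset.insert_eq_cons, Multiset.mem_cons,
            Multiset.mem_singleton, forall_eq_or_imp, forall_eq, bump_ne z.next_ne.symm,
            bump_ne hxz', bump_self]
          omega
      · refine send_client_ok (x := z) hok rfl ?_ hzn (Multiset.le_cons_self _ _) ht'
        have : r z < r y := hok.rank z (by simp)
        omega
  | cut y P Q d d₁ d₂ a ha =>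
    set z : Chan L := ⟨a, 0, d⟩ with hzd
    have ht : PTyped (tctx τ γ) (.cut (.lit d) (.lit d₂) P Q) d₁ y (τ y) := hok.typ
    obtain ⟨Δ₁, Δ₂, B, hΓ, h₁, h₂, h₃, h₄, h₅⟩ := ht.inv_cut
    have hag : ∀ p ∈ Δ₁ + Δ₂, τ p.1 = p.2 := by
      rw [← hΓ]; simp +contextual [tctx]
    have hγ : γ = Ctx.fst Δ₁ + Ctx.fst Δ₂ := by
      rw [← Ctx.fst_add, ← hΓ, fst_tctx]
    have hΔ₁ := eq_tctx_fst (τ := τ) (Δ := Δ₁) fun p hp => hag p (Multiset.mem_add.2 (.inl hp))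
    have hΔ₂ := eq_tctx_fst (τ := τ) (Δ := Δ₂) fun p hp => hag p (Multiset.mem_add.2 (.inr hp))
    set γ₁ := Ctx.fst Δ₁
    set γ₂ := Ctx.fst Δ₂
    -- Not only the spawned channel but also its name is new, so it is no generation of an existing
    -- channel and the naming discipline is unaffected.
    have hname : ∀ c ∈ TConfig.offers ((Node.proc y (.cut (.lit d) (.lit d₂) P Q) d₁, γ) ::ₘ tR),
        c.name ≠ a := by
      rintro c hc rfl
      rw [← TConfig.offers_cfg, Config.mem_offers] at hc
      obtain ⟨n, hn, rfl⟩ := hc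
      exact ha (hu ⟨n.offer, ⟨n, hn, n.offer_mem⟩, rfl⟩)
    have hz : z ∉ TConfig.offers ((Node.proc y (.cut (.lit d) (.lit d₂) P Q) d₁, γ) ::ₘ tR) :=
      fun h => hname z h rfl
    have hzn : z ∉ y ::ₘ γ := fun h => hz (H.mem_offers_of_mem hmem h)
    rw [Multiset.mem_cons, not_or] at hzn
    have hγ₁ : ∀ c ∈ γ₁, c ∈ γ := fun c hc => by rw [hγ]; exact Multiset.mem_add.2 (.inl hc)
    have hγ₂ : ∀ c ∈ γ₂, c ∈ γ := fun c hc => by rw [hγ]; exact Multiset.mem_add.2 (.inr hc)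
    have hz₁ : ∀ c ∈ γ₁, c ≠ z := fun c hc h => hzn.2 (h ▸ hγ₁ c hc)
    have hz₂ : ∀ c ∈ γ₂, c ≠ z := fun c hc h => hzn.2 (h ▸ hγ₂ c hc)
    have hnd : γ₁.Nodup ∧ γ₂.Nodup := by
      have : γ.Nodup := hγn
      rw [hγ, Multiset.nodup_add] at this
      exact ⟨this.1, this.2.1⟩
    obtain ⟨ht₁, ht₂⟩ := h₅ z rfl (by
      rw [← hΓ, mem_chans_tctx]; exact hzn.2) hzn.1
    -- `z` has to be above the client channels of `y` that its provider takes over, and below `y`,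
    -- its client.
    refine ⟨extend τ z B, bump r z (2 * r y),
      (.proc z (P.at z) d₂, γ₁) ::ₘ {(.proc y (Q.at z) d₁, z ::ₘ γ₂)}, by simp, ?_,
      fun c hc => extend_ne fun h => hz (h ▸ hc)⟩
    refine Typed.replace_new (ta := {(.proc y (.cut (.lit d) (.lit d₂) P Q) d₁, γ)})
      (by simpa using H) (by simpa using hz) (by simp [Node.offer])
      (by simp [hγ]) ?_ ?_
    · intro b hb
      simp only [Multiset.mem_cons, Multiset.mem_singleton] at hb
      rcases hb with rfl | rfl
      · constructor
        · exact Multiset.nodup_cons.2 ⟨fun h => hz₁ _ h rfl, hnd.1⟩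
        · exact h₂
        · exact fun c hc => h₃ c (Ctx.mem_fst.1 hc)
        · intro c hc
          have : r c < r y := hok.rank c (hγ₁ c hc)
          simp only [Node.offer]
          rw [bump_self, bump_ne (hz₁ c hc)]
          omega
        · simp only [Node.offer, Node.term, Node.sec, extend_self]
          rw [tctx_congr fun c hc => extend_ne (hz₁ c hc), ← hΔ₁]
          exact ht₁
      · constructor
        · refine Multiset.nodup_cons.2 ⟨?_, Multiset.nodup_cons.2 ⟨fun h => hz₂ _ h rfl, hnd.2⟩⟩
          rw [Multiset.mem_cons, not_or]
          exact ⟨fun h => hzn.1 h.symm, fun h => hyγ (hγ₂ _ h)⟩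
        · exact hok.sec
        · intro c hc
          rcases Multiset.mem_cons.1 hc with rfl | hc
          · exact h₄
          · exact hok.lvl c (hγ₂ c hc)
        · intro c hc
          simp only [Node.offer]
          rw [bump_ne (Ne.symm hzn.1)]
          rcases Multiset.mem_cons.1 hc with rfl | hc
          · rw [bump_self]; omega
          · have : r c < r y := hok.rank c (hγ₂ c hc)
            rw [bump_ne (hz₂ c hc)]
            omega
        · simp only [Node.offer, Node.term, Node.sec, extend_ne (Ne.symm hzn.1)]
          rw [tctx_cons, extend_self, tctx_congr fun c hc => extend_ne (hz₂ c hc), ← hΔ₂]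
          exact ht₂
    · refine H.named.insert (z := z) ?_ ?_ ?_ ?_
      · intro c hc
        rw [TConfig.offers_cfg] at hc ⊢
        simpa [Node.offer, or_assoc] using hc
      · intro m hm
        simp only [TConfig.cfg_cons, Multiset.mem_cons, TConfig.cfg_add, Multiset.mem_add] at hm ⊢
        rcases hm with hm | hm
        · cases hm
        · exact .inr hm
      · intro c hc e
        rw [TConfig.offers_cfg] at hc
        exact absurd e (hname c hc)
      · intro c hc e
        rw [TConfig.offers_cfg] at hc
        exact absurd e.symm (hname c hc)

/-- A received channel is fresh for the receiving process. -/
theorem Typed.recv_fresh {m : Msg L} {n : Node L} {γm : Multiset (Chan L)}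
    (H : Typed τ r ((.msg m, γm) ::ₘ (n, γ) ::ₘ tR) w) {v : Chan L} (hv : v ∈ γm)
    (hm : m.offer ∈ γ) : v ∉ n.offer ::ₘ γ := by
  have h₁ : r v < r m.offer := (H.ok (.msg m, γm) (by simp)).rank v hv
  have h₂ : r m.offer < r n.offer := (H.ok (n, γ) (by simp)).rank _ hm
  rw [Multiset.mem_cons, not_or]
  refine ⟨by rintro rfl; omega, fun hvγ => ?_⟩
  have := (Multiset.nodup_cons.1 H.nodup_ctxs).2
  simp only [TConfig.ctxs_cons] at this
  exact Multiset.disjoint_left.1 (Multiset.nodup_add.1 this).2.2 hv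
    (Multiset.mem_add.2 (.inl hvγ))

/-- A positive message sits just below its receiver. The receiver takes over the client channels of
the message; levels and ranks are compared through the channel that the message offered. -/
theorem Typed.replace_recv_client {m : Msg L} {u : Chan L} {P P' : Proc L} {d d' : L}
    {γm γ' : Multiset (Chan L)}
    (H : Typed τ r ((.msg m, γm) ::ₘ (.proc u P d, m.offer ::ₘ γ') ::ₘ tR) w)
    (hc : m.carrier = m.offer) (hd : d' = d ⊔ m.carrier.lvl)
    (ht : PTyped (tctx τ (γm + γ')) P' d' u (τ u)) :
    Typed τ r ((.proc u P' d', γm + γ') ::ₘ tR) w := by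
  have hm := H.ok (.msg m, γm) (by simp)
  have hn := H.ok (.proc u P d, m.offer ::ₘ γ') (by simp)
  have hok : Ok τ r (.proc u P' d') (γm + γ') := by
    have hfr := fun v hv => H.recv_fresh (v := v) hv (by simp)
    have hnd := Multiset.nodup_cons.1 hn.nodup
    constructor
    · refine Multiset.nodup_cons.2 ⟨?_, Multiset.nodup_add.2
        ⟨(Multiset.nodup_cons.1 hm.nodup).2, (Multiset.nodup_cons.1 hnd.2).2, ?_⟩⟩
      · rw [Multiset.mem_add, not_or]
        exact ⟨fun h => hfr _ h (by simp [Node.offer]), fun h => hnd.1 (Multiset.mem_cons_of_mem h)⟩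
      · rw [Multiset.disjoint_left]
        exact fun h₁ h₂ => hfr _ h₁ (by simp [h₂])
    · simp only [Node.sec, Node.offer, hd, hc]
      exact sup_le hn.sec (hn.lvl _ (by simp))
    · intro c h
      rcases Multiset.mem_add.1 h with h | h
      · exact (hm.lvl c h).trans (hn.lvl _ (by simp [Node.offer]))
      · exact hn.lvl c (by simp [h])
    · intro c h
      rcases Multiset.mem_add.1 h with h | h
      · exact (hm.rank c h).trans (hn.rank _ (by simp [Node.offer]))
      · exact hn.rank c (by simp [h])
    · exact ht
  rw [← Multiset.singleton_add]
  refine Typed.replace_old (ta := (.msg m, γm) ::ₘ {(.proc u P d, m.offer ::ₘ γ')})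
    (by simpa using H) ?_ ?_ ?_ ?_
  · simp only [TConfig.offers_cons, TConfig.offers_singleton, TConfig.ctxs_cons,
      TConfig.ctxs_singleton, Node.offer]
    simp only [← Multiset.singleton_add]
    abel
  · simp only [TConfig.offers_cons, TConfig.offers_singleton, Node.offer]
    exact Multiset.le_cons_self _ _
  · simpa using hok
  · intro m' hm' hmem
    simp only [TConfig.cfg_cons, TConfig.cfg_singleton, Multiset.mem_cons,
      Multiset.mem_singleton, Node.msg.injEq, reduceCtorEq, or_false] at hm'
    subst hm'
    have := H.nodup
    simp only [TConfig.offers_cons] at this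
    apply (Multiset.nodup_cons.1 this).1
    rw [hc] at hmem
    simpa [Node.offer] using hmem

/-- A negative message sits just above its receiver. The receiver moves into the place of the
message, so its own client channels have to be compared with `m.offer` through `y`. -/
theorem Typed.replace_recv_provider {m : Msg L} {y v : Chan L} {P P' : Proc L} {d : L}
    {γm γ : Multiset (Chan L)}
    (H : Typed τ r ((.msg m, y ::ₘ γm) ::ₘ (.proc y P d, γ) ::ₘ tR) w)
    (hc : m.carrier = y) (hv : m.offer = v)
    (ht : PTyped (tctx τ (γm + γ)) P' y.lvl v (τ v)) :
    Typed τ r ((.proc v P' y.lvl, γm + γ) ::ₘ tR) w := by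
  subst hv
  have hm := H.ok (.msg m, y ::ₘ γm) (by simp)
  have hn := H.ok (.proc y P d, γ) (by simp)
  have hry : r y < r m.offer := hm.rank y (by simp)
  have hnd := Multiset.nodup_cons.1 hn.nodup
  have hmd := Multiset.nodup_cons.1 hm.nodup
  have hok : Ok τ r (.proc m.offer P' y.lvl) (γm + γ) := by
    have hdis := (Multiset.nodup_cons.1 H.nodup_ctxs).2
    simp only [TConfig.ctxs_cons] at hdis
    have hdis : ∀ c ∈ y ::ₘ γm, c ∉ γ + TConfig.ctxs tR := fun c =>
      Multiset.disjoint_left.1 (Multiset.nodup_add.1 hdis).2.2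
    constructor
    · refine Multiset.nodup_cons.2 ⟨?_, Multiset.nodup_add.2
        ⟨(Multiset.nodup_cons.1 hmd.2).2, hnd.2, ?_⟩⟩
      · rw [Multiset.mem_add, not_or]
        refine ⟨fun h => hmd.1 (by simp [Node.offer] at h ⊢; simp [h]), fun h => ?_⟩
        have : r m.offer < r y := hn.rank _ h
        omega
      · rw [Multiset.disjoint_left]
        exact fun h₁ h₂ => hdis _ (Multiset.mem_cons_of_mem h₁) (Multiset.mem_add.2 (.inl h₂))
    · exact hm.lvl y (by simp)
    · intro c h
      rcases Multiset.mem_add.1 h with h | h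
      · exact hm.lvl c (by simp [h])
      · exact (hn.lvl c h).trans (hm.lvl y (by simp))
    · intro c h
      rcases Multiset.mem_add.1 h with h | h
      · exact hm.rank c (by simp [h])
      · exact (hn.rank c h).trans hry
    · exact ht
  rw [← Multiset.singleton_add]
  refine Typed.replace_old (ta := (.msg m, y ::ₘ γm) ::ₘ {(.proc y P d, γ)})
    (by simpa using H) ?_ ?_ ?_ ?_
  · simp only [TConfig.offers_cons, TConfig.offers_singleton, TConfig.ctxs_cons,
      TConfig.ctxs_singleton, Node.offer]
    simp only [← Multiset.singleton_add]
    abel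
  · simp only [TConfig.offers_cons, TConfig.offers_singleton, Node.offer]
    rw [Multiset.singleton_le]
    simp
  · simpa using hok
  · intro m' hm' hmem
    simp only [TConfig.cfg_cons, TConfig.cfg_singleton, Multiset.mem_cons,
      Multiset.mem_singleton, Node.msg.injEq, reduceCtorEq, or_false] at hm'
    subst hm'
    have := H.nodup
    simp only [TConfig.offers_cons] at this
    have h₂ := (Multiset.nodup_cons.1 this).2
    rw [hc] at hmem
    simp only [TConfig.offers_add, TConfig.offers_singleton, Node.offer, Multiset.mem_add,
      Multiset.mem_singleton] at hmem
    rcases hmem with h | h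
    · rw [← h] at hry; omega
    · exact (Multiset.nodup_cons.1 h₂).1 h

theorem Red2.pres {m : Msg L} {n n' : Node L} {γm : Multiset (Chan L)} (h : Red2 m n n')
    (H : Typed τ r ((.msg m, γm) ::ₘ (n, γ) ::ₘ tR) w) :
    ∃ γ', Typed τ r ((n', γ') ::ₘ tR) w := by
  have hm := (H.ok (.msg m, γm) (by simp)).msgOk
  have hn := H.ok (n, γ) (by simp)
  have hnd := Multiset.nodup_cons.1 hn.nodup
  cases h with
  | oneRecv x y Q d =>
    have ht : PTyped (tctx τ γ) (.wait (.chan y) Q) d x (τ x) := hn.typ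
    obtain ⟨Δ, hΓ, ht'⟩ := ht.inv_wait
    obtain ⟨γ', rfl, hy, rfl⟩ := tctx_eq_cons hΓ
    obtain ⟨rfl, -⟩ := hm
    exact ⟨_, H.replace_recv_client (m := .close y) rfl rfl
      (by simpa [sup_comm, Msg.carrier] using ht')⟩
  | plusRecv u y v I k Q d hne =>
    have ht : PTyped (tctx τ γ) (.branch (.chan y) I Q) d u (τ u) := hn.typ
    rcases ht.inv_branch with ⟨e, -⟩ | ⟨Δ, A, hΓ, ht'⟩
    · exact absurd e.symm hne
    · obtain ⟨γ', rfl, hy, rfl⟩ := tctx_eq_cons hΓ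
      obtain ⟨rfl, hl, I', A', hk, hy', hv⟩ := hm
      rw [hy] at hy'
      obtain ⟨rfl, hA⟩ := Ty.plus.inj hy'
      obtain rfl := eq_of_heq hA
      have hfr := H.recv_fresh (v := v) (by simp) (by simp [Msg.offer])
      simp only [Node.offer, Multiset.mem_cons, not_or] at hfr
      have hyγ : y ∉ γ' := (Multiset.nodup_cons.1 hnd.2).1
      have hyu : u ≠ y := hne
      have := (ht' k).ren (a := y) (b := v) hl hfr.1 (by
        rw [Ctx.mem_chans_cons, mem_chans_tctx, not_or]; exact hfr.2)
      rw [Ctx.ren_cons, Ctx.ren_of_notMem (fun h => hyγ (mem_chans_tctx.1 h)), ren_self,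
        ren_of_ne hyu] at this
      refine ⟨_, H.replace_recv_client (m := .selPos y k v) rfl rfl ?_⟩
      rw [Multiset.singleton_add, tctx_cons, hv]
      simpa [sup_comm, Msg.carrier] using this
  | ampRecv y v I k Q d =>
    have ht : PTyped (tctx τ γ) (.branch (.chan y) I Q) d y (τ y) := hn.typ
    rcases ht.inv_branch with ⟨-, A, hy, ht'⟩ | ⟨Δ, A, hΓ, -⟩
    · have hry : r y < r v := (H.ok (.msg (.selNeg y k v), γm) (by simp)).rank y (by
        rw [hm.1]; simp)
      obtain ⟨rfl, hl, I', A', hk, hy', hv⟩ := hm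
      rw [hy] at hy'
      obtain ⟨rfl, hA⟩ := Ty.amp.inj hy'
      obtain rfl := eq_of_heq hA
      have hyγ : y ∉ γ := hnd.1
      have hvγ : v ∉ γ := fun h => by
        have : r v < r y := hn.rank v h
        omega
      have := (ht' k).ren (a := y) (b := v) hl (by rintro rfl; omega)
        (fun h => hvγ (mem_chans_tctx.1 h))
      rw [Ctx.ren_of_notMem (fun h => hyγ (mem_chans_tctx.1 h)), ren_self] at this
      refine ⟨_, Typed.replace_recv_provider (m := .selNeg y k v) (γm := 0) (by simpa using H)
        rfl rfl ?_⟩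
      rw [zero_add, hv]
      exact this
    · obtain ⟨γ', rfl, -, -⟩ := tctx_eq_cons hΓ
      exact absurd (by simp [Node.offer]) hnd.1
  | tensorRecv u x y v P d hne =>
    have ht : PTyped (tctx τ γ) (.recv (.chan y) P) d u (τ u) := hn.typ
    rcases ht.inv_recv with ⟨e, -⟩ | ⟨Δ, A, B, hΓ, ht'⟩
    · exact absurd e.symm hne
    · obtain ⟨γ', rfl, hy, rfl⟩ := tctx_eq_cons hΓ
      have hmd := (H.ok (.msg (.sendPos x y v), γm) (by simp)).nodup
      obtain ⟨rfl, hlx, hl, hy'⟩ := hm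
      rw [hy] at hy'
      obtain ⟨rfl, rfl⟩ := Ty.tensor.inj hy'
      have hfr := H.recv_fresh (v := v) (by simp) (by simp [Msg.offer])
      have hfx := H.recv_fresh (v := x) (by simp) (by simp [Msg.offer])
      simp only [Node.offer, Multiset.mem_cons, not_or] at hfr hfx
      have hxv : x ≠ v := by
        rintro rfl
        simp [Multiset.insert_eq_cons] at hmd
      have hyγ : y ∉ γ' := (Multiset.nodup_cons.1 hnd.2).1
      have hyu : u ≠ y := hne
      -- The typing of the body is instantiated with the received channel and then renamed to the
      -- next generation, whereas the step renames first; `Proc.map_inst` exchanges the two.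
      have := (ht' x hlx (fun h => hfx.2.2 (mem_chans_tctx.1 h)) hfx.2.1 hfx.1).ren
        (a := y) (b := v) hl hfr.1 (by
          rw [Ctx.mem_chans_cons, Ctx.mem_chans_cons, mem_chans_tctx, not_or, not_or]
          exact ⟨hxv.symm, hfr.2⟩)
      rw [Ctx.ren_cons, Ctx.ren_cons, Ctx.ren_of_notMem (fun h => hyγ (mem_chans_tctx.1 h)),
        ren_self, ren_of_ne hyu, ren_of_ne hfx.2.1, Proc.map_inst (ren_lvl hl),
        ren_of_ne hfx.2.1] at this
      refine ⟨_, H.replace_recv_client (m := .sendPos x y v) rfl rfl ?_⟩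
      simpa [sup_comm, Msg.carrier, Multiset.insert_eq_cons, Multiset.singleton_add,
        Multiset.cons_add] using this
  | lolliRecv x y v P d =>
    have ht : PTyped (tctx τ γ) (.recv (.chan y) P) d y (τ y) := hn.typ
    rcases ht.inv_recv with ⟨-, A, B, hy, ht'⟩ | ⟨Δ, A, B, hΓ, -⟩
    · have hmo := H.ok (.msg (.sendNeg x y v), γm) (by simp)
      have hry : r y < r v := hmo.rank y (by rw [hm.1]; simp)
      have hrx : r x < r v := hmo.rank x (by rw [hm.1]; simp)
      have hmd := hmo.nodup
      have hdis := (Multiset.nodup_cons.1 H.nodup_ctxs).2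
      obtain ⟨rfl, hlx, hl, hy'⟩ := hm
      rw [hy] at hy'
      obtain ⟨rfl, rfl⟩ := Ty.lolli.inj hy'
      have hyγ : y ∉ γ := hnd.1
      have hvγ : v ∉ γ := fun h => by
        have : r v < r y := hn.rank v h
        omega
      have hxγ : x ∉ γ := by
        simp only [TConfig.ctxs_cons] at hdis
        have this : ∀ c ∈ ({x, y} : Multiset (Chan L)), c ∉ γ + TConfig.ctxs tR := fun c =>
          Multiset.disjoint_left.1 (Multiset.nodup_add.1 hdis).2.2
        exact fun h => this x (by simp) (Multiset.mem_add.2 (.inl h))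
      have hxy : x ≠ y := by
        rintro rfl
        simp [Multiset.insert_eq_cons] at hmd
      have := (ht' x hlx (fun h => hxγ (mem_chans_tctx.1 h)) hxy).ren
        (a := y) (b := v) hl (by rintro rfl; omega) (by
          rw [Ctx.mem_chans_cons, mem_chans_tctx, not_or]
          exact ⟨by rintro rfl; omega, hvγ⟩)
      rw [Ctx.ren_cons, Ctx.ren_of_notMem (fun h => hyγ (mem_chans_tctx.1 h)),
        ren_self, ren_of_ne hxy, Proc.map_inst (ren_lvl hl), ren_of_ne hxy] at this
      refine ⟨_, Typed.replace_recv_provider (m := .sendNeg x y v) (γm := {x})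
        (by rwa [Multiset.pair_comm] at H) rfl rfl ?_⟩
      rw [Multiset.singleton_add, tctx_cons]
      exact this
    · obtain ⟨γ', rfl, -, -⟩ := tctx_eq_cons hΓ
      exact absurd (by simp [Node.offer]) hnd.1

end

end SecSess

/-! ### Forwarding, progress, and the absence of doomed processes -/

namespace SecSess

universe u

set_option linter.unusedSectionVars false

variable {L : Type u} [Lattice L]

variable {τ : Chan L → Ty} {r : Chan L → ℕ} {w : Chan L}

/-! ## Forwarding and preservation -/

theorem Ok.fwd_inv {y z x : Chan L} {d : L} {γ : Multiset (Chan L)}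
    (h : Ok τ r (.proc y (.fwd (.chan z) (.chan x)) d) γ) :
    z = y ∧ γ = {x} ∧ x.lvl = y.lvl ∧ τ x = τ y ∧ r x < r y := by
  obtain ⟨rfl, h₁, h₂⟩ := h.typ.inv_fwd
  obtain ⟨γ', rfl, h₃, h₄⟩ := tctx_eq_cons (h₁.trans (Multiset.cons_zero _).symm)
  have : γ' = 0 := by simpa [tctx] using h₄.symm
  subst this
  exact ⟨rfl, rfl, h₂, h₃, h.rank x (by simp)⟩

/-- A client of `y` becomes a client of `x`, which has the same type and level and a lower rank. The
ranks also show that a client of `y` cannot offer `x`, so `x` is fresh for it. -/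
theorem Ok.ren {n : Node L} {γ : Multiset (Chan L)} {x y : Chan L} (h : Ok τ r n γ)
    (hy : y ≠ n.offer) (hx : x ∉ γ) (hl : x.lvl = y.lvl) (hτ : τ x = τ y) (hr : r x < r y) :
    Ok τ r (n.map (ren y x)) (γ.map (ren y x)) := by
  by_cases hyγ : y ∈ γ
  · have hxo : x ≠ n.offer := by
      rintro rfl
      exact absurd (h.rank y hyγ) (by omega)
    have hτ' : ∀ c, τ (SecSess.ren y x c) = τ c := by
      intro c
      by_cases hc : c = y
      · subst hc; simpa using hτ
      · rw [ren_of_ne hc]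
    have ho : (n.map (SecSess.ren y x)).offer = n.offer := by
      rw [Node.offer_map, ren_of_ne hy.symm]
    constructor
    · rw [Node.offer_map, ← Multiset.map_cons]
      refine Multiset.Nodup.map_on ?_ h.nodup
      have hx' : x ∉ n.offer ::ₘ γ := by simp [hx, hxo]
      intro a ha b hb hab
      have ha' : a ≠ x := fun e => hx' (e ▸ ha)
      have hb' : b ≠ x := fun e => hx' (e ▸ hb)
      rw [ren_eq_swap (.inl ha'), ren_eq_swap (.inl hb')] at hab
      exact (Equiv.injective _) hab
    · rw [ho, Node.sec_map (ren_lvl hl)]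
      exact h.sec
    · intro c' hc'
      obtain ⟨c, hc, rfl⟩ := Multiset.mem_map.1 hc'
      rw [ho, ren_lvl hl c]
      exact h.lvl c hc
    · intro c' hc'
      obtain ⟨c, hc, rfl⟩ := Multiset.mem_map.1 hc'
      rw [ho]
      by_cases hcy : c = y
      · subst hcy
        rw [ren_self]
        exact hr.trans (h.rank _ hc)
      · rw [ren_of_ne hcy]
        exact h.rank c hc
    · have := h.typ.ren (a := y) (b := x) hl hxo (by rwa [mem_chans_tctx])
      rw [ren_tctx fun c _ => hτ' c] at this
      rw [Node.term_map, Node.sec_map (ren_lvl hl), Node.offer_map, hτ']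
      exact this
  · have hn : y ∉ n.chans := fun hc => by
      rcases Multiset.mem_cons.1 (h.mem_of_mem_chans hc) with e | e
      · exact hy e
      · exact hyγ e
    have hγ : γ.map (SecSess.ren y x) = γ := by
      conv_rhs => rw [← Multiset.map_id γ]
      exact Multiset.map_congr rfl fun c hc => ren_of_ne fun e => hyγ (e ▸ hc)
    rw [Node.map_ren_of_notMem hn, hγ]
    exact h

/-- Renaming of the channels of an annotated configuration. -/
def TConfig.map (f : Chan L → Chan L) (t : TConfig L) : TConfig L :=
  Multiset.map (fun a => (a.1.map f, a.2.map f)) t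

theorem TConfig.cfg_map (f : Chan L → Chan L) (t : TConfig L) :
    TConfig.cfg (TConfig.map f t) = Multiset.map (Node.map f) (TConfig.cfg t) := by
  simp [TConfig.cfg, TConfig.map]

theorem TConfig.offers_map (f : Chan L → Chan L) (t : TConfig L) :
    TConfig.offers (TConfig.map f t) = Multiset.map f (TConfig.offers t) := by
  simp [TConfig.offers, TConfig.map, Node.offer_map]

theorem TConfig.ctxs_map (f : Chan L → Chan L) (t : TConfig L) :
    TConfig.ctxs (TConfig.map f t) = Multiset.map f (TConfig.ctxs t) := by
  induction t using Multiset.induction_on with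
  | empty => rfl
  | cons a t ih =>
    have : TConfig.map f (a ::ₘ t) = (a.1.map f, a.2.map f) ::ₘ TConfig.map f t := by
      simp [TConfig.map]
    simp [this, ih]

/-- The forwarder takes `y` from the offers and `x` from the uses. The renaming restores the balance
by giving the client of `y`, or the role of the root, to `x`. -/
theorem Typed.fwd {x y : Chan L} {d : L} {γ : Multiset (Chan L)} {t : TConfig L}
    (H : Typed τ r ((.proc y (.fwd (.chan y) (.chan x)) d, γ) ::ₘ t) w) :
    Typed τ r (TConfig.map (ren y x) t) (ren y x w) := by
  obtain ⟨-, rfl, hl, hτ, hr⟩ := (H.ok _ (Multiset.mem_cons_self _ _)).fwd_inv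
  have hb := H.bal
  have hn := H.nodup
  have hc := H.nodup_ctxs
  simp only [TConfig.offers_cons, TConfig.ctxs_cons, Node.offer, Multiset.singleton_add] at hb hn hc
  have hy : y ∉ TConfig.offers t := (Multiset.nodup_cons.1 hn).1
  have hx : x ∉ TConfig.ctxs t := (Multiset.nodup_cons.1 (Multiset.nodup_cons.1 hc).2).1
  have ho : Multiset.map (ren y x) (TConfig.offers t) = TConfig.offers t := by
    conv_rhs => rw [← Multiset.map_id (TConfig.offers t)]
    exact Multiset.map_congr rfl fun c hc => ren_of_ne fun e => hy (e ▸ hc)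
  constructor
  · intro a' ha'
    obtain ⟨a, ha, rfl⟩ := Multiset.mem_map.1 ha'
    refine (H.ok a (Multiset.mem_cons_of_mem ha)).ren ?_ ?_ hl hτ hr
    · rintro rfl
      exact hy (TConfig.mem_offers_of_mem ha)
    · exact fun h => hx (TConfig.mem_ctxs.2 ⟨a, ha, h⟩)
  · rw [TConfig.offers_map, TConfig.ctxs_map]
    have := congrArg (Multiset.map (ren y x)) hb
    simp only [Multiset.map_cons, ren_self] at this
    rw [ren_of_ne (c := x) (by rintro rfl; omega), Multiset.cons_swap] at this
    exact (Multiset.cons_inj_right _).1 this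
  · rw [TConfig.offers_map, ho]
    exact (Multiset.nodup_cons.1 hn).2
  · by_cases h : w = y
    · subst h
      rw [ren_self, hτ, H.one]
    · rw [ren_of_ne h, H.one]
  · intro c hc c' hc' e₁ e₂ e₃
    rw [TConfig.offers_cfg, TConfig.offers_map, ho] at hc hc'
    obtain ⟨m, hm, rfl⟩ := H.named c (by simp [hc]) c' (by simp [hc']) e₁ e₂ e₃
    refine ⟨m.map (ren y x), ?_, ?_⟩
    · rw [TConfig.cfg_cons, Multiset.mem_cons] at hm
      rw [TConfig.cfg_map]
      exact Multiset.mem_map_of_mem _ (hm.resolve_left (by simp))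
    · rw [Msg.carrier_map, ren_of_ne]
      rintro e
      exact hy (e ▸ hc)

theorem Config.rename_of_notMem {D : Config L} {y x : Chan L} (h : y ∉ Config.chans D) :
    Config.rename D y x = D := by
  rw [Config.rename]
  conv_rhs => rw [← Multiset.map_id D]
  exact Multiset.map_congr rfl fun n hn => Node.map_ren_of_notMem fun hc => h ⟨n, hn, hc⟩

/-- Preservation for a step of a part `tD` of a closed configuration. By `hk`, a forwarder at a
channel that the rest uses is not executed, so the renaming of a forwarding step does not reach the
rest. -/
theorem Typed.step {tD tR : TConfig L} {D' : Config L} {used : Set ℕ} {keep : Set (Chan L)}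
    (H : Typed τ r (tD + tR) w) (hs : Step used keep (TConfig.cfg tD) D')
    (hu : Config.names (TConfig.cfg (tD + tR)) ⊆ used)
    (hk : ∀ c ∈ TConfig.ctxs tR, c ∈ TConfig.offers tD → c ∈ keep) :
    ∃ (τ' : Chan L → Ty) (r' : Chan L → ℕ) (w' : Chan L) (tD' : TConfig L),
      TConfig.cfg tD' = D' ∧ Typed τ' r' (tD' + tR) w' ∧
      (∀ c ∈ TConfig.offers (tD + tR), τ' c = τ c) ∧
      (w' = w ∨ w ∈ TConfig.offers tD ∧ w ∉ keep) := by
  rcases hs.inv with ⟨R, y, x, d, hy, h, rfl⟩ | ⟨n, b, R, hr, h, rfl⟩ | ⟨m, n, n', R, hr, h, rfl⟩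
  · obtain ⟨γ, s, rfl, rfl⟩ := TConfig.cfg_eq_cons h
    rw [Multiset.cons_add] at H
    have hyo : y ∉ TConfig.offers (s + tR) := by
      have := H.nodup
      rw [TConfig.offers_cons] at this
      exact (Multiset.nodup_cons.1 this).1
    have hyR : TConfig.map (ren y x) tR = tR := by
      rw [TConfig.map]
      conv_rhs => rw [← Multiset.map_id tR]
      refine Multiset.map_congr rfl fun a ha => ?_
      have hyc : y ∉ a.2 := fun h => hy (hk y (TConfig.mem_ctxs.2 ⟨a, ha, h⟩) (by simp [Node.offer]))
      have hyo' : y ≠ a.1.offer := by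
        rintro rfl
        exact hyo (TConfig.mem_offers_of_mem (Multiset.mem_add.2 (.inr ha)))
      ext1
      · refine Node.map_ren_of_notMem fun h => ?_
        rcases Multiset.mem_cons.1 ((H.ok a (by simp [ha])).mem_of_mem_chans h) with e | e
        · exact hyo' e
        · exact hyc e
      · simp only [id]
        conv_rhs => rw [← Multiset.map_id a.2]
        exact Multiset.map_congr rfl fun c hc => ren_of_ne fun e => hyc (e ▸ hc)
    refine ⟨τ, r, ren y x w, TConfig.map (ren y x) s, by rw [TConfig.cfg_map]; rfl, ?_,
      fun _ _ => rfl, ?_⟩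
    · have := H.fwd
      rw [TConfig.map, Multiset.map_add] at this
      rw [← hyR]
      exact this
    · by_cases h : w = y
      · subst h
        exact .inr ⟨by simp [Node.offer], hy⟩
      · exact .inl (ren_of_ne h)
  · obtain ⟨γ, s, rfl, rfl⟩ := TConfig.cfg_eq_cons h
    rw [Multiset.cons_add] at H hu
    obtain ⟨τ', r', tb, h₁, h₂, h₃⟩ := hr.pres H hu
    refine ⟨τ', r', w, tb + s, by simp [h₁], by rwa [add_assoc], ?_, .inl rfl⟩
    rwa [Multiset.cons_add]
  · obtain ⟨γm, s, rfl, h'⟩ := TConfig.cfg_eq_cons h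
    obtain ⟨γ, s, rfl, rfl⟩ := TConfig.cfg_eq_cons h'
    rw [Multiset.cons_add, Multiset.cons_add] at H
    obtain ⟨γ', h'⟩ := hr.pres H
    exact ⟨τ, r, w, (n', γ') ::ₘ s, by simp, by rwa [Multiset.cons_add], fun _ _ => rfl, .inl rfl⟩

/-! ## Progress -/

/-- The node is a receiver or a message, or forwards. -/
inductive Stuck (τ : Chan L → Ty) : Node L → Multiset (Chan L) → Prop
  | fwd (y x : Chan L) (d : L) (γ : Multiset (Chan L)) : Stuck τ (.proc y (.fwd y x) d) γ
  | up (n : Node L) (γ : Multiset (Chan L)) : n.CommRight n.offer → Stuck τ n γ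
  | down (n : Node L) (γ : Multiset (Chan L)) (c : Chan L) : c ∈ γ → n.CommLeft c → Stuck τ n γ

theorem Ok.progress {n : Node L} {γ : Multiset (Chan L)} {used : Set ℕ} (h : Ok τ r n γ)
    (hu : used.Finite) : (∃ b, Red1 used n b) ∨ Stuck τ n γ := by
  cases n with
  | msg m =>
    have hm := h.msgOk
    right
    by_cases hp : m.Positive
    · exact .up _ _ ⟨hp, (hm.pos hp).2⟩
    · exact .down _ _ _ (hm.neg hp).2 ⟨hp, rfl⟩
  | proc y P d =>
    have ht := h.typ
    simp only [Node.term, Node.sec, Node.offer] at ht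
    have hmem : ∀ {x : Chan L} {A : Ty} {Δ : Ctx L}, tctx τ γ = (x, A) ::ₘ Δ → x ∈ γ ∧ x ≠ y := by
      intro x A Δ e
      obtain ⟨γ', rfl, -, -⟩ := tctx_eq_cons e
      refine ⟨by simp, ?_⟩
      rintro rfl
      exact absurd h.nodup (by simp [Node.offer])
    generalize hΓ : tctx τ γ = Γ at ht
    generalize hA : τ y = A at ht
    cases ht with
    | plusR k h => exact .inl ⟨_, .plusSend _ _ _ _⟩
    | plusL h => exact .inr (.down _ _ _ (hmem hΓ).1 ⟨(hmem hΓ).2, .inl ⟨_, _, rfl⟩⟩)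
    | ampR h => exact .inr (.up _ _ ⟨rfl, .inl ⟨_, _, rfl⟩⟩)
    | ampL k hd h => exact .inl ⟨_, .ampSend _ _ _ _ _ (hmem hΓ).2⟩
    | tensorR hz h => exact .inl ⟨_, .tensorSend _ _ _ _⟩
    | tensorL h => exact .inr (.down _ _ _ (hmem hΓ).1 ⟨(hmem hΓ).2, .inr (.inl ⟨_, rfl⟩)⟩)
    | lolliR h => exact .inr (.up _ _ ⟨rfl, .inr (.inl ⟨_, rfl⟩)⟩)
    | lolliL hd hz h =>
      exact .inl ⟨_, .lolliSend _ _ _ _ _ (hmem (hΓ.trans (Multiset.cons_swap _ _ _))).2⟩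
    | oneR => exact .inl ⟨_, .oneSend _ _⟩
    | oneL h => exact .inr (.down _ _ _ (hmem hΓ).1 ⟨(hmem hΓ).2, .inr (.inr ⟨_, rfl⟩)⟩)
    | fwd h => exact .inr (.fwd _ _ _ _)
    | cut B h₁ h₂ h₃ h₄ h₅ h₆ =>
      obtain ⟨a, ha⟩ := hu.exists_notMem
      exact .inl ⟨_, .cut _ _ _ _ _ _ a ha⟩

theorem Ok.nodup_ne {n : Node L} {γ : Multiset (Chan L)} (h : Ok τ r n γ) {c : Chan L}
    (hc : c ∈ γ) : c ≠ n.offer := by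
  rintro rfl
  exact (Multiset.nodup_cons.1 h.nodup).1 hc

theorem mem_of_tctx_eq {γ : Multiset (Chan L)} {x : Chan L} {A : Ty} {Δ : Ctx L}
    (e : tctx τ γ = (x, A) ::ₘ Δ) : x ∈ γ ∧ τ x = A := by
  obtain ⟨γ', rfl, h, -⟩ := tctx_eq_cons e
  exact ⟨by simp, h⟩

theorem Ok.branch_left {y c : Chan L} {I : Finset ℕ} {Q : {ℓ // ℓ ∈ I} → Proc L} {d : L}
    {γ : Multiset (Chan L)} (h : Ok τ r (.proc y (.branch (.chan c) I Q) d) γ) (hc : c ≠ y) :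
    c ∈ γ ∧ ∃ A, τ c = .plus I A := by
  rcases h.typ.inv_branch with ⟨rfl, -⟩ | ⟨Δ, A, e, -⟩
  · exact absurd rfl hc
  · exact ⟨(mem_of_tctx_eq e).1, A, (mem_of_tctx_eq e).2⟩

theorem Ok.recv_left {y c : Chan L} {P : Proc L} {d : L}
    {γ : Multiset (Chan L)} (h : Ok τ r (.proc y (.recv (.chan c) P) d) γ) (hc : c ≠ y) :
    c ∈ γ ∧ ∃ A B, τ c = .tensor A B := by
  rcases h.typ.inv_recv with ⟨rfl, -⟩ | ⟨Δ, A, B, e, -⟩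
  · exact absurd rfl hc
  · exact ⟨(mem_of_tctx_eq e).1, A, B, (mem_of_tctx_eq e).2⟩

theorem Ok.wait_left {y c : Chan L} {P : Proc L} {d : L}
    {γ : Multiset (Chan L)} (h : Ok τ r (.proc y (.wait (.chan c) P) d) γ) :
    c ∈ γ ∧ τ c = .one := by
  obtain ⟨Δ, e, -⟩ := h.typ.inv_wait
  exact mem_of_tctx_eq e

theorem Ok.branch_right {y : Chan L} {I : Finset ℕ} {Q : {ℓ // ℓ ∈ I} → Proc L} {d : L}
    {γ : Multiset (Chan L)} (h : Ok τ r (.proc y (.branch (.chan y) I Q) d) γ) :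
    ∃ A, τ y = .amp I A := by
  rcases h.typ.inv_branch with ⟨-, A, e, -⟩ | ⟨Δ, A, e, -⟩
  · exact ⟨A, e⟩
  · exact absurd rfl (h.nodup_ne (mem_of_tctx_eq e).1)

theorem Ok.recv_right {y : Chan L} {P : Proc L} {d : L}
    {γ : Multiset (Chan L)} (h : Ok τ r (.proc y (.recv (.chan y) P) d) γ) :
    ∃ A B, τ y = .lolli A B := by
  rcases h.typ.inv_recv with ⟨-, A, B, e, -⟩ | ⟨Δ, A, B, e, -⟩
  · exact ⟨A, B, e⟩
  · exact absurd rfl (h.nodup_ne (mem_of_tctx_eq e).1)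

/-- A node that waits for its provider and a provider that waits for its client react. -/
theorem Ok.react {n p : Node L} {γ δ : Multiset (Chan L)} (hn : Ok τ r n γ) (hp : Ok τ r p δ)
    (h₁ : n.CommLeft p.offer) (h₂ : p.CommRight p.offer)
    (hf : ∀ y x d, p ≠ .proc y (.fwd (.chan y) (.chan x)) d) :
    ∃ m n', (n = .msg m ∧ Red2 m p n') ∨ (p = .msg m ∧ Red2 m n n') := by
  cases n with
  | msg m =>
    obtain ⟨hm, hc⟩ := h₁
    have hok := hn.msgOk
    -- The type of a channel has one polarity, so a positive and a negative message never meet. The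
    -- same argument below excludes the meeting of two receivers, and equality of types selects the
    -- rule that applies.
    have hneg := (hok.neg hm).1
    cases p with
    | msg m' =>
      have := (hp.msgOk.pos h₂.1).1
      rw [h₂.2, ← hc] at this
      exact absurd this hneg
    | proc y P d =>
      simp only [Node.offer] at hc
      subst hc
      obtain ⟨-, h₂⟩ := h₂
      simp only [Node.offer] at h₂
      rcases h₂ with ⟨I, Q, rfl⟩ | ⟨Q, rfl⟩ | ⟨x, rfl⟩
      · obtain ⟨A, hA⟩ := hp.branch_right
        cases m with
        | selNeg y k v =>
          obtain ⟨-, -, I', A', hk, h', -⟩ := hok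
          simp only [Msg.carrier] at hA
          rw [h'] at hA
          cases hA
          exact ⟨_, _, .inl ⟨rfl, .ampRecv y v I ⟨k, hk⟩ Q d⟩⟩
        | sendNeg x y v =>
          obtain ⟨-, -, -, h'⟩ := hok
          simp only [Msg.carrier] at hA
          rw [h'] at hA
          cases hA
        | _ => exact absurd trivial hm
      · obtain ⟨A, B, hA⟩ := hp.recv_right
        cases m with
        | selNeg y k v =>
          obtain ⟨-, -, I', A', hk, h', -⟩ := hok
          simp only [Msg.carrier] at hA
          rw [h'] at hA
          cases hA
        | sendNeg x y v => exact ⟨_, _, .inl ⟨rfl, .lolliRecv x y v Q d⟩⟩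
        | _ => exact absurd trivial hm
      · exact absurd rfl (hf _ _ _)
  | proc y P d =>
    obtain ⟨hne, h₁⟩ := h₁
    have hpos : (τ p.offer).Pos := by
      rcases h₁ with ⟨I, Q, rfl⟩ | ⟨Q, rfl⟩ | ⟨Q, rfl⟩
      · obtain ⟨-, A, h⟩ := hn.branch_left hne
        simp [h, Ty.Pos]
      · obtain ⟨-, A, B, h⟩ := hn.recv_left hne
        simp [h, Ty.Pos]
      · simp [hn.wait_left.2, Ty.Pos]
    cases p with
    | proc z R e =>
      exfalso
      obtain ⟨-, h₂⟩ := h₂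
      simp only [Node.offer] at h₂ hpos
      rcases h₂ with ⟨I, Q, rfl⟩ | ⟨Q, rfl⟩ | ⟨x, rfl⟩
      · obtain ⟨A, hA⟩ := hp.branch_right
        simp [hA, Ty.Pos] at hpos
      · obtain ⟨A, B, hA⟩ := hp.recv_right
        simp [hA, Ty.Pos] at hpos
      · exact absurd rfl (hf _ _ _)
    | msg m =>
      have hok := hp.msgOk
      obtain ⟨hm, -⟩ := h₂
      cases m with
      | close z =>
        have hz := hok.2
        rcases h₁ with ⟨I, Q, rfl⟩ | ⟨Q, rfl⟩ | ⟨Q, rfl⟩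
        · obtain ⟨-, A, h⟩ := hn.branch_left hne
          simp [Node.offer, Msg.offer, hz] at h
        · obtain ⟨-, A, B, h⟩ := hn.recv_left hne
          simp [Node.offer, Msg.offer, hz] at h
        · exact ⟨_, _, .inr ⟨rfl, .oneRecv y z Q d⟩⟩
      | selPos z k v =>
        obtain ⟨-, -, I', A', hk, hz, -⟩ := hok
        rcases h₁ with ⟨I, Q, rfl⟩ | ⟨Q, rfl⟩ | ⟨Q, rfl⟩
        · obtain ⟨-, A, h⟩ := hn.branch_left hne
          simp only [Node.offer, Msg.offer, hz] at h
          cases h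
          exact ⟨_, _, .inr ⟨rfl, .plusRecv y z v _ ⟨k, hk⟩ Q d (Ne.symm hne)⟩⟩
        · obtain ⟨-, A, B, h⟩ := hn.recv_left hne
          simp [Node.offer, Msg.offer, hz] at h
        · have h := hn.wait_left.2
          simp [Node.offer, Msg.offer, hz] at h
      | sendPos x z v =>
        obtain ⟨-, -, -, hz⟩ := hok
        rcases h₁ with ⟨I, Q, rfl⟩ | ⟨Q, rfl⟩ | ⟨Q, rfl⟩
        · obtain ⟨-, A, h⟩ := hn.branch_left hne
          simp [Node.offer, Msg.offer, hz] at h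
        · exact ⟨_, _, .inr ⟨rfl, .tensorRecv y x z v Q d (Ne.symm hne)⟩⟩
        · have h := hn.wait_left.2
          simp [Node.offer, Msg.offer, hz] at h
      | _ => exact absurd hm id

theorem exists_max_rank {t : TConfig L} (ht : t ≠ 0) (f : Node L × Multiset (Chan L) → ℕ) :
    ∃ a ∈ t, ∀ b ∈ t, f b ≤ f a := by
  classical
  obtain ⟨a, ha⟩ := Multiset.exists_mem_of_ne_zero ht
  obtain ⟨b, hb, h⟩ := t.toFinset.exists_max_image f ⟨a, Multiset.mem_toFinset.2 ha⟩
  exact ⟨b, Multiset.mem_toFinset.1 hb, fun c hc => h c (Multiset.mem_toFinset.2 hc)⟩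

theorem Step.of_cons_mem {used : Set ℕ} {keep : Set (Chan L)} {D : Config L} {m : Msg L}
    {n n' : Node L} (h : Red2 m n n') (hm : Node.msg m ∈ D) (hn : n ∈ D) (hne : n ≠ .msg m) :
    ∃ D', Step used keep D D' := by
  obtain ⟨D, rfl⟩ := Multiset.exists_cons_of_mem hm
  obtain ⟨D, rfl⟩ := Multiset.exists_cons_of_mem ((Multiset.mem_cons.1 hn).resolve_left hne)
  exact ⟨_, h.step D⟩

theorem Red2.proc_left {m m' : Msg L} {n' : Node L} (h : Red2 m (.msg m') n') : False := by
  cases h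

/-- An open configuration that cannot take a step attempts to communicate with its environment. -/
theorem progress {t : TConfig L} {δ l : Multiset (Chan L)} {used : Set ℕ} {keep : Set (Chan L)}
    (hok : ∀ a ∈ t, Ok τ r a.1 a.2) (hbal : δ + TConfig.offers t = l + TConfig.ctxs t)
    (hu : used.Finite) (hk : ∀ c ∈ keep, c ∈ l)
    (hs : ∀ D', ¬ Step used keep (TConfig.cfg t) D') (ht : t ≠ 0) :
    ∃ n ∈ TConfig.cfg t, (∃ c ∈ δ, n.CommLeft c) ∨ ∃ c ∈ l, n.CommRight c := by
  by_contra! hcon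
  have hmem : ∀ {a}, a ∈ t → a.1 ∈ TConfig.cfg t := fun {a} h => TConfig.mem_cfg.2 ⟨a.2, h⟩
  have hst : ∀ a ∈ t, Stuck τ a.1 a.2 := by
    intro a ha
    refine ((hok a ha).progress hu).resolve_left ?_
    rintro ⟨b, hb⟩
    obtain ⟨R, hR⟩ := Multiset.exists_cons_of_mem (hmem ha)
    exact hs _ (hR ▸ hb.step R)
  have hfwd : ∀ a ∈ t, ∀ y x d, a.1 = .proc y (.fwd (.chan y) (.chan x)) d → False := by
    intro a ha y x d e
    have h := hcon _ (hmem ha)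
    by_cases hy : y ∈ keep
    · refine h.2 y (hk y hy) ?_
      rw [e]
      exact ⟨rfl, .inr (.inr ⟨x, rfl⟩)⟩
    · obtain ⟨R, hR⟩ := Multiset.exists_cons_of_mem (hmem ha)
      rw [e] at hR
      exact hs _ (hR ▸ Step.fwd R y x d hy)
  have hup : ∀ a ∈ t, (∃ c ∈ a.2, a.1.CommLeft c) ∨ a.1.CommRight a.1.offer := by
    intro a ha
    have h := hst a ha
    have hoka := hok a ha
    obtain ⟨n, γ⟩ := a
    cases h with
    | fwd y x d γ =>
      exact (hfwd _ ha y x d rfl).elim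
    | up n γ h => exact .inr h
    | down n γ c hc h => exact .inl ⟨c, hc, h⟩
  -- No node waits for a provider inside the configuration: this provider has a lower rank, so by
  -- induction it waits for its client, and then the two react.
  have hdown : ∀ k, ∀ a ∈ t, r a.1.offer = k → ∀ c ∈ a.2, ¬ a.1.CommLeft c := by
    intro k
    induction k using Nat.strong_induction_on with
    | _ k ih =>
      rintro a ha rfl c hc hcl
      have hcδ : c ∉ δ := fun h => (hcon _ (hmem ha)).1 c h hcl
      have : c ∈ δ + TConfig.offers t := by
        rw [hbal]
        exact Multiset.mem_add.2 (.inr (TConfig.mem_ctxs.2 ⟨a, ha, hc⟩))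
      obtain ⟨p, hp, rfl⟩ := TConfig.mem_offers.1 ((Multiset.mem_add.1 this).resolve_left hcδ)
      have hpr : p.1.CommRight p.1.offer :=
        (hup p hp).resolve_left fun ⟨c', hc', h⟩ =>
          ih _ ((hok a ha).rank _ hc) p hp rfl c' hc' h
      obtain ⟨m, n', h⟩ := (hok a ha).react (hok p hp) hcl hpr fun y x d => hfwd p hp y x d
      rcases h with ⟨e, h⟩ | ⟨e, h⟩
      · obtain ⟨D', h'⟩ := Step.of_cons_mem (used := used) (keep := keep) h (e ▸ hmem ha) (hmem hp)
          (by intro e'; rw [e'] at h; exact h.proc_left)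
        exact hs D' h'
      · obtain ⟨D', h'⟩ := Step.of_cons_mem (used := used) (keep := keep) h (e ▸ hmem hp) (hmem ha)
          (by intro e'; rw [e'] at h; exact h.proc_left)
        exact hs D' h'
  -- A node of maximal rank has no client among the nodes, so its channel belongs to `l`, and it
  -- communicates there.
  obtain ⟨a, ha, hmax⟩ := exists_max_rank ht fun a => r a.1.offer
  have h : a.1.offer ∈ l + TConfig.ctxs t := by
    rw [← hbal]
    exact Multiset.mem_add.2 (.inr (TConfig.mem_offers_of_mem ha))
  rcases Multiset.mem_add.1 h with h | h
  · exact (hcon _ (hmem ha)).2 _ h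
      ((hup a ha).resolve_left fun ⟨c, hc, h⟩ => hdown _ a ha rfl c hc h)
  · obtain ⟨b, hb, hc⟩ := TConfig.mem_ctxs.1 h
    exact absurd ((hok b hb).rank _ hc) (not_lt.2 (hmax b hb))

/-- In a nonempty configuration, a node of maximal rank would offer a channel that nobody uses,
against the balance. -/
theorem eq_zero_of_bal {t : TConfig L} {δ : Multiset (Chan L)} (hok : ∀ a ∈ t, Ok τ r a.1 a.2)
    (hbal : δ + TConfig.offers t = TConfig.ctxs t) : t = 0 := by
  by_contra ht
  obtain ⟨a, ha, hmax⟩ := exists_max_rank ht fun a => r a.1.offer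
  have h : a.1.offer ∈ TConfig.ctxs t := by
    rw [← hbal]
    exact Multiset.mem_add.2 (.inr (TConfig.mem_offers_of_mem ha))
  obtain ⟨b, hb, hc⟩ := TConfig.mem_ctxs.1 h
  exact absurd ((hok b hb).rank _ hc) (not_lt.2 (hmax b hb))

/-- A closed configuration that cannot take a step is a single close message. -/
theorem Typed.normal {t : TConfig L} {used : Set ℕ} (H : Typed τ r t w) (hu : used.Finite)
    (hs : ∀ D', ¬ Step used ∅ (TConfig.cfg t) D') : TConfig.cfg t = {.msg (.close w)} := by
  have ht : t ≠ 0 := by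
    rintro rfl
    have := H.bal
    simp at this
  obtain ⟨n, hn, h⟩ := progress (δ := 0) (l := {w}) H.ok
    (by rw [zero_add, Multiset.singleton_add]; exact H.bal) hu (by simp) hs ht
  rcases h with ⟨c, hc, -⟩ | ⟨c, hc, h⟩
  · simp at hc
  obtain rfl : c = w := by simpa using hc
  obtain ⟨γ, hγ⟩ := TConfig.mem_cfg.1 hn
  have hok := H.ok _ hγ
  cases n with
  | proc y P d =>
    exfalso
    obtain ⟨rfl, ⟨I, Q, rfl⟩ | ⟨Q, rfl⟩ | ⟨x, rfl⟩⟩ := h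
    · obtain ⟨A, hA⟩ := hok.branch_right
      rw [H.one] at hA
      cases hA
    · obtain ⟨A, B, hA⟩ := hok.recv_right
      rw [H.one] at hA
      cases hA
    · obtain ⟨R, hR⟩ := Multiset.exists_cons_of_mem hn
      exact hs _ (hR ▸ Step.fwd R c x d (by simp))
  | msg m =>
    obtain ⟨hm, rfl⟩ := h
    have hm' := hok.msgOk
    have h1 := H.one
    cases m with
    | close y =>
      obtain ⟨rfl, -⟩ := hm'
      obtain ⟨t, rfl⟩ := Multiset.exists_cons_of_mem hγ
      have hb := H.bal
      simp only [TConfig.offers_cons, TConfig.ctxs_cons, zero_add, Node.offer, Msg.offer,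
        Msg.carrier] at hb
      have := eq_zero_of_bal (t := t) (δ := 0) (fun a ha => H.ok a (Multiset.mem_cons_of_mem ha))
        (by rw [zero_add]; exact (Multiset.cons_inj_right _).1 hb)
      simp [this, Msg.carrier]
    | selPos y k v =>
      obtain ⟨-, -, I, A, hk, h₁, -⟩ := hm'
      simp [Msg.carrier, h₁] at h1
    | sendPos x y v => simp [Msg.carrier, hm'.2.2.2] at h1
    | _ => exact absurd hm id

/-- No process of a closed configuration ends in empty branchings only. -/
theorem Typed.not_doomed {t : TConfig L} (H : Typed τ r t w) :
    ∀ n ∈ TConfig.cfg t, ¬ n.Doomed := by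
  induction hk : Config.size (TConfig.cfg t) using Nat.strong_induction_on generalizing τ r w t with
  | _ k ih =>
    subst hk
    -- A step keeps a doomed process alive and shrinks the configuration, so the claim is passed
    -- down to the normal form, a single close message.
    by_cases hs : ∃ D', Step (Config.names (TConfig.cfg t)) ∅ (TConfig.cfg t) D'
    · obtain ⟨D', hs⟩ := hs
      obtain ⟨τ', r', w', t', rfl, H', -⟩ := Typed.step (tR := 0) (by simpa using H) hs
        (by simp) (by simp)
      rw [add_zero] at H'
      intro n hn hd
      obtain ⟨n', hn', hd'⟩ := hs.doomed ⟨n, hn, hd⟩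
      exact ih _ hs.size_lt H' rfl n' hn' hd'
    · rw [H.normal (Config.names_finite _) (by simpa using hs)]
      simp [Node.Doomed]

end SecSess

/-! ### Closed configurations divided along an interface -/

namespace SecSess

universe u

set_option linter.unusedSectionVars false

variable {L : Type u} [Lattice L]

variable {τ : Chan L → Ty} {r : Chan L → ℕ} {w : Chan L}

/-! ## Well-typed closed configurations -/

/-- A well-typed closed configuration that offers the terminating channel `w`. -/
structure Wt (τ : Chan L → Ty) (r : Chan L → ℕ) (B : Config L) (w : Chan L) : Prop where
  ok : ∀ n ∈ B, Ok τ r n n.usesM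
  bal : Config.offers B = w ::ₘ Config.usesM B
  nodup : (Config.offers B).Nodup
  one : τ w = .one
  named : Named B
  alive : ∀ n ∈ B, ¬ n.Doomed

/-- The configuration whose nodes are annotated with the client channels that they mention. -/
noncomputable def Config.ann (B : Config L) : TConfig L := Multiset.map (fun n => (n, n.usesM)) B

@[simp] theorem Config.cfg_ann (B : Config L) : TConfig.cfg B.ann = B := by
  simp [TConfig.cfg, Config.ann]

@[simp] theorem Config.offers_ann (B : Config L) : TConfig.offers B.ann = Config.offers B := by
  rw [← TConfig.offers_cfg, Config.cfg_ann]

@[simp] theorem Config.ctxs_ann (B : Config L) : TConfig.ctxs B.ann = Config.usesM B := by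
  simp [TConfig.ctxs, Config.ann, Config.usesM]

@[simp] theorem Config.ann_add (B D : Config L) :
    Config.ann (B + D) = Config.ann B + Config.ann D := by simp [Config.ann]

theorem Config.ok_ann {B : Config L} (h : ∀ n ∈ B, Ok τ r n n.usesM) :
    ∀ a ∈ Config.ann B, Ok τ r a.1 a.2 := by
  intro a ha
  obtain ⟨n, hn, rfl⟩ := Multiset.mem_map.1 ha
  exact h n hn

theorem Typed.eq_ann {t : TConfig L} (H : Typed τ r t w) : t = (TConfig.cfg t).ann := by
  rw [TConfig.cfg, Config.ann, Multiset.map_map]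
  conv_lhs => rw [← Multiset.map_id t]
  refine Multiset.map_congr rfl fun a ha => ?_
  ext1
  · rfl
  · exact (H.ok a ha).eq_usesM (H.not_doomed _ (TConfig.mem_cfg.2 ⟨a.2, ha⟩))

theorem Typed.wt {t : TConfig L} (H : Typed τ r t w) : Wt τ r (TConfig.cfg t) w where
  ok n hn := by
    obtain ⟨γ, hγ⟩ := TConfig.mem_cfg.1 hn
    have := H.ok _ hγ
    rwa [this.eq_usesM (H.not_doomed n hn)] at this
  bal := by
    have := H.bal
    rw [H.eq_ann] at this
    simpa using this
  nodup := by simpa using H.nodup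
  one := H.one
  named := H.named
  alive := H.not_doomed

theorem Wt.typed {B : Config L} (H : Wt τ r B w) : Typed τ r B.ann w where
  ok := Config.ok_ann H.ok
  bal := by simpa using H.bal
  nodup := by simpa using H.nodup
  one := H.one
  named := by simpa using H.named

theorem Wt.mem_offers {B : Config L} (H : Wt τ r B w) {n : Node L} (hn : n ∈ B) {c : Chan L}
    (hc : c ∈ n.chans) : c ∈ Config.offers B := by
  by_cases h : c = n.offer
  · rw [h]; exact Config.mem_offers_of_mem hn
  · rw [H.bal]
    exact Multiset.mem_cons_of_mem (Config.mem_usesM.2 ⟨n, hn, Node.mem_usesM.2 ⟨hc, h⟩⟩)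

theorem Wt.nodup_uses {B : Config L} (H : Wt τ r B w) : (w ::ₘ Config.usesM B).Nodup :=
  H.bal ▸ H.nodup

theorem Wt.offer_inj {B : Config L} (H : Wt τ r B w) {n n' : Node L} (hn : n ∈ B) (hn' : n' ∈ B)
    (h : n.offer = n'.offer) : n = n' :=
  Multiset.inj_on_of_nodup_map H.nodup n hn n' hn' h

/-- The channels `δ` and those that `D` offers are the channels `l` and those that `D` uses. -/
def Bal (δ : Multiset (Chan L)) (D : Config L) (l : Multiset (Chan L)) : Prop :=
  δ + Config.offers D = l + Config.usesM D

theorem Bal.add {δ δ' l l' : Multiset (Chan L)} {D E : Config L} (h : Bal δ D l)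
    (h' : Bal δ' E l') : Bal (δ + δ') (D + E) (l + l') := by
  unfold Bal at *
  rw [Config.offers_add, Config.usesM_add]
  calc _ = (δ + Config.offers D) + (δ' + Config.offers E) := by abel
    _ = _ := by rw [h, h']; abel

/-- Channels may be passed from the left to the right. -/
theorem Bal.pass {δ l : Multiset (Chan L)} {D : Config L} (γ : Multiset (Chan L)) :
    Bal (δ + γ) D (l + γ) ↔ Bal δ D l := by
  unfold Bal
  rw [add_right_comm, add_right_comm l, add_left_inj]

theorem Wt.step {D R D' : Config L} {used : Set ℕ} {keep : Set (Chan L)}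
    (H : Wt τ r (D + R) w) (hs : Step used keep D D')
    (hu : Config.names (D + R) ⊆ used)
    (hk : ∀ c ∈ Config.usesM R, c ∈ Config.offers D → c ∈ keep) :
    ∃ (τ' : Chan L → Ty) (r' : Chan L → ℕ) (w' : Chan L), Wt τ' r' (D' + R) w' ∧
      (∀ c ∈ Config.offers (D + R), τ' c = τ c) ∧
      (w' = w ∨ w ∈ Config.offers D ∧ w ∉ keep) := by
  have hT := H.typed
  rw [Config.ann_add] at hT
  obtain ⟨τ', r', w', t, rfl, h₁, h₂, h₃⟩ := hT.step (by simpa using hs) (by simpa using hu)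
    (by simpa using hk)
  refine ⟨τ', r', w', ?_, by simpa using h₂, by simpa using h₃⟩
  simpa using h₁.wt

/-! ## Well-typed divided configurations -/

/-- The channels that the partial program provides. -/
def RIface.root (K : RIface L) (w : Chan L) : Multiset (Chan L) :=
  match K with
  | some p => {p.1}
  | none => {w}

/-- The channels that the closing configuration on the right provides. -/
def RIface.rest (K : RIface L) (w : Chan L) : Multiset (Chan L) :=
  match K with
  | some _ => {w}
  | none => 0

/-- A well-typed closed configuration, divided along the interface `Δ ⊩ K`. -/
structure St (τ : Chan L → Ty) (r : Chan L → ℕ) (Δ : Ctx L) (K : RIface L) (t : Triple L)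
    (w : Chan L) : Prop where
  wt : Wt τ r t.all w
  tyΔ : ∀ p ∈ Δ, τ p.1 = p.2
  tyK : ∀ p ∈ RIface.ctx K, τ p.1 = p.2
  balC : Bal 0 t.C (Ctx.fst Δ)
  balD : Bal (Ctx.fst Δ) t.D (RIface.root K w)

theorem RIface.fst_ctx_add_rest (K : RIface L) (w : Chan L) :
    Ctx.fst (RIface.ctx K) + {w} = RIface.root K w + RIface.rest K w := by
  cases K <;> simp [RIface.ctx, RIface.root, RIface.rest]

section St

variable {Δ : Ctx L} {K : RIface L} {t : Triple L}

/-- Obtained by subtracting the balances of `C` and `D` from that of the closed configuration; it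
need not be carried along as an invariant. -/
theorem St.balF (H : St τ r Δ K t w) : Bal (Ctx.fst (RIface.ctx K)) t.F (RIface.rest K w) := by
  classical
  have h := H.wt.bal
  have hC := H.balC
  have hD := H.balD
  have hK := RIface.fst_ctx_add_rest K w
  rw [Triple.all, ← Multiset.singleton_add] at h
  unfold Bal at *
  rw [Multiset.ext] at *
  intro c
  have h := h c
  have hC := hC c
  have hD := hD c
  have hK := hK c
  simp only [Config.offers_add, Config.usesM_add, Multiset.count_add, Multiset.count_zero] at *
  omega

theorem eq_zero_of_bal' {D : Config L} {δ : Multiset (Chan L)}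
    (hok : ∀ n ∈ D, Ok τ r n n.usesM) (h : Bal δ D 0) : D = 0 ∧ δ = 0 := by
  have := eq_zero_of_bal (t := D.ann) (δ := δ) (Config.ok_ann hok) (by simpa [Bal] using h)
  have h0 : D = 0 := by
    have h' := congrArg TConfig.cfg this
    simpa using h'
  subst h0
  simpa [Bal] using h

/-- This reduces typing of a part of a well-typed closed configuration to an equation of multisets,
besides the types of the boundary channels. -/
theorem CTyped.of_bal {D : Config L} {Δ Λ : Ctx L} (hok : ∀ n ∈ D, Ok τ r n n.usesM)
    (h : Bal (Ctx.fst Δ) D (Ctx.fst Λ)) (hΔ : ∀ p ∈ Δ, τ p.1 = p.2) (hΛ : ∀ p ∈ Λ, τ p.1 = p.2) :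
    CTyped Δ D Λ := by
  rw [eq_tctx_fst hΔ, eq_tctx_fst hΛ]
  simpa using CTyped.of_ok (t := D.ann) (Config.ok_ann hok) (by simpa [Bal] using h)

theorem St.F_eq_zero (H : St τ r Δ none t w) : t.F = 0 :=
  (eq_zero_of_bal' (fun n hn => H.wt.ok n (Multiset.mem_add.2 (.inr hn))) H.balF).1

/-- The context that the partial program provides. -/
def RIface.rootCtx (K : RIface L) (w : Chan L) : Ctx L :=
  match K with
  | some p => {p}
  | none => {(w, Ty.one)}

/-- The context that the closing configuration on the right provides. -/
def RIface.restCtx (K : RIface L) (w : Chan L) : Ctx L :=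
  match K with
  | some _ => {(w, Ty.one)}
  | none => 0

theorem RIface.fst_rootCtx (K : RIface L) (w : Chan L) :
    Ctx.fst (RIface.rootCtx K w) = RIface.root K w := by
  cases K <;> simp [RIface.rootCtx, RIface.root]

theorem RIface.fst_restCtx (K : RIface L) (w : Chan L) :
    Ctx.fst (RIface.restCtx K w) = RIface.rest K w := by
  cases K <;> simp [RIface.restCtx, RIface.rest]

theorem RIface.stands_rootCtx (K : RIface L) (w : Chan L) :
    RIface.Stands K (RIface.rootCtx K w) := by
  cases K with
  | some p => rfl
  | none => exact .inr ⟨w, rfl⟩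

theorem RIface.stands_restCtx (K : RIface L) (w : Chan L) :
    RIface.Stands none (RIface.restCtx K w) := by
  cases K with
  | some p => exact .inr ⟨w, rfl⟩
  | none => exact .inl rfl

theorem St.ok_C (H : St τ r Δ K t w) : ∀ n ∈ t.C, Ok τ r n n.usesM := fun n hn =>
  H.wt.ok n (by simp [Triple.all, hn])

theorem St.ok_D (H : St τ r Δ K t w) : ∀ n ∈ t.D, Ok τ r n n.usesM := fun n hn =>
  H.wt.ok n (by simp [Triple.all, hn])

theorem St.ok_F (H : St τ r Δ K t w) : ∀ n ∈ t.F, Ok τ r n n.usesM := fun n hn =>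
  H.wt.ok n (by simp [Triple.all, hn])

theorem St.ctyped_C (H : St τ r Δ K t w) : CTyped 0 t.C Δ :=
  .of_bal H.ok_C H.balC (by simp) H.tyΔ

theorem St.ctyped_D (H : St τ r Δ K t w) : CTyped Δ t.D (RIface.rootCtx K w) := by
  refine .of_bal H.ok_D (by rw [RIface.fst_rootCtx]; exact H.balD) H.tyΔ ?_
  have h := H.wt.one
  have h' := H.tyK
  cases K with
  | some p => simpa [RIface.rootCtx, RIface.ctx] using h'
  | none => simpa [RIface.rootCtx] using h

theorem St.ctyped_F (H : St τ r Δ K t w) :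
    CTyped (RIface.ctx K) t.F (RIface.restCtx K w) := by
  refine .of_bal H.ok_F (by rw [RIface.fst_restCtx]; exact H.balF) H.tyK ?_
  have h := H.wt.one
  cases K with
  | some p => simpa [RIface.restCtx] using h
  | none => simp [RIface.restCtx]

theorem St.tree (H : St τ r Δ K t w) : Tree Δ K t :=
  ⟨H.ctyped_C, ⟨_, K.stands_rootCtx w, H.ctyped_D⟩, ⟨_, K.stands_restCtx w, H.ctyped_F⟩⟩

theorem poised_of_bal {D : Config L} {Δ Λ : Ctx L} {used : Set ℕ} {keep : Set (Chan L)}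
    (hok : ∀ n ∈ D, Ok τ r n n.usesM) (h : Bal (Ctx.fst Δ) D (Ctx.fst Λ))
    (hu : used.Finite) (hk : ∀ c ∈ keep, c ∈ Ctx.fst Λ) (hs : ∀ D', ¬ Step used keep D D') :
    Poised used keep Δ D Λ := by
  refine ⟨hs, or_iff_not_imp_left.2 fun h0 => ?_⟩
  obtain ⟨n, hn, h⟩ := progress (t := D.ann) (δ := Ctx.fst Δ) (l := Ctx.fst Λ)
    (Config.ok_ann hok) (by simpa [Bal] using h) hu hk (by simpa using hs)
    (fun e => h0 (by simpa using congrArg TConfig.cfg e))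
  refine ⟨n, by simpa using hn, ?_⟩
  simpa only [Ctx.mem_fst] using h

/-- None of the three parts can take a step. -/
def Normal (Δ : Ctx L) (K : RIface L) (t : Triple L) : Prop := ∀ t', ¬ TStep Δ K t t'

theorem St.tpoised (H : St τ r Δ K t w) (hn : Normal Δ K t) : TPoised Δ K t := by
  have hf := Config.names_finite t.all
  refine ⟨?_, ⟨_, K.stands_rootCtx w, H.ctyped_D, ?_⟩, ⟨_, K.stands_restCtx w, H.ctyped_F, ?_⟩⟩
  · exact poised_of_bal H.ok_C H.balC hf (fun c => Ctx.mem_fst.2) fun C' h => hn _ (.left h)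
  · refine poised_of_bal H.ok_D (by rw [RIface.fst_rootCtx]; exact H.balD) hf ?_
      fun C' h => hn _ (.mid h)
    cases K <;> simp [RIface.ctx, RIface.rootCtx, Ctx.mem_chans_singleton, Ctx.notMem_chans_zero]
  · exact poised_of_bal H.ok_F (by rw [RIface.fst_restCtx]; exact H.balF) hf (by simp)
      fun C' h => hn _ (.right h)

theorem TStep.size_lt {t' : Triple L} (h : TStep Δ K t t') :
    Config.size t'.all < Config.size t.all := by
  cases h with
  | left h | mid h | right h =>
    have := h.size_lt
    simp only [Triple.all, Config.size_add]
    omega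

/-! ## Preservation for divided configurations -/

theorem St.mem_Δ (H : St τ r Δ K t w) {c : Chan L} (hc : c ∈ Ctx.fst Δ) :
    c ∈ Config.offers t.C := by
  have := H.balC
  rw [Bal, zero_add] at this
  rw [this]
  simp [hc]

theorem St.mem_root (H : St τ r Δ K t w) {c : Chan L} (hc : c ∈ RIface.root K w) :
    c ∈ Ctx.fst Δ + Config.offers t.D := by
  have := H.balD
  rw [Bal] at this
  rw [this]
  simp [hc]

theorem St.offers_all (t : Triple L) :
    Config.offers t.all = Config.offers t.C + Config.offers t.D + Config.offers t.F := by
  simp [Triple.all]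

theorem St.mem_K (H : St τ r Δ K t w) {c : Chan L} (hc : c ∈ Ctx.fst (RIface.ctx K)) :
    c ∈ Config.offers t.all := by
  have : c ∈ RIface.root K w := by cases K <;> simp_all [RIface.ctx, RIface.root]
  rw [St.offers_all]
  rcases Multiset.mem_add.1 (H.mem_root this) with h | h
  · simp [H.mem_Δ h]
  · simp [h]

theorem St.ty_congr (H : St τ r Δ K t w) {τ' : Chan L → Ty}
    (h : ∀ c ∈ Config.offers t.all, τ' c = τ c) :
    (∀ p ∈ Δ, τ' p.1 = p.2) ∧ ∀ p ∈ RIface.ctx K, τ' p.1 = p.2 := by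
  refine ⟨fun p hp => ?_, fun p hp => ?_⟩
  · rw [h, H.tyΔ p hp]
    rw [St.offers_all]
    have := H.mem_Δ (Ctx.mem_fst.2 ⟨p.2, hp⟩)
    simp [this]
  · rw [h _ (H.mem_K (Ctx.mem_fst.2 ⟨p.2, hp⟩)), H.tyK p hp]

/-- A linear channel is used only once. -/
theorem Wt.uses_disjoint {D E : Config L} (H : Wt τ r (D + E) w) {c : Chan L}
    (h : c ∈ Config.usesM D) (h' : c ∈ Config.usesM E) : False := by
  have := (Multiset.nodup_cons.1 H.nodup_uses).2
  rw [Config.usesM_add] at this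
  exact Multiset.disjoint_left.1 (Multiset.nodup_add.1 this).2.2 h h'

theorem Wt.offers_disjoint {D E : Config L} (H : Wt τ r (D + E) w) {c : Chan L}
    (h : c ∈ Config.offers D) (h' : c ∈ Config.offers E) : False := by
  have := H.nodup
  rw [Config.offers_add] at this
  exact Multiset.disjoint_left.1 (Multiset.nodup_add.1 this).2.2 h h'

theorem Wt.not_mem_uses_root {B : Config L} (H : Wt τ r B w) : w ∉ Config.usesM B :=
  (Multiset.nodup_cons.1 H.nodup_uses).1

/-- The balance of the part that takes a step. -/
theorem Bal.step {D D' R : Config L} {w' : Chan L} {τ' : Chan L → Ty} {r' : Chan L → ℕ}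
    {δ l : Multiset (Chan L)} (H : Wt τ r (D + R) w) (H' : Wt τ' r' (D' + R) w')
    (h : Bal δ D (l + {w})) : Bal δ D' (l + {w'}) := by
  classical
  have h₁ := H.bal
  have h₂ := H'.bal
  rw [← Multiset.singleton_add] at h₁ h₂
  unfold Bal at *
  rw [Multiset.ext] at *
  intro c
  have h₁ := h₁ c
  have h₂ := h₂ c
  have h := h c
  simp only [Config.offers_add, Config.usesM_add, Multiset.count_add] at *
  omega

theorem Bal.step_same {D D' R : Config L} {τ' : Chan L → Ty} {r' : Chan L → ℕ}
    {δ l : Multiset (Chan L)} (H : Wt τ r (D + R) w) (H' : Wt τ' r' (D' + R) w)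
    (h : Bal δ D l) : Bal δ D' l := by
  classical
  have h₁ := H.bal
  have h₂ := H'.bal
  rw [← Multiset.singleton_add] at h₁ h₂
  unfold Bal at *
  rw [Multiset.ext] at *
  intro c
  have h₁ := h₁ c
  have h₂ := h₂ c
  have h := h c
  simp only [Config.offers_add, Config.usesM_add, Multiset.count_add] at *
  omega

theorem St.uses_D_subset (H : St τ r Δ K t w) {c : Chan L} (hc : c ∈ Config.usesM t.D) :
    c ∈ Ctx.fst Δ + Config.offers t.D := by
  have := H.balD
  rw [Bal] at this
  rw [this]
  simp [hc]

theorem St.uses_F_subset (H : St τ r Δ K t w) {c : Chan L} (hc : c ∈ Config.usesM t.F) :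
    c ∈ Ctx.fst (RIface.ctx K) + Config.offers t.F := by
  have := H.balF
  rw [Bal] at this
  rw [this]
  simp [hc]

theorem St.uses_C_subset (H : St τ r Δ K t w) {c : Chan L} (hc : c ∈ Config.usesM t.C) :
    c ∈ Config.offers t.C := by
  have := H.balC
  rw [Bal, zero_add] at this
  rw [this]
  simp [hc]

/-- All parts belong to one closed configuration, so `Wt.step` applies once no interface channel can
be forwarded away. The channels of `C` and of `D` that other parts use are in `keep`, and `F` offers
nothing that the other parts use. -/
theorem St.step {t' : Triple L} (H : St τ r Δ K t w) (hs : TStep Δ K t t') :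
    ∃ (τ' : Chan L → Ty) (r' : Chan L → ℕ) (w' : Chan L), St τ' r' Δ K t' w' := by
  cases hs with
  | @left C D F C' h =>
    have hw := H.wt
    simp only [Triple.all, add_assoc] at hw
    have key : ∀ c ∈ Config.usesM (D + F), c ∈ Config.offers C → c ∈ Ctx.chans Δ := by
      intro c hc ho
      have hd := fun h => hw.offers_disjoint ho h
      have := H.balC
      rw [Bal, zero_add] at this
      rw [this, Multiset.mem_add, Ctx.mem_fst] at ho
      exact ho.resolve_right fun h => hw.uses_disjoint h hc
    obtain ⟨τ', r', w', h₁, h₂, h₃⟩ := hw.step h (by rw [add_assoc]) key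
    -- The root is used nowhere, so if `C` offered it, it would be a channel of `Δ`, and those are
    -- protected from forwarding.
    have hwC : w' = w := h₃.resolve_right fun ⟨ho, hk⟩ => by
      have := H.balC
      rw [Bal, zero_add] at this
      rw [this, Multiset.mem_add, Ctx.mem_fst] at ho
      exact hw.not_mem_uses_root (by rw [Config.usesM_add]; simp [ho.resolve_left hk])
    subst hwC
    have hty := H.ty_congr (τ' := τ') (by simpa only [Triple.all, add_assoc] using h₂)
    exact ⟨τ', r', w', by simpa only [Triple.all, add_assoc] using h₁, hty.1, hty.2,
      Bal.step_same hw h₁ H.balC, H.balD⟩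
  | @mid C D F D' h =>
    have hw := H.wt
    have e : ∀ X : Config L, C + X + F = X + (C + F) := fun X => by abel
    simp only [Triple.all, e] at hw
    have key : ∀ c ∈ Config.usesM (C + F), c ∈ Config.offers D → c ∈ Ctx.chans (RIface.ctx K) := by
      intro c hc ho
      rw [Config.usesM_add, Multiset.mem_add] at hc
      rcases hc with hc | hc
      · exact (hw.offers_disjoint ho (by simp [H.uses_C_subset hc])).elim
      · rcases Multiset.mem_add.1 (H.uses_F_subset hc) with h | h
        · exact Ctx.mem_fst.1 h
        · exact (hw.offers_disjoint ho (by simp [h])).elim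
    obtain ⟨τ', r', w', h₁, h₂, h₃⟩ := hw.step h (by rw [e]) key
    have hty := H.ty_congr (τ' := τ') (by simpa only [Triple.all, e] using h₂)
    have hb := H.balD
    refine ⟨τ', r', w', by simpa only [Triple.all, e] using h₁, hty.1, hty.2, H.balC, ?_⟩
    -- If there is no channel on the right, the program itself provides the root, and forwarding may
    -- then replace it.
    cases K with
    | none =>
      have := Bal.step (l := 0) hw h₁ (by rwa [zero_add])
      rwa [zero_add] at this
    | some p =>
      have hwC : w' = w := h₃.resolve_right fun ⟨ho, hk⟩ => by
        have : w ∈ Ctx.fst Δ + Config.offers D := Multiset.mem_add.2 (.inr ho)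
        rw [hb, Multiset.mem_add] at this
        rcases this with h | h
        · obtain rfl : w = p.1 := by simpa [RIface.root] using h
          exact hk (Ctx.mem_chans_singleton.2 rfl)
        · exact hw.not_mem_uses_root (by rw [Config.usesM_add]; simp [h])
      subst hwC
      exact Bal.step_same hw h₁ hb
  | @right C D F F' h =>
    have hw := H.wt
    have e : ∀ X : Config L, C + D + X = X + (C + D) := fun X => by abel
    simp only [Triple.all, e] at hw
    have key : ∀ c ∈ Config.usesM (C + D), c ∈ Config.offers F → c ∈ (∅ : Set (Chan L)) := by
      intro c hc ho
      exfalso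
      rw [Config.usesM_add, Multiset.mem_add] at hc
      refine hw.offers_disjoint ho ?_
      rw [Config.offers_add, Multiset.mem_add]
      rcases hc with hc | hc
      · exact .inl (H.uses_C_subset hc)
      · exact (Multiset.mem_add.1 (H.uses_D_subset hc)).imp H.mem_Δ id
    obtain ⟨τ', r', w', h₁, h₂, h₃⟩ := hw.step h (by rw [e]) key
    have hty := H.ty_congr (τ' := τ') (by simpa only [Triple.all, e] using h₂)
    refine ⟨τ', r', w', by simpa only [Triple.all, e] using h₁, hty.1, hty.2, H.balC, ?_⟩
    have hb := H.balD
    cases K with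
    | some p => exact hb
    | none =>
      have hF : F = 0 := H.F_eq_zero
      subst hF
      rcases h₃ with rfl | ⟨h, -⟩
      · exact hb
      · simp at h

end St

end SecSess

/-! ### Renaming of secret channels -/

namespace SecSess

universe u

set_option linter.unusedSectionVars false

variable {L : Type u} [Lattice L]

variable {τ : Chan L → Ty} {r : Chan L → ℕ} {w : Chan L} {ξ : L}

/-! ## Equality up to renaming of channels that are not observable -/

/-- A renaming that preserves levels and fixes the observable channels. -/
def Hides (ξ : L) (f : Chan L → Chan L) : Prop := LvlPres f ∧ ∀ c, c.lvl ≤ ξ → f c = c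

theorem Hides.obs_iff {f : Chan L → Chan L} (h : Hides ξ f) (c : Chan L) :
    (f c).lvl ≤ ξ ↔ c.lvl ≤ ξ := by rw [h.1 c]

theorem nodeEq_iff {n n' : Node L} :
    NodeEq ξ n n' ↔ ∃ π : Equiv.Perm (Chan L), Hides ξ π ∧ n' = n.map π := by
  simp only [NodeEq, Hides, LvlPres, and_assoc]

theorem Node.map_id' (n : Node L) : n.map (fun c => c) = n := by
  cases n <;> simp [Node.map, Proc.map_id', Msg.map_id']

theorem NodeEq.refl (n : Node L) : NodeEq ξ n n := by
  refine nodeEq_iff.2 ⟨Equiv.refl _, ⟨fun _ => rfl, fun _ _ => rfl⟩, ?_⟩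
  exact n.map_id'.symm

theorem Hides.symm {π : Equiv.Perm (Chan L)} (h : Hides ξ π) : Hides ξ π.symm := by
  refine ⟨fun c => ?_, fun c hc => ?_⟩
  · rw [← h.1, Equiv.apply_symm_apply]
  · rw [Equiv.symm_apply_eq, h.2 c hc]

theorem NodeEq.symm {n n' : Node L} (h : NodeEq ξ n n') : NodeEq ξ n' n := by
  obtain ⟨π, hπ, rfl⟩ := nodeEq_iff.1 h
  refine nodeEq_iff.2 ⟨π.symm, hπ.symm, ?_⟩
  rw [Node.map_map]
  conv_lhs => rw [← Node.map_id' n]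
  exact Node.map_congr fun c _ => by simp

theorem NodeEq.trans {n n' n'' : Node L} (h : NodeEq ξ n n') (h' : NodeEq ξ n' n'') :
    NodeEq ξ n n'' := by
  obtain ⟨π, hπ, rfl⟩ := nodeEq_iff.1 h
  obtain ⟨ρ, hρ, rfl⟩ := nodeEq_iff.1 h'
  refine nodeEq_iff.2 ⟨π.trans ρ, ⟨fun c => ?_, fun c hc => ?_⟩, ?_⟩
  · simp [hρ.1 _, hπ.1 c]
  · simp [hπ.2 c hc, hρ.2 c hc]
  · rw [Node.map_map]
    exact Node.map_congr fun c _ => by simp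

theorem Node.map_eq_self {f : Chan L → Chan L} {n : Node L} (h : ∀ c ∈ n.chans, f c = c) :
    n.map f = n := (Node.map_congr h).trans n.map_id'

theorem NodeEq.eq_of_obs {n n' : Node L} (h : NodeEq ξ n n') (hn : ∀ c ∈ n.chans, c.lvl ≤ ξ) :
    n' = n := by
  obtain ⟨π, hπ, rfl⟩ := nodeEq_iff.1 h
  exact Node.map_eq_self fun c hc => hπ.2 c (hn c hc)

theorem NodeEq.mem_chans {n n' : Node L} (h : NodeEq ξ n n') {c : Chan L} (hc : c ∈ n.chans)
    (hl : c.lvl ≤ ξ) : c ∈ n'.chans := by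
  obtain ⟨π, hπ, rfl⟩ := nodeEq_iff.1 h
  rw [Node.chans_map]
  exact ⟨c, hc, hπ.2 c hl⟩

theorem rel_nodeEq_symm {S S' : Config L} (h : Multiset.Rel (NodeEq ξ) S S') :
    Multiset.Rel (NodeEq ξ) S' S := by
  rw [← Multiset.rel_flip]
  exact h.mono fun a _ b _ h => h.symm

theorem rel_nodeEq_refl (S : Config L) : Multiset.Rel (NodeEq ξ) S S :=
  Multiset.rel_refl_of_refl_on fun n _ => NodeEq.refl n

theorem rel_mem_chans {S S' : Config L} (h : Multiset.Rel (NodeEq ξ) S S') {c : Chan L}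
    (hc : c ∈ Config.chans S) (hl : c.lvl ≤ ξ) : c ∈ Config.chans S' := by
  obtain ⟨n, hn, hc⟩ := hc
  obtain ⟨n', hn', h'⟩ := Multiset.exists_mem_of_rel_of_mem h hn
  exact ⟨n', hn', h'.mem_chans hc hl⟩

theorem rel_cons {S S' : Config L} {n : Node L} (h : Multiset.Rel (NodeEq ξ) (n ::ₘ S) S') :
    ∃ (π : Equiv.Perm (Chan L)) (S'' : Config L), Hides ξ π ∧ S' = n.map π ::ₘ S'' ∧
      Multiset.Rel (NodeEq ξ) S S'' := by
  obtain ⟨n', S'', h₁, h₂, rfl⟩ := Multiset.rel_cons_left.1 h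
  obtain ⟨π, hπ, rfl⟩ := nodeEq_iff.1 h₁
  exact ⟨π, S'', hπ, rfl, h₂⟩

theorem rel_map_perm {S : Config L} {π : Equiv.Perm (Chan L)} (h : Hides ξ π) :
    Multiset.Rel (NodeEq ξ) S (Multiset.map (Node.map π) S) := by
  rw [Multiset.rel_map_right]
  exact Multiset.rel_refl_of_refl_on fun n _ => nodeEq_iff.2 ⟨π, h, rfl⟩

/-- Redirection of one channel in a renaming. -/
theorem Hides.extend {π : Equiv.Perm (Chan L)} (h : Hides ξ π) {z₁ z₂ : Chan L}
    (hl : z₂.lvl = z₁.lvl) (hz : z₁.lvl ≤ ξ → z₂ = z₁) :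
    ∃ π' : Equiv.Perm (Chan L), Hides ξ π' ∧ π' z₁ = z₂ ∧
      ∀ c, c ≠ z₁ → π c ≠ z₂ → π' c = π c := by
  classical
  refine ⟨π.trans (Equiv.swap (π z₁) z₂), ⟨fun c => ?_, fun c hc => ?_⟩, by simp, ?_⟩
  · have := swap_lvl (y := π z₁) (x := z₂) (by rw [h.1, hl]) (π c)
    simpa [h.1 c] using this
  · simp only [Equiv.trans_apply, h.2 c hc]
    by_cases ho : z₁.lvl ≤ ξ
    · rw [hz ho, h.2 z₁ ho]
      simp
    · refine Equiv.swap_apply_of_ne_of_ne ?_ ?_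
      · rintro rfl
        exact ho ((h.obs_iff z₁).1 hc)
      · rintro rfl
        exact ho (hl ▸ hc)
  · intro c h₁ h₂
    simp only [Equiv.trans_apply]
    exact Equiv.swap_apply_of_ne_of_ne (fun e => h₁ (π.injective e)) h₂

/-! ## Reductions under renamings -/

theorem Proc.map_ren_map {π : Equiv.Perm (Chan L)} (P : Proc L) (y v : Chan L) :
    (P.map (ren y v)).map π = (P.map π).map (ren (π y) (π v)) := by
  rw [Proc.map_map, Proc.map_map]
  refine Proc.map_congr fun c _ => ?_
  by_cases h : c = y
  · subst h; simp
  · simp [ren_of_ne h, ren_of_ne fun e => h (π.injective e)]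

theorem Red2.map {π : Equiv.Perm (Chan L)} (hπ : LvlPres π) {m : Msg L} {n n' : Node L}
    (h : Red2 m n n') : Red2 (m.map π) (n.map π) (n'.map π) := by
  cases h with
  | oneRecv x y Q d =>
    have := Red2.oneRecv (π x) (π y) (Q.map π) d
    rwa [hπ y] at this
  | plusRecv u y v I k Q d h =>
    have := Red2.plusRecv (π u) (π y) (π v) I k (fun k => (Q k).map π) d fun e => h (π.injective e)
    rw [hπ y, ← Proc.map_ren_map] at this
    exact this
  | ampRecv y v I k Q d =>
    have := Red2.ampRecv (π y) (π v) I k (fun k => (Q k).map π) d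
    rw [hπ y, ← Proc.map_ren_map] at this
    exact this
  | tensorRecv u x y v P d h =>
    have := Red2.tensorRecv (π u) (π x) (π y) (π v) (P.map π) d fun e => h (π.injective e)
    rw [hπ y, ← Proc.map_ren_map, Proc.at, ← Proc.map_inst hπ] at this
    exact this
  | lolliRecv x y v P d =>
    have := Red2.lolliRecv (π x) (π y) (π v) (P.map π) d
    rw [hπ y, ← Proc.map_ren_map, Proc.at, ← Proc.map_inst hπ] at this
    exact this

theorem Proc.map_send {π π' : Equiv.Perm (Chan L)} {P : Proc L} {y z z' : Chan L}
    (hz : π' z = z') (h : ∀ c ∈ P.chans, π' c = π c) :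
    (P.map π).map (ren (π y) z') = (P.map (ren y z)).map π' := by
  rw [Proc.map_map, Proc.map_map]
  refine Proc.map_congr fun c hc => ?_
  by_cases hy : c = y
  · subst hy; simp [hz]
  · simp [ren_of_ne hy, ren_of_ne fun e => hy (π.injective e), h c hc]

/-- A process and its renaming take matching steps. -/
theorem Red1.map {used used' : Set ℕ} (hu : used.Finite) (hu' : used'.Finite)
    {π : Equiv.Perm (Chan L)} (hπ : Hides ξ π) {n : Node L} {b : Config L} (h : Red1 used n b)
    (hn : ∀ c ∈ n.chans, c.name ∈ used) (hn' : ∀ c ∈ (n.map π).chans, c.name ∈ used')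
    (hf : ∀ b z, Red1 used n b → Config.offers b = z ::ₘ {n.offer} → z ∉ n.chans)
    (hf' : ∀ b z, Red1 used' (n.map π) b → Config.offers b = z ::ₘ {(n.map π).offer} →
      z ∉ (n.map π).chans) :
    ∃ (b₁ : Config L) (π' : Equiv.Perm (Chan L)), Hides ξ π' ∧ Red1 used n b₁ ∧
      Red1 used' (n.map π) (Multiset.map (Node.map π') b₁) := by
  have hch : ∀ c, c ∈ n.chans → π c ∈ (n.map π).chans := fun c hc => by
    rw [Node.chans_map]; exact ⟨c, hc, rfl⟩
  -- The renaming is redirected so that it takes the new channel of one run to that of the other. As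
  -- both are fresh, it keeps its values on the old channels.
  have send : ∀ z z' : Chan L, z ∉ n.chans → z' ∉ (n.map π).chans → z'.lvl = z.lvl →
      (z.lvl ≤ ξ → z' = z) → ∃ π' : Equiv.Perm (Chan L), Hides ξ π' ∧ π' z = z' ∧
        ∀ c ∈ n.chans, π' c = π c := by
    intro z z' hz hz' hl ho
    obtain ⟨π', h₁, h₂, h₃⟩ := hπ.extend hl ho
    exact ⟨π', h₁, h₂, fun c hc => h₃ c (by rintro rfl; exact hz hc)
      (by rintro rfl; exact hz' (hch c hc))⟩
  -- An observable channel is fixed by `π`, so its next generation is the same in both runs.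
  have next : ∀ y : Chan L, (π y).next.lvl = y.next.lvl ∧ (y.next.lvl ≤ ξ → (π y).next = y.next) :=
    fun y => ⟨hπ.1 y, fun h => by rw [hπ.2 y h]⟩
  cases h with
  | cut y P Q d d₁ d₂ a ha =>
    -- The spawned channel may be observable, and then both runs have to call it the same. So a name
    -- is taken that is new in both; for this reason the result `b₁` may differ from the given `b`.
    obtain ⟨a, ha⟩ := (hu.union hu').exists_notMem
    simp only [Set.mem_union, not_or] at ha
    have h₁ := Red1.cut y P Q d d₁ d₂ a ha.1
    have h₂ := Red1.cut (π y) (P.map π) (Q.map π) d d₁ d₂ a ha.2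
    obtain ⟨π', k₁, k₂, k₃⟩ := send ⟨a, 0, d⟩ ⟨a, 0, d⟩ (fun h => ha.1 (hn _ h))
      (fun h => ha.2 (hn' _ h)) rfl fun _ => rfl
    refine ⟨_, π', k₁, h₁, ?_⟩
    have e₁ : P.map π' = P.map π := Proc.map_congr fun c hc => k₃ c (by simp [Node.chans, Proc.chans, hc])
    have e₂ : Q.map π' = Q.map π := Proc.map_congr fun c hc => k₃ c (by simp [Node.chans, Proc.chans, hc])
    have e₃ : π' y = π y := k₃ y (by simp [Node.chans])
    simp only [Multiset.map_cons, Multiset.map_singleton, Node.map, Proc.at, Proc.map_inst k₁.1,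
      e₁, e₂, e₃, k₂]
    exact h₂
  | oneSend y d => exact ⟨_, π, hπ, .oneSend y d, .oneSend (π y) d⟩
  | plusSend y k P d =>
    have h₁ := Red1.plusSend (used := used) y k P d
    have h₂ := Red1.plusSend (used := used') (π y) k (P.map π) d
    obtain ⟨π', k₁, k₂, k₃⟩ := send y.next (π y).next
      (hf _ _ h₁ (by simp [Node.offer, Msg.offer])) (hf' _ _ h₂ (by simp [Node.offer, Msg.offer, Node.map]))
      (next y).1 (next y).2
    refine ⟨_, π', k₁, h₁, ?_⟩
    have e₃ : π' y = π y := k₃ y (by simp [Node.chans])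
    simp only [Multiset.map_cons, Multiset.map_singleton, Node.map, Msg.map, e₃, k₂]
    rw [← Proc.map_send k₂ fun c hc => k₃ c (by simp [Node.chans, Proc.chans, hc])]
    exact h₂
  | ampSend x y k P d h =>
    have h₁ := Red1.ampSend (used := used) x y k P d h
    have h₂ := Red1.ampSend (used := used') (π x) (π y) k (P.map π) d fun e => h (π.injective e)
    obtain ⟨π', k₁, k₂, k₃⟩ := send x.next (π x).next
      (hf _ _ h₁ (by simp [Node.offer, Msg.offer])) (hf' _ _ h₂ (by simp [Node.offer, Msg.offer, Node.map]))
      (next x).1 (next x).2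
    refine ⟨_, π', k₁, h₁, ?_⟩
    have e₃ : π' y = π y := k₃ y (by simp [Node.chans])
    have e₄ : π' x = π x := k₃ x (by simp [Node.chans, Proc.chans, Ref.chans])
    simp only [Multiset.map_cons, Multiset.map_singleton, Node.map, Msg.map, e₃, e₄, k₂]
    rw [← Proc.map_send k₂ fun c hc => k₃ c (by simp [Node.chans, Proc.chans, hc])]
    exact h₂
  | tensorSend x y P d =>
    have h₁ := Red1.tensorSend (used := used) x y P d
    have h₂ := Red1.tensorSend (used := used') (π x) (π y) (P.map π) d
    obtain ⟨π', k₁, k₂, k₃⟩ := send y.next (π y).next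
      (hf _ _ h₁ (by simp [Node.offer, Msg.offer])) (hf' _ _ h₂ (by simp [Node.offer, Msg.offer, Node.map]))
      (next y).1 (next y).2
    refine ⟨_, π', k₁, h₁, ?_⟩
    have e₃ : π' y = π y := k₃ y (by simp [Node.chans])
    have e₄ : π' x = π x := k₃ x (by simp [Node.chans, Proc.chans, Ref.chans])
    simp only [Multiset.map_cons, Multiset.map_singleton, Node.map, Msg.map, e₃, e₄, k₂]
    rw [← Proc.map_send k₂ fun c hc => k₃ c (by simp [Node.chans, Proc.chans, hc])]
    exact h₂
  | lolliSend x y z P d h =>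
    have h₁ := Red1.lolliSend (used := used) x y z P d h
    have h₂ := Red1.lolliSend (used := used') (π x) (π y) (π z) (P.map π) d
      fun e => h (π.injective e)
    obtain ⟨π', k₁, k₂, k₃⟩ := send z.next (π z).next
      (hf _ _ h₁ (by simp [Node.offer, Msg.offer])) (hf' _ _ h₂ (by simp [Node.offer, Msg.offer, Node.map]))
      (next z).1 (next z).2
    refine ⟨_, π', k₁, h₁, ?_⟩
    have e₃ : π' y = π y := k₃ y (by simp [Node.chans])
    have e₄ : π' x = π x := k₃ x (by simp [Node.chans, Proc.chans, Ref.chans])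
    have e₅ : π' z = π z := k₃ z (by simp [Node.chans, Proc.chans, Ref.chans])
    simp only [Multiset.map_cons, Multiset.map_singleton, Node.map, Msg.map, e₃, e₄, e₅, k₂]
    rw [← Proc.map_send k₂ fun c hc => k₃ c (by simp [Node.chans, Proc.chans, hc])]
    exact h₂

end SecSess

/-! ### Secrecy of the results of reductions, and the partition seen by an observer -/

namespace SecSess

universe u

set_option linter.unusedSectionVars false

variable {L : Type u} [Lattice L]

variable {τ : Chan L → Ty} {r : Chan L → ℕ} {w : Chan L} {ξ : L}

/-! ## Facts about reductions of well-typed nodes -/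

/-- What the observer may know about the result `b` of a reduction of `n`; `Z` are the new
channels. -/
structure Red1.Facts (B : Config L) (n : Node L) (b : Config L) (Z : Set (Chan L)) : Prop where
  sub : ∀ n' ∈ b, n'.chans ⊆ n.chans ∪ Z
  fresh : ∀ z ∈ Z, z ∉ Config.offers B
  proc : ∀ y P d, Node.proc y P d ∈ b → n.sec ≤ d
  msg : ∀ m, Node.msg m ∈ b →
    n.sec ≤ m.carrier.lvl ∧ ∀ c ∈ (Node.msg m).chans, c.lvl = m.carrier.lvl

theorem Proc.chans_ren_subset (P : Proc L) (y z : Chan L) :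
    (P.map (ren y z)).chans ⊆ P.chans ∪ {z} := by
  rw [Proc.chans_map]
  rintro _ ⟨c, hc, rfl⟩
  by_cases h : c = y
  · subst h; simp
  · rw [ren_of_ne h]; exact .inl hc

theorem Red1.chans_subset {used : Set ℕ} {n : Node L} {b : Config L} (h : Red1 used n b) :
    ∃ Z : Set (Chan L), (∀ n' ∈ b, n'.chans ⊆ n.chans ∪ Z) ∧
      ∀ z ∈ Z, Config.offers b = z ::ₘ {n.offer} := by
  have send : ∀ (y z : Chan L) (P : Proc L) (s : Set (Chan L)), P.chans ⊆ s →
      (P.map (ren y z)).chans ⊆ s ∪ {z} := fun y z P s hs =>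
    (Proc.chans_ren_subset P y z).trans (Set.union_subset_union_left _ hs)
  have inst : ∀ (z : Chan L) (P : Proc L) (s : Set (Chan L)), P.chans ⊆ s →
      (P.at z).chans ⊆ s ∪ {z} := fun z P s hs c hc => by
    rcases Proc.chans_inst_subset _ _ _ hc with h | h
    · exact .inr h
    · exact .inl (hs h)
  cases h with
  | cut y P Q d d₁ d₂ a ha =>
    refine ⟨{⟨a, 0, d⟩}, ?_, by simp [Node.offer]⟩
    simp only [Multiset.mem_cons, Multiset.mem_singleton, forall_eq_or_imp, forall_eq]
    refine ⟨Set.union_subset (by simp) (inst _ _ _ fun c hc => by simp [Node.chans, Proc.chans, hc]),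
      Set.union_subset (by simp [Node.chans]) (inst _ _ _ fun c hc => by simp [Node.chans, Proc.chans, hc])⟩
  | oneSend y d => exact ⟨∅, by simp [Node.chans, Proc.chans, Msg.toProc, Ref.chans], by simp⟩
  | plusSend y k P d =>
    refine ⟨{y.next}, ?_, by simp [Node.offer, Msg.offer]⟩
    simp only [Multiset.mem_cons, Multiset.mem_singleton, forall_eq_or_imp, forall_eq]
    refine ⟨Set.union_subset (by simp) (send _ _ _ _ fun c hc => by simp [Node.chans, Proc.chans, hc]), ?_⟩
    intro c
    simp only [Node.chans, Proc.chans, Msg.toProc, Ref.chans, Set.mem_union, Set.mem_singleton_iff]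
    tauto
  | ampSend x y k P d h =>
    refine ⟨{x.next}, ?_, by simp [Node.offer, Msg.offer]⟩
    simp only [Multiset.mem_cons, Multiset.mem_singleton, forall_eq_or_imp, forall_eq]
    refine ⟨?_, Set.union_subset (by simp [Node.chans]) (send _ _ _ _ fun c hc => by simp [Node.chans, Proc.chans, hc])⟩
    intro c
    simp only [Node.chans, Proc.chans, Msg.toProc, Ref.chans, Set.mem_union, Set.mem_singleton_iff]
    tauto
  | tensorSend x y P d =>
    refine ⟨{y.next}, ?_, by simp [Node.offer, Msg.offer]⟩
    simp only [Multiset.mem_cons, Multiset.mem_singleton, forall_eq_or_imp, forall_eq]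
    refine ⟨Set.union_subset (by simp) (send _ _ _ _ fun c hc => by simp [Node.chans, Proc.chans, hc]), ?_⟩
    intro c
    simp only [Node.chans, Proc.chans, Msg.toProc, Ref.chans, Set.mem_union, Set.mem_singleton_iff]
    tauto
  | lolliSend x y z P d h =>
    refine ⟨{z.next}, ?_, by simp [Node.offer, Msg.offer]⟩
    simp only [Multiset.mem_cons, Multiset.mem_singleton, forall_eq_or_imp, forall_eq]
    refine ⟨?_, Set.union_subset (by simp [Node.chans]) (send _ _ _ _ fun c hc => by simp [Node.chans, Proc.chans, hc])⟩
    intro c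
    simp only [Node.chans, Proc.chans, Msg.toProc, Ref.chans, Set.mem_union, Set.mem_singleton_iff]
    tauto

/-- The flow conditions of the type system enter here: a spawned process runs at least as high as
its parent, a client may send along `x` only if `d ≤ x.lvl`, and a provider runs below the level of
its channel. -/
theorem Red1.sec_le {used : Set ℕ} {n : Node L} {b : Config L} (h : Red1 used n b)
    {γ : Multiset (Chan L)} (hok : Ok τ r n γ) :
    (∀ y P d, Node.proc y P d ∈ b → n.sec ≤ d) ∧
      ∀ m, Node.msg m ∈ b → n.sec ≤ m.carrier.lvl := by
  have hs := hok.sec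
  cases h with
  | cut y P Q d d₁ d₂ a ha =>
    obtain ⟨-, -, -, -, h, -⟩ := hok.typ.inv_cut
    simp [Node.sec, or_imp, forall_and]
    exact ⟨by rintro _ _ _ - - rfl; exact h, by rintro _ _ _ - - rfl; exact le_rfl⟩
  | oneSend y d => simpa [Node.sec, Node.offer, Msg.carrier] using hs
  | plusSend y k P d =>
    simp [Node.sec, Msg.carrier]
    exact ⟨by rintro _ _ _ - - rfl; exact le_rfl, hs⟩
  | tensorSend x y P d =>
    simp [Node.sec, Msg.carrier]
    exact ⟨by rintro _ _ _ - - rfl; exact le_rfl, hs⟩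
  | ampSend x y k P d h =>
    rcases hok.typ.inv_sel with ⟨e, -⟩ | ⟨-, -, -, -, -, h', -⟩
    · exact absurd e h
    · simp [Node.sec, Msg.carrier]
      exact ⟨by rintro _ _ _ - - rfl; exact le_rfl, h'⟩
  | lolliSend x y z P d h =>
    rcases hok.typ.inv_send with ⟨e, -⟩ | ⟨-, -, -, -, h', -⟩
    · exact absurd e h
    · simp [Node.sec, Msg.carrier]
      exact ⟨by rintro _ _ _ - - rfl; exact le_rfl, h'⟩

/-- By preservation the result has no double offers, and it offers `n.offer` again along with the
channels of `R`; so `z` is none of these. The individual rules need not be inspected. -/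
theorem Wt.red1_fresh {used : Set ℕ} {n : Node L} {b R : Config L} (H : Wt τ r (n ::ₘ R) w)
    (hu : Config.names (n ::ₘ R) ⊆ used) (h : Red1 used n b) {z : Chan L}
    (hz : Config.offers b = z ::ₘ {n.offer}) : z ∉ Config.offers (n ::ₘ R) := by
  obtain ⟨τ', r', w', H', -⟩ := Wt.step (D := {n}) (R := R) (keep := Set.univ)
    (by simpa using H) (by simpa using h.step 0) (by simpa using hu) (by simp)
  have := H'.nodup
  rw [Config.offers_add, hz] at this
  simp only [Multiset.cons_add, Multiset.nodup_cons, Multiset.mem_cons, Multiset.mem_add,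
    Multiset.mem_singleton, Config.offers_cons] at this ⊢
  exact this.1

theorem Wt.red1 {used : Set ℕ} {n : Node L} {b R : Config L} (H : Wt τ r (n ::ₘ R) w)
    (hu : Config.names (n ::ₘ R) ⊆ used) (h : Red1 used n b) :
    ∃ Z, Red1.Facts (n ::ₘ R) n b Z := by
  obtain ⟨Z, h₁, h₂⟩ := h.chans_subset
  obtain ⟨h₃, h₄⟩ := h.sec_le (H.ok n (by simp))
  obtain ⟨τ', r', w', H', -⟩ := Wt.step (D := {n}) (R := R) (keep := Set.univ)
    (by simpa using H) (by simpa using h.step 0) (by simpa using hu) (by simp)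
  exact ⟨Z, h₁, fun z hz => H.red1_fresh hu h (h₂ z hz), h₃, fun m hm => ⟨h₄ m hm,
    fun c hc => (H'.ok _ (Multiset.mem_add.2 (.inl hm))).msgOk.lvl_eq hc⟩⟩

/-- The node is a process that receives along the channel. -/
def Node.Waits : Node L → Chan L → Prop
  | .proc _ P _, c => (∃ I Q, P = .branch (.chan c) I Q) ∨ (∃ Q, P = .recv (.chan c) Q) ∨
      ∃ Q, P = .wait (.chan c) Q
  | .msg _, _ => False

theorem Node.Waits.unique {n : Node L} {c c' : Chan L} (h : n.Waits c) (h' : n.Waits c') :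
    c = c' := by
  cases n with
  | msg m => exact h.elim
  | proc y P d =>
    rcases h with ⟨I, Q, rfl⟩ | ⟨Q, rfl⟩ | ⟨Q, rfl⟩ <;>
      rcases h' with ⟨I', Q', h⟩ | ⟨Q', h⟩ | ⟨Q', h⟩ <;> cases h <;> rfl

theorem Node.Waits.mem {n : Node L} {c : Chan L} (h : n.Waits c) : c ∈ n.chans := by
  cases n with
  | msg m => exact h.elim
  | proc y P d =>
    rcases h with ⟨I, Q, rfl⟩ | ⟨Q, rfl⟩ | ⟨Q, rfl⟩ <;> simp [Node.chans, Proc.chans, Ref.chans]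

theorem Node.Waits.map {n : Node L} {c : Chan L} (h : n.Waits c) (f : Chan L → Chan L) :
    (n.map f).Waits (f c) := by
  cases n with
  | msg m => exact h.elim
  | proc y P d =>
    rcases h with ⟨I, Q, rfl⟩ | ⟨Q, rfl⟩ | ⟨Q, rfl⟩
    · exact .inl ⟨I, fun k => (Q k).map f, rfl⟩
    · exact .inr (.inl ⟨Q.map f, rfl⟩)
    · exact .inr (.inr ⟨Q.map f, rfl⟩)

theorem Red1.not_waits {used : Set ℕ} {n : Node L} {b : Config L} (h : Red1 used n b)
    {c : Chan L} : ¬ n.Waits c := by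
  cases h <;> simp [Node.Waits]

theorem Red2.waits {m : Msg L} {n n' : Node L} (h : Red2 m n n') : n.Waits m.carrier := by
  cases h with
  | oneRecv x y Q d => exact .inr (.inr ⟨_, rfl⟩)
  | plusRecv u y v I k Q d h => exact .inl ⟨_, _, rfl⟩
  | ampRecv y v I k Q d => exact .inl ⟨_, _, rfl⟩
  | tensorRecv u x y v P d h => exact .inr (.inl ⟨_, rfl⟩)
  | lolliRecv x y v P d => exact .inr (.inl ⟨_, rfl⟩)

theorem Red2.chans_subset {m : Msg L} {n n' : Node L} (h : Red2 m n n') :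
    n'.chans ⊆ n.chans ∪ (Node.msg m).chans := by
  have ren' : ∀ (y z : Chan L) (P : Proc L) (s : Set (Chan L)), P.chans ⊆ s → z ∈ s →
      (P.map (ren y z)).chans ⊆ s := fun y z P s hs hz =>
    (Proc.chans_ren_subset P y z).trans (Set.union_subset hs (by simpa using hz))
  have inst : ∀ (z : Chan L) (P : Proc L) (s : Set (Chan L)), P.chans ⊆ s → z ∈ s →
      (P.at z).chans ⊆ s := fun z P s hs hz c hc => by
    rcases Proc.chans_inst_subset _ _ _ hc with h | h
    · exact h ▸ hz
    · exact hs h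
  cases h with
  | oneRecv x y Q d =>
    intro c
    simp only [Node.chans, Proc.chans, Msg.toProc, Ref.chans, Set.mem_union, Set.mem_singleton_iff]
    tauto
  | plusRecv u y v I k Q d h =>
    refine Set.union_subset (by simp [Node.chans]) (ren' _ _ _ _ ?_ ?_)
    · intro c hc
      simp only [Node.chans, Proc.chans, Set.mem_union, Set.mem_iUnion]
      exact .inl (.inr (.inr ⟨k, hc⟩))
    · simp [Node.chans, Proc.chans, Msg.toProc, Ref.chans]
  | ampRecv y v I k Q d =>
    refine Set.union_subset (by simp [Node.chans, Proc.chans, Msg.toProc, Ref.chans])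
      (ren' _ _ _ _ ?_ ?_)
    · intro c hc
      simp only [Node.chans, Proc.chans, Set.mem_union, Set.mem_iUnion]
      exact .inl (.inr (.inr ⟨k, hc⟩))
    · simp [Node.chans, Proc.chans, Msg.toProc, Ref.chans]
  | tensorRecv u x y v P d h =>
    refine Set.union_subset (by simp [Node.chans]) (inst _ _ _ (ren' _ _ _ _ ?_ ?_) ?_)
    · intro c hc
      simp [Node.chans, Proc.chans, hc]
    all_goals simp [Node.chans, Proc.chans, Msg.toProc, Ref.chans]
  | lolliRecv x y v P d =>
    refine Set.union_subset (by simp [Node.chans, Proc.chans, Msg.toProc, Ref.chans])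
      (inst _ _ _ (ren' _ _ _ _ ?_ ?_) ?_)
    · intro c hc
      simp [Node.chans, Proc.chans, hc]
    all_goals simp [Node.chans, Proc.chans, Msg.toProc, Ref.chans]

theorem Red2.sec {m : Msg L} {n n' : Node L} (h : Red2 m n n') :
    (∃ y P d, n = .proc y P d) ∧ ∃ y P d, n' = .proc y P d ∧
      (m.Positive → d = n.sec ⊔ m.carrier.lvl) ∧
      (¬ m.Positive → m.carrier = n.offer ∧ d = m.carrier.lvl) := by
  cases h <;> exact ⟨⟨_, _, _, rfl⟩, _, _, _, rfl, by simp [Msg.Positive, Node.sec, Msg.carrier, Node.offer]⟩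

theorem Red2.carrier_eq {m : Msg L} {n n' : Node L} (h : Red2 m n n') :
    m.Positive → m.carrier = m.offer := by
  cases h <;> simp [Msg.Positive, Msg.carrier, Msg.offer]

/-! ## The observable and the secret part of a configuration -/

/-- A process with observable running secrecy or an observable message. -/
def Node.Low (ξ : L) : Node L → Prop
  | .proc _ _ d => d ≤ ξ
  | .msg m => m.carrier.lvl ≤ ξ

/-- A process that has a secret running secrecy or waits along a secret channel. -/
def Node.High (ξ : L) : Node L → Prop
  | .proc y P d => ¬ d ≤ ξ ∨ ∃ c, ¬ c.lvl ≤ ξ ∧ Node.Waits (.proc y P d) c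
  | .msg _ => False

/-- Invariants of a partition of a configuration with observable interface channels `I` into nodes
`S` that agree with those of another run, secret nodes `W` that may share channels with `S`, and
nodes `U` that are not connected to `S`. -/
structure Side (ξ : L) (I : Set (Chan L)) (S W U : Config L) : Prop where
  low : ∀ n ∈ S, n.Low ξ
  high : ∀ n ∈ W, n.High ξ ∨ ∃ m, n = .msg m ∧ m.Positive ∧ m.offer.lvl ≤ ξ ∧ m.offer ∉ I ∧
    m.offer ∉ Config.chans S ∧ m.offer ∉ Config.chans U
  unrel : ∀ c ∈ Config.chans U, c.lvl ≤ ξ → c ∉ I ∧ c ∉ Config.chans S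

/-- Old channels separate the three groups as before. The channels `Z` are new to the interface and
to the partition, so they could connect the new `S` and `U` only by being observable and occurring
in both, which `hZ'` excludes. -/
theorem Side.update {I Z : Set (Chan L)} {S W U S' W' U' : Config L} (h : Side ξ I S W U)
    (hl : ∀ n ∈ S', n.Low ξ) (hW : ∀ n ∈ W', n.High ξ ∨ n ∈ W)
    (hS : ∀ c ∈ Config.chans S', c.lvl ≤ ξ → c ∈ Config.chans S ∨ c ∈ Z)
    (hU : ∀ c ∈ Config.chans U', c.lvl ≤ ξ → c ∈ Config.chans U ∨ c ∈ Z)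
    (hZ : ∀ c ∈ Z, c ∉ I ∧ c ∉ Config.chans S ∧ c ∉ Config.chans W ∧ c ∉ Config.chans U)
    (hZ' : ∀ c ∈ Z, c ∈ Config.chans S' → c ∈ Config.chans U' → ¬ c.lvl ≤ ξ) :
    Side ξ I S' W' U' where
  low := hl
  high n hn := by
    rcases hW n hn with h' | h'
    · exact .inl h'
    · rcases h.high n h' with h'' | ⟨m, rfl, h₁, h₂, h₃, h₄, h₅⟩
      · exact .inl h''
      · have hm : m.offer ∉ Z := fun hz => (hZ _ hz).2.2.1 ⟨_, h', m.offer_mem⟩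
        exact .inr ⟨m, rfl, h₁, h₂, h₃, fun hc => (hS _ hc h₂).elim h₄ hm,
          fun hc => (hU _ hc h₂).elim h₅ hm⟩
  unrel c hc hl := by
    rcases hU c hc hl with h' | h'
    · refine ⟨(h.unrel c h' hl).1, fun hs => ?_⟩
      rcases hS c hs hl with h'' | h''
      · exact (h.unrel c h' hl).2 h''
      · exact (hZ c h'').2.2.2 h'
    · exact ⟨(hZ c h').1, fun hs => hZ' c h' hs hc hl⟩

/-- Nodes are sorted by what the observer may see of them. -/
theorem exists_sort (ξ : L) (b : Config L) : ∃ bS bW bU : Config L, b = bS + bW + bU ∧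
    (∀ n ∈ bS, n.Low ξ) ∧ (∀ n ∈ bW, ¬ n.Low ξ ∧ ∃ y P d, n = .proc y P d) ∧
    ∀ n ∈ bU, ¬ n.Low ξ ∧ ∃ m, n = .msg m := by
  induction b using Multiset.induction_on with
  | empty => exact ⟨0, 0, 0, by simp, by simp, by simp, by simp⟩
  | cons n b ih =>
    obtain ⟨bS, bW, bU, rfl, h₁, h₂, h₃⟩ := ih
    by_cases hn : n.Low ξ
    · exact ⟨n ::ₘ bS, bW, bU, by simp, by simpa using ⟨hn, h₁⟩, h₂, h₃⟩
    · cases n with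
      | proc y P d =>
        exact ⟨bS, .proc y P d ::ₘ bW, bU, by simp, h₁, by simpa using ⟨hn, h₂⟩, h₃⟩
      | msg m =>
        exact ⟨bS, bW, .msg m ::ₘ bU, by simp, h₁, h₂, by simpa using ⟨hn, h₃⟩⟩

theorem Node.low_map {f : Chan L → Chan L} (hf : LvlPres f) (n : Node L) :
    (n.map f).Low ξ ↔ n.Low ξ := by
  cases n <;> simp [Node.map, Node.Low, Msg.carrier_map, hf _]

theorem Node.High.map {f : Chan L → Chan L} (hf : LvlPres f) {n : Node L} (h : n.High ξ) :
    (n.map f).High ξ := by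
  cases n with
  | msg m => exact h.elim
  | proc y P d =>
    rcases h with h | ⟨c, h, h'⟩
    · exact .inl h
    · exact .inr ⟨f c, by rwa [hf c], h'.map f⟩

theorem Node.high_of_not_low {n : Node L} (h : ¬ n.Low ξ) (h' : ∃ y P d, n = .proc y P d) :
    n.High ξ := by
  obtain ⟨y, P, d, rfl⟩ := h'
  exact .inl h

/-- The new nodes of a reduction, sorted. -/
theorem Side.red1 {I : Set (Chan L)} {S W U bS bW bU B b : Config L} {n : Node L}
    {Z : Set (Chan L)} (h : Side ξ I S W U) (hf : Red1.Facts B n b Z)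
    (hB : ∀ n ∈ S + W + U, ∀ c ∈ n.chans, c ∈ Config.offers B)
    (hI : ∀ c ∈ I, c ∈ Config.offers B) (hb : b = bS + bW + bU)
    (h₁ : ∀ n ∈ bS, n.Low ξ) (h₂ : ∀ n ∈ bW, ¬ n.Low ξ ∧ ∃ y P d, n = .proc y P d)
    (h₃ : ∀ n ∈ bU, ¬ n.Low ξ ∧ ∃ m, n = .msg m) :
    (n ∈ S ∨ bS = 0) → ∀ S' W' U', (∀ n ∈ S', n ∈ S) → (∀ n ∈ W', n ∈ W) → (∀ n ∈ U', n ∈ U) →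
      Side ξ I (bS + S') (bW + W') (bU + U') := by
  intro hn S' W' U' hS' hW' hU'
  have hout : ∀ {X : Config L}, (∀ n ∈ X, n ∈ S + W + U) → ∀ c ∈ Z, c ∉ Config.chans X := by
    rintro X hX c hc ⟨n', hn', hc'⟩
    exact hf.fresh c hc (hB n' (hX n' hn') c hc')
  -- A message has one level, and those in `bU` have a secret carrier, so they mention no observable
  -- channel at all and are safe in `U`.
  have hbU : ∀ c ∈ Config.chans bU, ¬ c.lvl ≤ ξ := by
    rintro c ⟨n', hn', hc⟩
    obtain ⟨hl, m, rfl⟩ := h₃ n' hn'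
    rw [(hf.msg m (by rw [hb]; simp [hn'])).2 c hc]
    exact hl
  refine h.update (Z := Z) ?_ ?_ ?_ ?_ ?_ ?_
  · intro n' hn'
    exact (Multiset.mem_add.1 hn').elim (h₁ n') fun h' => h.low n' (hS' n' h')
  · intro n' hn'
    exact (Multiset.mem_add.1 hn').imp (fun h => Node.high_of_not_low (h₂ n' h).1 (h₂ n' h).2)
      (hW' n')
  · rintro c ⟨n', hn', hc⟩ -
    rcases Multiset.mem_add.1 hn' with h' | h'
    · have hnS : n ∈ S := hn.resolve_right (by rintro rfl; simp at h')
      exact (hf.sub n' (by rw [hb]; simp [h']) hc).imp (fun h => ⟨n, hnS, h⟩) id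
    · exact .inl ⟨n', hS' n' h', hc⟩
  · rintro c ⟨n', hn', hc⟩ hl
    rcases Multiset.mem_add.1 hn' with h' | h'
    · exact absurd hl (hbU c ⟨n', h', hc⟩)
    · exact .inl ⟨n', hU' n' h', hc⟩
  · intro c hc
    exact ⟨fun h => hf.fresh c hc (hI c h), hout (fun n hn => by simp [hn]) c hc,
      hout (fun n hn => by simp [hn]) c hc, hout (fun n hn => by simp [hn]) c hc⟩
  · rintro c hc - ⟨n', hn', hc'⟩
    rcases Multiset.mem_add.1 hn' with h' | h'
    · exact hbU c ⟨n', h', hc'⟩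
    · exact (hout (fun n hn => by simp [hU' n hn]) c hc ⟨n', h', hc'⟩).elim

end SecSess

/-! ### Simulation of sends, cuts and receives -/

namespace SecSess

universe u

set_option linter.unusedSectionVars false

variable {L : Type u} [Lattice L]

variable {τ : Chan L → Ty} {r : Chan L → ℕ} {w : Chan L} {ξ : L}

/-! ## Simulation -/

/-- Two configurations agree on the nodes that an observer of the interface channels `I` may be
influenced by. -/
def Agree (ξ : L) (I : Set (Chan L)) (D₁ D₂ : Config L) : Prop :=
  ∃ S₁ W₁ U₁ S₂ W₂ U₂ : Config L, D₁ = S₁ + W₁ + U₁ ∧ D₂ = S₂ + W₂ + U₂ ∧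
    Multiset.Rel (NodeEq ξ) S₁ S₂ ∧ Side ξ I S₁ W₁ U₁ ∧ Side ξ I S₂ W₂ U₂

theorem Agree.symm {I : Set (Chan L)} {D₁ D₂ : Config L} (h : Agree ξ I D₁ D₂) :
    Agree ξ I D₂ D₁ := by
  obtain ⟨S₁, W₁, U₁, S₂, W₂, U₂, h₁, h₂, h₃, h₄, h₅⟩ := h
  exact ⟨S₂, W₂, U₂, S₁, W₁, U₁, h₂, h₁, rel_nodeEq_symm h₃, h₅, h₄⟩

/-- A partial program `D` with interface channels `I` in a well-typed closed configuration. -/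
structure Inside (τ : Chan L → Ty) (r : Chan L → ℕ) (I : Set (Chan L)) (D R : Config L)
    (w : Chan L) : Prop where
  wt : Wt τ r (D + R) w
  sub : ∀ c ∈ I, c ∈ Config.offers (D + R)
  half : ∀ c ∈ I, c ∈ Config.offers D → c ∉ Config.usesM D

theorem Inside.mem {I : Set (Chan L)} {D R : Config L} (h : Inside τ r I D R w) {n : Node L}
    (hn : n ∈ D) {c : Chan L} (hc : c ∈ n.chans) : c ∈ Config.offers (D + R) :=
  h.wt.mem_offers (Multiset.mem_add.2 (.inl hn)) hc

theorem cons_eq_add {n : Node L} {R S W U : Config L} (h : n ::ₘ R = S + W + U) :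
    (∃ S', S = n ::ₘ S' ∧ R = S' + W + U) ∨ (∃ W', W = n ::ₘ W' ∧ R = S + W' + U) ∨
      ∃ U', U = n ::ₘ U' ∧ R = S + W + U' := by
  have hn : n ∈ S + W + U := h ▸ Multiset.mem_cons_self n R
  simp only [Multiset.mem_add] at hn
  rcases hn with (hn | hn) | hn
  · obtain ⟨S', rfl⟩ := Multiset.exists_cons_of_mem hn
    refine .inl ⟨S', rfl, ?_⟩
    simpa [Multiset.cons_add] using h
  · obtain ⟨W', rfl⟩ := Multiset.exists_cons_of_mem hn
    refine .inr (.inl ⟨W', rfl, ?_⟩)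
    simpa [Multiset.cons_add, Multiset.add_cons] using h
  · obtain ⟨U', rfl⟩ := Multiset.exists_cons_of_mem hn
    refine .inr (.inr ⟨U', rfl, ?_⟩)
    simpa [Multiset.cons_add, Multiset.add_cons] using h

theorem Side.mono {I : Set (Chan L)} {S W U S' W' U' : Config L} (h : Side ξ I S W U)
    (hS : ∀ n ∈ S', n ∈ S) (hW : ∀ n ∈ W', n.High ξ ∨ n ∈ W) (hU : ∀ n ∈ U', n ∈ U) :
    Side ξ I S' W' U' :=
  h.update (Z := ∅) (fun n hn => h.low n (hS n hn)) hW
    (fun _ ⟨n, hn, hc⟩ _ => .inl ⟨n, hS n hn, hc⟩) (fun _ ⟨n, hn, hc⟩ _ => .inl ⟨n, hU n hn, hc⟩)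
    (by simp) (by simp)

theorem name_mem_names {B : Config L} {n : Node L} (hn : n ∈ B) {c : Chan L} (hc : c ∈ n.chans) :
    c.name ∈ Config.names B := ⟨c, ⟨n, hn, hc⟩, rfl⟩

section Sim

variable {I : Set (Chan L)} {τ₁ τ₂ : Chan L → Ty} {r₁ r₂ : Chan L → ℕ} {w₁ w₂ : Chan L}

/-- A process of `S` is followed by its renamed partner, and both results are sorted alike. A
process of `W` that can reduce alone does not wait for anything, so its running secrecy is secret
and so are all its products; the other run rests. The products of a process of `U` stay in `U`. -/
theorem Agree.red1 {n : Node L} {b T R D₂ R₂ : Config L}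
    (h₁ : Inside τ₁ r₁ I (n ::ₘ T) R w₁) (h₂ : Inside τ₂ r₂ I D₂ R₂ w₂)
    (h : Agree ξ I (n ::ₘ T) D₂) (hr : Red1 (Config.names (n ::ₘ T + R)) n b) :
    ∃ b₁ D₂', Red1 (Config.names (n ::ₘ T + R)) n b₁ ∧
      (D₂' = D₂ ∨ ∀ keep, Step (Config.names (D₂ + R₂)) keep D₂ D₂') ∧
      Agree ξ I (b₁ + T) D₂' := by
  obtain ⟨S₁, W₁, U₁, S₂, W₂, U₂, e₁, rfl, hS, k₁, k₂⟩ := h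
  have hw := h₁.wt
  rw [Multiset.cons_add] at hw
  have hmem : ∀ n' ∈ S₁ + W₁ + U₁, ∀ c ∈ n'.chans, c ∈ Config.offers (n ::ₘ (T + R)) := by
    intro n' hn' c hc
    rw [← e₁] at hn'
    simpa using h₁.mem hn' hc
  have hI : ∀ c ∈ I, c ∈ Config.offers (n ::ₘ (T + R)) := fun c hc => by simpa using h₁.sub c hc
  rcases cons_eq_add e₁ with ⟨S₁, rfl, rfl⟩ | ⟨W₁, rfl, rfl⟩ | ⟨U₁, rfl, rfl⟩
  · obtain ⟨π, S₂, hπ, rfl, hS'⟩ := rel_cons hS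
    have hw₂ := h₂.wt
    simp only [Multiset.cons_add] at hw₂
    obtain ⟨b₁, π', hπ', r₁, r₂⟩ := hr.map (Config.names_finite _)
      (Config.names_finite (Node.map π n ::ₘ (S₂ + W₂ + U₂ + R₂))) hπ
      (fun c hc => name_mem_names (by simp) hc) (fun c hc => name_mem_names (by simp) hc)
      (fun b z hb hz hn => hw.red1_fresh (by simp [Multiset.cons_add]) hb hz
        (hw.mem_offers (by simp) hn))
      (fun b z hb hz hn => hw₂.red1_fresh (by simp) hb hz (hw₂.mem_offers (by simp) hn))
    obtain ⟨Z₁, f₁⟩ := hw.red1 (by simp [Multiset.cons_add]) r₁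
    obtain ⟨Z₂, f₂⟩ := hw₂.red1 (by simp) r₂
    obtain ⟨bS, bW, bU, rfl, s₁, s₂, s₃⟩ := exists_sort ξ b₁
    refine ⟨_, Multiset.map (Node.map π') (bS + bW + bU) + (S₂ + W₂ + U₂), r₁, .inr fun keep => ?_,
      bS + S₁, bW + W₁, bU + U₁, Multiset.map (Node.map π') bS + S₂,
      Multiset.map (Node.map π') bW + W₂, Multiset.map (Node.map π') bU + U₂,
      by abel, by simp only [Multiset.map_add]; abel, (rel_map_perm hπ').add hS', ?_, ?_⟩
    · simp only [Multiset.cons_add]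
      exact r₂.step _
    · exact k₁.red1 f₁ hmem hI rfl s₁ s₂ s₃ (.inl (by simp)) _ _ _ (by simp +contextual)
        (by simp) (by simp)
    · refine k₂.red1 (bS := Multiset.map (Node.map π') bS) (bW := Multiset.map (Node.map π') bW)
        (bU := Multiset.map (Node.map π') bU) f₂ ?_ ?_ (by simp) ?_ ?_ ?_ (.inl (by simp)) _ _ _
        (by simp +contextual) (by simp) (by simp)
      · intro n' hn' c hc
        simpa using h₂.mem hn' hc
      · intro c hc
        simpa using h₂.sub c hc
      · intro n' hn'
        obtain ⟨n', hn, rfl⟩ := Multiset.mem_map.1 hn'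
        exact (Node.low_map hπ'.1 _).2 (s₁ _ hn)
      · intro n' hn'
        obtain ⟨n', hn, rfl⟩ := Multiset.mem_map.1 hn'
        obtain ⟨hl, y, P, d, rfl⟩ := s₂ _ hn
        exact ⟨fun h => hl ((Node.low_map hπ'.1 _).1 h), _, _, _, rfl⟩
      · intro n' hn'
        obtain ⟨n', hn, rfl⟩ := Multiset.mem_map.1 hn'
        obtain ⟨hl, m, rfl⟩ := s₃ _ hn
        exact ⟨fun h => hl ((Node.low_map hπ'.1 _).1 h), _, rfl⟩
  · obtain ⟨Z, f⟩ := hw.red1 (by simp [Multiset.cons_add]) hr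
    have hsec : ¬ n.sec ≤ ξ := by
      rcases k₁.high n (by simp) with h | ⟨m, rfl, -⟩
      · cases n with
        | msg m => exact h.elim
        | proc y P d => exact h.resolve_right fun ⟨c, _, h⟩ => hr.not_waits h
      · cases hr
    obtain ⟨bS, bW, bU, rfl, s₁, s₂, s₃⟩ := exists_sort ξ b
    have hbS : bS = 0 := by
      refine Multiset.eq_zero_of_forall_notMem fun n' hn' => hsec ?_
      have := s₁ n' hn'
      cases n' with
      | proc y P d => exact (f.proc y P d (by simp [hn'])).trans this
      | msg m => exact (f.msg m (by simp [hn'])).1.trans this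
    refine ⟨_, _, hr, .inl rfl, bS + S₁, bW + W₁, bU + U₁, S₂, W₂, U₂, by abel, rfl, ?_, ?_, k₂⟩
    · rwa [hbS, zero_add]
    · exact k₁.red1 f hmem hI rfl s₁ s₂ s₃ (.inr hbS) _ _ _ (by simp) (by simp +contextual)
        (by simp)
  · obtain ⟨Z, f⟩ := hw.red1 (by simp [Multiset.cons_add]) hr
    have hout : ∀ {X : Config L}, (∀ n' ∈ X, n' ∈ S₁ + W₁ + n ::ₘ U₁) → ∀ c ∈ Z,
        c ∉ Config.chans X := by
      rintro X hX c hc ⟨n', hn', hc'⟩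
      exact f.fresh c hc (hmem n' (hX n' hn') c hc')
    refine ⟨b, _, hr, .inl rfl, S₁, W₁, b + U₁, S₂, W₂, U₂, by abel, rfl, hS, ?_, k₂⟩
    refine k₁.update (Z := Z) k₁.low (fun _ h => .inr h) (fun _ h _ => .inl h) ?_ ?_ ?_
    · rintro c ⟨n', hn', hc⟩ -
      rcases Multiset.mem_add.1 hn' with h | h
      · exact (f.sub n' h hc).imp (fun h => ⟨n, by simp, h⟩) id
      · exact .inl ⟨n', by simp [h], hc⟩
    · intro c hc
      exact ⟨fun h => f.fresh c hc (hI c h), hout (fun n hn => by simp [hn]) c hc,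
        hout (fun n hn => by simp [hn]) c hc,
        hout (fun n hn => Multiset.mem_add.2 (.inr hn)) c hc⟩
    · exact fun c hc h => (hout (fun n hn => by simp [hn]) c hc h).elim

/-- A client that receives adds the level of the channel to its running secrecy. A provider
continues at the level of its own channel, which bounds its former running secrecy; so nothing
secret is forgotten in either case. -/
theorem Red2.high {m : Msg L} {n n' : Node L} {γ : Multiset (Chan L)} (h : Red2 m n n')
    (hn : Ok τ r n γ) (hh : n.High ξ) : n'.High ξ := by
  obtain ⟨⟨y, P, d, rfl⟩, y', P', d', rfl, h₁, h₂⟩ := h.sec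
  have hc : ¬ d ≤ ξ ∨ ¬ m.carrier.lvl ≤ ξ := by
    rcases hh with h' | ⟨c, h', h''⟩
    · exact .inl h'
    · exact .inr (by rwa [h.waits.unique h''])
  refine .inl fun hd => ?_
  by_cases hp : m.Positive
  · rw [h₁ hp] at hd
    exact hc.elim (fun h => h (le_sup_left.trans hd)) fun h => h (le_sup_right.trans hd)
  · obtain ⟨e, rfl⟩ := h₂ hp
    refine hc.elim (fun h => h ?_) fun h => h hd
    have := hn.sec
    rw [← e] at this
    exact le_trans this hd

/-- The receiver is secret, so the other run rests. The delicate case is a message of `S`: it is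
consumed in the first run, so its partner has to leave `S` in the second run as well, where it joins
`W` as a positive message with no visible reader. -/
theorem Agree.red2_high {m : Msg L} {n n' : Node L} {T R S₁ W₁ U₁ S₂ W₂ U₂ : Config L}
    (h₁ : Inside τ₁ r₁ I (.msg m ::ₘ n ::ₘ T) R w₁) (hr : Red2 m n n')
    (e₁ : .msg m ::ₘ T = S₁ + W₁ + U₁) (hS : Multiset.Rel (NodeEq ξ) S₁ S₂)
    (k₁ : Side ξ I S₁ (n ::ₘ W₁) U₁) (k₂ : Side ξ I S₂ W₂ U₂) (hn : n.High ξ) :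
    Agree ξ I (n' ::ₘ T) (S₂ + W₂ + U₂) := by
  have hok := h₁.wt.ok
  have hn' : n'.High ξ := hr.high (hok n (by simp)) hn
  rcases cons_eq_add e₁ with ⟨S₁, rfl, rfl⟩ | ⟨W₁, rfl, rfl⟩ | ⟨U₁, rfl, rfl⟩
  · obtain ⟨π, S₂, hπ, rfl, hS'⟩ := rel_cons hS
    have hmo := (hok (.msg m) (by simp)).msgOk
    have hcl : m.carrier.lvl ≤ ξ := k₁.low _ (Multiset.mem_cons_self _ _)
    have hobs : ∀ c ∈ (Node.msg m).chans, c.lvl ≤ ξ := fun c hc => by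
      rw [hmo.lvl_eq hc]; exact hcl
    have hmap : Node.map π (.msg m) = .msg m := Node.map_eq_self fun c hc => hπ.2 c (hobs c hc)
    rw [hmap] at k₂ ⊢
    obtain ⟨⟨y, P, d, rfl⟩, -⟩ := hr.sec
    have hsec : ¬ d ≤ ξ := by
      rcases hn with h | ⟨c, h, h'⟩
      · exact h
      · rw [← hr.waits.unique h'] at h
        exact absurd hcl h
    -- The receiver of a negative message runs below the level of the carrier; as this level is
    -- observable, the receiver would not be secret.
    have hpos : m.Positive := by
      by_contra hp
      obtain ⟨-, y', P', d', -, -, h⟩ := hr.sec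
      refine hsec ?_
      have := (hok (.proc y P d) (by simp)).sec
      rw [← (h hp).1] at this
      exact le_trans this hcl
    have hco := hr.carrier_eq hpos
    have hne : m.offer ≠ y := by
      intro e
      have := h₁.wt.offer_inj (n := .msg m) (n' := .proc y P d) (by simp) (by simp) e
      cases this
    have hu : m.offer ∈ Node.usesM (.proc y P d) :=
      Node.mem_usesM.2 ⟨hco ▸ hr.waits.mem, hne⟩
    -- The channel is offered by the message and used by the receiver, both inside the program, so
    -- it is not an interface channel.
    have hI : m.offer ∉ I := fun h =>
      h₁.half _ h (by simp [Node.offer]) (Config.mem_usesM.2 ⟨.proc y P d, by simp, hu⟩)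
    -- By linearity no node besides the message and its receiver mentions the channel. Being
    -- observable, it is then absent from the partners of these nodes in the second run too.
    have hS₁ : m.offer ∉ Config.chans S₁ := by
      rintro ⟨n₀, hn₀, hc⟩
      have hw := h₁.wt
      simp only [Multiset.cons_add] at hw
      by_cases he : m.offer = n₀.offer
      · have := (Multiset.nodup_cons.1 ((Config.offers_cons _ _) ▸ hw.nodup)).1
        refine this (Config.mem_offers.2 ⟨n₀, ?_, he.symm⟩)
        simp [hn₀]
      · rw [← Multiset.cons_add, ← Multiset.cons_add, Multiset.cons_swap, Multiset.cons_add,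
          ← Multiset.singleton_add] at hw
        refine hw.uses_disjoint (c := m.offer) (by simpa using hu)
          (Config.mem_usesM.2 ⟨n₀, ?_, Node.mem_usesM.2 ⟨hc, he⟩⟩)
        simp [hn₀]
    refine ⟨S₁, n' ::ₘ W₁, U₁, S₂, .msg m ::ₘ W₂, U₂, by simp [Multiset.cons_add, Multiset.add_cons],
      by simp [Multiset.cons_add, Multiset.add_cons], hS', ?_, ?_⟩
    · refine k₁.mono (fun n h => by simp [h]) (fun n h => ?_) fun n h => h
      rcases Multiset.mem_cons.1 h with rfl | h
      · exact .inl hn'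
      · exact .inr (by simp [h])
    · have k := k₂.mono (S' := S₂) (W' := W₂) (U' := U₂) (fun n h => by simp [h])
        (fun n h => .inr h) fun n h => h
      refine ⟨k.low, fun n h => ?_, k.unrel⟩
      rcases Multiset.mem_cons.1 h with rfl | h
      · refine .inr ⟨m, rfl, hpos, hobs _ m.offer_mem, hI, fun h => ?_, fun h => ?_⟩
        · exact hS₁ (rel_mem_chans (rel_nodeEq_symm hS') h (hobs _ m.offer_mem))
        · exact (k₂.unrel _ h (hobs _ m.offer_mem)).2 ⟨.msg m, by simp, m.offer_mem⟩
      · exact k.high n h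
  · refine ⟨S₁, n' ::ₘ W₁, U₁, S₂, W₂, U₂, by simp [Multiset.cons_add, Multiset.add_cons],
      rfl, hS, ?_, k₂⟩
    refine k₁.mono (fun n h => by simp [h]) (fun n h => ?_) fun n h => h
    rcases Multiset.mem_cons.1 h with rfl | h
    · exact .inl hn'
    · exact .inr (by simp [h])
  · refine ⟨S₁, n' ::ₘ W₁, U₁, S₂, W₂, U₂, by simp [Multiset.cons_add, Multiset.add_cons],
      rfl, hS, ?_, k₂⟩
    refine k₁.mono (fun n h => by simp [h]) (fun n h => ?_) fun n h => by simp [h]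
    rcases Multiset.mem_cons.1 h with rfl | h
    · exact .inl hn'
    · exact .inr (by simp [h])

theorem Node.waits_high {n : Node L} {c : Chan L} (h : n.Waits c) (hc : ¬ c.lvl ≤ ξ) :
    n.High ξ := by
  cases n with
  | msg m => exact h.elim
  | proc y P d => exact .inr ⟨c, hc, h⟩

/-- If the receiver is in `S` and the carrier is observable, then the message shares an observable
channel with `S` and must itself be in `S`; it is the same message in both runs, and both receive
it. If the carrier is secret, the receiver and its partner wait along a secret channel and can be
moved to `W` beforehand. A receiver in `U` finds its message in `U`. -/
theorem Agree.red2 {m : Msg L} {n n' : Node L} {T R D₂ : Config L} {used₂ : Set ℕ}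
    (h₁ : Inside τ₁ r₁ I (.msg m ::ₘ n ::ₘ T) R w₁)
    (h : Agree ξ I (.msg m ::ₘ n ::ₘ T) D₂) (hr : Red2 m n n') :
    ∃ D₂', (D₂' = D₂ ∨ ∀ keep, Step used₂ keep D₂ D₂') ∧ Agree ξ I (n' ::ₘ T) D₂' := by
  obtain ⟨S₁, W₁, U₁, S₂, W₂, U₂, e₁, rfl, hS, k₁, k₂⟩ := h
  have hmo := (h₁.wt.ok (.msg m) (by simp)).msgOk
  obtain ⟨⟨y, P, d, hnp⟩, y', P', d', hnp', hd₁, hd₂⟩ := hr.sec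
  rw [Multiset.cons_swap] at e₁
  rcases cons_eq_add e₁ with ⟨S₁, rfl, e₂⟩ | ⟨W₁, rfl, e₂⟩ | ⟨U₁, rfl, e₂⟩
  · obtain ⟨π, S₂, hπ, rfl, hS'⟩ := rel_cons hS
    by_cases hc : m.carrier.lvl ≤ ξ
    · have hnS : ∀ c ∈ n.chans, c ∈ Config.chans (n ::ₘ S₁) := fun c hc => ⟨n, by simp, hc⟩
      have hcn := hnS _ hr.waits.mem
      rcases cons_eq_add e₂ with ⟨S₁, rfl, rfl⟩ | ⟨W₁, rfl, rfl⟩ | ⟨U₁, rfl, rfl⟩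
      · obtain ⟨ρ, S₂, hρ, rfl, hS''⟩ := rel_cons hS'
        have hobs : ∀ c ∈ (Node.msg m).chans, c.lvl ≤ ξ := fun c h => by
          rw [hmo.lvl_eq h]; exact hc
        have hmap : ∀ {σ : Equiv.Perm (Chan L)}, Hides ξ σ → Node.map σ (.msg m) = .msg m :=
          fun hσ => Node.map_eq_self fun c hc => hσ.2 c (hobs c hc)
        have hr₂ := hr.map hπ.1
        have hm₂ := hmap hπ
        rw [Node.map, Node.msg.injEq] at hm₂
        rw [hm₂] at hr₂
        rw [hmap hρ] at k₂ ⊢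
        have hlow : n'.Low ξ := by
          have hl : n.Low ξ := k₁.low n (by simp)
          subst hnp hnp'
          by_cases hp : m.Positive
          · exact (hd₁ hp).le.trans (sup_le hl hc)
          · exact (hd₂ hp).2.le.trans hc
        have key : ∀ {S W U : Config L} {q q' : Node L}, Red2 m q q' → q'.Low ξ →
            Side ξ I (q ::ₘ .msg m ::ₘ S) W U → Side ξ I (q' ::ₘ S) W U := by
          intro S W U q q' hq hl k
          refine k.update (Z := ∅) ?_ (fun _ => .inr) ?_ (fun c hc _ => .inl hc) (by simp) (by simp)
          · intro p hp
            rcases Multiset.mem_cons.1 hp with rfl | hp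
            · exact hl
            · exact k.low p (by simp [hp])
          · rintro c ⟨p, hp, hc⟩ -
            rcases Multiset.mem_cons.1 hp with rfl | hp
            · rcases hq.chans_subset hc with h | h
              · exact .inl ⟨q, by simp, h⟩
              · exact .inl ⟨.msg m, by simp, h⟩
            · exact .inl ⟨p, by simp [hp], hc⟩
        refine ⟨n'.map π ::ₘ (S₂ + W₂ + U₂), .inr fun keep => ?_, n' ::ₘ S₁, W₁, U₁,
          n'.map π ::ₘ S₂, W₂, U₂, by simp [Multiset.cons_add], by simp [Multiset.cons_add],
          .cons (nodeEq_iff.2 ⟨π, hπ, rfl⟩) hS'', key hr hlow k₁,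
          key hr₂ ((Node.low_map hπ.1 _).2 hlow) k₂⟩
        simp only [Multiset.cons_add]
        rw [Multiset.cons_swap]
        exact hr₂.step _
      · exfalso
        rcases k₁.high (.msg m) (by simp) with h | ⟨m', h, hp, -, -, h', -⟩
        · exact h
        · cases h
          exact h' (hr.carrier_eq hp ▸ hcn)
      · exact ((k₁.unrel _ ⟨.msg m, by simp, m.carrier_mem⟩ hc).2 hcn).elim
    · have hh := Node.waits_high hr.waits hc
      have hh₂ : (n.map π).High ξ := hh.map hπ.1
      have k₁' : Side ξ I S₁ (n ::ₘ W₁) U₁ := by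
        refine k₁.mono (fun n h => by simp [h]) (fun p h => ?_) fun n h => h
        rcases Multiset.mem_cons.1 h with rfl | h
        · exact .inl hh
        · exact .inr h
      have k₂' : Side ξ I S₂ (n.map π ::ₘ W₂) U₂ := by
        refine k₂.mono (fun n h => by simp [h]) (fun p h => ?_) fun n h => h
        rcases Multiset.mem_cons.1 h with rfl | h
        · exact .inl hh₂
        · exact .inr h
      refine ⟨_, .inl rfl, ?_⟩
      have := Agree.red2_high h₁ hr e₂ hS' k₁' k₂' hh
      simpa [Multiset.cons_add, Multiset.add_cons] using this
  · have hh : n.High ξ := by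
      rcases k₁.high n (by simp) with h | ⟨m', h, -⟩
      · exact h
      · rw [h] at hnp
        cases hnp
    exact ⟨_, .inl rfl, Agree.red2_high h₁ hr e₂ hS k₁ k₂ hh⟩
  · have hcn : m.carrier ∈ Config.chans (n ::ₘ U₁) := ⟨n, by simp, hr.waits.mem⟩
    refine ⟨_, .inl rfl, ?_⟩
    rcases cons_eq_add e₂ with ⟨S₁, rfl, rfl⟩ | ⟨W₁, rfl, rfl⟩ | ⟨U₁, rfl, rfl⟩
    · exact ((k₁.unrel _ hcn (k₁.low _ (Multiset.mem_cons_self _ _))).2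
        ⟨.msg m, by simp, m.carrier_mem⟩).elim
    · exfalso
      rcases k₁.high (.msg m) (by simp) with h | ⟨m', h, hp, -, -, -, h'⟩
      · exact h
      · cases h
        exact h' (hr.carrier_eq hp ▸ hcn)
    · refine ⟨S₁, W₁, n' ::ₘ U₁, S₂, W₂, U₂, by simp [Multiset.add_cons], rfl, hS, ?_, k₂⟩
      refine k₁.update (Z := ∅) k₁.low (fun _ => .inr) (fun c hc _ => .inl hc) ?_ (by simp)
        (by simp)
      rintro c ⟨p, hp, hc⟩ -
      rcases Multiset.mem_cons.1 hp with rfl | hp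
      · rcases hr.chans_subset hc with h | h
        · exact .inl ⟨n, by simp, h⟩
        · exact .inl ⟨.msg m, by simp, h⟩
      · exact .inl ⟨p, by simp [hp], hc⟩

end Sim

end SecSess

/-! ### Simulation of forwarding -/

namespace SecSess

universe u

set_option linter.unusedSectionVars false

variable {L : Type u} [Lattice L]

variable {τ : Chan L → Ty} {r : Chan L → ℕ} {w : Chan L} {ξ : L}

/-! ## Simulation of forwarding -/

/-- The forwarder is the only client of `x`. Another node that uses `y` could thus mention `x` only
by offering it, which the ranks exclude. -/
theorem Wt.fwd_facts {x y : Chan L} {d : L} {R : Config L}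
    (H : Wt τ r (.proc y (.fwd (.chan y) (.chan x)) d ::ₘ R) w) :
    x.lvl = y.lvl ∧ x ≠ y ∧ d ≤ y.lvl ∧ (∀ n ∈ R, y ≠ n.offer) ∧ (∀ n ∈ R, x ∉ n.usesM) ∧
      ∀ n ∈ R, y ∈ n.chans → x ∉ n.chans := by
  have hok := H.ok _ (Multiset.mem_cons_self _ _)
  obtain ⟨-, hγ, hl, -, hr⟩ := hok.fwd_inv
  have h₁ : ∀ n ∈ R, y ≠ n.offer := by
    rintro n hn rfl
    have := H.nodup
    rw [Config.offers_cons] at this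
    exact (Multiset.nodup_cons.1 this).1 (Config.mem_offers.2 ⟨n, hn, rfl⟩)
  have h₂ : ∀ n ∈ R, x ∉ n.usesM := by
    intro n hn hx
    rw [← Multiset.singleton_add] at H
    exact H.uses_disjoint (c := x) (by simp [hγ]) (Config.mem_usesM.2 ⟨n, hn, hx⟩)
  refine ⟨hl, by rintro rfl; omega, hok.sec, h₁, h₂, fun n hn hy hx => ?_⟩
  have hyu : y ∈ n.usesM := Node.mem_usesM.2 ⟨hy, h₁ n hn⟩
  have hxo : x = n.offer := by
    by_contra h
    exact h₂ n hn (Node.mem_usesM.2 ⟨hx, h⟩)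
  have := (H.ok n (Multiset.mem_cons_of_mem hn)).rank y hyu
  rw [← hxo] at this
  omega

/-- Since `x` does not occur beside `y`, the renaming acts on the node as a transposition of two
secret channels, which `NodeEq` disregards. -/
theorem nodeEq_ren {n : Node L} {x y : Chan L} (hl : x.lvl = y.lvl) (ho : ¬ y.lvl ≤ ξ)
    (h : y ∈ n.chans → x ∉ n.chans) : NodeEq ξ n (n.map (ren y x)) := by
  classical
  by_cases hy : y ∈ n.chans
  · refine nodeEq_iff.2 ⟨Equiv.swap y x, ⟨swap_lvl hl, fun c hc => ?_⟩, ?_⟩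
    · exact Equiv.swap_apply_of_ne_of_ne (by rintro rfl; exact ho hc)
        (by rintro rfl; exact ho (hl ▸ hc))
    · exact Node.map_congr fun c hc => ren_eq_swap (.inl fun e => h hy (e ▸ hc))
  · rw [Node.map_ren_of_notMem hy]
    exact .refl n

theorem Config.mem_chans_map {f : Chan L → Chan L} {D : Config L} {c : Chan L} :
    c ∈ Config.chans (Multiset.map (Node.map f) D) ↔ ∃ c' ∈ Config.chans D, f c' = c := by
  constructor
  · rintro ⟨n', hn', hc⟩
    obtain ⟨n, hn, rfl⟩ := Multiset.mem_map.1 hn'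
    rw [Node.chans_map] at hc
    obtain ⟨c', hc', rfl⟩ := hc
    exact ⟨c', ⟨n, hn, hc'⟩, rfl⟩
  · rintro ⟨c', ⟨n, hn, hc'⟩, rfl⟩
    exact ⟨_, Multiset.mem_map_of_mem _ hn, by rw [Node.chans_map]; exact ⟨c', hc', rfl⟩⟩

/-- A hiding renaming changes no level and moves secret channels only, while the invariants speak of
levels and of occurrences of observable channels. -/
theorem Side.map {I : Set (Chan L)} {S W U : Config L} (h : Side ξ I S W U)
    {f : Chan L → Chan L} (hf : Hides ξ f) :
    Side ξ I (Multiset.map (Node.map f) S) (Multiset.map (Node.map f) W)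
      (Multiset.map (Node.map f) U) where
  low n' hn' := by
    obtain ⟨n, hn, rfl⟩ := Multiset.mem_map.1 hn'
    exact (Node.low_map hf.1 n).2 (h.low n hn)
  high n' hn' := by
    obtain ⟨n, hn, rfl⟩ := Multiset.mem_map.1 hn'
    rcases h.high n hn with h' | ⟨m, rfl, h₁, h₂, h₃, h₄, h₅⟩
    · exact .inl (h'.map hf.1)
    · have key : ∀ {X : Config L}, m.offer ∉ Config.chans X →
          m.offer ∉ Config.chans (Multiset.map (Node.map f) X) := by
        intro X hX hc
        obtain ⟨c', hc', e⟩ := Config.mem_chans_map.1 hc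
        rw [hf.2 c' ((hf.obs_iff c').1 (e ▸ h₂))] at e
        exact hX (e ▸ hc')
      refine .inr ⟨m.map f, rfl, (m.positive_map f).2 h₁, ?_⟩
      rw [Msg.offer_map, hf.2 _ h₂]
      exact ⟨h₂, h₃, key h₄, key h₅⟩
  unrel c hc hl := by
    obtain ⟨c', hc', rfl⟩ := Config.mem_chans_map.1 hc
    have hl' := (hf.obs_iff c').1 hl
    rw [hf.2 _ hl']
    refine ⟨(h.unrel c' hc' hl').1, fun hs => ?_⟩
    obtain ⟨c'', hc'', e⟩ := Config.mem_chans_map.1 hs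
    rw [hf.2 c'' ((hf.obs_iff c'').1 (e ▸ hl'))] at e
    exact (h.unrel c' hc' hl').2 (e ▸ hc'')

theorem map_ren_eq_self {X : Config L} {x y : Chan L} (h : y ∉ Config.chans X) :
    Multiset.map (Node.map (ren y x)) X = X := Config.rename_of_notMem h

theorem map_ren_commute {π : Equiv.Perm (Chan L)} (hπ : Hides ξ π) {x y : Chan L}
    (hx : x.lvl ≤ ξ) (hy : y.lvl ≤ ξ) (n : Node L) :
    (n.map π).map (ren y x) = (n.map (ren y x)).map π := by
  rw [Node.map_map, Node.map_map]
  refine Node.map_congr fun c _ => ?_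
  by_cases h : c = y
  · subst h; simp [hπ.2 c hy, hπ.2 x hx]
  · have : π c ≠ y := fun e => h (π.injective (e.trans (hπ.2 y hy).symm))
    simp [ren_of_ne h, ren_of_ne this]

theorem rel_map_ren {S₁ S₂ : Config L} (h : Multiset.Rel (NodeEq ξ) S₁ S₂) {x y : Chan L}
    (hx : x.lvl ≤ ξ) (hy : y.lvl ≤ ξ) :
    Multiset.Rel (NodeEq ξ) (Multiset.map (Node.map (ren y x)) S₁)
      (Multiset.map (Node.map (ren y x)) S₂) := by
  rw [Multiset.rel_map_left, Multiset.rel_map_right]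
  refine h.mono fun a _ b _ hab => ?_
  obtain ⟨π, hπ, rfl⟩ := nodeEq_iff.1 hab
  exact nodeEq_iff.2 ⟨π, hπ, map_ren_commute hπ hx hy a⟩

/-- Renaming of an observable channel `y` to `x`, where `x` may occur in secret messages only. -/
theorem Side.ren {I I' : Set (Chan L)} {S W U : Config L} (h : Side ξ I S W U) {x y : Chan L}
    (hl : x.lvl = y.lvl) (hI' : ∀ c ∈ I', c ∈ I ∨ c = x)
    (hyU : y ∉ Config.chans U ∨ y ∉ Config.chans S)
    (hxU : x ∉ Config.chans U ∨ x ∉ I' ∧ y ∉ Config.chans S)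
    (hW : ∀ m, Node.msg m ∈ W → m.Positive → m.offer ≠ x ∧ m.offer ≠ y)
    (hyI : y ∉ Config.chans U ∨ x ∉ I' ∧ x ∉ Config.chans S) :
    Side ξ I' (Multiset.map (Node.map (ren y x)) S) (Multiset.map (Node.map (ren y x)) W)
      (Multiset.map (Node.map (ren y x)) U) where
  low n' hn' := by
    obtain ⟨n, hn, rfl⟩ := Multiset.mem_map.1 hn'
    exact (Node.low_map (ren_lvl hl) n).2 (h.low n hn)
  high n' hn' := by
    obtain ⟨n, hn, rfl⟩ := Multiset.mem_map.1 hn'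
    rcases h.high n hn with h' | ⟨m, rfl, h₁, h₂, h₃, h₄, h₅⟩
    · exact .inl (h'.map (ren_lvl hl))
    · obtain ⟨hmx, hmy⟩ := hW m hn h₁
      have key : ∀ {X : Config L}, m.offer ∉ Config.chans X →
          m.offer ∉ Config.chans (Multiset.map (Node.map (SecSess.ren y x)) X) := by
        intro X hX hc
        obtain ⟨c', hc', e⟩ := Config.mem_chans_map.1 hc
        by_cases hcy : c' = y
        · subst hcy
          rw [ren_self] at e
          exact hmx e.symm
        · rw [ren_of_ne hcy] at e
          exact hX (e ▸ hc')
      refine .inr ⟨m.map (SecSess.ren y x), rfl, (m.positive_map _).2 h₁, ?_⟩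
      rw [Msg.offer_map, ren_of_ne hmy]
      exact ⟨h₂, fun h => (hI' _ h).elim h₃ hmx, key h₄, key h₅⟩
  unrel c hc hlc := by
    obtain ⟨c', hc', rfl⟩ := Config.mem_chans_map.1 hc
    have hl' : c'.lvl ≤ ξ := (ren_lvl hl c') ▸ hlc
    by_cases hcy : c' = y
    · subst hcy
      rw [ren_self]
      have hh := hyI.resolve_left (fun h => h hc')
      refine ⟨hh.1, ?_⟩
      rw [map_ren_eq_self (hyU.resolve_left fun h => h hc')]
      exact hh.2
    · rw [ren_of_ne hcy]
      refine ⟨fun hi => ?_, fun hs => ?_⟩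
      · rcases hI' _ hi with hi | rfl
        · exact (h.unrel c' hc' hl').1 hi
        · exact hxU.elim (fun h => h hc') fun h => h.1 hi
      · obtain ⟨c'', hc'', e⟩ := Config.mem_chans_map.1 hs
        by_cases hcy' : c'' = y
        · subst hcy'
          rw [ren_self] at e
          exact hxU.elim (fun h => h (e ▸ hc')) fun h => h.2 hc''
        · rw [ren_of_ne hcy'] at e
          exact (h.unrel c' hc' hl').2 (e ▸ hc'')

section Sim

variable {I : Set (Chan L)} {τ₁ τ₂ : Chan L → Ty} {r₁ r₂ : Chan L → ℕ} {w₁ w₂ : Chan L}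

/-- Suppose first that `y` is observable. The forwarder neither waits nor runs high, so it is not in
`W`. If it is in `S`, it is the same node in both runs and both execute it. If it is in `U`, then
`y` does not occur in `S`, and only the first run changes. If `y` is secret, the renaming is
absorbed by `NodeEq`, and the second run rests. -/
theorem Agree.fwd {x y : Chan L} {d : L} {T R D₂ R₂ : Config L} {used₂ : Set ℕ}
    {keep : Set (Chan L)}
    (h₁ : Inside τ₁ r₁ I (.proc y (.fwd (.chan y) (.chan x)) d ::ₘ T) R w₁)
    (h₂ : Inside τ₂ r₂ I D₂ R₂ w₂)
    (h : Agree ξ I (.proc y (.fwd (.chan y) (.chan x)) d ::ₘ T) D₂) (hy : y ∉ keep) :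
    ∃ D₂', (D₂' = D₂ ∨ Step used₂ keep D₂ D₂') ∧ Agree ξ I (Config.rename T y x) D₂' := by
  obtain ⟨S₁, W₁, U₁, S₂, W₂, U₂, e₁, rfl, hS, k₁, k₂⟩ := h
  have hw := h₁.wt
  rw [Multiset.cons_add] at hw
  obtain ⟨hl, hxy, hd, f₁, f₂, f₃⟩ := hw.fwd_facts
  simp only [Config.rename]
  by_cases ho : y.lvl ≤ ξ
  · have hx : x.lvl ≤ ξ := hl ▸ ho
    rcases cons_eq_add e₁ with ⟨S₁, rfl, rfl⟩ | ⟨W₁, rfl, rfl⟩ | ⟨U₁, rfl, rfl⟩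
    · obtain ⟨π, S₂, hπ, rfl, hS'⟩ := rel_cons hS
      have e : (Node.proc y (.fwd (.chan y) (.chan x)) d).map π =
          .proc y (.fwd (.chan y) (.chan x)) d := by
        refine Node.map_eq_self fun c hc => hπ.2 c ?_
        simp only [Node.chans, Proc.chans, Ref.chans, Set.mem_union, Set.mem_singleton_iff] at hc
        rcases hc with rfl | rfl | rfl <;> assumption
      rw [e] at k₂ h₂ ⊢
      have hw₂ := h₂.wt
      simp only [Multiset.cons_add] at hw₂
      obtain ⟨-, -, -, g₁, -, -⟩ := hw₂.fwd_facts
      have key : ∀ {S W U : Config L}, Side ξ I (.proc y (.fwd (.chan y) (.chan x)) d ::ₘ S) W U →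
          (∀ n ∈ W, y ≠ n.offer) →
          Side ξ I (Multiset.map (Node.map (ren y x)) S) (Multiset.map (Node.map (ren y x)) W)
            (Multiset.map (Node.map (ren y x)) U) := by
        intro S W U k hW
        have hyU : y ∉ Config.chans U := fun h => (k.unrel y h ho).2
          ⟨_, Multiset.mem_cons_self _ _, by simp [Node.chans]⟩
        have hxU : x ∉ Config.chans U := fun h => (k.unrel x h hx).2
          ⟨_, Multiset.mem_cons_self _ _, by simp [Node.chans, Proc.chans, Ref.chans]⟩
        refine (k.mono (S' := S) (fun n h => by simp [h]) (fun _ => .inr) fun _ => id).ren hl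
          (fun c => .inl) (.inl hyU) (.inl hxU) (fun m hm hp => ⟨?_, ?_⟩) (.inl hyU)
        · rintro rfl
          rcases k.high _ hm with h | ⟨m', e, -, -, -, h', -⟩
          · exact h
          · cases e
            exact h' ⟨_, Multiset.mem_cons_self _ _, by simp [Node.chans, Proc.chans, Ref.chans]⟩
        · exact fun e => hW _ hm e.symm
      refine ⟨Multiset.map (Node.map (ren y x)) (S₂ + W₂ + U₂), .inr ?_, _, _, _, _, _, _,
        by rw [Multiset.map_add, Multiset.map_add], by rw [Multiset.map_add, Multiset.map_add],
        rel_map_ren hS' hx ho, key k₁ fun n hn => f₁ n (by simp [hn]),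
        key k₂ fun n hn => g₁ n (by simp [hn])⟩
      simp only [Multiset.cons_add]
      exact Step.fwd _ y x d hy
    · exfalso
      rcases k₁.high _ (Multiset.mem_cons_self _ _) with h | ⟨m, h, -⟩
      · rcases h with h | ⟨c, -, h⟩
        · exact h (hd.trans ho)
        · simp [Node.Waits] at h
      · cases h
    · have hyc : y ∈ Config.chans (.proc y (.fwd (.chan y) (.chan x)) d ::ₘ U₁) :=
        ⟨_, Multiset.mem_cons_self _ _, by simp [Node.chans]⟩
      have hxc : x ∈ Config.chans (.proc y (.fwd (.chan y) (.chan x)) d ::ₘ U₁) :=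
        ⟨_, Multiset.mem_cons_self _ _, by simp [Node.chans, Proc.chans, Ref.chans]⟩
      have hy' := k₁.unrel y hyc ho
      have hx' := k₁.unrel x hxc hx
      refine ⟨_, .inl rfl, S₁, Multiset.map (Node.map (ren y x)) W₁,
        Multiset.map (Node.map (ren y x)) U₁, S₂, W₂, U₂, ?_, rfl, hS, ?_, k₂⟩
      · rw [Multiset.map_add, Multiset.map_add, map_ren_eq_self hy'.2]
      · have k := (k₁.mono (W' := W₁) (U' := U₁) (fun n => id) (fun _ => .inr)
          fun n hn => by simp [hn]).ren hl (I' := I) (fun c => .inl) (.inr hy'.2)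
          (.inr ⟨hx'.1, hy'.2⟩) ?_ (.inr hx')
        · rwa [map_ren_eq_self hy'.2] at k
        · intro m hm hp
          rcases k₁.high _ hm with h | ⟨m', e, -, -, -, -, h'⟩
          · exact h.elim
          · cases e
            exact ⟨fun e => h' (e ▸ hxc), fun e => h' (e ▸ hyc)⟩
  · have hf : Hides ξ (ren y x) := ⟨ren_lvl hl, fun c hc => ren_of_ne (by rintro rfl; exact ho hc)⟩
    have hrel : ∀ {S : Config L}, (∀ n ∈ S, n ∈ T) →
        Multiset.Rel (NodeEq ξ) (Multiset.map (Node.map (ren y x)) S) S := by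
      intro S hS
      rw [Multiset.rel_map_left]
      refine Multiset.rel_refl_of_refl_on fun n hn => (nodeEq_ren hl ho ?_).symm
      exact f₃ n (by simp [hS n hn])
    have : IsTrans (Node L) (NodeEq ξ) := ⟨fun _ _ _ => NodeEq.trans⟩
    have hrt : ∀ {S S' : Config L}, (∀ n ∈ S, n ∈ T) → Multiset.Rel (NodeEq ξ) S S' →
        Multiset.Rel (NodeEq ξ) (Multiset.map (Node.map (ren y x)) S) S' := fun h h' =>
      Multiset.Rel.trans _ (hrel h) h'
    rcases cons_eq_add e₁ with ⟨S₁, rfl, rfl⟩ | ⟨W₁, rfl, rfl⟩ | ⟨U₁, rfl, rfl⟩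
    · obtain ⟨π, S₂, hπ, rfl, hS'⟩ := rel_cons hS
      refine ⟨_, .inl rfl, _, _, _, S₂, W₂,
        (Node.proc y (.fwd (.chan y) (.chan x)) d).map π ::ₘ U₂,
        by rw [Multiset.map_add, Multiset.map_add],
        by simp only [Multiset.cons_add, Multiset.add_cons],
        hrt (fun n hn => by simp [hn]) hS',
        (k₁.mono (fun n hn => by simp [hn]) (fun _ => .inr) fun _ => id).map hf, ?_⟩
      -- The forwarder that the second run keeps has lost its partner; all its channels are secret,
      -- so it can join `U`.
      refine k₂.update (Z := ∅) (fun n hn => k₂.low n (by simp [hn])) (fun _ => .inr)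
        (fun c ⟨n, hn, hc⟩ _ => .inl ⟨n, by simp [hn], hc⟩) ?_ (by simp) (by simp)
      rintro c ⟨n, hn, hc⟩ hlc
      rcases Multiset.mem_cons.1 hn with rfl | hn
      · exfalso
        rw [Node.chans_map] at hc
        obtain ⟨c, hc, rfl⟩ := hc
        rw [hπ.1] at hlc
        simp only [Node.chans, Proc.chans, Ref.chans, Set.mem_union, Set.mem_singleton_iff] at hc
        rcases hc with rfl | rfl | rfl
        · exact ho hlc
        · exact ho hlc
        · exact ho (hl ▸ hlc)
      · exact .inl ⟨n, hn, hc⟩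
    · exact ⟨_, .inl rfl, _, _, _, S₂, W₂, U₂, by rw [Multiset.map_add, Multiset.map_add], rfl,
        hrt (fun n hn => by simp [hn]) hS,
        (k₁.mono (W' := W₁) (fun _ => id) (fun n hn => .inr (by simp [hn])) fun _ => id).map hf, k₂⟩
    · exact ⟨_, .inl rfl, _, _, _, S₂, W₂, U₂, by rw [Multiset.map_add, Multiset.map_add], rfl,
        hrt (fun n hn => by simp [hn]) hS,
        (k₁.mono (U' := U₁) (fun _ => id) (fun _ => .inr) fun n hn => by simp [hn]).map hf, k₂⟩

/-- Every step of one run is matched by at most one step of the other run. -/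
theorem Agree.step {D₁ R₁ D₂ R₂ D₁' : Config L} {keep : Set (Chan L)}
    (h₁ : Inside τ₁ r₁ I D₁ R₁ w₁) (h₂ : Inside τ₂ r₂ I D₂ R₂ w₂) (h : Agree ξ I D₁ D₂)
    (hs : Step (Config.names (D₁ + R₁)) keep D₁ D₁') :
    ∃ D₁'' D₂'', Step (Config.names (D₁ + R₁)) keep D₁ D₁'' ∧
      (D₂'' = D₂ ∨ Step (Config.names (D₂ + R₂)) keep D₂ D₂'') ∧ Agree ξ I D₁'' D₂'' := by
  rcases hs.inv with ⟨T, y, x, d, hy, rfl, rfl⟩ | ⟨n, b, T, hr, rfl, rfl⟩ | ⟨m, n, n', T, hr, rfl, rfl⟩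
  · obtain ⟨D₂', h', h''⟩ := h.fwd h₁ h₂ hy
    exact ⟨_, D₂', hs, h', h''⟩
  · obtain ⟨b₁, D₂', hb, h', h''⟩ := h.red1 h₁ h₂ hr
    exact ⟨_, D₂', hb.step T, h'.imp id fun h => h keep, h''⟩
  · obtain ⟨D₂', h', h''⟩ := h.red2 h₁ hr
    exact ⟨_, D₂', hs, h'.imp id fun h => h keep, h''⟩

end Sim

end SecSess

/-! ### Related runs, their normal forms, and what they have in common at the interface -/

namespace SecSess

universe u

set_option linter.unusedSectionVars false

variable {L : Type u} [Lattice L]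

variable {τ : Chan L → Ty} {r : Chan L → ℕ} {w : Chan L} {ξ : L} {Δ : Ctx L} {K : RIface L}
  {s t : Triple L}

/-! ## Related divided configurations -/

/-- The channels of an interface. -/
def iface (Δ : Ctx L) (K : RIface L) : Set (Chan L) := Ctx.chans Δ ∪ Ctx.chans (RIface.ctx K)

theorem Triple.all_eq (t : Triple L) : t.all = t.D + (t.C + t.F) := by
  rw [Triple.all]; abel

theorem St.wt' (H : St τ r Δ K t w) : Wt τ r (t.D + (t.C + t.F)) w := t.all_eq ▸ H.wt

theorem St.Δ_disjoint (H : St τ r Δ K t w) {c : Chan L} (hc : c ∈ Ctx.fst Δ) :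
    c ∉ Config.offers t.D := fun h =>
  H.wt'.offers_disjoint h (by simp [H.mem_Δ hc])

theorem St.nodup_left (H : St τ r Δ K t w) : (Ctx.fst Δ + Config.offers t.D).Nodup := by
  refine Multiset.nodup_of_le ?_ H.wt.nodup
  have h : Config.offers t.C = Ctx.fst Δ + Config.usesM t.C := by
    simpa [Bal] using H.balC
  rw [St.offers_all, h]
  calc _ ≤ Ctx.fst Δ + Config.offers t.D + (Config.usesM t.C + Config.offers t.F) :=
        Multiset.le_add_right _ _
    _ = _ := by abel

theorem St.nodup_right (H : St τ r Δ K t w) : (RIface.root K w + Config.usesM t.D).Nodup := by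
  have := H.nodup_left
  rwa [H.balD] at this

theorem RIface.ctx_subset_root {c : Chan L} (hc : c ∈ Ctx.fst (RIface.ctx K)) (w : Chan L) :
    c ∈ RIface.root K w := by
  cases K <;> simp_all [RIface.ctx, RIface.root]

theorem St.inside (H : St τ r Δ K t w) : Inside τ r (iface Δ K) t.D (t.C + t.F) w where
  wt := H.wt'
  sub c hc := by
    rw [← Triple.all_eq]
    rcases hc with hc | hc
    · rw [St.offers_all]
      simp [H.mem_Δ (Ctx.mem_fst.2 hc)]
    · exact H.mem_K (Ctx.mem_fst.2 hc)
  half c hc ho := by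
    rcases hc with hc | hc
    · exact absurd ho (H.Δ_disjoint (Ctx.mem_fst.2 hc))
    · exact Multiset.disjoint_left.1 (Multiset.nodup_add.1 H.nodup_right).2.2
        (RIface.ctx_subset_root (Ctx.mem_fst.2 hc) w)

/-- Two well-typed divided configurations with an observable interface whose partial programs
agree. -/
structure Related (ξ : L) (Δ : Ctx L) (K : RIface L) (s t : Triple L) : Prop where
  obs : ∀ c ∈ iface Δ K, c.lvl ≤ ξ
  st₁ : ∃ τ r w, St τ r Δ K s w
  st₂ : ∃ τ r w, St τ r Δ K t w
  agree : Agree ξ (iface Δ K) s.D t.D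

theorem Related.symm (h : Related ξ Δ K s t) : Related ξ Δ K t s :=
  ⟨h.obs, h.st₂, h.st₁, h.agree.symm⟩

theorem St.step_of {s' : Triple L} (h : ∃ τ r w, St τ r Δ K s w) (hs : TStep Δ K s s') :
    ∃ τ r w, St τ r Δ K s' w := by
  obtain ⟨τ, r, w, h⟩ := h
  exact h.step hs

/-- Steps of the closing configurations do not concern the other run. A step of the program is
answered by `Agree.step`, which may exchange it for one with another spawned name; therefore the
reached triple is existentially quantified. -/
theorem Related.step {s₁ : Triple L} (h : Related ξ Δ K s t) (hs : TStep Δ K s s₁) :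
    ∃ s' t', TStep Δ K s s' ∧ (t' = t ∨ TStep Δ K t t') ∧ Related ξ Δ K s' t' := by
  cases hs with
  | left h' => exact ⟨_, t, .left h', .inl rfl, h.obs, St.step_of h.st₁ (.left h'), h.st₂, h.agree⟩
  | right h' =>
    exact ⟨_, t, .right h', .inl rfl, h.obs, St.step_of h.st₁ (.right h'), h.st₂, h.agree⟩
  | @mid C D F D' h' =>
    obtain ⟨τ₁, r₁, w₁, H₁⟩ := h.st₁
    obtain ⟨τ₂, r₂, w₂, H₂⟩ := h.st₂
    obtain ⟨C₂, D₂, F₂⟩ := t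
    have e : ∀ C D F : Config L, D + (C + F) = C + D + F := fun C D F => by abel
    obtain ⟨D₁'', D₂'', k₁, k₂, k₃⟩ := h.agree.step (keep := Ctx.chans (RIface.ctx K))
      H₁.inside H₂.inside (by rw [e]; exact h')
    rw [e] at k₁ k₂
    have j₁ : TStep Δ K ⟨C, D, F⟩ ⟨C, D₁'', F⟩ := .mid k₁
    refine ⟨⟨C, D₁'', F⟩, ⟨C₂, D₂'', F₂⟩, j₁, ?_, h.obs, H₁.step j₁, ?_, k₃⟩
    · rcases k₂ with rfl | k₂
      · exact .inl rfl
      · exact .inr (.mid k₂)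
    · rcases k₂ with rfl | k₂
      · exact h.st₂
      · exact H₂.step (.mid k₂)

/-- Related configurations run to related configurations that cannot take a step. -/
theorem Related.run (h : Related ξ Δ K s t) : ∃ s' t',
    Relation.ReflTransGen (TStep Δ K) s s' ∧ Relation.ReflTransGen (TStep Δ K) t t' ∧
    Normal Δ K s' ∧ Normal Δ K t' ∧ Related ξ Δ K s' t' ∧
    Config.size s'.all + Config.size t'.all ≤ Config.size s.all + Config.size t.all := by
  induction hk : Config.size s.all + Config.size t.all using Nat.strong_induction_on
    generalizing s t with
  | _ k ih =>
    subst hk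
    by_cases hs : Normal Δ K s
    · by_cases ht : Normal Δ K t
      · exact ⟨s, t, .refl, .refl, hs, ht, h, le_rfl⟩
      -- The first run is at its end, and the simulation is applied in the other direction. The
      -- joint size decreases whichever run leads, so the process ends.
      · simp only [Normal, not_forall, not_not] at ht
        obtain ⟨t₁, ht⟩ := ht
        obtain ⟨t', s', h₁, h₂, h₃⟩ := h.symm.step ht
        have hl := h₁.size_lt
        have hl' : Config.size s'.all ≤ Config.size s.all := by
          rcases h₂ with rfl | h₂
          · exact le_rfl
          · exact h₂.size_lt.le
        obtain ⟨s'', t'', k₁, k₂, k₃, k₄, k₅, k₆⟩ := ih _ (by omega) h₃.symm rfl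
        refine ⟨s'', t'', ?_, .head h₁ k₂, k₃, k₄, k₅, by omega⟩
        rcases h₂ with rfl | h₂
        · exact k₁
        · exact .head h₂ k₁
    · simp only [Normal, not_forall, not_not] at hs
      obtain ⟨s₁, hs⟩ := hs
      obtain ⟨s', t', h₁, h₂, h₃⟩ := h.step hs
      have hl := h₁.size_lt
      have hl' : Config.size t'.all ≤ Config.size t.all := by
        rcases h₂ with rfl | h₂
        · exact le_rfl
        · exact h₂.size_lt.le
      obtain ⟨s'', t'', k₁, k₂, k₃, k₄, k₅, k₆⟩ := ih _ (by omega) h₃ rfl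
      refine ⟨s'', t'', .head h₁ k₁, ?_, k₃, k₄, k₅, by omega⟩
      rcases h₂ with rfl | h₂
      · exact k₂
      · exact .head h₂ k₂

/-! ## Moving messages across the interface -/

/-- A message that both programs obtain from outside is observable and identical, so it joins `S`.
Its channels are interface channels or new to the program, hence not among the observable channels
that `W` and `U` keep to themselves. -/
theorem Agree.insert {I I' : Set (Chan L)} {D₁ D₂ : Config L} {m : Msg L} (h : Agree ξ I D₁ D₂)
    (hm : ∀ c ∈ (Node.msg m).chans, c.lvl ≤ ξ)
    (hI' : ∀ c ∈ I', c ∈ I ∨ c ∈ (Node.msg m).chans)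
    (h₁ : ∀ c ∈ (Node.msg m).chans, c ∈ I ∨ c ∉ Config.chans D₁)
    (h₂ : ∀ c ∈ (Node.msg m).chans, c ∈ I ∨ c ∉ Config.chans D₂) :
    Agree ξ I' (.msg m ::ₘ D₁) (.msg m ::ₘ D₂) := by
  obtain ⟨S₁, W₁, U₁, S₂, W₂, U₂, rfl, rfl, hS, k₁, k₂⟩ := h
  have key : ∀ {S W U : Config L}, Side ξ I S W U →
      (∀ c ∈ (Node.msg m).chans, c ∈ I ∨ c ∉ Config.chans (S + W + U)) →
      Side ξ I' (.msg m ::ₘ S) W U := by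
    intro S W U k hf
    refine ⟨fun n hn => ?_, fun n hn => ?_, fun c hc hl => ?_⟩
    · rcases Multiset.mem_cons.1 hn with rfl | hn
      · exact hm _ m.carrier_mem
      · exact k.low n hn
    · rcases k.high n hn with h | ⟨m', rfl, a₁, a₂, a₃, a₄, a₅⟩
      · exact .inl h
      · have hno : m'.offer ∉ (Node.msg m).chans := fun hc =>
          (hf _ hc).elim a₃ fun h => h ⟨.msg m', by simp [hn], m'.offer_mem⟩
        refine .inr ⟨m', rfl, a₁, a₂, fun h => (hI' _ h).elim a₃ hno, ?_, a₅⟩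
        rintro ⟨n, hn, hc⟩
        rcases Multiset.mem_cons.1 hn with rfl | hn
        · exact hno hc
        · exact a₄ ⟨n, hn, hc⟩
    · have hno : c ∉ (Node.msg m).chans := fun h => (hf _ h).elim (k.unrel c hc hl).1
        fun h' => h' (by obtain ⟨n, hn, h⟩ := hc; exact ⟨n, by simp [hn], h⟩)
      refine ⟨fun h => (hI' _ h).elim (k.unrel c hc hl).1 hno, ?_⟩
      rintro ⟨n, hn, hc'⟩
      rcases Multiset.mem_cons.1 hn with rfl | hn
      · exact hno hc'
      · exact (k.unrel c hc hl).2 ⟨n, hn, hc'⟩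
  exact ⟨.msg m ::ₘ S₁, W₁, U₁, .msg m ::ₘ S₂, W₂, U₂, by simp [Multiset.cons_add],
    by simp [Multiset.cons_add], .cons (.refl _) hS, key k₁ h₁, key k₂ h₂⟩

/-- The invariants treat channels of `S` and interface channels alike, so channels of removed nodes
of `S` may become interface channels. -/
theorem Side.restrict {I I' : Set (Chan L)} {S S' W U : Config L} (h : Side ξ I S W U)
    (hS : ∀ n ∈ S', n ∈ S) (hI : ∀ c ∈ I', c ∈ I ∨ c ∈ Config.chans S) : Side ξ I' S' W U := by
  have hc : ∀ c, c ∈ Config.chans S' → c ∈ Config.chans S := fun c ⟨n, hn, hc⟩ => ⟨n, hS n hn, hc⟩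
  refine ⟨fun n hn => h.low n (hS n hn), fun n hn => ?_, fun c hc' hl => ?_⟩
  · rcases h.high n hn with h | ⟨m', rfl, a₁, a₂, a₃, a₄, a₅⟩
    · exact .inl h
    · exact .inr ⟨m', rfl, a₁, a₂, fun h => (hI _ h).elim a₃ a₄, fun h => a₄ (hc _ h), a₅⟩
  · have := h.unrel c hc' hl
    exact ⟨fun h => (hI _ h).elim this.1 this.2, fun h => this.2 (hc _ h)⟩

/-- An observable node that communicates across the interface occurs in both programs. -/
theorem Agree.take {I : Set (Chan L)} {D₁ D₂ : Config L} {n : Node L} (h : Agree ξ I D₁ D₂)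
    (hn : n ∈ D₁) (hobs : ∀ c ∈ n.chans, c.lvl ≤ ξ) (hI : ∃ c ∈ n.chans, c ∈ I)
    (hh : ¬ n.High ξ) (hp : ∀ m, n = .msg m → m.Positive → m.offer ∈ I) :
    ∃ S₁ W₁ U₁ S₂ W₂ U₂ : Config L, D₁ = n ::ₘ S₁ + W₁ + U₁ ∧ D₂ = n ::ₘ S₂ + W₂ + U₂ ∧
      Multiset.Rel (NodeEq ξ) S₁ S₂ ∧ Side ξ I (n ::ₘ S₁) W₁ U₁ ∧ Side ξ I (n ::ₘ S₂) W₂ U₂ := by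
  obtain ⟨S₁, W₁, U₁, S₂, W₂, U₂, rfl, rfl, hS, k₁, k₂⟩ := h
  simp only [Multiset.mem_add] at hn
  rcases hn with (hn | hn) | hn
  · obtain ⟨S₁, rfl⟩ := Multiset.exists_cons_of_mem hn
    obtain ⟨π, S₂, hπ, rfl, hS'⟩ := rel_cons hS
    rw [Node.map_eq_self fun c hc => hπ.2 c (hobs c hc)] at k₂ ⊢
    exact ⟨S₁, W₁, U₁, S₂, W₂, U₂, rfl, rfl, hS', k₁, k₂⟩
  · rcases k₁.high n hn with h | ⟨m, rfl, h₁, h₂, h₃, -⟩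
    · exact absurd h hh
    · exact absurd (hp m rfl h₁) h₃
  · obtain ⟨c, hc, hI⟩ := hI
    exact absurd hI (k₁.unrel c ⟨n, hn, hc⟩ (hobs c hc)).1

theorem Agree.erase {I : Set (Chan L)} {D₁ D₂ : Config L} {n : Node L} (h : Agree ξ I D₁ D₂)
    (hn : n ∈ D₁) (hobs : ∀ c ∈ n.chans, c.lvl ≤ ξ) (hI : ∃ c ∈ n.chans, c ∈ I)
    (hh : ¬ n.High ξ) (hp : ∀ m, n = .msg m → m.Positive → m.offer ∈ I) :
    ∃ D₁' D₂' : Config L, D₁ = D₁' + {n} ∧ D₂ = D₂' + {n} ∧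
      ∀ I' : Set (Chan L), (∀ c ∈ I', c ∈ I ∨ c ∈ n.chans) → Agree ξ I' D₁' D₂' := by
  obtain ⟨S₁, W₁, U₁, S₂, W₂, U₂, rfl, rfl, hS, k₁, k₂⟩ := h.take hn hobs hI hh hp
  refine ⟨S₁ + W₁ + U₁, S₂ + W₂ + U₂, by rw [← Multiset.singleton_add]; abel,
    by rw [← Multiset.singleton_add]; abel, fun I' hI' =>
    ⟨S₁, W₁, U₁, S₂, W₂, U₂, rfl, rfl, hS, k₁.restrict (by simp +contextual) ?_,
      k₂.restrict (by simp +contextual) ?_⟩⟩ <;>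
  exact fun c hc => (hI' c hc).imp id fun h => ⟨n, by simp, h⟩

/-! ## Subtrees -/

/-- The channels below `x`. -/
inductive Reach (D : Config L) (x : Chan L) : Chan L → Prop
  | refl : Reach D x x
  | step (n : Node L) (c : Chan L) : Reach D x n.offer → n ∈ D → c ∈ n.usesM → Reach D x c

/-- A node with observable channels only is fixed by every hiding renaming, so it is its own
partner. These nodes form the literally common part `O`. -/
theorem rel_split {S₁ S₂ : Config L} (h : Multiset.Rel (NodeEq ξ) S₁ S₂) :
    ∃ O N₁ N₂ : Config L, S₁ = O + N₁ ∧ S₂ = O + N₂ ∧ Multiset.Rel (NodeEq ξ) N₁ N₂ ∧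
      (∀ n ∈ O, ∀ c ∈ n.chans, c.lvl ≤ ξ) ∧ (∀ n ∈ N₁, ∃ c ∈ n.chans, ¬ c.lvl ≤ ξ) ∧
      ∀ n ∈ N₂, ∃ c ∈ n.chans, ¬ c.lvl ≤ ξ := by
  induction h with
  | zero => exact ⟨0, 0, 0, by simp, by simp, .zero, by simp, by simp, by simp⟩
  | @cons a b as bs hab h ih =>
    obtain ⟨O, N₁, N₂, rfl, rfl, h₁, h₂, h₃, h₄⟩ := ih
    by_cases ha : ∀ c ∈ a.chans, c.lvl ≤ ξ
    · obtain rfl := hab.eq_of_obs ha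
      exact ⟨b ::ₘ O, N₁, N₂, by simp, by simp, h₁, by simpa using ⟨ha, h₂⟩, h₃, h₄⟩
    · refine ⟨O, a ::ₘ N₁, b ::ₘ N₂, by simp, by simp, .cons hab h₁, h₂, ?_, ?_⟩
      · push Not at ha
        simpa using ⟨ha, h₃⟩
      · have hb : ∃ c ∈ b.chans, ¬ c.lvl ≤ ξ := by
          by_contra hb
          push Not at hb
          obtain rfl := hab.symm.eq_of_obs hb
          exact ha hb
        simpa using ⟨hb, h₄⟩

/-- Levels do not increase from a node to its children. -/
theorem Ok.obs_of_offer {n : Node L} (h : Ok τ r n n.usesM) (ho : n.offer.lvl ≤ ξ) :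
    ∀ c ∈ n.chans, c.lvl ≤ ξ := by
  intro c hc
  by_cases e : c = n.offer
  · rwa [e]
  · exact (h.lvl c (Node.mem_usesM.2 ⟨hc, e⟩)).trans ho

/-- The nodes that offer a channel below an observable channel of an agreeing node are
observable. -/
theorem Side.mem_of_reach {I : Set (Chan L)} {O N W U : Config L} {m : Node L} {x : Chan L}
    (k : Side ξ I (m ::ₘ O + N) W U) (hm : ∀ c ∈ m.chans, c.lvl ≤ ξ)
    (hO : ∀ n ∈ O, ∀ c ∈ n.chans, c.lvl ≤ ξ) (hN : ∀ n ∈ N, ∃ c ∈ n.chans, ¬ c.lvl ≤ ξ)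
    (hx : x ∈ m.usesM) (hok : ∀ n ∈ m ::ₘ O + N + W + U, Ok τ r n n.usesM) {n : Node L}
    (hn : n ∈ m ::ₘ O + N + W + U) (hr : Reach O x n.offer) : n ∈ m ::ₘ O := by
  have key : ∀ c, Reach O x c → c.lvl ≤ ξ ∧ c ∈ Config.chans (m ::ₘ O + N) := by
    intro c hc
    cases hc with
    | refl =>
      have := (Node.mem_usesM.1 hx).1
      exact ⟨hm _ this, m, by simp, this⟩
    | step n c h hn hc =>
      have := (Node.mem_usesM.1 hc).1
      exact ⟨hO n hn _ this, n, by simp [hn], this⟩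
  obtain ⟨ho, hc⟩ := key _ hr
  have hobs := (hok n hn).obs_of_offer ho
  rw [Multiset.mem_add, Multiset.mem_add, Multiset.mem_add] at hn
  rcases hn with ((hn | hn) | hn) | hn
  · exact hn
  · obtain ⟨c, hc, h⟩ := hN n hn
    exact absurd (hobs c hc) h
  · exfalso
    rcases k.high n hn with h | ⟨m', rfl, -, -, -, h, -⟩
    · have hokn := hok n (by simp [hn])
      cases n with
      | msg m => exact h.elim
      | proc y P d =>
        rcases h with h | ⟨c, h, h'⟩
        · exact h (hokn.sec.trans ho)
        · exact h (hobs c h'.mem)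
    · exact h hc
  · exact ((k.unrel _ ⟨n, hn, n.offer_mem⟩ ho).2 hc).elim

end SecSess

/-! ### Common subtrees, and messages at the interface -/

namespace SecSess

universe u

set_option linter.unusedSectionVars false

variable {L : Type u} [Lattice L]

variable {τ : Chan L → Ty} {r : Chan L → ℕ} {w : Chan L} {ξ : L} {Δ : Ctx L} {K : RIface L}
  {s t : Triple L}

theorem Reach.rank_le {D : Config L} {x c : Chan L} (h : Reach D x c)
    (hok : ∀ n ∈ D, Ok τ r n n.usesM) : r c ≤ r x := by
  induction h with
  | refl => exact le_rfl
  | step n c _ hn hc ih => exact ((hok n hn).rank c hc).le.trans ih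

/-- The part of a context that the tree below `x` uses. -/
noncomputable def Ctx.below (Δ : Ctx L) (T : Config L) (x : Chan L) : Ctx L :=
  open Classical in Multiset.filter (fun p => p.1 ∈ x ::ₘ Config.usesM T) Δ

/-- The rest of a context. -/
noncomputable def Ctx.beside (Δ : Ctx L) (T : Config L) (x : Chan L) : Ctx L :=
  open Classical in Multiset.filter (fun p => ¬ p.1 ∈ x ::ₘ Config.usesM T) Δ

theorem Ctx.beside_add_below (Δ : Ctx L) (T : Config L) (x : Chan L) :
    Δ.beside T x + Δ.below T x = Δ := by
  classical
  rw [add_comm]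
  exact Multiset.filter_add_not _ _

/-- Both sides of the balance are duplicate-free, so memberships suffice. A channel that the tree
uses is a channel of `Δ` or is offered in the program, and in the latter case `h₁` puts its provider
into the tree. -/
theorem St.bal_tree (H : St τ r Δ K t w) {m : Node L} {T D' : Config L} {x : Chan L}
    (hD : t.D = m ::ₘ (T + D')) (hx : x ∈ m.usesM)
    (h₁ : ∀ n ∈ t.D, n.offer ∈ x ::ₘ Config.usesM T → n ∈ T)
    (h₂ : ∀ n ∈ T, n.offer ∈ x ::ₘ Config.usesM T) :
    Bal (Ctx.fst (Δ.below T x)) T {x} := by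
  classical
  have hle : Δ.below T x ≤ Δ := Multiset.filter_le _ _
  have hle' : Ctx.fst (Δ.below T x) ≤ Ctx.fst Δ := Multiset.map_le_map hle
  have hx' : ({x} : Multiset (Chan L)) + Config.usesM T ≤ Config.usesM t.D := by
    rw [hD, Config.usesM_cons, Config.usesM_add]
    exact add_le_add (Multiset.singleton_le.2 hx) (Multiset.le_add_right _ _)
  have n₁ : ({x} + Config.usesM T).Nodup :=
    Multiset.nodup_of_le (hx'.trans (Multiset.le_add_left _ _)) H.nodup_right
  have n₂ : (Ctx.fst (Δ.below T x) + Config.offers T).Nodup := by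
    refine Multiset.nodup_of_le (add_le_add hle' ?_) H.nodup_left
    rw [hD, Config.offers_cons, Config.offers_add]
    exact (Multiset.le_add_right _ _).trans (Multiset.le_cons_self _ _)
  refine (Multiset.Nodup.ext n₂ n₁).2 fun c => ?_
  rw [Multiset.singleton_add]
  constructor
  · intro hc
    rcases Multiset.mem_add.1 hc with hc | hc
    · obtain ⟨A, hA⟩ := Ctx.mem_fst.1 hc
      exact (Multiset.mem_filter.1 hA).2
    · obtain ⟨n, hn, rfl⟩ := Config.mem_offers.1 hc
      exact h₂ n hn
  · intro hc
    have hu : c ∈ Config.usesM t.D := Multiset.mem_of_le hx' (by rwa [Multiset.singleton_add])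
    rw [Multiset.mem_add]
    rcases Multiset.mem_add.1 (H.uses_D_subset hu) with h | h
    · obtain ⟨A, hA⟩ := Ctx.mem_fst.1 h
      exact .inl (Ctx.mem_fst.2 ⟨A, Multiset.mem_filter.2 ⟨hA, hc⟩⟩)
    · obtain ⟨n, hn, rfl⟩ := Config.mem_offers.1 h
      exact .inr (Config.mem_offers_of_mem (h₁ n hn hc))

/-- The trees below an observable channel of an agreeing message coincide. -/
theorem Agree.subtree (h₁ : ∃ τ r w, St τ r Δ K s w) (h₂ : ∃ τ r w, St τ r Δ K t w)
    (h : Agree ξ (iface Δ K) s.D t.D) {m : Msg L} {x : Chan L} (hm : .msg m ∈ s.D)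
    (hobs : ∀ c ∈ (Node.msg m).chans, c.lvl ≤ ξ) (hI : m.carrier ∈ iface Δ K)
    (hp : m.Positive → m.offer ∈ iface Δ K) (hx : x ∈ (Node.msg m).usesM) :
    ∃ T D₁ D₂ : Config L, s.D = D₁ + T + {.msg m} ∧ t.D = D₂ + T + {.msg m} ∧
      (∀ I', Agree ξ I' T T) ∧
      (∀ I' : Set (Chan L), (∀ c ∈ I', c ∈ iface Δ K ∨ c ∈ (Node.msg m).chans) →
        Agree ξ I' D₁ D₂) ∧
      Bal (Ctx.fst (Δ.below T x)) T {x} := by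
  classical
  obtain ⟨S₁, W₁, U₁, S₂, W₂, U₂, e₁, e₂, hS, k₁, k₂⟩ := h.take hm hobs
    ⟨_, m.carrier_mem, hI⟩ (fun h => h) (fun m' e => by cases e; exact hp)
  obtain ⟨O, N₁, N₂, rfl, rfl, hN, hO, u₁, u₂⟩ := rel_split hS
  -- The tree is collected inside the common part `O`, so it is one and the same multiset for both
  -- runs; `key` then shows that neither run has further nodes below `x`.
  obtain ⟨T, hT⟩ : ∃ T, T = Multiset.filter (fun n : Node L => Reach O x n.offer) O := ⟨_, rfl⟩
  obtain ⟨O', hO'⟩ : ∃ O', O' = Multiset.filter (fun n : Node L => ¬ Reach O x n.offer) O :=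
    ⟨_, rfl⟩
  have hOT : O = T + O' := by rw [hT, hO', Multiset.filter_add_not]
  have reach : ∀ c, c ∈ x ::ₘ Config.usesM T → Reach O x c := by
    intro c hc
    rcases Multiset.mem_cons.1 hc with rfl | hc
    · exact .refl
    · obtain ⟨n, hn, hc⟩ := Config.mem_usesM.1 hc
      rw [hT, Multiset.mem_filter] at hn
      exact .step n c hn.2 hn.1 hc
  have reach' : ∀ c, Reach O x c → c ∈ x ::ₘ Config.usesM T := by
    intro c hc
    cases hc with
    | refl => simp
    | step n c h hn hc =>
      exact Multiset.mem_cons_of_mem (Config.mem_usesM.2 ⟨n, by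
        rw [hT]; exact Multiset.mem_filter.2 ⟨hn, h⟩, hc⟩)
  have key : ∀ {N W U : Config L} {t : Triple L}, (∃ τ r w, St τ r Δ K t w) →
      t.D = .msg m ::ₘ (O + N) + W + U → Side ξ (iface Δ K) (.msg m ::ₘ (O + N)) W U →
      (∀ n ∈ N, ∃ c ∈ n.chans, ¬ c.lvl ≤ ξ) →
      ∀ n ∈ t.D, n.offer ∈ x ::ₘ Config.usesM T → n ∈ T := by
    intro N W U t ⟨τ, r, w, H⟩ e k u n hn hc
    rw [← Multiset.cons_add] at k e
    have hr := reach _ hc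
    have hok := H.ok_D
    rw [e] at hn hok
    have := k.mem_of_reach hobs hO u hx hok hn hr
    rcases Multiset.mem_cons.1 this with rfl | hn'
    -- The message uses `x` and so has a higher rank; it cannot lie below `x`.
    · have a := hr.rank_le (τ := τ) (r := r) fun n hn => hok n (by simp [hn])
      have b := (hok (.msg m) (by simp)).rank x hx
      omega
    · rw [hT]; exact Multiset.mem_filter.2 ⟨hn', hr⟩
  have q₁ := key h₁ e₁ k₁ u₁
  refine ⟨T, O' + N₁ + W₁ + U₁, O' + N₂ + W₂ + U₂, ?_, ?_, fun I' => ?_, fun I' hI' => ?_, ?_⟩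
  · rw [e₁, hOT, ← Multiset.singleton_add]; abel
  · rw [e₂, hOT, ← Multiset.singleton_add]; abel
  · refine ⟨T, 0, 0, T, 0, 0, by simp, by simp, rel_nodeEq_refl T, ?_, ?_⟩ <;>
    exact ⟨fun n hn => k₁.low n (by simp [hOT, hn]), by simp, fun c ⟨n, hn, _⟩ => by simp at hn⟩
  · refine ⟨O' + N₁, W₁, U₁, O' + N₂, W₂, U₂, rfl, rfl, (rel_nodeEq_refl O').add hN,
      k₁.restrict ?_ ?_, k₂.restrict ?_ ?_⟩
    · intro n hn
      simp only [hOT, Multiset.mem_cons, Multiset.mem_add] at hn ⊢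
      tauto
    · exact fun c hc => (hI' c hc).imp id fun h => ⟨_, by simp, h⟩
    · intro n hn
      simp only [hOT, Multiset.mem_cons, Multiset.mem_add] at hn ⊢
      tauto
    · exact fun c hc => (hI' c hc).imp id fun h => ⟨_, by simp, h⟩
  · obtain ⟨τ, r, w, H⟩ := h₁
    refine H.bal_tree (m := .msg m) (D' := O' + N₁ + W₁ + U₁) ?_ hx q₁ fun n hn => ?_
    · rw [e₁, hOT, ← Multiset.singleton_add, ← Multiset.singleton_add]; abel
    · rw [hT] at hn
      exact reach' _ (Multiset.mem_filter.1 hn).2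

/-! ## Facts about the nodes at the interface -/

theorem Bal.erase {δ l δ' l' : Multiset (Chan L)} {D E : Config L} (h : Bal δ (D + E) l)
    (h' : δ' + l + Config.usesM E = δ + l' + Config.offers E) : Bal δ' D l' := by
  classical
  unfold Bal at *
  rw [Multiset.ext] at *
  intro c
  have h := h c
  have h' := h' c
  simp only [Config.offers_add, Config.usesM_add, Multiset.count_add] at *
  omega

theorem Bal.insert {δ l δ' l' : Multiset (Chan L)} {D E : Config L} (h : Bal δ D l)
    (h' : δ' + l + Config.offers E = δ + l' + Config.usesM E) : Bal δ' (D + E) l' := by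
  classical
  unfold Bal at *
  rw [Multiset.ext] at *
  intro c
  have h := h c
  have h' := h' c
  simp only [Config.offers_add, Config.usesM_add, Multiset.count_add] at *
  omega

/-- A channel of a closing configuration occurs in the partial program only if it belongs to the
interface. -/
theorem St.fresh (H : St τ r Δ K t w) {n : Node L} (hn : n ∈ t.C + t.F) {c : Chan L}
    (hc : c ∈ n.chans) : c ∈ iface Δ K ∨ c ∉ Config.chans t.D := by
  rw [or_iff_not_imp_right, not_not]
  rintro ⟨n', hn', hc'⟩
  have hw := H.wt'
  have hD : c ∈ Config.offers t.D ∨ c ∈ Config.usesM t.D := by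
    by_cases e : c = n'.offer
    · exact .inl (e ▸ Config.mem_offers_of_mem hn')
    · exact .inr (Config.mem_usesM.2 ⟨n', hn', Node.mem_usesM.2 ⟨hc', e⟩⟩)
  by_cases e : c = n.offer
  · have ho : c ∈ Config.offers (t.C + t.F) := e ▸ Config.mem_offers_of_mem hn
    have hu := hD.resolve_left fun h => hw.offers_disjoint h ho
    rcases Multiset.mem_add.1 (H.uses_D_subset hu) with h | h
    · exact .inl (Ctx.mem_fst.1 h)
    · exact (hw.offers_disjoint h ho).elim
  · have hu : c ∈ Config.usesM (t.C + t.F) :=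
      Config.mem_usesM.2 ⟨n, hn, Node.mem_usesM.2 ⟨hc, e⟩⟩
    have ho := hD.resolve_right fun h => hw.uses_disjoint h hu
    have : c ∈ RIface.root K w + Config.usesM t.D := by
      rw [← H.balD]; exact Multiset.mem_add.2 (.inr ho)
    rcases Multiset.mem_add.1 this with h | h
    · cases K with
      | some p => exact .inr (by simpa [RIface.root, RIface.ctx, Ctx.mem_chans_singleton] using h)
      | none =>
        obtain rfl : c = w := by simpa [RIface.root] using h
        exact (H.wt'.not_mem_uses_root (by simp only [Config.usesM_add, Multiset.mem_add] at hu ⊢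
                                           exact .inr hu)).elim
    · exact (hw.uses_disjoint h hu).elim

theorem St.msgOk (H : St τ r Δ K t w) {m : Msg L} (hm : .msg m ∈ t.all) :
    MsgOk τ (Node.msg m).usesM m := (H.wt.ok _ hm).msgOk

/-- A renaming that merges channels need not commute with taking client channels. It does here,
since the renamed annotation is a typing of the result and, without doom, must be the canonical one.
-/
theorem Wt.fwd {x y : Chan L} {d : L} {R : Config L}
    (H : Wt τ r (.proc y (.fwd (.chan y) (.chan x)) d ::ₘ R) w) :
    Wt τ r (Config.rename R y x) (ren y x w) ∧
      ∀ n ∈ R, (n.map (ren y x)).usesM = n.usesM.map (ren y x) := by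
  have h := H.typed
  rw [Config.ann, Multiset.map_cons] at h
  have h' := Typed.fwd h
  refine ⟨?_, fun n hn => ?_⟩
  · have := h'.wt
    rw [TConfig.cfg_map] at this
    simpa [TConfig.cfg, Config.rename] using this
  · have hm : (n.map (SecSess.ren y x), n.usesM.map (SecSess.ren y x)) ∈
        TConfig.map (SecSess.ren y x) (Multiset.map (fun n => (n, n.usesM)) R) :=
      Multiset.mem_map.2 ⟨(n, n.usesM), Multiset.mem_map.2 ⟨n, hn, rfl⟩, rfl⟩
    exact ((h'.ok _ hm).eq_usesM (h'.not_doomed _ (TConfig.mem_cfg.2 ⟨_, hm⟩))).symm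

theorem Related.obs_msg (h : Related ξ Δ K s t) {m : Msg L} (hm : .msg m ∈ s.all)
    (hc : m.carrier ∈ iface Δ K) : ∀ c ∈ (Node.msg m).chans, c.lvl ≤ ξ := by
  obtain ⟨τ, r, w, H⟩ := h.st₁
  intro c hc'
  rw [(H.msgOk hm).lvl_eq hc']
  exact h.obs _ hc

/-- A message of the closing configurations is received by the partial programs. -/
theorem Related.receive {Δ' : Ctx L} {K' : RIface L} {s' t' : Triple L} {m : Msg L}
    (h : Related ξ Δ K s t) (hm₁ : .msg m ∈ s.C + s.F) (hm₂ : .msg m ∈ t.C + t.F)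
    (hc : m.carrier ∈ iface Δ K) (h₁ : ∃ τ r w, St τ r Δ' K' s' w)
    (h₂ : ∃ τ r w, St τ r Δ' K' t' w) (e₁ : s'.D = .msg m ::ₘ s.D) (e₂ : t'.D = .msg m ::ₘ t.D)
    (hI : ∀ c ∈ iface Δ' K', c ∈ iface Δ K ∨ c ∈ (Node.msg m).chans) :
    Related ξ Δ' K' s' t' := by
  have hobs := h.obs_msg (by rw [Triple.all_eq]; exact Multiset.mem_add.2 (.inr hm₁)) hc
  refine ⟨fun c hc => (hI c hc).elim (h.obs c) (hobs c), h₁, h₂, ?_⟩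
  rw [e₁, e₂]
  obtain ⟨_, _, _, H₁⟩ := h.st₁
  obtain ⟨_, _, _, H₂⟩ := h.st₂
  exact h.agree.insert hobs hI (fun c => H₁.fresh hm₁) fun c => H₂.fresh hm₂

/-- A message of one of the partial programs to the closing configurations occurs in both. -/
theorem Related.sent {m : Msg L} (h : Related ξ Δ K s t) (hm : .msg m ∈ s.D ∨ .msg m ∈ t.D)
    (hc : m.carrier ∈ iface Δ K) (hp : m.Positive → m.offer ∈ iface Δ K) :
    ∃ D₁ D₂ : Config L, s.D = D₁ + {.msg m} ∧ t.D = D₂ + {.msg m} ∧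
      (∀ c ∈ (Node.msg m).chans, c.lvl ≤ ξ) ∧
      ∀ I' : Set (Chan L), (∀ c ∈ I', c ∈ iface Δ K ∨ c ∈ (Node.msg m).chans) →
        Agree ξ I' D₁ D₂ := by
  have key : ∀ {s t : Triple L}, Related ξ Δ K s t → .msg m ∈ s.D →
      ∃ D₁ D₂ : Config L, s.D = D₁ + {.msg m} ∧ t.D = D₂ + {.msg m} ∧
      (∀ c ∈ (Node.msg m).chans, c.lvl ≤ ξ) ∧
      ∀ I' : Set (Chan L), (∀ c ∈ I', c ∈ iface Δ K ∨ c ∈ (Node.msg m).chans) →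
        Agree ξ I' D₁ D₂ := by
    intro s t h hm
    have hobs := h.obs_msg (by simp [Triple.all, hm]) hc
    obtain ⟨D₁, D₂, e₁, e₂, h'⟩ := h.agree.erase hm hobs ⟨_, m.carrier_mem, hc⟩ (fun h => h)
      (fun m' e => by cases e; exact hp)
    exact ⟨D₁, D₂, e₁, e₂, hobs, h'⟩
  rcases hm with hm | hm
  · exact key h hm
  · obtain ⟨D₁, D₂, e₁, e₂, h₁, h₂⟩ := key h.symm hm
    exact ⟨D₂, D₁, e₂, e₁, h₁, fun I' hI' => (h₂ I' hI').symm⟩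

/-- The same for a message that sends a channel, with the tree that provides it. -/
theorem Related.sent_tree {m : Msg L} {x : Chan L} (h : Related ξ Δ K s t)
    (hm : .msg m ∈ s.D ∨ .msg m ∈ t.D)
    (hc : m.carrier ∈ iface Δ K) (hp : m.Positive → m.offer ∈ iface Δ K)
    (hx : x ∈ (Node.msg m).usesM) :
    ∃ T D₁ D₂ : Config L, s.D = D₁ + T + {.msg m} ∧ t.D = D₂ + T + {.msg m} ∧
      (∀ c ∈ (Node.msg m).chans, c.lvl ≤ ξ) ∧ (∀ I', Agree ξ I' T T) ∧
      (∀ I' : Set (Chan L), (∀ c ∈ I', c ∈ iface Δ K ∨ c ∈ (Node.msg m).chans) →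
        Agree ξ I' D₁ D₂) ∧
      Bal (Ctx.fst (Δ.below T x)) T {x} := by
  rcases hm with hm | hm
  · have hobs := h.obs_msg (by simp [Triple.all, hm]) hc
    obtain ⟨T, D₁, D₂, e₁, e₂, h₁, h₂, h₃⟩ := h.agree.subtree h.st₁ h.st₂ hm hobs hc hp hx
    exact ⟨T, D₁, D₂, e₁, e₂, hobs, h₁, h₂, h₃⟩
  · have h := h.symm
    have hobs := h.obs_msg (by simp [Triple.all, hm]) hc
    obtain ⟨T, D₁, D₂, e₁, e₂, h₁, h₂, h₃⟩ := h.agree.subtree h.st₁ h.st₂ hm hobs hc hp hx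
    exact ⟨T, D₂, D₁, e₂, e₁, hobs, h₁, fun I' hI' => (h₂ I' hI').symm, h₃⟩

end SecSess

/-! ### Typing after a message has crossed the interface -/

namespace SecSess

universe u

set_option linter.unusedSectionVars false

variable {L : Type u} [Lattice L]

variable {τ : Chan L → Ty} {r : Chan L → ℕ} {w : Chan L} {ξ : L} {Δ Δ' Δ'' : Ctx L} {K : RIface L}
  {s t : Triple L} {C D F C' C'' T T' D' : Config L} {y v x : Chan L} {A B : Ty}

/-! ## One run: communication across the interface -/

@[simp] theorem mem_iface_some {p : Chan L × Ty} {c : Chan L} :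
    c ∈ iface Δ (some p) ↔ c ∈ Ctx.chans Δ ∨ c = p.1 := by
  simp [iface, RIface.ctx, Ctx.mem_chans_singleton]

@[simp] theorem mem_iface_cons {p : Chan L × Ty} {c : Chan L} :
    c ∈ iface (p ::ₘ Δ) K ↔ c = p.1 ∨ c ∈ iface Δ K := by
  simp [iface, Ctx.mem_chans_cons, or_assoc]

theorem mem_iface_add {c : Chan L} :
    c ∈ iface (Δ + Δ') K ↔ c ∈ Ctx.chans Δ ∨ c ∈ iface Δ' K := by
  simp [iface, Ctx.mem_chans_add, or_assoc]

@[simp] theorem RIface.ctx_some (p : Chan L × Ty) : RIface.ctx (some p) = {p} := rfl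

@[simp] theorem RIface.root_some (p : Chan L × Ty) : RIface.root (some p) w = {p.1} := rfl

/-- Without its close message, the program has nothing left to provide; a balance with empty
right-hand side forces it and its context to be empty. -/
theorem St.oneR (H : St τ r Δ (some (y, .one)) ⟨C, D + {.msg (.close y)}, F⟩ w) :
    Δ = 0 ∧ C = 0 ∧ D = 0 := by
  have hm := (H.msgOk (m := .close y) (by simp [Triple.all])).1
  have hb : Bal (Ctx.fst Δ) D 0 := H.balD.erase (by simp [hm, Node.offer, Msg.offer])
  obtain ⟨rfl, h⟩ := eq_zero_of_bal' (fun n hn => H.ok_D n (by simp [hn])) hb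
  obtain rfl : Δ = 0 := by simpa [Ctx.fst] using h
  exact ⟨rfl, (eq_zero_of_bal' H.ok_C H.balC).1, rfl⟩

/-- The closed configuration, and with it the global typing, stays the same when a message changes
sides. Only the types of the new interface channels and the balances at the new boundary are left to
check, here and for the other connectives. -/
theorem St.plusR {I : Finset ℕ} {A : {ℓ // ℓ ∈ I} → Ty} {k : ℕ}
    (H : St τ r Δ (some (y, .plus I A)) ⟨C, D + {.msg (.selPos y k v)}, F⟩ w) :
    ∃ hk : k ∈ I, St τ r Δ (some (v, A ⟨k, hk⟩)) ⟨C, D, {.msg (.selPos y k v)} + F⟩ w := by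
  obtain ⟨hu, -, I', A', hk, h₁, h₂⟩ := H.msgOk (m := .selPos y k v) (by simp [Triple.all])
  have hy := H.tyK (y, .plus I A) (by simp)
  rw [h₁] at hy
  cases hy
  refine ⟨hk, ?_, H.tyΔ, by simpa using h₂, H.balC, ?_⟩
  · have := H.wt
    simpa only [Triple.all, add_assoc] using this
  · exact H.balD.erase (by simp [hu, Node.offer, Msg.offer]; abel)

theorem St.ampR {I : Finset ℕ} {A : {ℓ // ℓ ∈ I} → Ty} {k : {ℓ // ℓ ∈ I}}
    (H : St τ r Δ (some (y, .amp I A)) ⟨C, D, {.msg (.selNeg y k v)} + F⟩ w) :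
    St τ r Δ (some (v, A k)) ⟨C, D + {.msg (.selNeg y k v)}, F⟩ w := by
  obtain ⟨hu, -, I', A', hk, h₁, h₂⟩ := H.msgOk (m := .selNeg y k v) (by simp [Triple.all])
  have hy := H.tyK (y, .amp I A) (by simp)
  rw [h₁] at hy
  cases hy
  refine ⟨?_, H.tyΔ, by simpa using h₂, H.balC, ?_⟩
  · have := H.wt
    simpa only [Triple.all, add_assoc] using this
  · exact H.balD.insert (by simp [hu, Node.offer, Msg.offer]; abel)

theorem St.split_C (H : St τ r (Δ' + Δ'') K ⟨C, D, F⟩ w) :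
    ∃ C' C'' : Config L, C = C' + C'' ∧ CTyped 0 C' Δ' ∧ CTyped 0 C'' Δ'' := by
  obtain ⟨Δa, Δb, C', C'', h, rfl, h₁, h₂⟩ := H.ctyped_C.split
  obtain ⟨rfl, rfl⟩ : Δa = 0 ∧ Δb = 0 := by
    have := h.symm
    exact ⟨Multiset.le_zero.1 (this ▸ Multiset.le_add_right _ _),
      Multiset.le_zero.1 (this ▸ Multiset.le_add_left _ _)⟩
  exact ⟨C', C'', rfl, h₁, h₂⟩

/-- A typed part of the closed configuration contains no doomed process, so its typing yields a
balance in terms of mentioned channels. -/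
theorem St.bal_of_le (H : St τ r Δ K t w) {E : Config L} {Λ Λ' : Ctx L} (hE : E ≤ t.all)
    (h : CTyped Λ E Λ') : Bal (Ctx.fst Λ) E (Ctx.fst Λ') :=
  h.bal fun n hn => H.wt.alive n (Multiset.mem_of_le hE hn)

theorem Wt.tree_ctyped {E : Config L} (H : Wt τ r E w) (hT : T ≤ E) (hb : Bal (Ctx.fst Δ) T {x})
    (hΔ : ∀ p ∈ Δ, τ p.1 = p.2) (hx : τ x = A) : CTyped Δ T {(x, A)} :=
  .of_bal (fun n hn => H.ok n (Multiset.mem_of_le hT hn)) (by simpa using hb) hΔ (by simpa using hx)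

theorem St.tensorR (H : St τ r (Δ' + Δ'') (some (y, .tensor A B))
      ⟨C' + C'', D + T + {.msg (.sendPos x y v)}, F⟩ w)
    (h' : CTyped 0 C' Δ') (h'' : CTyped 0 C'' Δ'') (hT : Bal (Ctx.fst Δ'') T {x}) :
    CTyped Δ'' T {(x, A)} ∧
    St τ r Δ'' (some (x, A)) ⟨C'', T, C' + D + {.msg (.sendPos x y v)} + F⟩ w ∧
    St τ r Δ' (some (v, B)) ⟨C', D, C'' + T + {.msg (.sendPos x y v)} + F⟩ w := by
  obtain ⟨hu, -, -, h₁⟩ := H.msgOk (m := .sendPos x y v) (by simp [Triple.all])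
  have hy := H.tyK (y, .tensor A B) (by simp)
  rw [h₁] at hy
  cases hy
  have tyΔ' : ∀ p ∈ Δ', τ p.1 = p.2 := fun p hp => H.tyΔ p (by simp [hp])
  have tyΔ'' : ∀ p ∈ Δ'', τ p.1 = p.2 := fun p hp => H.tyΔ p (by simp [hp])
  refine ⟨H.wt.tree_ctyped ?_ hT tyΔ'' rfl, ⟨?_, tyΔ'', by simp, ?_, by simpa using hT⟩,
    ⟨?_, tyΔ', by simp, ?_, ?_⟩⟩
  · exact Multiset.le_iff_exists_add.2 ⟨C' + C'' + D + {.msg (.sendPos x y v)} + F, by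
      simp only [Triple.all]; abel⟩
  · convert H.wt using 1
    simp only [Triple.all]; abel
  · simpa using H.bal_of_le (Multiset.le_iff_exists_add.2 ⟨C' + (D + T + {.msg (.sendPos x y v)}) + F, by
      simp only [Triple.all]; abel⟩) h''
  · convert H.wt using 1
    simp only [Triple.all]; abel
  · simpa using H.bal_of_le (Multiset.le_iff_exists_add.2 ⟨C'' + (D + T + {.msg (.sendPos x y v)}) + F, by
      simp only [Triple.all]; abel⟩) h'
  -- The balances of the tree and the message are subtracted from that of the whole program; their
  -- contributions are added to both sides first.
  · have hb := H.balD
    unfold Bal at *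
    simp only [Config.offers_add, Config.usesM_add, Ctx.fst_add, Config.offers_singleton,
      Config.usesM_singleton, hu, Node.offer, Msg.offer, RIface.root_some] at hb ⊢
    apply add_right_cancel (b := Ctx.fst Δ'' + Config.offers T + {y})
    calc _ = Ctx.fst Δ' + Ctx.fst Δ'' + (Config.offers D + Config.offers T + {y}) := by abel
      _ = _ := by
        rw [hb, hT, Multiset.insert_eq_cons, ← Multiset.singleton_add]; abel

theorem St.lolliR (H : St τ r Δ (some (y, .lolli A B))
      ⟨C, D, T + {.msg (.sendNeg x y v)} + F⟩ w) (hT : CTyped 0 T {(x, A)}) :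
    St τ r ((x, A) ::ₘ Δ) (some (v, B)) ⟨C + T, D + {.msg (.sendNeg x y v)}, F⟩ w := by
  obtain ⟨hu, -, -, h₁⟩ := H.msgOk (m := .sendNeg x y v) (by simp [Triple.all])
  have hy := H.tyK (y, .lolli A B) (by simp)
  rw [h₁] at hy
  cases hy
  have hT' := H.bal_of_le (Multiset.le_iff_exists_add.2 ⟨C + D + {.msg (.sendNeg x y v)} + F, by
    simp only [Triple.all]; abel⟩) hT
  refine ⟨?_, ?_, by simp, ?_, ?_⟩
  · convert H.wt using 1
    simp only [Triple.all]; abel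
  · simpa using H.tyΔ
  · simpa [← Multiset.singleton_add, add_comm] using H.balC.add hT'
  · refine H.balD.insert ?_
    simp only [Config.offers_singleton, Config.usesM_singleton, hu, Node.offer, Msg.offer,
      RIface.root_some, Multiset.insert_eq_cons, ← Multiset.singleton_add, Ctx.fst_add,
      Ctx.fst_singleton]
    abel

theorem St.oneL (H : St τ r ((y, .one) ::ₘ Δ) K ⟨C + {.msg (.close y)}, D, F⟩ w) :
    St τ r Δ K ⟨C, {.msg (.close y)} + D, F⟩ w := by
  obtain ⟨hu, -⟩ := H.msgOk (m := .close y) (by simp [Triple.all])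
  refine ⟨?_, fun p hp => H.tyΔ p (by simp [hp]), H.tyK, ?_, ?_⟩
  · have := H.wt
    simpa only [Triple.all, add_assoc] using this
  · exact H.balC.erase (by simp [hu, Node.offer, Msg.offer, ← Multiset.singleton_add, add_comm])
  · rw [add_comm]
    refine H.balD.insert ?_
    simp [hu, Node.offer, Msg.offer, ← Multiset.singleton_add]
    abel

theorem St.plusL {I : Finset ℕ} {A : {ℓ // ℓ ∈ I} → Ty} {k : {ℓ // ℓ ∈ I}}
    (H : St τ r ((y, .plus I A) ::ₘ Δ) K ⟨C + {.msg (.selPos y k v)}, D, F⟩ w) :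
    St τ r ((v, A k) ::ₘ Δ) K ⟨C, {.msg (.selPos y k v)} + D, F⟩ w := by
  obtain ⟨hu, -, I', A', hk, h₁, h₂⟩ := H.msgOk (m := .selPos y k v) (by simp [Triple.all])
  have hy := H.tyΔ (y, .plus I A) (by simp)
  rw [h₁] at hy
  cases hy
  refine ⟨?_, ?_, H.tyK, ?_, ?_⟩
  · have := H.wt
    simpa only [Triple.all, add_assoc] using this
  · simpa using ⟨h₂, fun a b h => H.tyΔ (a, b) (by simp [h])⟩
  · refine H.balC.erase ?_
    simp [hu, Node.offer, Msg.offer, ← Multiset.singleton_add]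
    abel
  · rw [add_comm]
    refine H.balD.insert ?_
    simp [hu, Node.offer, Msg.offer, ← Multiset.singleton_add]
    abel

theorem St.ampL {I : Finset ℕ} {A : {ℓ // ℓ ∈ I} → Ty} {k : ℕ}
    (H : St τ r ((y, .amp I A) ::ₘ Δ) K ⟨C, D + {.msg (.selNeg y k v)}, F⟩ w) :
    ∃ hk : k ∈ I, St τ r ((v, A ⟨k, hk⟩) ::ₘ Δ) K ⟨C + {.msg (.selNeg y k v)}, D, F⟩ w := by
  obtain ⟨hu, -, I', A', hk, h₁, h₂⟩ := H.msgOk (m := .selNeg y k v) (by simp [Triple.all])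
  have hy := H.tyΔ (y, .amp I A) (by simp)
  rw [h₁] at hy
  cases hy
  refine ⟨hk, ?_, ?_, H.tyK, ?_, ?_⟩
  · convert H.wt using 1
    simp only [Triple.all]; abel
  · simpa using ⟨h₂, fun a b h => H.tyΔ (a, b) (by simp [h])⟩
  · refine H.balC.insert ?_
    simp [hu, Node.offer, Msg.offer, ← Multiset.singleton_add]
    abel
  · refine H.balD.erase ?_
    simp [hu, Node.offer, Msg.offer, ← Multiset.singleton_add]
    abel

theorem St.tensorL (H : St τ r ((y, .tensor A B) ::ₘ Δ) K
      ⟨C + T + {.msg (.sendPos x y v)}, D, F⟩ w) :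
    St τ r ((x, A) ::ₘ (v, B) ::ₘ Δ) K ⟨C + T, {.msg (.sendPos x y v)} + D, F⟩ w := by
  obtain ⟨hu, -, -, h₁⟩ := H.msgOk (m := .sendPos x y v) (by simp [Triple.all])
  have hy := H.tyΔ (y, .tensor A B) (by simp)
  rw [h₁] at hy
  cases hy
  refine ⟨?_, ?_, H.tyK, ?_, ?_⟩
  · have := H.wt
    simpa only [Triple.all, add_assoc] using this
  · simpa using fun a b h => H.tyΔ (a, b) (by simp [h])
  · refine H.balC.erase ?_
    simp [hu, Node.offer, Msg.offer, Multiset.insert_eq_cons, ← Multiset.singleton_add]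
    abel
  · show Bal _ ({.msg (.sendPos x y v)} + D) _
    rw [add_comm]
    refine H.balD.insert ?_
    simp [hu, Node.offer, Msg.offer, Multiset.insert_eq_cons, ← Multiset.singleton_add]
    abel

theorem St.lolliL (H : St τ r ((y, .lolli A B) ::ₘ Δ' + Δ'') K
      ⟨C' + C'', D + T + {.msg (.sendNeg x y v)}, F⟩ w)
    (h' : CTyped 0 C' ((y, .lolli A B) ::ₘ Δ')) (h'' : CTyped 0 C'' Δ'')
    (hT : Bal (Ctx.fst Δ'') T {x}) :
    CTyped Δ'' T {(x, A)} ∧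
    St τ r Δ'' (some (x, A)) ⟨C'', T, C' + {.msg (.sendNeg x y v)} + D + F⟩ w ∧
    St τ r ((v, B) ::ₘ Δ') K ⟨C' + C'' + T + {.msg (.sendNeg x y v)}, D, F⟩ w := by
  obtain ⟨hu, -, -, h₁⟩ := H.msgOk (m := .sendNeg x y v) (by simp [Triple.all])
  have hy := H.tyΔ (y, .lolli A B) (by simp)
  rw [h₁] at hy
  cases hy
  have tyΔ' : ∀ p ∈ Δ', τ p.1 = p.2 := fun p hp => H.tyΔ p (by simp [hp])
  have tyΔ'' : ∀ p ∈ Δ'', τ p.1 = p.2 := fun p hp => H.tyΔ p (by simp [hp])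
  have b' := H.bal_of_le (Multiset.le_iff_exists_add.2 ⟨C'' + (D + T + {.msg (.sendNeg x y v)}) + F, by
      simp only [Triple.all]; abel⟩) h'
  have b'' := H.bal_of_le (Multiset.le_iff_exists_add.2 ⟨C' + (D + T + {.msg (.sendNeg x y v)}) + F, by
      simp only [Triple.all]; abel⟩) h''
  refine ⟨H.wt.tree_ctyped ?_ hT tyΔ'' rfl, ⟨?_, tyΔ'', by simp, b'', by simpa using hT⟩,
    ⟨?_, ?_, H.tyK, ?_, ?_⟩⟩
  · exact Multiset.le_iff_exists_add.2 ⟨C' + C'' + D + {.msg (.sendNeg x y v)} + F, by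
      simp only [Triple.all]; abel⟩
  · convert H.wt using 1
    simp only [Triple.all]; abel
  · convert H.wt using 1
    simp only [Triple.all]; abel
  · simpa using fun a b h => tyΔ' (a, b) h
  · refine Bal.insert (l := {y} + Ctx.fst Δ' + {x}) (δ := 0) ?_ ?_
    · unfold Bal at *
      simp only [Config.offers_add, Config.usesM_add, Ctx.fst_zero, zero_add, Ctx.fst_add,
        Ctx.fst_singleton, ← Multiset.singleton_add] at *
      rw [b', b'']
      calc _ = {y} + Ctx.fst Δ' + Config.usesM C' + Config.usesM C'' +
            (Ctx.fst Δ'' + Config.offers T) := by abel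
        _ = _ := by rw [hT]; abel
    · simp [hu, Node.offer, Msg.offer, Multiset.insert_eq_cons, ← Multiset.singleton_add]
      abel
  · have hb := H.balD
    unfold Bal at *
    simp only [Config.offers_add, Config.usesM_add, Ctx.fst_add, Ctx.fst_singleton,
      Config.offers_singleton, Config.usesM_singleton, hu, Node.offer, Msg.offer,
      ← Multiset.singleton_add, Multiset.insert_eq_cons] at hb ⊢
    apply add_right_cancel (b := Ctx.fst Δ'' + Config.offers T + {y})
    calc _ = {y} + Ctx.fst Δ' + Ctx.fst Δ'' + (Config.offers D + Config.offers T + {v}) := by abel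
      _ = _ := by rw [hb, hT]; abel

/-- By linearity the message is the only client of `y` in the program. So the carrier does not go
with the tree when the context is split. -/
theorem St.lolliL_fst (H : St τ r ((y, .lolli A B) ::ₘ Δ) K
      ⟨C, D + T + {.msg (.sendNeg x y v)}, F⟩ w) : y ∉ x ::ₘ Config.usesM T := by
  obtain ⟨hu, -⟩ := H.msgOk (m := .sendNeg x y v) (by simp [Triple.all])
  have := (Multiset.nodup_add.1 H.nodup_right).2.1
  simp only [Config.usesM_add, Config.usesM_singleton, hu] at this
  obtain ⟨-, h₁, h₂⟩ := Multiset.nodup_add.1 this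
  have h₃ := (Multiset.nodup_add.1 (Multiset.nodup_add.1 this).1).2.1
  simp only [Multiset.insert_eq_cons, Multiset.nodup_cons, Multiset.mem_singleton] at h₁
  rw [Multiset.mem_cons, not_or]
  exact ⟨fun e => h₁.1 e.symm, fun h => Multiset.disjoint_left.1 h₂
    (Multiset.mem_add.2 (.inr h)) (by simp)⟩

end SecSess

/-! ### Typing and agreement after forwarding across the interface; sizes of interfaces -/

namespace SecSess

universe u

set_option linter.unusedSectionVars false

variable {L : Type u} [Lattice L]

variable {τ : Chan L → Ty} {r : Chan L → ℕ} {w : Chan L} {ξ : L} {Δ Δ' Δ'' : Ctx L} {K : RIface L}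
  {s t : Triple L} {C D F C₁ C₂ D₁ D₂ F₁ F₂ : Config L} {y v x : Chan L} {A B : Ty} {d : L}

/-! ## One run: forwarding across the interface -/

theorem Ctx.fst_ren (f : Chan L → Chan L) (Γ : Ctx L) :
    Ctx.fst (Ctx.ren f Γ) = (Ctx.fst Γ).map f := by
  simp [Ctx.ren, Ctx.fst]

theorem St.notMem_C (H : St τ r Δ K t w) {c : Chan L} (h : c ∉ Config.offers t.C) :
    c ∉ Config.chans t.C := by
  rintro ⟨n, hn, hc⟩
  by_cases e : c = n.offer
  · exact h (e ▸ Config.mem_offers_of_mem hn)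
  · exact h (H.uses_C_subset (Config.mem_usesM.2 ⟨n, hn, Node.mem_usesM.2 ⟨hc, e⟩⟩))

theorem notMem_chans {c : Chan L} (h₁ : c ∉ Config.offers D) (h₂ : c ∉ Config.usesM D) :
    c ∉ Config.chans D := by
  rintro ⟨n, hn, hc⟩
  by_cases e : c = n.offer
  · exact h₁ (e ▸ Config.mem_offers_of_mem hn)
  · exact h₂ (Config.mem_usesM.2 ⟨n, hn, Node.mem_usesM.2 ⟨hc, e⟩⟩)

/-- The forwarder offers `y` to the right, so no other node of the program and none of `C` mentions
it. The renaming thus acts at most on `F`, and on the root. -/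
theorem St.fwdR (H : St τ r Δ (some (y, A))
      ⟨C, D + {.proc y (.fwd (.chan y) (.chan x)) d}, F⟩ w) :
    Config.rename D y x = D ∧ x.lvl = y.lvl ∧
      St τ r Δ (some (x, A)) ⟨Config.rename C y x, Config.rename D y x, Config.rename F y x⟩
        (ren y x w) := by
  have hu := (H.ok_D (.proc y (.fwd (.chan y) (.chan x)) d) (by simp)).fwd_inv
  have hw : Wt τ r (.proc y (.fwd (.chan y) (.chan x)) d ::ₘ (C + D + F)) w := by
    convert H.wt using 1
    simp only [Triple.all, ← Multiset.singleton_add]; abel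
  have hC : Config.rename C y x = C := Config.rename_of_notMem <| H.notMem_C fun h =>
    H.wt'.offers_disjoint (c := y) (by simp [Node.offer]) (by simp [h])
  have hD : Config.rename D y x = D := by
    refine Config.rename_of_notMem (notMem_chans ?_ ?_)
    · have := (Multiset.nodup_add.1 H.nodup_left).2.1
      rw [Config.offers_add] at this
      exact fun h => Multiset.disjoint_left.1 (Multiset.nodup_add.1 this).2.2 h
        (by simp [Node.offer])
    · have := (Multiset.nodup_add.1 H.nodup_right).2.2
      have hy : y ∈ RIface.root (some (y, A)) w := by simp
      exact fun h => Multiset.disjoint_left.1 this hy (by simp [h])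
  refine ⟨hD, hu.2.2.1, ?_, H.tyΔ, ?_, ?_, ?_⟩
  · have := hw.fwd.1
    simpa [Config.rename, Triple.all] using this
  · have := H.tyK (y, A) (by simp)
    simpa [hu.2.2.2.1] using this
  · rw [hC]; exact H.balC
  · rw [hD]
    refine H.balD.erase ?_
    simp [hu.2.1, Node.offer]
    abel

theorem RIface.ctx_rename (K : RIface L) (y x : Chan L) :
    RIface.ctx (RIface.rename K y x) = Ctx.ren (ren y x) (RIface.ctx K) := by
  cases K <;> simp [RIface.rename, RIface.ctx, Ctx.ren]

theorem RIface.root_rename (K : RIface L) (y x : Chan L) :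
    RIface.root (RIface.rename K y x) (ren y x w) = (RIface.root K w).map (ren y x) := by
  cases K <;> simp [RIface.rename, RIface.root]

theorem Config.offers_rename (D : Config L) (y x : Chan L) :
    Config.offers (Config.rename D y x) = (Config.offers D).map (ren y x) := by
  simp [Config.offers, Config.rename, Node.offer_map]

theorem Config.usesM_rename (h : ∀ n ∈ D, (n.map (ren y x)).usesM = n.usesM.map (ren y x)) :
    Config.usesM (Config.rename D y x) = (Config.usesM D).map (ren y x) := by
  induction D using Multiset.induction with
  | empty => rfl
  | cons n D ih =>
    rw [Config.usesM_cons, Multiset.map_add, ← ih fun n hn => h n (by simp [hn]),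
      ← h n (by simp), ← Config.usesM_cons]
    simp [Config.rename]

/-- The channel `y` may be passed through the program to the right-hand side, which is why `K` is
renamed as well. The former client of `x` was the forwarder alone, so `x` does not occur in `D`. -/
theorem St.fwdL (H : St τ r ((y, A) ::ₘ Δ) K
      ⟨C + {.proc y (.fwd (.chan y) (.chan x)) d}, D, F⟩ w) :
    x.lvl = y.lvl ∧ x ∉ Config.chans D ∧ y ∉ Config.offers D ∧
      St τ r ((x, A) ::ₘ Δ) (RIface.rename K y x)
        ⟨Config.rename C y x, Config.rename D y x, Config.rename F y x⟩ (ren y x w) := by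
  have hu := (H.ok_C (.proc y (.fwd (.chan y) (.chan x)) d) (by simp)).fwd_inv
  have hw : Wt τ r (.proc y (.fwd (.chan y) (.chan x)) d ::ₘ (C + D + F)) w := by
    convert H.wt using 1
    simp only [Triple.all, ← Multiset.singleton_add]; abel
  obtain ⟨-, hxy, -, h₁, h₂, -⟩ := hw.fwd_facts
  have hyΔ : y ∉ Ctx.fst Δ := by
    have := (Multiset.nodup_add.1 H.nodup_left).1
    rw [Ctx.fst_cons, Multiset.nodup_cons] at this
    exact this.1
  have hCo : y ∉ Config.offers C := fun h => by
    obtain ⟨n, hn, e⟩ := Config.mem_offers.1 h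
    exact h₁ n (by simp [hn]) e.symm
  have hyD : y ∉ Config.offers D := fun h => by
    obtain ⟨n, hn, e⟩ := Config.mem_offers.1 h
    exact h₁ n (by simp [hn]) e.symm
  have hbC : Bal 0 C (x ::ₘ Ctx.fst Δ) := by
    refine H.balC.erase ?_
    simp [hu.2.1, Node.offer, ← Multiset.singleton_add]
    abel
  have hC : Config.rename C y x = C := by
    refine Config.rename_of_notMem (notMem_chans hCo fun h => hCo ?_)
    rw [Bal, zero_add] at hbC
    rw [hbC]; simp [h]
  have hxD : x ∉ Config.chans D := by
    refine notMem_chans (fun h => ?_) fun h => ?_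
    · have : x ∈ Config.offers C := by
        rw [Bal, zero_add] at hbC
        rw [hbC]; simp
      exact H.wt'.offers_disjoint h (by simp [this])
    · obtain ⟨n, hn, h⟩ := Config.mem_usesM.1 h
      exact h₂ n (by simp [hn]) h
  refine ⟨hu.2.2.1, hxD, hyD, ?_, ?_, ?_, ?_, ?_⟩
  · have := hw.fwd.1
    simpa [Config.rename, Triple.all] using this
  · have := H.tyΔ (y, A) (by simp)
    intro p hp
    rcases Multiset.mem_cons.1 hp with rfl | hp
    · exact hu.2.2.2.1.trans this
    · exact H.tyΔ p (by simp [hp])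
  · intro p hp
    rw [RIface.ctx_rename] at hp
    obtain ⟨q, hq, rfl⟩ := Multiset.mem_map.1 hp
    have := H.tyK q hq
    by_cases e : q.1 = y
    · simp only [e, ren_self]
      rw [hu.2.2.2.1, ← e, this]
    · simpa only [ren_of_ne e] using this
  · rw [hC, Ctx.fst_cons]; exact hbC
  · have hb := congrArg (Multiset.map (ren y x)) H.balD
    simp only [Multiset.map_add, Ctx.fst_cons, Multiset.map_cons, ren_self] at hb
    have e : (Ctx.fst Δ).map (ren y x) = Ctx.fst Δ := by
      conv_rhs => rw [← Multiset.map_id (Ctx.fst Δ)]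
      exact Multiset.map_congr rfl fun c hc => ren_of_ne (by rintro rfl; exact hyΔ hc)
    rw [e] at hb
    rw [Bal, RIface.root_rename, Config.offers_rename,
      Config.usesM_rename fun n hn => hw.fwd.2 n (by simp [hn]), Ctx.fst_cons, hb]

/-! ## The clauses of the value relation -/

/-- Both channels are observable, so the renaming commutes with the hiding renamings between the two
`S`. As an interface channel `y` is absent from `U`, and `x` is new to both programs, so no new
connection with `W` or `U` arises. -/
theorem Agree.rename {I I' : Set (Chan L)} (h : Agree ξ I D₁ D₂) (hy : y.lvl ≤ ξ) (hyI : y ∈ I)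
    (hl : x.lvl = y.lvl) (hI' : ∀ c ∈ I', c ∈ I ∨ c = x)
    (h₁ : x ∉ Config.chans D₁) (h₁' : y ∉ Config.offers D₁)
    (h₂ : x ∉ Config.chans D₂) (h₂' : y ∉ Config.offers D₂) :
    Agree ξ I' (Config.rename D₁ y x) (Config.rename D₂ y x) := by
  obtain ⟨S₁, W₁, U₁, S₂, W₂, U₂, rfl, rfl, hS, k₁, k₂⟩ := h
  have key : ∀ {S W U : Config L}, Side ξ I S W U → x ∉ Config.chans (S + W + U) →
      y ∉ Config.offers (S + W + U) →
      Side ξ I' (Multiset.map (Node.map (ren y x)) S) (Multiset.map (Node.map (ren y x)) W)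
        (Multiset.map (Node.map (ren y x)) U) := by
    intro S W U k hx hy'
    have hU : y ∉ Config.chans U := fun h => (k.unrel y h hy).1 hyI
    refine k.ren hl hI' (.inl hU) (.inl fun ⟨n, hn, hc⟩ => hx ⟨n, by simp [hn], hc⟩)
      (fun m hm _ => ⟨?_, ?_⟩) (.inl hU)
    · rintro rfl
      exact hx ⟨.msg m, by simp [hm], m.offer_mem⟩
    · rintro rfl
      exact hy' (Config.mem_offers.2 ⟨.msg m, by simp [hm], rfl⟩)
  exact ⟨_, _, _, _, _, _, by simp only [Config.rename, Multiset.map_add],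
    by simp only [Config.rename, Multiset.map_add], rel_map_ren hS (hl ▸ hy) hy,
    key k₁ h₁ h₁', key k₂ h₂ h₂'⟩

/-- The forwarder has observable channels, runs below the level of `y` and does not wait, so it
cannot be in `W`; as it touches the interface it is not in `U`. It therefore occurs in both
programs. -/
theorem Related.fwdR (h : Related ξ Δ (some (y, A)) s t)
    (hd : Node.proc y (.fwd (.chan y) (.chan x)) d ∈ s.D) :
    ∃ D₁ D₂ : Config L, s.D = D₁ + {.proc y (.fwd (.chan y) (.chan x)) d} ∧
      t.D = D₂ + {.proc y (.fwd (.chan y) (.chan x)) d} ∧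
      Related ξ Δ (some (x, A))
        ⟨Config.rename s.C y x, Config.rename D₁ y x, Config.rename s.F y x⟩
        ⟨Config.rename t.C y x, Config.rename D₂ y x, Config.rename t.F y x⟩ := by
  have hy : y.lvl ≤ ξ := h.obs y (by simp)
  obtain ⟨τ₁, r₁, w₁, H₁⟩ := h.st₁
  obtain ⟨τ₂, r₂, w₂, H₂⟩ := h.st₂
  have hok := H₁.ok_D _ hd
  have hx : x.lvl ≤ ξ := hok.fwd_inv.2.2.1 ▸ hy
  have hch : ∀ c, c ∈ (Node.proc y (.fwd (.chan y) (.chan x)) d).chans ↔ c = y ∨ c = x := by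
    intro c
    simp [Node.chans, Proc.chans, Ref.chans, or_comm]
  obtain ⟨D₁, D₂, e₁, e₂, h'⟩ := h.agree.erase hd (fun c hc => by
      rcases (hch c).1 hc with rfl | rfl <;> assumption) ⟨y, (hch y).2 (.inl rfl), by simp⟩
    (by
      rintro (h | ⟨c, -, h⟩)
      · exact h (hok.sec.trans hy)
      · simp [Node.Waits] at h)
    (fun m e => by cases e)
  refine ⟨D₁, D₂, e₁, e₂, ?_⟩
  obtain ⟨C₁, D₁', F₁⟩ := s
  obtain ⟨C₂, D₂', F₂⟩ := t
  subst e₁ e₂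
  have k₁ := H₁.fwdR
  have k₂ := H₂.fwdR
  refine ⟨fun c hc => ?_, ⟨_, _, _, k₁.2.2⟩, ⟨_, _, _, k₂.2.2⟩, ?_⟩
  · rcases mem_iface_some.1 hc with hc | rfl
    · exact h.obs c (by simp [hc])
    · exact hx
  · simp only [k₁.1, k₂.1]
    refine h' _ fun c hc => ?_
    rcases mem_iface_some.1 hc with hc | rfl
    · exact .inl (by simp [hc])
    · exact .inr ((hch _).2 (.inr rfl))

/-- The number of connectives of a type. -/
def Ty.size : Ty → ℕ
  | .one => 1
  | .plus _ A => 1 + ∑ ℓ, (A ℓ).size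
  | .amp _ A => 1 + ∑ ℓ, (A ℓ).size
  | .tensor A B => 1 + A.size + B.size
  | .lolli A B => 1 + A.size + B.size

/-- The number of connectives of a context. -/
def Ctx.size (Δ : Ctx L) : ℕ := (Multiset.map (fun p => Ty.size p.2) Δ).sum

@[simp] theorem Ctx.size_cons (p : Chan L × Ty) (Δ : Ctx L) :
    Ctx.size (p ::ₘ Δ) = p.2.size + Ctx.size Δ := by simp [Ctx.size]

@[simp] theorem Ctx.size_add (Δ Δ' : Ctx L) :
    Ctx.size (Δ + Δ') = Ctx.size Δ + Ctx.size Δ' := by simp [Ctx.size]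

@[simp] theorem Ctx.size_singleton (p : Chan L × Ty) :
    Ctx.size ({p} : Ctx L) = p.2.size := by simp [Ctx.size]

/-- The number of connectives of an interface. -/
def isize (Δ : Ctx L) (K : RIface L) : ℕ := Ctx.size Δ + Ctx.size (RIface.ctx K)

theorem Ty.size_plus_lt {I : Finset ℕ} (A : {ℓ // ℓ ∈ I} → Ty) (k : {ℓ // ℓ ∈ I}) :
    (A k).size < (Ty.plus I A).size := by
  have := Finset.single_le_sum (f := fun ℓ => (A ℓ).size) (fun _ _ => Nat.zero_le _)
    (Finset.mem_univ k)
  simp only [Ty.size] at this ⊢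
  omega

theorem Ty.size_amp_lt {I : Finset ℕ} (A : {ℓ // ℓ ∈ I} → Ty) (k : {ℓ // ℓ ∈ I}) :
    (A k).size < (Ty.amp I A).size := Ty.size_plus_lt A k

end SecSess

/-! ### The value and term relations for related configurations -/

namespace SecSess

universe u

set_option linter.unusedSectionVars false

variable {L : Type u} [Lattice L]

variable {τ : Chan L → Ty} {r : Chan L → ℕ} {w : Chan L} {ξ : L} {Δ Δ' Δ'' : Ctx L} {K : RIface L}
  {s t : Triple L}

theorem Related.fwdL {C₁ D₁ F₁ C₂ D₂ F₂ : Config L} {y x : Chan L} {A : Ty} {d₁ d₂ : L}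
    (h : Related ξ ((y, A) ::ₘ Δ) K ⟨C₁ + {.proc y (.fwd (.chan y) (.chan x)) d₁}, D₁, F₁⟩
      ⟨C₂ + {.proc y (.fwd (.chan y) (.chan x)) d₂}, D₂, F₂⟩) :
    Related ξ ((x, A) ::ₘ Δ) (RIface.rename K y x)
      ⟨Config.rename C₁ y x, Config.rename D₁ y x, Config.rename F₁ y x⟩
      ⟨Config.rename C₂ y x, Config.rename D₂ y x, Config.rename F₂ y x⟩ := by
  obtain ⟨τ₁, r₁, w₁, H₁⟩ := h.st₁
  obtain ⟨τ₂, r₂, w₂, H₂⟩ := h.st₂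
  obtain ⟨hl, a₁, b₁, k₁⟩ := H₁.fwdL
  obtain ⟨-, a₂, b₂, k₂⟩ := H₂.fwdL
  have hy : y.lvl ≤ ξ := h.obs y (by simp)
  have hI : ∀ c ∈ iface ((x, A) ::ₘ Δ) (RIface.rename K y x),
      c ∈ iface ((y, A) ::ₘ Δ) K ∨ c = x := by
    intro c hc
    rcases hc with hc | hc
    · rcases Ctx.mem_chans_cons.1 hc with rfl | hc
      · exact .inr rfl
      · exact .inl (.inl (Ctx.mem_chans_cons.2 (.inr hc)))
    · rw [← Ctx.mem_fst, RIface.ctx_rename, Ctx.fst_ren] at hc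
      obtain ⟨c', hc', rfl⟩ := Multiset.mem_map.1 hc
      by_cases e : c' = y
      · exact .inr (by rw [e, ren_self])
      · rw [ren_of_ne e]
        exact .inl (.inr (Ctx.mem_fst.1 hc'))
  refine ⟨fun c hc => ?_, ⟨_, _, _, k₁⟩, ⟨_, _, _, k₂⟩,
    h.agree.rename hy (by simp) hl hI a₁ b₁ a₂ b₂⟩
  rcases hI c hc with hc | rfl
  · exact h.obs c hc
  · exact hl ▸ hy

theorem chans_selPos {y v c : Chan L} {k : ℕ} :
    c ∈ (Node.msg (.selPos y k v)).chans ↔ c = y ∨ c = v := by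
  simp [Node.chans, Msg.toProc, Proc.chans, Ref.chans, or_comm]

theorem chans_selNeg {y v c : Chan L} {k : ℕ} :
    c ∈ (Node.msg (.selNeg y k v)).chans ↔ c = y ∨ c = v := by
  simp [Node.chans, Msg.toProc, Proc.chans, Ref.chans, or_comm]

theorem chans_sendPos {x y v c : Chan L} :
    c ∈ (Node.msg (.sendPos x y v)).chans ↔ c = x ∨ c = y ∨ c = v := by
  simp only [Node.chans, Msg.toProc, Proc.chans, Ref.chans, Set.mem_union, Set.mem_singleton_iff]
  tauto

theorem chans_sendNeg {x y v c : Chan L} :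
    c ∈ (Node.msg (.sendNeg x y v)).chans ↔ c = x ∨ c = y ∨ c = v := by
  simp only [Node.chans, Msg.toProc, Proc.chans, Ref.chans, Set.mem_union, Set.mem_singleton_iff]
  tauto

/-- Related configurations that cannot take a step are related by the value relation, if the term
relation holds for related configurations that are smaller, or divided along a smaller
interface. -/
theorem Related.val {E : IRel L} (h : Related ξ Δ K s t)
    (hE : ∀ {Δ' : Ctx L} {K' : RIface L} (s' t' : Triple L), Related ξ Δ' K' s' t' →
      s'.all = s.all → t'.all = t.all → isize Δ' K' < isize Δ K → E Δ' K' s'.all t'.all)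
    (hE' : ∀ {Δ' : Ctx L} {K' : RIface L} (s' t' : Triple L), Related ξ Δ' K' s' t' →
      Config.size s'.all < Config.size s.all → Config.size t'.all < Config.size t.all →
      E Δ' K' s'.all t'.all) : Val E Δ K s t := by
  obtain ⟨τ₁, r₁, w₁, H₁⟩ := h.st₁
  obtain ⟨τ₂, r₂, w₂, H₂⟩ := h.st₂
  refine ⟨H₁.tree, H₂.tree, ?_, ?_, ?_, ?_, ?_, ?_, ?_, ?_, ?_, ?_, ?_, ?_⟩
  · rintro y rfl hm
    obtain ⟨D₁, D₂, e₁, e₂, -⟩ := h.sent hm (by simp [Msg.carrier])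
      (fun _ => by simp [Msg.offer])
    obtain ⟨C₁, _, F₁⟩ := s
    obtain ⟨C₂, _, F₂⟩ := t
    subst e₁ e₂
    obtain ⟨rfl, rfl, rfl⟩ := H₁.oneR
    obtain ⟨-, rfl, rfl⟩ := H₂.oneR
    simp
  · rintro y I A k v rfl hm
    obtain ⟨D₁, D₂, e₁, e₂, ho, hA⟩ := h.sent hm (by simp [Msg.carrier])
      (fun _ => by simp [Msg.offer])
    obtain ⟨C₁, _, F₁⟩ := s
    obtain ⟨C₂, _, F₂⟩ := t
    subst e₁ e₂
    obtain ⟨hk, k₁⟩ := H₁.plusR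
    obtain ⟨_, k₂⟩ := H₂.plusR
    refine ⟨hk, D₁, D₂, rfl, rfl, hE ⟨C₁, D₁, _ + F₁⟩ ⟨C₂, D₂, _ + F₂⟩
      ⟨fun c hc => ?_, ⟨_, _, _, k₁⟩, ⟨_, _, _, k₂⟩, hA _ fun c hc => ?_⟩ ?_ ?_ ?_⟩
    · rcases mem_iface_some.1 hc with hc | rfl
      · exact h.obs c (by simp [hc])
      · exact ho _ (chans_selPos.2 (.inr rfl))
    · rcases mem_iface_some.1 hc with hc | rfl
      · exact .inl (by simp [hc])
      · exact .inr (chans_selPos.2 (.inr rfl))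
    · simp only [Triple.all, add_assoc]
    · simp only [Triple.all, add_assoc]
    · have := Ty.size_plus_lt A ⟨k, hk⟩
      simpa [isize]
  · rintro y I A k v F₁ F₂ rfl e₁ e₂
    obtain ⟨C₁, D₁, _⟩ := s
    obtain ⟨C₂, D₂, _⟩ := t
    subst e₁ e₂
    refine hE ⟨C₁, D₁ + _, F₁⟩ ⟨C₂, D₂ + _, F₂⟩ (h.receive (m := .selNeg y k v) (by simp)
      (by simp) (by simp [Msg.carrier]) ⟨_, _, _, H₁.ampR⟩ ⟨_, _, _, H₂.ampR⟩
      (by simp [← Multiset.singleton_add, add_comm]) (by simp [← Multiset.singleton_add, add_comm])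
      fun c hc => ?_) ?_ ?_ ?_
    · rcases mem_iface_some.1 hc with hc | rfl
      · exact .inl (by simp [hc])
      · exact .inr (chans_selNeg.2 (.inr rfl))
    · simp only [Triple.all, add_assoc]
    · simp only [Triple.all, add_assoc]
    · have := Ty.size_amp_lt A k
      simpa [isize]
  · rintro y A B x v rfl hm
    have hx : x ∈ (Node.msg (.sendPos x y v)).usesM := by
      rcases hm with hm | hm
      · simp [(H₁.msgOk (m := .sendPos x y v) (by simp [Triple.all, hm])).1]
      · simp [(H₂.msgOk (m := .sendPos x y v) (by simp [Triple.all, hm])).1]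
    obtain ⟨T, D₁, D₂, e₁, e₂, ho, hT, hA, hb⟩ := h.sent_tree hm (by simp [Msg.carrier])
      (fun _ => by simp [Msg.offer]) hx
    -- The context is split by what the tree uses. Both runs have the same tree, so one splitting
    -- serves both.
    obtain ⟨Δ', hΔ'⟩ : ∃ Δ', Δ' = Δ.beside T x := ⟨_, rfl⟩
    obtain ⟨Δ'', hΔ''⟩ : ∃ Δ'', Δ'' = Δ.below T x := ⟨_, rfl⟩
    obtain rfl : Δ = Δ' + Δ'' := by rw [hΔ', hΔ'', Ctx.beside_add_below]
    rw [← hΔ''] at hb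
    obtain ⟨C₁, _, F₁⟩ := s
    obtain ⟨C₂, _, F₂⟩ := t
    subst e₁ e₂
    obtain ⟨C₁', C₁'', rfl, h₁', h₁''⟩ := H₁.split_C
    obtain ⟨C₂', C₂'', rfl, h₂', h₂''⟩ := H₂.split_C
    obtain ⟨t₁, p₁, q₁⟩ := H₁.tensorR h₁' h₁'' hb
    obtain ⟨t₂, p₂, q₂⟩ := H₂.tensorR h₂' h₂'' hb
    have hobs : ∀ c, c ∈ Ctx.chans (Δ' + Δ'') → c.lvl ≤ ξ := fun c hc => h.obs c (by simp [hc])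
    refine ⟨Δ', Δ'', C₁', C₁'', C₂', C₂'', D₁, D₂, T, T, rfl, rfl, rfl, h₁', h₁'', h₂', h₂'',
      t₁, t₂, rfl, rfl, hE ⟨C₁'', T, _⟩ ⟨C₂'', T, _⟩
        ⟨fun c hc => ?_, ⟨_, _, _, p₁⟩, ⟨_, _, _, p₂⟩, hT _⟩ ?_ ?_ ?_,
      hE ⟨C₁', D₁, _⟩ ⟨C₂', D₂, _⟩
        ⟨fun c hc => ?_, ⟨_, _, _, q₁⟩, ⟨_, _, _, q₂⟩, hA _ fun c hc => ?_⟩ ?_ ?_ ?_⟩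
    · rcases mem_iface_some.1 hc with hc | rfl
      · exact hobs c (Ctx.mem_chans_add.2 (.inr hc))
      · exact ho _ (chans_sendPos.2 (.inl rfl))
    · simp only [Triple.all]; abel
    · simp only [Triple.all]; abel
    · simp [isize, Ty.size]; omega
    · rcases mem_iface_some.1 hc with hc | rfl
      · exact hobs c (Ctx.mem_chans_add.2 (.inl hc))
      · exact ho _ (chans_sendPos.2 (.inr (.inr rfl)))
    · rcases mem_iface_some.1 hc with hc | rfl
      · exact .inl (by simp [Ctx.mem_chans_add, hc])
      · exact .inr (chans_sendPos.2 (.inr (.inr rfl)))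
    · simp only [Triple.all]; abel
    · simp only [Triple.all]; abel
    · simp [isize, Ty.size]; omega
  · rintro y A B x v T₁ T₂ F₁ F₂ rfl h₁ h₂ e₁ e₂
    obtain ⟨C₁, D₁, _⟩ := s
    obtain ⟨C₂, D₂, _⟩ := t
    subst e₁ e₂
    refine hE ⟨C₁ + T₁, D₁ + _, F₁⟩ ⟨C₂ + T₂, D₂ + _, F₂⟩ (h.receive (m := .sendNeg x y v)
      (by simp) (by simp) (by simp [Msg.carrier]) ⟨_, _, _, H₁.lolliR h₁⟩ ⟨_, _, _, H₂.lolliR h₂⟩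
      (by simp [← Multiset.singleton_add, add_comm]) (by simp [← Multiset.singleton_add, add_comm])
      fun c hc => ?_) ?_ ?_ ?_
    · rcases mem_iface_cons.1 hc with rfl | hc
      · exact .inr (chans_sendNeg.2 (.inl rfl))
      · rcases mem_iface_some.1 hc with hc | rfl
        · exact .inl (by simp [hc])
        · exact .inr (chans_sendNeg.2 (.inr (.inr rfl)))
    · simp only [Triple.all]; abel
    · simp only [Triple.all]; abel
    · simp [isize, Ty.size]; omega
  · rintro Δ y C₁ C₂ rfl e₁ e₂
    obtain ⟨_, D₁, F₁⟩ := s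
    obtain ⟨_, D₂, F₂⟩ := t
    subst e₁ e₂
    refine hE ⟨C₁, _ + D₁, F₁⟩ ⟨C₂, _ + D₂, F₂⟩ (h.receive (m := .close y) (by simp)
      (by simp) (by simp [Msg.carrier]) ⟨_, _, _, H₁.oneL⟩ ⟨_, _, _, H₂.oneL⟩
      (by rw [Multiset.singleton_add]) (by rw [Multiset.singleton_add])
      fun c hc => .inl (by simp [hc])) ?_ ?_ ?_
    · simp only [Triple.all, add_assoc]
    · simp only [Triple.all, add_assoc]
    · simp [isize, Ty.size]
  · rintro Δ y I A k v C₁ C₂ rfl e₁ e₂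
    obtain ⟨_, D₁, F₁⟩ := s
    obtain ⟨_, D₂, F₂⟩ := t
    subst e₁ e₂
    refine hE ⟨C₁, _ + D₁, F₁⟩ ⟨C₂, _ + D₂, F₂⟩ (h.receive (m := .selPos y k v) (by simp)
      (by simp) (by simp [Msg.carrier]) ⟨_, _, _, H₁.plusL⟩ ⟨_, _, _, H₂.plusL⟩
      (by rw [Multiset.singleton_add]) (by rw [Multiset.singleton_add])
      fun c hc => ?_) ?_ ?_ ?_
    · rcases mem_iface_cons.1 hc with rfl | hc
      · exact .inr (chans_selPos.2 (.inr rfl))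
      · exact .inl (by simp [hc])
    · simp only [Triple.all, add_assoc]
    · simp only [Triple.all, add_assoc]
    · have := Ty.size_plus_lt A k
      simpa [isize]
  · rintro Δ y I A k v rfl hm
    obtain ⟨D₁, D₂, e₁, e₂, ho, hA⟩ := h.sent hm (by simp [Msg.carrier])
      (fun hp => hp.elim)
    obtain ⟨C₁, _, F₁⟩ := s
    obtain ⟨C₂, _, F₂⟩ := t
    subst e₁ e₂
    obtain ⟨hk, k₁⟩ := H₁.ampL
    obtain ⟨_, k₂⟩ := H₂.ampL
    refine ⟨hk, D₁, D₂, add_comm _ _, add_comm _ _, hE ⟨C₁ + _, D₁, F₁⟩ ⟨C₂ + _, D₂, F₂⟩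
      ⟨fun c hc => ?_, ⟨_, _, _, k₁⟩, ⟨_, _, _, k₂⟩, hA _ fun c hc => ?_⟩ ?_ ?_ ?_⟩
    · rcases mem_iface_cons.1 hc with rfl | hc
      · exact ho _ (chans_selNeg.2 (.inr rfl))
      · exact h.obs c (by simp [hc])
    · rcases mem_iface_cons.1 hc with rfl | hc
      · exact .inr (chans_selNeg.2 (.inr rfl))
      · exact .inl (by simp [hc])
    · simp only [Triple.all]; abel
    · simp only [Triple.all]; abel
    · have := Ty.size_amp_lt A ⟨k, hk⟩
      simpa [isize]
  · rintro Δ y A B x v T₁ T₂ C₁ C₂ rfl - - e₁ e₂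
    obtain ⟨_, D₁, F₁⟩ := s
    obtain ⟨_, D₂, F₂⟩ := t
    subst e₁ e₂
    refine hE ⟨C₁ + T₁, _ + D₁, F₁⟩ ⟨C₂ + T₂, _ + D₂, F₂⟩ (h.receive (m := .sendPos x y v)
      (by simp) (by simp) (by simp [Msg.carrier]) ⟨_, _, _, H₁.tensorL⟩ ⟨_, _, _, H₂.tensorL⟩
      (by rw [Multiset.singleton_add]) (by rw [Multiset.singleton_add])
      fun c hc => ?_) ?_ ?_ ?_
    · rcases mem_iface_cons.1 hc with rfl | hc
      · exact .inr (chans_sendPos.2 (.inl rfl))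
      · rcases mem_iface_cons.1 hc with rfl | hc
        · exact .inr (chans_sendPos.2 (.inr (.inr rfl)))
        · exact .inl (by simp [hc])
    · simp only [Triple.all, add_assoc]
    · simp only [Triple.all, add_assoc]
    · simp [isize, Ty.size]; omega
  · rintro Δ y A B x v rfl hm
    have hx : x ∈ (Node.msg (.sendNeg x y v)).usesM := by
      rcases hm with hm | hm
      · simp [(H₁.msgOk (m := .sendNeg x y v) (by simp [Triple.all, hm])).1]
      · simp [(H₂.msgOk (m := .sendNeg x y v) (by simp [Triple.all, hm])).1]
    obtain ⟨T, D₁, D₂, e₁, e₂, ho, hT, hA, hb⟩ := h.sent_tree hm (by simp [Msg.carrier])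
      (fun hp => hp.elim) hx
    obtain ⟨C₁, _, F₁⟩ := s
    obtain ⟨C₂, _, F₂⟩ := t
    subst e₁ e₂
    have hy := H₁.lolliL_fst
    have hbe : Ctx.below ((y, .lolli A B) ::ₘ Δ) T x = Δ.below T x := by
      classical
      exact Multiset.filter_cons_of_neg _ hy
    rw [hbe] at hb
    obtain ⟨Δ', hΔ'⟩ : ∃ Δ', Δ' = Δ.beside T x := ⟨_, rfl⟩
    obtain ⟨Δ'', hΔ''⟩ : ∃ Δ'', Δ'' = Δ.below T x := ⟨_, rfl⟩
    obtain rfl : Δ = Δ' + Δ'' := by rw [hΔ', hΔ'', Ctx.beside_add_below]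
    rw [← hΔ''] at hb
    rw [← Multiset.cons_add] at H₁ H₂
    obtain ⟨C₁', C₁'', rfl, h₁', h₁''⟩ := H₁.split_C
    obtain ⟨C₂', C₂'', rfl, h₂', h₂''⟩ := H₂.split_C
    obtain ⟨t₁, p₁, q₁⟩ := H₁.lolliL h₁' h₁'' hb
    obtain ⟨t₂, p₂, q₂⟩ := H₂.lolliL h₂' h₂'' hb
    have e : ∀ D : Config L, D + T + {.msg (.sendNeg x y v)} = T + {.msg (.sendNeg x y v)} + D :=
      fun D => by abel
    refine ⟨Δ', Δ'', C₁', C₁'', C₂', C₂'', D₁, D₂, T, T, rfl, rfl, rfl, h₁', h₁'', h₂', h₂'',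
      t₁, t₂, e D₁, e D₂, hE ⟨C₁'', T, _⟩ ⟨C₂'', T, _⟩
        ⟨fun c hc => ?_, ⟨_, _, _, p₁⟩, ⟨_, _, _, p₂⟩, hT _⟩ ?_ ?_ ?_,
      hE ⟨C₁' + C₁'' + T + _, D₁, F₁⟩ ⟨C₂' + C₂'' + T + _, D₂, F₂⟩
        ⟨fun c hc => ?_, ⟨_, _, _, q₁⟩, ⟨_, _, _, q₂⟩, hA _ fun c hc => ?_⟩ ?_ ?_ ?_⟩
    · rcases mem_iface_some.1 hc with hc | rfl
      · exact h.obs c (.inl (Ctx.mem_chans_cons.2 (.inr (Ctx.mem_chans_add.2 (.inr hc)))))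
      · exact ho _ (chans_sendNeg.2 (.inl rfl))
    · simp only [Triple.all]; abel
    · simp only [Triple.all]; abel
    · simp [isize, Ty.size]; omega
    · rcases mem_iface_cons.1 hc with rfl | hc
      · exact ho _ (chans_sendNeg.2 (.inr (.inr rfl)))
      · refine h.obs c (mem_iface_cons.2 (.inr ?_))
        rw [add_comm]
        exact mem_iface_add.2 (.inr hc)
    · rcases mem_iface_cons.1 hc with rfl | hc
      · exact .inr (chans_sendNeg.2 (.inr (.inr rfl)))
      · refine .inl (mem_iface_cons.2 (.inr ?_))
        rw [add_comm]
        exact mem_iface_add.2 (.inr hc)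
    · simp only [Triple.all]; abel
    · simp only [Triple.all]; abel
    · simp [isize, Ty.size]; omega
  · rintro y A x rfl ⟨d, hd⟩
    have key : ∃ D₁ D₂ : Config L, s.D = D₁ + {.proc y (.fwd (.chan y) (.chan x)) d} ∧
        t.D = D₂ + {.proc y (.fwd (.chan y) (.chan x)) d} ∧
        Related ξ Δ (some (x, A))
          ⟨Config.rename s.C y x, Config.rename D₁ y x, Config.rename s.F y x⟩
          ⟨Config.rename t.C y x, Config.rename D₂ y x, Config.rename t.F y x⟩ := by
      rcases hd with hd | hd
      · exact h.fwdR hd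
      · obtain ⟨D₁, D₂, e₁, e₂, h'⟩ := h.symm.fwdR hd
        exact ⟨D₂, D₁, e₂, e₁, h'.symm⟩
    obtain ⟨D₁, D₂, e₁, e₂, h'⟩ := key
    refine ⟨d, d, D₁, D₂, e₁, e₂, ?_⟩
    -- Forwarding keeps the type at the interface, but each run loses a node, so here the induction
    -- goes by the size of the configurations.
    have := hE' _ _ h' (by simp [Triple.all, e₁, Node.size, Proc.size])
      (by simp [Triple.all, e₂, Node.size, Proc.size])
    simpa only [Triple.all, Config.rename, Multiset.map_add] using this
  · rintro Δ y A x d₁ d₂ C₁ C₂ rfl e₁ e₂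
    obtain ⟨_, D₁, F₁⟩ := s
    obtain ⟨_, D₂, F₂⟩ := t
    subst e₁ e₂
    have := hE' _ _ h.fwdL (by simp [Triple.all, Node.size, Proc.size])
      (by simp [Triple.all, Node.size, Proc.size])
    simpa only [Triple.all, Config.rename, Multiset.map_add] using this

/-- Related configurations are related by the term relation. -/
theorem Related.term (h : Related ξ Δ K s t) : Term Δ K s.all t.all := by
  induction hk : Config.size s.all + Config.size t.all using Nat.strong_induction_on
    generalizing s t Δ K with
  | _ k ih =>
    induction hi : isize Δ K using Nat.strong_induction_on generalizing s t Δ K with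
    | _ i ih' =>
      subst hk hi
      obtain ⟨s', t', hs, ht, ns, nt, h', hl⟩ := h.run
      obtain ⟨_, _, _, H₁⟩ := h.st₁
      obtain ⟨_, _, _, H₂⟩ := h.st₂
      obtain ⟨_, _, _, H₁'⟩ := h'.st₁
      obtain ⟨_, _, _, H₂'⟩ := h'.st₂
      -- `Term` itself serves as the smaller relation `E`; well-foundedness is provided by the
      -- induction.
      refine .intro Term (fun _ _ _ _ => id) ⟨s, t, s', t', rfl, rfl, H₁.tree, H₂.tree,
        ⟨hs, H₁'.tpoised ns⟩, ⟨ht, H₂'.tpoised nt⟩, h'.val ?_ ?_⟩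
      · intro Δ' K' s'' t'' h'' e₁ e₂ hi
        -- If the runs to poised configurations took any step, the joint size has dropped; otherwise
        -- the smaller interface is what decreases.
        rcases lt_or_eq_of_le hl with hl | hl
        · exact ih _ (by rwa [e₁, e₂]) h'' rfl
        · exact ih' _ hi h'' (by rw [e₁, e₂, hl]) rfl
      · intro Δ' K' s'' t'' h'' e₁ e₂
        exact ih _ (by omega) h'' rfl

end SecSess

/-! ### From relevant parts to related divided configurations -/

namespace SecSess

universe u

set_option linter.unusedSectionVars false

variable {L : Type u} [Lattice L]

variable {τ : Chan L → Ty} {r : Chan L → ℕ} {w : Chan L} {ξ : L} {Δ Δ' Δ'' : Ctx L} {K : RIface L}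
  {s t : Triple L} {C D F R : Config L} {u : Chan L} {A : Ty}

/-! ## The initial division -/

/-- The parts are extracted from the leaves to the root, each from the assignment found for the
previous one. The naming discipline makes their offers disjoint, so later choices do not affect
earlier parts. -/
theorem closed_typed (hC : CTyped 0 C Δ) (hD : CTyped Δ D {(u, A)})
    (hF : KTyped {(u, A)} F none) (hN : WellNamed (C + D + F)) :
    ∃ τ r w, St τ r Δ (some (u, A)) ⟨C, D, F⟩ w := by
  obtain ⟨w, hF⟩ : ∃ w, CTyped {(u, A)} F {(w, Ty.one)} := by
    obtain ⟨Λ, rfl | ⟨w, rfl⟩, h⟩ := hF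
    -- `F` uses `u`, so it cannot provide the empty context.
    · exact absurd (h.zero_right rfl).1 (by simp)
    · exact ⟨w, h⟩
  have hn : (Config.offers (C + D + F)).Nodup := hN.1
  simp only [Config.offers_add] at hn
  obtain ⟨hCD, nF, dF⟩ := Multiset.nodup_add.1 hn
  obtain ⟨nC, nD, dCD⟩ := Multiset.nodup_add.1 hCD
  rw [Multiset.disjoint_left] at dF dCD
  obtain ⟨τ₁, r₁, tC, rfl, -, ok₁, b₁, ty₁⟩ := hC.extract nC
    (fun c _ => Ctx.notMem_chans_zero) (fun _ => .one) (fun _ => 0) (by simp)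
  rw [Ctx.fst_zero, zero_add] at b₁
  have hΔC : ∀ c ∈ Ctx.fst Δ, c ∈ Config.offers (TConfig.cfg tC) := fun c hc => by
    rw [b₁]; simp [hc]
  obtain ⟨τ₂, r₂, tD, rfl, a₂, ok₂, b₂, ty₂⟩ := hD.extract nD
    (fun c hc h => dCD (hΔC c (Ctx.mem_fst.2 h)) hc) τ₁ r₁ ty₁
  have hu : u ∈ Config.offers (TConfig.cfg tC) + Config.offers (TConfig.cfg tD) := by
    have : u ∈ Ctx.fst Δ + Config.offers (TConfig.cfg tD) := by rw [b₂]; simp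
    rw [Multiset.mem_add] at this ⊢
    exact this.imp (hΔC u) id
  obtain ⟨τ₃, r₃, tF, rfl, a₃, ok₃, b₃, ty₃⟩ := hF.extract nF
    (fun c hc h => dF (by rwa [Ctx.mem_chans_singleton.1 h]) hc) τ₂ r₂ ty₂
  have ag₂ : ∀ c ∈ TConfig.offers tC, τ₂ c = τ₁ c ∧ r₂ c = r₁ c := fun c hc =>
    a₂ c (dCD (by simpa using hc))
  have ag₃ : ∀ c ∈ TConfig.offers tC + TConfig.offers tD, τ₃ c = τ₂ c ∧ r₃ c = r₂ c :=
    fun c hc => a₃ c (dF (by simpa using hc))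
  have mono : ∀ {τ τ' : Chan L → Ty} {r r' : Chan L → ℕ} {n : Node L} {γ : Multiset (Chan L)},
      Ok τ r n γ → (∀ c ∈ n.offer ::ₘ γ, τ' c = τ c ∧ r' c = r c) → Ok τ' r' n γ :=
    fun h h' => h.mono (fun c hc => (h' c hc).1) fun c hc hr => by
      rwa [(h' c (by simp [hc])).2, (h' _ (by simp)).2]
  have mC : ∀ a ∈ tC, ∀ c ∈ a.1.offer ::ₘ a.2, c ∈ TConfig.offers tC := by
    intro a ha c hc
    rcases Multiset.mem_cons.1 hc with rfl | hc
    · exact TConfig.mem_offers_of_mem ha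
    · rw [← TConfig.offers_cfg, b₁]
      simp [TConfig.mem_ctxs.2 ⟨a, ha, hc⟩]
  have mD : ∀ a ∈ tD, ∀ c ∈ a.1.offer ::ₘ a.2, c ∈ TConfig.offers tC + TConfig.offers tD := by
    intro a ha c hc
    rcases Multiset.mem_cons.1 hc with rfl | hc
    · simp [TConfig.mem_offers_of_mem ha]
    · have : c ∈ Ctx.fst Δ + Config.offers (TConfig.cfg tD) := by
        rw [b₂]; simp [TConfig.mem_ctxs.2 ⟨a, ha, hc⟩]
      rw [TConfig.offers_cfg, Multiset.mem_add] at this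
      rw [Multiset.mem_add]
      exact this.imp (fun h => by simpa using hΔC c h) id
  have H : Typed τ₃ r₃ (tC + tD + tF) w := by
    refine ⟨fun a ha => ?_, ?_, by simpa using hn, ?_, ?_⟩
    · simp only [Multiset.mem_add] at ha
      rcases ha with (ha | ha) | ha
      · exact mono (mono (ok₁ a ha) fun c hc => ag₂ c (mC a ha c hc)) fun c hc =>
          ag₃ c (Multiset.mem_add.2 (.inl (mC a ha c hc)))
      · exact mono (ok₂ a ha) fun c hc => ag₃ c (mD a ha c hc)
      · exact ok₃ a ha
    · simp only [TConfig.offers_cfg, Ctx.fst_singleton] at b₁ b₂ b₃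
      rw [TConfig.offers_add, TConfig.offers_add, TConfig.ctxs_add, TConfig.ctxs_add,
        ← Multiset.singleton_add, b₁]
      calc _ = TConfig.ctxs tC + (Ctx.fst Δ + TConfig.offers tD) + TConfig.offers tF := by abel
        _ = TConfig.ctxs tC + TConfig.ctxs tD + ({u} + TConfig.offers tF) := by rw [b₂]; abel
        _ = _ := by rw [b₃]; abel
    · exact ty₃ (w, .one) (by simp)
    · intro c hc c' hc' e₁ e₂ e₃
      rw [TConfig.cfg_add, TConfig.cfg_add] at hc hc' ⊢
      have : ∀ c ∈ Config.offers (TConfig.cfg tC + TConfig.cfg tD + TConfig.cfg tF),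
          c ∈ Config.chans (TConfig.cfg tC + TConfig.cfg tD + TConfig.cfg tF) := by
        intro c hc
        obtain ⟨n, hn, rfl⟩ := Config.mem_offers.1 hc
        exact ⟨n, hn, n.offer_mem⟩
      exact hN.2 c (this c hc) c' (this c' hc') e₁ e₂ e₃
  have W := H.wt
  simp only [TConfig.cfg_add] at W
  refine ⟨τ₃, r₃, w, W, fun p hp => ?_, fun p hp => ?_, ?_, ?_⟩
  · have hp' := hΔC p.1 (Ctx.mem_fst.2 ⟨p.2, hp⟩)
    rw [TConfig.offers_cfg] at hp'
    rw [(ag₃ p.1 (by simp [hp'])).1, (ag₂ p.1 hp').1, ty₁ p hp]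
  · obtain rfl : p = (u, A) := by simpa using hp
    rw [(ag₃ u (by simpa using hu)).1]
    exact ty₂ (u, A) (by simp)
  -- Only for the whole closed configuration is doom excluded; now the parts can be balanced by the
  -- channels that their nodes mention.
  · exact hC.bal fun n hn => W.alive n (by simp [hn])
  · simpa [Bal, RIface.root] using hD.bal fun n hn => W.alive n (by simp only [Multiset.mem_add]
                                                                    exact .inl (.inr hn))

theorem Proc.le_quasi (d : L) (P : Proc L) : d ≤ P.quasi d := by
  unfold Proc.quasi
  split <;> simp

theorem QuasiLe.low {n : Node L} (h : QuasiLe ξ D n) : n.Low ξ := by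
  obtain ⟨q, h, hq⟩ := h
  cases h with
  | proc y P d => exact (P.le_quasi d).trans hq
  | neg m => exact hq
  | root m => exact hq
  | child m n q => exact le_sup_right.trans hq

/-- The quasi running secrecy is the running secrecy, joined for `branch` and `recv` with the level
of the channel. If it is secret, one of the two is. -/
theorem QuasiLe.high {y : Chan L} {P : Proc L} {d : L} (h : ¬ QuasiLe ξ D (.proc y P d)) :
    (Node.proc y P d).High ξ := by
  have hq : ¬ P.quasi d ≤ ξ := fun hq => h ⟨_, .proc y P d, hq⟩
  by_cases hd : d ≤ ξ
  · refine .inr ?_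
    unfold Proc.quasi at hq
    split at hq
    · exact ⟨_, fun hc => hq (sup_le hd hc), .inl ⟨_, _, rfl⟩⟩
    · exact ⟨_, fun hc => hq (sup_le hd hc), .inr (.inl ⟨_, rfl⟩)⟩
    · exact absurd hd hq
  · exact .inl hd

theorem Msg.carrier_eq_offer {m : Msg L} (h : m.Positive) : m.carrier = m.offer := by
  cases m <;> first | rfl | exact h.elim

theorem RelChan.of_iface {c : Chan L}
    (hc : c ∈ iface (Ctx.proj ξ Δ) (projR ξ (u, A))) : RelChan ξ Δ D {(u, A)} c := by
  classical
  rcases hc with ⟨B, hB⟩ | hc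
  · obtain ⟨h, hl⟩ := Multiset.mem_filter.1 hB
    exact .obs c hl (.inl ⟨B, h⟩)
  · rw [projR] at hc
    split_ifs at hc with h
    · obtain rfl : c = u := by simpa [Ctx.mem_chans_singleton] using hc
      exact .obs c h (.inr (Ctx.mem_chans_singleton.2 rfl))
    · exact absurd hc Ctx.notMem_chans_zero

/-- The relevant part of a partial program, extended by configurations that share no observable
channel with it. -/
theorem St.side (H : St τ r Δ (some (u, A)) ⟨C, D, F⟩ w)
    (hR : ∀ c ∈ Config.chans R, c.lvl ≤ ξ → c ∉ Config.offers D ∧ c ∉ Ctx.fst Δ) :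
    ∃ W U : Config L, D + R = relevant ξ Δ D {(u, A)} + W + U ∧
      Side ξ (iface (Ctx.proj ξ Δ) (projR ξ (u, A))) (relevant ξ Δ D {(u, A)}) W U := by
  classical
  obtain ⟨I, hI⟩ : ∃ I, I = iface (Ctx.proj ξ Δ) (projR ξ (u, A)) := ⟨_, rfl⟩
  rw [← hI]
  have hrelI : ∀ c ∈ I, RelChan ξ Δ D {(u, A)} c := fun c hc => .of_iface (hI ▸ hc)
  have hId : ∀ c ∈ I, c ∈ Ctx.fst Δ ∨ c = u := by
    intro c hc
    rw [hI] at hc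
    rcases hc with ⟨B, hB⟩ | hc
    · exact .inl (Ctx.mem_fst.2 ⟨B, (Multiset.mem_filter.1 hB).1⟩)
    · rw [projR] at hc
      split_ifs at hc with h
      · exact .inr (by simpa [Ctx.mem_chans_singleton] using hc)
      · exact absurd hc Ctx.notMem_chans_zero
  have huD : u ∈ Ctx.fst Δ + Config.offers D := H.mem_root (by simp)
  have hRD : ∀ c ∈ Config.chans R, c.lvl ≤ ξ → c ∉ I ∧ c ∉ Config.chans D := by
    intro c hc hl
    obtain ⟨h₁, h₂⟩ := hR c hc hl
    refine ⟨fun h => ?_, notMem_chans h₁ fun h => ?_⟩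
    · rcases hId c h with h | rfl
      · exact h₂ h
      · exact (Multiset.mem_add.1 huD).elim h₂ h₁
    · exact (Multiset.mem_add.1 (H.uses_D_subset h)).elim h₂ h₁
  have hoD : ∀ n ∈ D, ∀ n' ∈ D, n.offer = n'.offer → n = n' := fun n hn n' hn' e =>
    H.wt.offer_inj (by simp [Triple.all, hn]) (by simp [Triple.all, hn']) e
  -- `P` describes the relevant nodes, which form `S`. Among the others, `Q` selects for `W` the
  -- nodes of secret quasi running secrecy, but messages only if they are positive along an
  -- observable channel. What remains goes into `U`, together with `R`.
  obtain ⟨P, hP⟩ : ∃ P : Node L → Prop, P = fun n => QuasiLe ξ D n ∧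
    ∃ c ∈ n.chans, RelChan ξ Δ D {(u, A)} c := ⟨_, rfl⟩
  obtain ⟨Q, hQ⟩ : ∃ Q : Node L → Prop, Q = fun n => ¬ QuasiLe ξ D n ∧
    ∀ m, n = .msg m → m.Positive ∧ m.offer.lvl ≤ ξ := ⟨_, rfl⟩
  have hS : relevant ξ Δ D {(u, A)} = Multiset.filter P D := by
    subst hP
    rw [relevant]
    congr
  rw [hS]
  -- A node that is left over and has an observable channel has an observable quasi running secrecy:
  -- a negative message inherits it from its carrier, and a positive one would otherwise satisfy
  -- `Q`. So it was left out only because none of its channels is relevant.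
  have hU : ∀ n ∈ D, ¬ P n → ¬ Q n → ∀ c ∈ n.chans, c.lvl ≤ ξ →
      QuasiLe ξ D n ∧ ∀ c ∈ n.chans, ¬ RelChan ξ Δ D {(u, A)} c := by
    intro n hn hp hq c hc hl
    simp only [hP, not_and, not_exists] at hp
    by_cases h : QuasiLe ξ D n
    · exact ⟨h, hp h⟩
    · exfalso
      simp only [hQ, not_and, not_forall] at hq
      obtain ⟨m, rfl, hm⟩ := hq h
      have hlc := (H.msgOk (m := m) (by simp [Triple.all, hn])).lvl_eq hc
      by_cases hpos : m.Positive
      · exact hm hpos (by rwa [← Msg.carrier_eq_offer hpos, ← hlc])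
      · exact h ⟨_, .neg m hpos, by rwa [← hlc]⟩
  -- The quasi running secrecy of a positive message is taken from its parent. If the message has a
  -- secret one although its channel is observable, the parent is secret, so no node of observable
  -- quasi running secrecy mentions the channel.
  have hM : ∀ m, Node.msg m ∈ D → m.Positive → m.offer.lvl ≤ ξ → ¬ QuasiLe ξ D (.msg m) →
      ∀ n ∈ D, QuasiLe ξ D n → m.offer ∉ n.chans := by
    intro m hm hp hl hq n hn hqn hc
    by_cases e : m.offer = n.offer
    · obtain rfl := hoD (.msg m) hm n hn e
      exact hq hqn
    · obtain ⟨q, h, hq'⟩ := hqn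
      exact hq ⟨_, .child m n q hp hn ⟨hc, e⟩ h,
        sup_le hq' (by rwa [Msg.carrier_eq_offer hp])⟩
  refine ⟨Multiset.filter Q (Multiset.filter (fun n => ¬ P n) D),
    Multiset.filter (fun n => ¬ Q n) (Multiset.filter (fun n => ¬ P n) D) + R, ?_, ?_, ?_, ?_⟩
  · rw [add_assoc, ← add_assoc (Multiset.filter Q _), Multiset.filter_add_not, ← add_assoc,
      Multiset.filter_add_not]
  · intro n hn
    have := (Multiset.mem_filter.1 hn).2
    rw [hP] at this
    exact this.1.low
  · intro n hn
    simp only [Multiset.mem_filter] at hn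
    obtain ⟨⟨hn, hp⟩, hq⟩ := hn
    rw [hQ] at hq
    cases n with
    | proc y P d => exact .inl (QuasiLe.high hq.1)
    | msg m =>
      obtain ⟨hpos, hl⟩ := hq.2 m rfl
      refine .inr ⟨m, rfl, hpos, hl, fun h => ?_, ?_, ?_⟩
      · rcases hId _ h with h | h
        · exact H.Δ_disjoint h (Config.mem_offers.2 ⟨_, hn, rfl⟩)
        -- A message offered at `u` has no parent within `D`, so its quasi running secrecy is just
        -- the level of its carrier.
        · refine hq.1 ⟨_, .root m hpos fun n' hn' hu => ?_, by rwa [Msg.carrier_eq_offer hpos]⟩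
          have h' := (Multiset.nodup_add.1 H.nodup_right).2.2
          rw [h] at hu
          have hroot : u ∈ RIface.root (some (u, A)) w := by simp
          exact Multiset.disjoint_left.1 h' hroot
            (Config.mem_usesM.2 ⟨n', hn', Node.mem_usesM.2 ⟨hu.1, hu.2⟩⟩)
      · rintro ⟨n', hn', hc⟩
        obtain ⟨hn', hp'⟩ := Multiset.mem_filter.1 hn'
        rw [hP] at hp'
        exact hM m hn hpos hl hq.1 n' hn' hp'.1 hc
      · rintro ⟨n', hn', hc⟩
        rcases Multiset.mem_add.1 hn' with hn' | hn'
        · simp only [Multiset.mem_filter] at hn'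
          obtain ⟨⟨hn', hp'⟩, hq'⟩ := hn'
          exact hM m hn hpos hl hq.1 n' hn' (hU n' hn' hp' hq' _ hc hl).1 hc
        · exact (hRD _ ⟨n', hn', hc⟩ hl).2 ⟨.msg m, hn, m.offer_mem⟩
  · rintro c ⟨n, hn, hc⟩ hl
    rcases Multiset.mem_add.1 hn with hn | hn
    · simp only [Multiset.mem_filter] at hn
      obtain ⟨⟨hn, hp⟩, hq⟩ := hn
      obtain ⟨hle, hno⟩ := hU n hn hp hq c hc hl
      refine ⟨fun h => hno c hc (hrelI c h), ?_⟩
      rintro ⟨n', hn', hc'⟩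
      obtain ⟨hn', hp'⟩ := Multiset.mem_filter.1 hn'
      rw [hP] at hp'
      obtain ⟨hle', c', hc'', hr⟩ := hp'
      exact hno c hc (.share c c' n' hl hn' hle' hc' hc'' hr)
    · obtain ⟨h₁, h₂⟩ := hRD c ⟨n, hn, hc⟩ hl
      exact ⟨h₁, fun ⟨n', hn', hc'⟩ => h₂ ⟨n', (Multiset.mem_filter.1 hn').1, hc'⟩⟩

/-- The division of a closed configuration along its observable interface. -/
theorem St.proj (H : St τ r Δ (some (u, A)) ⟨C, D, F⟩ w) :
    ∃ (s : Triple L) (W U : Config L), s.all = C + D + F ∧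
      St τ r (Ctx.proj ξ Δ) (projR ξ (u, A)) s w ∧
      s.D = relevant ξ Δ D {(u, A)} + W + U ∧
      Side ξ (iface (Ctx.proj ξ Δ) (projR ξ (u, A))) (relevant ξ Δ D {(u, A)}) W U := by
  classical
  obtain ⟨Δ', hΔ'⟩ : ∃ Δ', Δ' = Ctx.proj ξ Δ := ⟨_, rfl⟩
  -- The trees behind the secret channels of the context become part of the partial program, and so
  -- does `F` if `u` is secret. They share no observable channel with `D` or `Δ`, so they can be put
  -- into `U`.
  obtain ⟨Δ'', hΔ''⟩ : ∃ Δ'' : Ctx L, Δ'' = Multiset.filter (fun p => ¬ p.1.lvl ≤ ξ) Δ := ⟨_, rfl⟩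
  have e : Δ = Δ' + Δ'' := by
    rw [hΔ', hΔ'', Ctx.proj]
    convert (Multiset.filter_add_not _ _).symm
  have H' := H
  rw [e] at H'
  obtain ⟨C', C'', rfl, h', h''⟩ := H'.split_C
  have b' := H.bal_of_le (Multiset.le_iff_exists_add.2 ⟨C'' + D + F, by
    simp only [Triple.all]; abel⟩) h'
  have b'' := H.bal_of_le (Multiset.le_iff_exists_add.2 ⟨C' + D + F, by
    simp only [Triple.all]; abel⟩) h''
  have bD : Bal (Ctx.fst Δ') (C'' + D) {u} := by
    have := b''.add H'.balD
    rw [Ctx.fst_zero, zero_add, Ctx.fst_add, add_comm (Ctx.fst Δ''), RIface.root_some,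
      Bal.pass] at this
    exact this
  have tyΔ : ∀ p ∈ Δ', τ p.1 = p.2 := fun p hp => H'.tyΔ p (by simp [hp])
  have hC'' : ∀ c ∈ Config.chans C'', c.lvl ≤ ξ → c ∉ Config.offers D ∧ c ∉ Ctx.fst Δ := by
    intro c hc hl
    have ho : c ∈ Config.offers C'' := by
      by_contra h
      refine notMem_chans h (fun h' => h ?_) hc
      rw [Bal, Ctx.fst_zero, zero_add] at b''
      rw [b'']; simp [h']
    refine ⟨fun h => H.wt'.offers_disjoint h (by simp [ho]), fun h => ?_⟩
    obtain ⟨B, hB⟩ := Ctx.mem_fst.1 h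
    have hc' : c ∈ Ctx.fst Δ' := Ctx.mem_fst.2 ⟨B, by
      rw [hΔ']; exact Multiset.mem_filter.2 ⟨hB, hl⟩⟩
    have : c ∈ Config.offers C' := by
      rw [Bal, Ctx.fst_zero, zero_add] at b'
      rw [b']; simp [hc']
    have hn := H.wt.nodup
    rw [St.offers_all, Config.offers_add] at hn
    exact Multiset.disjoint_left.1 (Multiset.nodup_add.1 (Multiset.nodup_add.1
      (Multiset.nodup_add.1 hn).1).1).2.2 this ho
  rw [← hΔ']
  by_cases hu : u.lvl ≤ ξ
  · have hK : projR ξ (u, A) = some (u, A) := if_pos hu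
    obtain ⟨W, U, h₁, h₂⟩ := H.side hC''
    rw [← hΔ'] at h₂
    rw [hK] at h₂ ⊢
    refine ⟨⟨C', D + C'', F⟩, W, U, ?_, ⟨?_, tyΔ, H.tyK, b', ?_⟩, h₁, h₂⟩
    · simp only [Triple.all]; abel
    · convert H.wt using 1
      simp only [Triple.all]; abel
    · rw [add_comm D]; exact bD
  · have hK : projR ξ (u, A) = none := if_neg hu
    have hF : ∀ c ∈ Config.chans F, c.lvl ≤ ξ → c ∉ Config.offers D ∧ c ∉ Ctx.fst Δ := by
      intro c hc hl
      have ho : c ∈ Config.offers F := by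
        by_contra h
        refine notMem_chans h (fun h' => ?_) hc
        rcases Multiset.mem_add.1 (H.uses_F_subset h') with h' | h'
        · obtain rfl : c = u := by simpa using h'
          exact hu hl
        · exact h h'
      have hd := fun h => H.wt'.offers_disjoint (c := c) h (by simp [ho])
      refine ⟨hd, fun h => ?_⟩
      have := H.mem_Δ h
      have hn := H.wt.nodup
      rw [St.offers_all] at hn
      exact Multiset.disjoint_left.1 (Multiset.nodup_add.1 hn).2.2 (by simp only [Multiset.mem_add]
                                                                       exact .inl this) ho
    obtain ⟨W, U, h₁, h₂⟩ := H.side (R := C'' + F) (fun c ⟨n, hn, hc⟩ hl => by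
      rcases Multiset.mem_add.1 hn with hn | hn
      · exact hC'' c ⟨n, hn, hc⟩ hl
      · exact hF c ⟨n, hn, hc⟩ hl)
    rw [← hΔ'] at h₂
    rw [hK] at h₂ ⊢
    refine ⟨⟨C', D + (C'' + F), 0⟩, W, U, ?_, ⟨?_, tyΔ, by simp [RIface.ctx], b', ?_⟩, h₁, h₂⟩
    · simp only [Triple.all]; abel
    · convert H.wt using 1
      simp only [Triple.all]; abel
    · have := bD.add H.balF
      rw [RIface.ctx_some, Ctx.fst_singleton, add_comm ({u} : Multiset (Chan L)), Bal.pass] at this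
      rw [show D + (C'' + F) = C'' + D + F by abel]
      exact this

theorem related_of_configEq {Δ₁ Δ₂ : Ctx L} {C₁ C₂ D₁ D₂ F₁ F₂ : Config L} {u v : Chan L}
    {A₁ A₂ : Ty} (hD₁ : CTyped Δ₁ D₁ {(u, A₁)}) (hD₂ : CTyped Δ₂ D₂ {(v, A₂)})
    (hrel : ConfigEq ξ (relevant ξ Δ₁ D₁ {(u, A₁)}) (relevant ξ Δ₂ D₂ {(v, A₂)}))
    (hΔ : Ctx.proj ξ Δ₁ = Ctx.proj ξ Δ₂) (hK : projR ξ (u, A₁) = projR ξ (v, A₂))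
    (hC₁ : CTyped 0 C₁ Δ₁) (hC₂ : CTyped 0 C₂ Δ₂) (hF₁ : KTyped {(u, A₁)} F₁ none)
    (hF₂ : KTyped {(v, A₂)} F₂ none) (hN₁ : WellNamed (C₁ + D₁ + F₁))
    (hN₂ : WellNamed (C₂ + D₂ + F₂)) :
    ∃ s t : Triple L, s.all = C₁ + D₁ + F₁ ∧ t.all = C₂ + D₂ + F₂ ∧
      Related ξ (Ctx.proj ξ Δ₁) (projR ξ (u, A₁)) s t := by
  obtain ⟨_, _, _, H₁⟩ := closed_typed hC₁ hD₁ hF₁ hN₁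
  obtain ⟨_, _, _, H₂⟩ := closed_typed hC₂ hD₂ hF₂ hN₂
  obtain ⟨s, W₁, U₁, e₁, k₁, d₁, s₁⟩ := H₁.proj (ξ := ξ)
  obtain ⟨t, W₂, U₂, e₂, k₂, d₂, s₂⟩ := H₂.proj (ξ := ξ)
  rw [← hΔ, ← hK] at k₂ s₂
  refine ⟨s, t, e₁, e₂, fun c hc => ?_, ⟨_, _, _, k₁⟩, ⟨_, _, _, k₂⟩,
    _, _, _, _, _, _, d₁, d₂, hrel, s₁, s₂⟩
  cases RelChan.of_iface (D := D₁) hc <;> assumption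

end SecSess

theorem mainTheorem2 {L : Type*} [Lattice L] (ξ : L)
    (Δ₁ Δ₂ : SecSess.Ctx L) (D₁ D₂ : SecSess.Config L)
    (u v : SecSess.Chan L) (A₁ A₂ : SecSess.Ty)
    (hD₁ : SecSess.CTyped Δ₁ D₁ {(u, A₁)}) (hD₂ : SecSess.CTyped Δ₂ D₂ {(v, A₂)})
    (hrel : SecSess.ConfigEq ξ (SecSess.relevant ξ Δ₁ D₁ {(u, A₁)})
      (SecSess.relevant ξ Δ₂ D₂ {(v, A₂)}))
    (hΔ : SecSess.Ctx.proj ξ Δ₁ = SecSess.Ctx.proj ξ Δ₂)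
    (hK : SecSess.projR ξ (u, A₁) = SecSess.projR ξ (v, A₂)) :
    SecSess.ObsEquiv ξ Δ₁ D₁ (u, A₁) Δ₂ D₂ (v, A₂) := by
  refine ⟨hD₁, hD₂, hΔ, hK, fun C₁ C₂ F₁ F₂ hC₁ hC₂ hF₁ hF₂ hN₁ hN₂ => ?_⟩
  obtain ⟨s, t, e₁, e₂, h⟩ := SecSess.related_of_configEq hD₁ hD₂ hrel hΔ hK hC₁ hC₂ hF₁ hF₂ hN₁ hN₂
  rw [← e₁, ← e₂]
  exact h.term
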